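/- **Setting.** Let $d\ge 1$, $J=(-\infty,0)$, $D=-i\partial_x$. Fix a smooth radial $\psi:\mathbb R^d\to[0,1]$ supported in $B(0,\frac43)$ with $\psi=1$ on $|\xi|\le\frac34$, put $\varphi(\xi)=\psi(\xi/2)-\psi(\xi)$ and $\dot\Delta_j=\varphi(2^{-j}D)$, $j\in\mathbb Z$. For a real tempered distribution $u$ modulo polynomials, $\|u\|_{\dot B^s_{\infty,1}}=\sum_j2^{sj}\|\dot\Delta_ju\|_{L^\infty}$; for functions $u(x,z)$ on $\mathbb R^d\times J$, $\|u\|_{\widetilde L^q(J;\dot B^s_{\infty,1})}=\sum_j2^{sj}\|\dot\Delta_ju\|_{L^q(J;L^\infty)}$. Let $$X_*=L^\infty(J;L^\infty)\cap\widetilde L^1(J;\dot B^1_{\infty,1}),\qquad X^r=\widetilde L^\infty(J;\dot B^r_{\infty,1})\cap\widetilde L^1(J;\dot B^{r+1}_{\infty,1}).$$ Let $\mathcal V_*$ (resp. $\mathcal V^r$) be the space of $v\in\mathcal D'(\mathbb R^d\times J)$, modulo constants, with $(|D_x|v,\partial_zv)\in X_*$ (resp. $X^r$), normed by $\|v\|_{\mathcal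 V_*}=\||D_x|v\|_{X_*}+\|\partial_zv\|_{X_*}$ (resp. with $X^r$). Here $v$ has a bounded weak gradient, $\nabla_xv=\sum_j\dot\Delta_j\nabla_xv$ and $|D_x|v=-\sum_j\mathcal R_x\dot\Delta_j\nabla_xv$ almost everywhere, with $\mathcal R_x=|D_x|^{-1}\mathrm{div}_x$ (so $v$ has no part $a\cdot x$). Elements of $\dot B^1_{\infty,1}$ are regarded as functions modulo constants through their dyadic sums. Given $\eta$ and $f$, let $H(x,z)=e^{z|D_x|}\eta(x)$ and $$Q_a[v]=\nabla_xH\cdot\nabla_xv-\frac{|\nabla_xH|^2-|D_x|H}{1+|D_x|H}\,\partial_zv,\qquad Q_b[v]=\mathcal R_x\big(\nabla_xH\,\partial_zv-|D_x|H\,\nabla_xv\big),$$ $$\begin{aligned}\mathcal T[v](\cdot,z)=e^{z|D_x|}f&+\int_0^ze^{(z-z')|D_x|}Q_a[v](\cdot,z')\,dz'\\&+\int_0^ze^{(z-z')|D_x|}\int_{-\infty}^{z'}e^{-(z'-\tau)|D_x|}|D_x|\{Q_b[v]-Q_a[v]\}(\cdot,\tau)\,d\tau\,dz'.\end{aligned}$$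 If $v$ is the fixed point of $\mathcal T$ (modulo constants), put $$R^-(\eta)f=\int_{-\infty}^0e^{\tau|D_x|}|D_x|\{Q_b[v]-Q_a[v]\}(\cdot,\tau)\,d\tau,\qquad G^-(\eta)f=|D_x|f+R^-(\eta)f.$$ **Proposition.** There is $c_0=c_0(d)\in(0,1)$ such that $1+|D_x|H\ge\frac12$ on $\mathbb R^d\times J$ whenever $\eta\in\dot B^1_{\infty,1}$ and $\||D_x|\eta\|_{\dot B^0_{\infty,1}}\le c_0$, and there is $c_1=c_1(d)\in(0,c_0)$ such that the following holds. 1) There is $C=C(d)$ such that, for all $\eta,f\in\dot B^1_{\infty,1}$ with $\||D_x|\eta\|_{\dot B^0_{\infty,1}}<c_1$, the integrals defining $\mathcal T[v]$ and $R^-(\eta)f$ converge absolutely for every $v\in\mathcal V_*$, $\mathcal T$ has a unique fixed point $v$ in $\mathcal V_*$ (so that $G^-(\eta)f$ is well defined), and $$\|v\|_{\mathcal V_*}\le C\||D_x|f\|_{\dot B^0_{\infty,1}},\qquad\|R^-(\eta)f\|_{\dot B^0_{\infty,1}}\le C\||D_x|\eta\|_{\dot B^0_{\infty,1}}\||D_x|f\|_{\dot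 B^0_{\infty,1}}.$$ 2) For every $r>0$ there are $c_*=c_*(d,r)\in(0,c_1)$ and $C=C(d,r)$ such that, for all $\eta,f\in\dot B^1_{\infty,1}\cap\dot B^{1+r}_{\infty,1}$ with $\||D_x|\eta\|_{\dot B^0_{\infty,1}}<c_*$, the unique fixed point $v\in\mathcal V_*$ of $\mathcal T$ belongs to $\mathcal V^r$, and $$\|v\|_{\mathcal V^r}\le C\||D_x|f\|_{\dot B^r_{\infty,1}}+C\||D_x|\eta\|_{\dot B^r_{\infty,1}}\||D_x|f\|_{\dot B^0_{\infty,1}},$$ $$\|R^-(\eta)f\|_{\dot B^r_{\infty,1}}\le C\||D_x|\eta\|_{\dot B^0_{\infty,1}}\||D_x|f\|_{\dot B^r_{\infty,1}}+C\||D_x|\eta\|_{\dot B^r_{\infty,1}}\||D_x|f\|_{\dot B^0_{\infty,1}}.$$ -/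

import Mathlib

open MeasureTheory Set Filter Topology
open scoped ENNReal NNReal ContDiff SchwartzMap Distributions FourierTransform LineDeriv

noncomputable section

namespace Muskat

/-! ### Littlewood-Paley theory on `ℝ^d` -/

/-- The horizontal space `ℝ^d`. -/
abbrev E (d : ℕ) : Type := EuclideanSpace ℝ (Fin d)

/-- A Littlewood-Paley cut-off: a smooth radial function `ψ : ℝ^d → [0, 1]`, supported in the open
ball of radius `4/3`, such that `φ(ξ) = ψ(ξ/2) - ψ(ξ)` is supported in the annulus
`3/4 ≤ |ξ| ≤ 8/3` (that is, `ψ = 1` for `|ξ| ≤ 3/4`). -/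
structure LPCutoff (d : ℕ) where
  toFun : E d → ℝ
  smooth : ContDiff ℝ ∞ toFun
  radial : ∀ ξ ζ : E d, ‖ξ‖ = ‖ζ‖ → toFun ξ = toFun ζ
  nonneg : ∀ ξ, 0 ≤ toFun ξ
  le_one : ∀ ξ, toFun ξ ≤ 1
  support_subset : tsupport toFun ⊆ Metric.ball 0 (4 / 3)
  eq_one : ∀ ξ, ‖ξ‖ ≤ 3 / 4 → toFun ξ = 1

/-- The dyadic localizer `φ(2^{-j} ξ)`, where `φ(ξ) = ψ(ξ/2) - ψ(ξ)`. -/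
def LPCutoff.phi {d : ℕ} (ψ : LPCutoff d) (j : ℤ) (ξ : E d) : ℝ :=
  ψ.toFun ((2 : ℝ)⁻¹ • (2 : ℝ) ^ (-j) • ξ) - ψ.toFun ((2 : ℝ) ^ (-j) • ξ)

/-- Littlewood-Paley cut-offs exist. -/
theorem LPCutoff.nonempty (d : ℕ) : Nonempty (LPCutoff d) := by
  have h1 : ∀ ξ : E d, ‖ξ‖ ≤ 3 / 4 → Real.smoothTransition ((5 / 4 - ‖ξ‖) * 2) = 1 := fun ξ h =>
    Real.smoothTransition.one_of_one_le (by linarith)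
  refine ⟨⟨fun ξ => Real.smoothTransition ((5 / 4 - ‖ξ‖) * 2), ?_, ?_, ?_, ?_, ?_, ?_⟩⟩
  · rw [contDiff_iff_contDiffAt]
    intro ξ
    by_cases hξ : ξ = 0
    · subst hξ
      refine (contDiffAt_const (c := (1 : ℝ))).congr_of_eventuallyEq ?_
      filter_upwards [Metric.ball_mem_nhds (0 : E d) (by norm_num : (0 : ℝ) < 3 / 4)] with ζ hζ
      exact h1 ζ (by simpa using (mem_ball_zero_iff.1 hζ).le)
    · have hn : ContDiffAt ℝ ∞ (fun ζ : E d => ‖ζ‖) ξ := contDiffAt_norm ℝ hξ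
      exact Real.smoothTransition.contDiffAt.comp ξ
        ((contDiffAt_const.sub hn).mul contDiffAt_const)
  · intro ξ ζ h
    simp only [h]
  · exact fun ξ => Real.smoothTransition.nonneg _
  · exact fun ξ => Real.smoothTransition.le_one _
  · have hsub : tsupport (fun ξ : E d => Real.smoothTransition ((5 / 4 - ‖ξ‖) * 2))
        ⊆ Metric.closedBall 0 (5 / 4) := by
      refine closure_minimal ?_ Metric.isClosed_closedBall
      intro ξ hξ
      by_contra hb
      have : 5 / 4 < ‖ξ‖ := by simpa using hb
      exact hξ (Real.smoothTransition.zero_of_nonpos (by linarith))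
    exact hsub.trans (Metric.closedBall_subset_ball (by norm_num))
  · exact h1

/-- Symbols of Fourier multipliers `m(D)`, `D = -i∂`, that are smooth away from the origin. -/
structure Symbol (d : ℕ) where
  toFun : E d → ℂ
  smooth : ∀ ξ, ξ ≠ 0 → ContDiffAt ℝ ∞ toFun ξ

namespace Symbol

variable {d : ℕ}

/-- The symbol `1` of the identity. -/
def one : Symbol d := ⟨fun _ => 1, fun _ _ => contDiffAt_const⟩

/-- The product of two symbols (composition of the multipliers). -/
def mul (m n : Symbol d) : Symbol d :=
  ⟨fun ξ => m.toFun ξ * n.toFun ξ, fun ξ h => (m.smooth ξ h).mul (n.smooth ξ h)⟩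

/-- The symbol `|ξ|` of `|D|`. -/
def abs : Symbol d :=
  ⟨fun ξ => ((‖ξ‖ : ℝ) : ℂ), fun ξ h =>
    Complex.ofRealCLM.contDiff.contDiffAt.comp ξ (contDiffAt_norm ℝ h)⟩

/-- The symbol `i ξ_k` of the partial derivative `∂_k`. -/
def partialD (k : Fin d) : Symbol d :=
  ⟨fun ξ => Complex.I * ((ξ k : ℝ) : ℂ), fun ξ _ =>
    contDiffAt_const.mul (Complex.ofRealCLM.contDiff.contDiffAt.comp ξ
      (contDiff_euclidean.1 contDiff_id k).contDiffAt)⟩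

/-- The symbol `e^{-s|ξ|}` of `e^{-s|D|}`. -/
def heat (s : ℝ) : Symbol d :=
  ⟨fun ξ => ((Real.exp (-s * ‖ξ‖) : ℝ) : ℂ), fun ξ h =>
    Complex.ofRealCLM.contDiff.contDiffAt.comp ξ
      (Real.contDiff_exp.contDiffAt.comp ξ (contDiffAt_const.mul (contDiffAt_norm ℝ h)))⟩

/-- The symbol `i ξ_k / |ξ|` of the `k`-th component `|D|⁻¹ ∂_k` of `ℛ = |D|⁻¹ div`. -/
def riesz (k : Fin d) : Symbol d :=
  ⟨fun ξ => Complex.I * (((ξ k) / ‖ξ‖ : ℝ) : ℂ), fun ξ h =>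
    contDiffAt_const.mul (Complex.ofRealCLM.contDiff.contDiffAt.comp ξ
      ((contDiff_euclidean.1 contDiff_id k).contDiffAt.div
        (contDiffAt_norm ℝ h) (norm_ne_zero_iff.2 h)))⟩

end Symbol

variable {d : ℕ}

/-- The function `ν ↦ e^{2πi x·ν} m(2πν) φ(2^{-j} 2πν)`. The factors `2π` convert the frequency
variable `ν` of Mathlib's Fourier transform into `ξ = 2πν`, the variable of symbols of `m(D)`. -/
def lpSymbol (ψ : LPCutoff d) (m : Symbol d) (j : ℤ) (x ν : E d) : ℂ :=
  Complex.exp (((2 * Real.pi * inner ℝ x ν : ℝ) : ℂ) * Complex.I) *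
    (m.toFun ((2 * Real.pi) • ν) * ((ψ.phi j ((2 * Real.pi) • ν) : ℝ) : ℂ))

theorem LPCutoff.contDiff_phi (ψ : LPCutoff d) (j : ℤ) : ContDiff ℝ ∞ (ψ.phi j) := by
  unfold LPCutoff.phi
  exact (ψ.smooth.comp ((contDiff_id.const_smul _).const_smul _)).sub
    (ψ.smooth.comp (contDiff_id.const_smul _))

theorem LPCutoff.phi_eq_zero_of_small (ψ : LPCutoff d) (j : ℤ) (ξ : E d)
    (h : (2 : ℝ) ^ (-j) * ‖ξ‖ ≤ 3 / 4) : ψ.phi j ξ = 0 := by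
  have hp : (0 : ℝ) < (2 : ℝ) ^ (-j) := by positivity
  have hn : ‖(2 : ℝ) ^ (-j) • ξ‖ = (2 : ℝ) ^ (-j) * ‖ξ‖ := by
    rw [norm_smul, Real.norm_of_nonneg hp.le]
  have hn' : ‖(2 : ℝ)⁻¹ • (2 : ℝ) ^ (-j) • ξ‖ = 2⁻¹ * ((2 : ℝ) ^ (-j) * ‖ξ‖) := by
    rw [norm_smul, hn, Real.norm_of_nonneg (by norm_num)]
  have h0 : 0 ≤ (2 : ℝ) ^ (-j) * ‖ξ‖ := by positivity
  unfold LPCutoff.phi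
  rw [ψ.eq_one _ (by rw [hn']; linarith), ψ.eq_one _ (by rw [hn]; exact h), sub_self]

theorem LPCutoff.phi_eq_zero_of_large (ψ : LPCutoff d) (j : ℤ) (ξ : E d)
    (h : 8 / 3 ≤ (2 : ℝ) ^ (-j) * ‖ξ‖) : ψ.phi j ξ = 0 := by
  have hp : (0 : ℝ) < (2 : ℝ) ^ (-j) := by positivity
  have hn : ‖(2 : ℝ) ^ (-j) • ξ‖ = (2 : ℝ) ^ (-j) * ‖ξ‖ := by
    rw [norm_smul, Real.norm_of_nonneg hp.le]
  have hn' : ‖(2 : ℝ)⁻¹ • (2 : ℝ) ^ (-j) • ξ‖ = 2⁻¹ * ((2 : ℝ) ^ (-j) * ‖ξ‖) := by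
    rw [norm_smul, hn, Real.norm_of_nonneg (by norm_num)]
  have hz : ∀ ζ : E d, 4 / 3 ≤ ‖ζ‖ → ψ.toFun ζ = 0 := by
    intro ζ hζ
    refine image_eq_zero_of_notMem_tsupport fun hm => ?_
    have := mem_ball_zero_iff.1 (ψ.support_subset hm)
    linarith
  unfold LPCutoff.phi
  rw [hz _ (by rw [hn']; linarith), hz _ (by rw [hn]; linarith), sub_self]

theorem contDiff_lpSymbol (ψ : LPCutoff d) (m : Symbol d) (j : ℤ) (x : E d) :
    ContDiff ℝ ∞ (lpSymbol ψ m j x) := by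
  have hpi : (0 : ℝ) < 2 * Real.pi := by positivity
  rw [contDiff_iff_contDiffAt]
  intro ν
  by_cases hν : ν = 0
  · subst hν
    refine (contDiffAt_const (c := (0 : ℂ))).congr_of_eventuallyEq ?_
    have hc : Tendsto (fun ν : E d => (2 : ℝ) ^ (-j) * ‖(2 * Real.pi) • ν‖) (𝓝 0) (𝓝 0) := by
      have : Continuous (fun ν : E d => (2 : ℝ) ^ (-j) * ‖(2 * Real.pi) • ν‖) := by fun_prop
      simpa using this.tendsto 0
    filter_upwards [hc.eventually (gt_mem_nhds (by norm_num : (0 : ℝ) < 3 / 4))] with ν h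
    unfold lpSymbol
    rw [ψ.phi_eq_zero_of_small j _ h.le]
    simp
  · have hne : (2 * Real.pi) • ν ≠ 0 := smul_ne_zero hpi.ne' hν
    have hsm : ContDiffAt ℝ ∞ (fun ν : E d => (2 * Real.pi) • ν) ν :=
      contDiffAt_id.const_smul _
    have he : ContDiffAt ℝ ∞ (fun ν : E d =>
        Complex.exp (((2 * Real.pi * inner ℝ x ν : ℝ) : ℂ) * Complex.I)) ν := by
      refine ContDiffAt.cexp (ContDiffAt.mul ?_ contDiffAt_const)
      exact Complex.ofRealCLM.contDiff.contDiffAt.comp ν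
        (contDiffAt_const.mul (contDiffAt_const.inner ℝ contDiffAt_id))
    have hm : ContDiffAt ℝ ∞ (fun ν : E d => m.toFun ((2 * Real.pi) • ν)) ν :=
      (m.smooth _ hne).comp ν hsm
    have hphi : ContDiffAt ℝ ∞ (fun ν : E d => ((ψ.phi j ((2 * Real.pi) • ν) : ℝ) : ℂ)) ν :=
      Complex.ofRealCLM.contDiff.contDiffAt.comp ν
        ((ψ.contDiff_phi j).contDiffAt.comp ν hsm)
    exact he.mul (hm.mul hphi)

theorem hasCompactSupport_lpSymbol (ψ : LPCutoff d) (m : Symbol d) (j : ℤ) (x : E d) :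
    HasCompactSupport (lpSymbol ψ m j x) := by
  have hpi : (0 : ℝ) < 2 * Real.pi := by positivity
  have hp : (0 : ℝ) < (2 : ℝ) ^ (-j) := by positivity
  refine HasCompactSupport.intro
    (isCompact_closedBall (0 : E d) (8 / 3 / ((2 : ℝ) ^ (-j) * (2 * Real.pi)))) fun ν hν => ?_
  have hlt : 8 / 3 / ((2 : ℝ) ^ (-j) * (2 * Real.pi)) < ‖ν‖ := by simpa using hν
  rw [div_lt_iff₀ (by positivity)] at hlt
  unfold lpSymbol
  rw [ψ.phi_eq_zero_of_large j]
  · simp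
  · rw [norm_smul, Real.norm_of_nonneg hpi.le]
    nlinarith

/-- The Schwartz function `y ↦ K(x - y)`, where `K` is the convolution kernel of the multiplier
`m(D) Δ_j`, i.e. `K` is the inverse Fourier transform of `m(ξ) φ(2^{-j} ξ)`. (For the symbols used
below, `m(-ξ)` is the complex conjugate of `m(ξ)` and `φ` is even, so that `K` is real-valued and
taking the real part changes nothing.) -/
def lpKernel (ψ : LPCutoff d) (m : Symbol d) (j : ℤ) (x : E d) : 𝓢(E d, ℝ) :=
  SchwartzMap.postcompCLM (𝕜 := ℝ) Complex.reCLM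
    (𝓕 ((hasCompactSupport_lpSymbol ψ m j x).toSchwartzMap (contDiff_lpSymbol ψ m j x)))

/-- Real-valued tempered distributions on `ℝ^d`. -/
abbrev TemperedDist (d : ℕ) : Type := 𝓢(E d, ℝ) →L[ℝ] ℝ

/-- The smooth function `m(D) Δ_j f` for a tempered distribution `f`. It does not change when a
polynomial is added to `f`, hence depends only on the class of `f` in `𝓢'/𝒫`. -/
def distBlock (ψ : LPCutoff d) (m : Symbol d) (j : ℤ) (f : TemperedDist d) (x : E d) : ℝ :=
  f (lpKernel ψ m j x)

/-- The smooth function `m(D) Δ_j u` for a bounded measurable function `u`. -/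
def funBlock (ψ : LPCutoff d) (m : Symbol d) (j : ℤ) (u : E d → ℝ) (x : E d) : ℝ :=
  ∫ y, lpKernel ψ m j x y * u y

/-- The norm `‖m(D) f‖` in `Ḃ^s_{∞,1}`, that is `∑_j 2^{sj} ‖Δ_j m(D) f‖_{L^∞}`, of a tempered
distribution modulo polynomials. -/
def besovNorm (ψ : LPCutoff d) (s : ℝ) (m : Symbol d) (f : TemperedDist d) : ℝ≥0∞ :=
  ∑' j : ℤ, ENNReal.ofReal ((2 : ℝ) ^ (s * j)) * ⨆ x, ‖distBlock ψ m j f x‖ₑ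

/-- `f` (more precisely its class modulo polynomials) belongs to `Ḃ^s_{∞,1}(ℝ^d)`. -/
def MemBesov (ψ : LPCutoff d) (s : ℝ) (f : TemperedDist d) : Prop :=
  besovNorm ψ s Symbol.one f < ⊤

/-- The norm in `Ḃ^s_{∞,1}` of a bounded function. -/
def besovNormFun (ψ : LPCutoff d) (s : ℝ) (u : E d → ℝ) : ℝ≥0∞ :=
  ∑' j : ℤ, ENNReal.ofReal ((2 : ℝ) ^ (s * j)) * ⨆ x, ‖funBlock ψ Symbol.one j u x‖ₑ

/-- The action of the Fourier multiplier `m(D)` on a bounded function, as the convolution with the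
inverse Fourier transform of `m`. It is used for `e^{-s|D|}` (whose kernel is the Poisson kernel),
`|D| e^{-s|D|}` and `∂_k e^{-s|D|}` with `s > 0`, whose kernels are real-valued and integrable. -/
def convMult (m : Symbol d) (u : E d → ℝ) (x : E d) : ℝ :=
  ∫ y, (𝓕⁻ (fun ν : E d => m.toFun ((2 * Real.pi) • ν)) (x - y)).re * u y

/-! ### Function spaces on the lower half space `ℝ^d × J`, `J = (-∞, 0)` -/

/-- The half space `ℝ^d × J`. -/
def halfSpace (d : ℕ) : TopologicalSpace.Opens (E d × ℝ) :=
  ⟨{p | p.2 < 0}, isOpen_lt continuous_snd continuous_const⟩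

/-- Lebesgue measure on `ℝ^d × J`. -/
def halfVol (d : ℕ) : Measure (E d × ℝ) := volume.restrict (halfSpace d : Set (E d × ℝ))

/-- The Chemin-Lerner norm of `u` in `L̃^q(J; Ḃ^s_{∞,1})`, that is
`∑_j 2^{sj} ‖Δ_j u‖_{L^q(J; L^∞)}`. -/
def cheminLerner (ψ : LPCutoff d) (q : ℝ≥0∞) (s : ℝ) (u : E d × ℝ → ℝ) : ℝ≥0∞ :=
  ∑' j : ℤ, ENNReal.ofReal ((2 : ℝ) ^ (s * j)) *
    eLpNorm (fun z : ℝ => ⨆ x, ‖funBlock ψ Symbol.one j (fun y => u (y, z)) x‖ₑ) q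
      (volume.restrict (Iio 0))

/-- The norm of `X_*(J) = L^∞(J; L^∞) ∩ L̃^1(J; Ḃ^1_{∞,1})`. -/
def xStarNorm (ψ : LPCutoff d) (u : E d × ℝ → ℝ) : ℝ≥0∞ :=
  eLpNorm u ⊤ (halfVol d) + cheminLerner ψ 1 1 u

/-- The norm of `X^r(J) = L̃^∞(J; Ḃ^r_{∞,1}) ∩ L̃^1(J; Ḃ^{r+1}_{∞,1})`. -/
def xNorm (ψ : LPCutoff d) (r : ℝ) (u : E d × ℝ → ℝ) : ℝ≥0∞ :=
  cheminLerner ψ ⊤ r u + cheminLerner ψ 1 (r + 1) u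

/-- The distribution `u` on the half space is given by the function `g`. -/
def IsGivenBy (u : 𝓓'(halfSpace d, ℝ)) (g : E d × ℝ → ℝ) : Prop :=
  ∀ φ : 𝓓(halfSpace d, ℝ), u φ = ∫ p, g p * φ p

/-- Functions playing the roles of `∇_x v`, `∂_z v` and `|D_x| v`. -/
structure GradData (d : ℕ) where
  gradX : E d × ℝ → E d
  gradZ : E d × ℝ → ℝ
  absD : E d × ℝ → ℝ

/-- The distribution `v` has the bounded weak gradient `(∇_x v, ∂_z v)`; `∇_x v` is the sum of its
dyadic blocks in `x` (for a bounded gradient, this excludes only a linear function `a·x`, which is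
annihilated by all dyadic blocks); and `|D_x| v` is the sum of its dyadic blocks
`Δ_j |D_x| v = -∑_k |D_x|⁻¹ ∂_k Δ_j ∂_k v`. -/
structure HasGradData (ψ : LPCutoff d) (v : 𝓓'(halfSpace d, ℝ)) (D : GradData d) : Prop where
  memLp_gradX : MemLp D.gradX ⊤ (halfVol d)
  memLp_gradZ : MemLp D.gradZ ⊤ (halfVol d)
  weak_gradX : ∀ k : Fin d,
    IsGivenBy (∂_{((EuclideanSpace.single k (1 : ℝ), (0 : ℝ)) : E d × ℝ)} v) (fun p => D.gradX p k)
  weak_gradZ : IsGivenBy (∂_{((0, 1) : E d × ℝ)} v) D.gradZ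
  hasSum_gradX : ∀ k : Fin d, ∀ᵐ p ∂(halfVol d),
    HasSum (fun j : ℤ => funBlock ψ Symbol.one j (fun y => D.gradX (y, p.2) k) p.1) (D.gradX p k)
  hasSum_absD : ∀ᵐ p ∂(halfVol d),
    HasSum (fun j : ℤ => -∑ k : Fin d,
      funBlock ψ (Symbol.riesz k) j (fun y => D.gradX (y, p.2) k) p.1) (D.absD p)

/-- The norm of `(|D_x| v, ∂_z v)` with respect to a given norm `N` of functions on `ℝ^d × J`. The
data of `v` are unique up to null sets, so that the infimum only expresses that the norm is
infinite when there are none. -/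
def potNorm (ψ : LPCutoff d) (N : (E d × ℝ → ℝ) → ℝ≥0∞) (v : 𝓓'(halfSpace d, ℝ)) : ℝ≥0∞ :=
  ⨅ (D : GradData d) (_ : HasGradData ψ v D), N D.absD + N D.gradZ

/-- The norm of `𝒱_*`. -/
def vStarNorm (ψ : LPCutoff d) (v : 𝓓'(halfSpace d, ℝ)) : ℝ≥0∞ := potNorm ψ (xStarNorm ψ) v

/-- The norm of `𝒱^r`. -/
def vNorm (ψ : LPCutoff d) (r : ℝ) (v : 𝓓'(halfSpace d, ℝ)) : ℝ≥0∞ := potNorm ψ (xNorm ψ r) v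

/-- `v`, modulo constants, belongs to `𝒱_*`. -/
def MemVStar (ψ : LPCutoff d) (v : 𝓓'(halfSpace d, ℝ)) : Prop := vStarNorm ψ v < ⊤

/-- `v`, modulo constants, belongs to `𝒱^r`. -/
def MemV (ψ : LPCutoff d) (r : ℝ) (v : 𝓓'(halfSpace d, ℝ)) : Prop := vNorm ψ r v < ⊤

/-- Two distributions on the half space differ by a constant. -/
def EqModConst (v w : 𝓓'(halfSpace d, ℝ)) : Prop :=
  ∃ c : ℝ, ∀ φ : 𝓓(halfSpace d, ℝ), v φ = w φ + c * ∫ p, φ p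

/-! ### The operator `𝒯` and the remainder -/

/-- `∇_x H(x, z)`, where `H(·, z) = e^{z|D|} η`. -/
def gradH (ψ : LPCutoff d) (η : TemperedDist d) (p : E d × ℝ) : E d :=
  WithLp.toLp 2 fun k => ∑' j : ℤ,
    distBlock ψ ((Symbol.partialD k).mul (Symbol.heat (-p.2))) j η p.1

/-- `|D_x| H(x, z)`, where `H(·, z) = e^{z|D|} η`. -/
def absDH (ψ : LPCutoff d) (η : TemperedDist d) (p : E d × ℝ) : ℝ :=
  ∑' j : ℤ, distBlock ψ (Symbol.abs.mul (Symbol.heat (-p.2))) j η p.1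

/-- `e^{z|D|} f` at `(x, z)`, normalized to vanish at `(0, 0)`: an element `f` of `Ḃ^1_{∞,1}`
determines this function up to an additive constant. -/
def harmExt (ψ : LPCutoff d) (f : TemperedDist d) (p : E d × ℝ) : ℝ :=
  ∑' j : ℤ, (distBlock ψ (Symbol.heat (-p.2)) j f p.1 - distBlock ψ Symbol.one j f 0)

/-- `Q_a[v] = ∇_x H·∇_x v - (|∇_x H|² - |D_x|H) / (1 + |D_x|H) ∂_z v`. -/
def qA (ψ : LPCutoff d) (η : TemperedDist d) (D : GradData d) (p : E d × ℝ) : ℝ :=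
  inner ℝ (gradH ψ η p) (D.gradX p) -
    (‖gradH ψ η p‖ ^ 2 - absDH ψ η p) / (1 + absDH ψ η p) * D.gradZ p

/-- The vector field `B[v] = ∇_x H ∂_z v - |D_x|H ∇_x v`, for which `Q_b[v] = |D_x|⁻¹ div_x B[v]`. -/
def qBField (ψ : LPCutoff d) (η : TemperedDist d) (D : GradData d) (p : E d × ℝ) : E d :=
  D.gradZ p • gradH ψ η p - absDH ψ η p • D.gradX p

/-- `e^{-s|D|} |D| {Q_b[v](·, τ) - Q_a[v](·, τ)}` at `x`, for `s > 0`. Here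
`e^{-s|D|} |D| Q_b[v] = ∑_k e^{-s|D|} ∂_k B_k[v]`. -/
def sourceTerm (ψ : LPCutoff d) (η : TemperedDist d) (D : GradData d) (s : ℝ) (x : E d) (τ : ℝ) :
    ℝ :=
  (∑ k : Fin d, convMult ((Symbol.partialD k).mul (Symbol.heat s))
      (fun y => qBField ψ η D (y, τ) k) x) -
    convMult (Symbol.abs.mul (Symbol.heat s)) (fun y => qA ψ η D (y, τ)) x

/-- `∫_{-∞}^r e^{-(r-τ)|D|} |D| {Q_b[v](·, τ) - Q_a[v](·, τ)} dτ` at `x`. -/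
def wTerm (ψ : LPCutoff d) (η : TemperedDist d) (D : GradData d) (x : E d) (r : ℝ) : ℝ :=
  ∫ τ in Iic r, sourceTerm ψ η D (r - τ) x τ

/-- `𝒯[v](x, z) = e^{z|D|} f + ∫_0^z e^{(z-z')|D|} Q_a[v](z') dz'
+ ∫_0^z e^{(z-z')|D|} ∫_{-∞}^{z'} e^{-(z'-τ)|D|} |D| {Q_b[v](τ) - Q_a[v](τ)} dτ dz'`, for `z < 0`. -/
def opT (ψ : LPCutoff d) (η f : TemperedDist d) (D : GradData d) (p : E d × ℝ) : ℝ :=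
  harmExt ψ f p +
    (∫ z' in (0 : ℝ)..p.2, convMult (Symbol.heat (z' - p.2)) (fun y => qA ψ η D (y, z')) p.1) +
    ∫ z' in (0 : ℝ)..p.2, convMult (Symbol.heat (z' - p.2)) (fun y => wTerm ψ η D y z') p.1

/-- All the integrals that define `𝒯[v]` and the remainder converge absolutely. -/
structure Converges (ψ : LPCutoff d) (η : TemperedDist d) (D : GradData d) : Prop where
  inner_integral : ∀ (x : E d) (r : ℝ), r ≤ 0 →
    IntegrableOn (fun τ => sourceTerm ψ η D (r - τ) x τ) (Iic r)
  outer_integral_qA : ∀ (x : E d) (z : ℝ), z < 0 → IntervalIntegrable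
    (fun z' => convMult (Symbol.heat (z' - z)) (fun y => qA ψ η D (y, z')) x) volume 0 z
  outer_integral_w : ∀ (x : E d) (z : ℝ), z < 0 → IntervalIntegrable
    (fun z' => convMult (Symbol.heat (z' - z)) (fun y => wTerm ψ η D y z') x) volume 0 z

/-- `v` is a fixed point of `𝒯` modulo constants: `v = 𝒯[v] + c` in `𝓓'(ℝ^d × J)` for some `c`. -/
def IsFixedPoint (ψ : LPCutoff d) (η f : TemperedDist d) (v : 𝓓'(halfSpace d, ℝ)) : Prop :=
  ∃ D : GradData d, HasGradData ψ v D ∧ ∃ c : ℝ, IsGivenBy v (fun p => opT ψ η f D p + c)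

/-- The remainder `R⁻(η) f = ∫_{-∞}^0 e^{τ|D|} |D| {Q_b[v](·, τ) - Q_a[v](·, τ)} dτ` of the
Dirichlet-Neumann operator, where `v` is the fixed point of `𝒯`, with data `D`. -/
def remainder (ψ : LPCutoff d) (η : TemperedDist d) (D : GradData d) (x : E d) : ℝ :=
  ∫ τ in Iio (0 : ℝ), sourceTerm ψ η D (-τ) x τ

/-- The function `G⁻(η) f = |D| f + R⁻(η) f`. -/
def dirichletNeumann (ψ : LPCutoff d) (η f : TemperedDist d) (D : GradData d) (x : E d) : ℝ :=
  (∑' j : ℤ, distBlock ψ Symbol.abs j f x) + remainder ψ η D x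

end Muskat

end

open Muskat

noncomputable section

namespace Muskat

open EuclideanSpace (single real_norm_sq_eq)
open Complex (conj_ofReal norm_real ofRealCLM measurable_ofReal ofReal_ne_zero I)
open Finset (sum_nonneg single_le_sum sum_le_sum sum_mul sum_insert mul_sum sum_singleton
  sum_add_distrib sum_comm sum_congr)
open Metric (closedBall ball)
open Function (uncurry)
open ENNReal (ofReal ofReal_lt_top toReal_mono ofReal_mul ofReal_le_ofReal toReal_mul mul_ne_top
  toReal_nonneg tsum_le_tsum summable_toReal tsum_add coe_mul mul_lt_top coe_lt_top coe_ne_top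
  ofReal_ne_top ofReal_pow add_lt_top sum_lt_top coe_add ofNNReal_finsetSum coe_le_coe)
open Real (norm_eq_abs exp exp_pos norm_of_nonneg rpow_add)
open SchwartzMap (seminorm_le_bound le_seminorm norm_iteratedFDeriv_le_seminorm)
open Muskat.Symbol (heat partialD riesz one)

variable {d : ℕ} {ψ : LPCutoff d} {f η : TemperedDist d} {m : Symbol d} {g : E d → ℂ}

local notation "V" => E d
local notation "LP" => LPCutoff d
local notation "TD" => TemperedDist d
local notation "ℍ" => halfSpace d
local notation "μJ" => halfVol d
local notation "𝓣" => 𝓓(halfSpace d, ℝ)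
local notation "CL" => cheminLerner
local notation "Fn" => E d × ℝ → ℝ
local notation "π" => Real.pi
local notation "conj" => starRingEnd ℂ
local notation:max "cis" x:max y:max =>
  Complex.exp (((2 * π * inner ℝ x y : ℝ) : ℂ) * I)
local notation "Λ" => Symbol.abs (d := d)
local notation:max "β" ψ:max => besovNorm ψ 0 Λ

variable {u : E d → ℝ} {q : E d × ℝ → ℝ} {v : 𝓓'(halfSpace d, ℝ)}
  {P : (E d × ℝ → ℝ) → ℝ≥0∞} {B c r s z : ℝ}

variable {σ : ℤ}

/-- The complex convolution kernel of the multiplier `g(D)`. -/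
def sker (g : V → ℂ) (x : V) : ℂ := 𝓕⁻ (fun ν : V => g ((2 * π) • ν)) x

/-- The real part of the convolution kernel of the multiplier `g(D)`. -/
def ker (g : V → ℂ) (x : V) : ℝ := (sker g x).re

/-- The multiplier `g(D)`, as a convolution operator. -/
def mop (g : V → ℂ) (u : V → ℝ) (x : V) : ℝ := ∫ y, ker g (x - y) * u y

/-- The `L¹` norm of the kernel. -/
def wnorm (g : V → ℂ) : ℝ := ∫ x, |ker g x|

/-- Hermitian symbols in the Wiener algebra. -/
structure Wiener (g : V → ℂ) : Prop where
  cont : Continuous g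
  int : Integrable g
  intK : Integrable (sker g)
  herm : ∀ ξ, g (-ξ) = conj (g ξ)

theorem convMult_eq_mop (m : Symbol d) (u : V → ℝ) : convMult m u = mop m.1 u := rfl

theorem two_pi_ne : (2 * π : ℝ) ≠ 0 := by positivity

theorem Wiener.int' (hg : Integrable g) : Integrable fun ν : V => g ((2 * π) • ν) :=
  (integrable_comp_smul_iff volume g two_pi_ne).2 hg

theorem sker_eq (g : V → ℂ) (x : V) : sker g x = ∫ ν : V, cis ν x * g ((2 * π) • ν) := by
  simp only [sker, Real.fourierInv_eq', smul_eq_mul]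

theorem norm_cexp_mul_I (t : ℝ) : ‖Complex.exp ((t : ℂ) * I)‖ = 1 :=
  Complex.norm_exp_ofReal_mul_I t

theorem wienerWave_integrable (hg : Integrable g) (x : V) : Integrable fun ν : V => cis ν x *
      g ((2 * π) • ν) := by
  refine (Wiener.int' hg).bdd_mul (c := 1) (by fun_prop) (ae_of_all _ fun ν => ?_)
  rw [norm_cexp_mul_I]

theorem continuous_sker (hg : Integrable g) : Continuous (sker g) := by
  have h := VectorFourier.fourierIntegral_continuous (μ := volume)
    (L := -(innerₗ V)) Real.continuous_fourierChar (by
      have : Continuous fun p : V × V => -(inner ℝ p.1 p.2 : ℝ) := by fun_prop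
      exact this) (Wiener.int' hg)
  convert h using 1
  ext x
  rw [sker_eq, VectorFourier.fourierIntegral]
  congr 1; ext ν
  rw [Circle.smul_def, Real.fourierChar_apply]
  simp [mul_assoc]

theorem continuous_ker (hg : Integrable g) : Continuous (ker g) :=
  Complex.continuous_re.comp (continuous_sker hg)

theorem conj_sker (herm : ∀ ξ, g (-ξ) = conj (g ξ)) (x : V) : conj (sker g x) = sker g x := by
  rw [sker_eq, ← integral_conj]
  rw [← integral_neg_eq_self]
  congr 1
  ext ν
  rw [map_mul, ← Complex.exp_conj, smul_neg, herm, map_mul, conj_ofReal, Complex.conj_I,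
    inner_neg_left, Complex.conj_conj]
  congr 2
  push_cast; ring

theorem ofReal_ker (herm : ∀ ξ, g (-ξ) = conj (g ξ)) (x : V) : ((ker g x : ℝ) : ℂ) = sker g x :=
  Complex.conj_eq_iff_re.1 (conj_sker herm x)

theorem abs_ker_le_norm (g : V → ℂ) (x : V) : |ker g x| ≤ ‖sker g x‖ := Complex.abs_re_le_norm _

theorem Wiener.ker_int (hg : Wiener g) : Integrable (ker g) := hg.intK.re

theorem norm_sker_le (x : V) : ‖sker g x‖ ≤ ∫ ν : V, ‖g ((2 * π) • ν)‖ := by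
  rw [sker_eq]
  refine (norm_integral_le_integral_norm _).trans (le_of_eq ?_)
  congr 1
  ext ν
  rw [norm_mul, norm_cexp_mul_I, one_mul]

theorem Wiener.fourier (hg : Wiener g) (ν : V) :
    ∫ y, Complex.exp (((-2 * π * inner ℝ y ν : ℝ) : ℂ) * I) * sker g y = g ((2 * π) • ν) := by
  have hc : Continuous fun ν : V => g ((2 * π) • ν) := hg.cont.comp (by fun_prop)
  have hi : Integrable (𝓕 fun ν : V => g ((2 * π) • ν)) := by
    have := hg.intK.comp_neg
    refine this.congr (ae_of_all _ fun x => ?_)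
    simp [sker, Real.fourierInv_eq_fourier_neg]
  have := congrFun (hc.fourier_fourierInv_eq (Wiener.int' hg.int) hi) ν
  rw [Real.fourier_eq'] at this
  simp only [smul_eq_mul] at this
  exact this

theorem Wiener.norm_le (hg : Wiener g) (ξ : V) : ‖g ξ‖ ≤ ∫ y, ‖sker g y‖ := by
  have h := hg.fourier ((2 * π)⁻¹ • ξ)
  rw [smul_inv_smul₀ two_pi_ne] at h
  rw [← h]
  refine (norm_integral_le_integral_norm _).trans (le_of_eq ?_)
  congr 1
  ext ν
  rw [norm_mul, norm_cexp_mul_I, one_mul]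

theorem Wiener.wnorm_eq (hg : Wiener g) : wnorm g = ∫ y, ‖sker g y‖ := by
  unfold wnorm
  congr 1
  ext y
  rw [← ofReal_ker hg.herm, norm_real, norm_eq_abs]

theorem wnorm_nonneg (g : V → ℂ) : 0 ≤ wnorm g := integral_nonneg fun _ => abs_nonneg _

theorem Wiener.sker_mul {f g : V → ℂ} (hf : Integrable f) (hg : Wiener g) (x : V) :
    sker (fun ξ => f ξ * g ξ) x = ∫ y, sker f (x - y) * sker g y := by
  have hF := Wiener.int' hf
  have hint : Integrable (fun p : V × V =>
      cis p.2 (x - p.1) * (f ((2 * π) • p.2) * sker g p.1)) (volume.prod volume) := by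
    have h1 : Integrable (fun p : V × V => f ((2 * π) • p.2) * sker g p.1)
        (volume.prod volume) := by
      refine (hg.intK.mul_prod hF).congr (ae_of_all _ fun p => mul_comm _ _)
    refine h1.bdd_mul (c := 1) (by fun_prop) (ae_of_all _ fun ν => ?_)
    rw [norm_cexp_mul_I]
  calc sker (fun ξ => f ξ * g ξ) x
      = ∫ ν : V, ∫ y : V, cis ν (x - y) * (f ((2 * π) • ν) * sker g y) := by
        rw [sker_eq]
        congr 1
        ext ν
        rw [← hg.fourier ν, ← integral_const_mul, ← integral_const_mul]
        congr 1
        ext y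
        have : cis ν (x - y) = cis ν x * Complex.exp (((-2 * π * inner ℝ y ν : ℝ) : ℂ) * I) := by
          rw [← Complex.exp_add, ← add_mul, ← Complex.ofReal_add, inner_sub_right,
            real_inner_comm y ν]
          congr 4; ring
        rw [this]; ring
    _ = ∫ y : V, ∫ ν : V, cis ν (x - y) * (f ((2 * π) • ν) * sker g y) := by
        rw [integral_integral_swap]
        exact hint.swap
    _ = _ := by
        congr 1
        ext y
        rw [sker_eq f, ← integral_mul_const]
        congr 1
        ext ν
        ring

theorem integrable_conv {a b : V → ℂ} (ha : Integrable a) (hb : Integrable b) :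
    Integrable fun x => ∫ y, a (x - y) * b y := by
  have := hb.integrable_convolution (ContinuousLinearMap.mul ℝ ℂ).flip ha
  refine this.congr (ae_of_all _ fun x => ?_)
  simp only [convolution, ContinuousLinearMap.flip_apply, ContinuousLinearMap.mul_apply']

theorem integrable_conv_real {a b : V → ℝ} (ha : Integrable a) (hb : Integrable b) :
    Integrable fun x => ∫ y, a (x - y) * b y := by
  have := hb.integrable_convolution (ContinuousLinearMap.mul ℝ ℝ).flip ha
  refine this.congr (ae_of_all _ fun x => ?_)
  simp only [convolution, ContinuousLinearMap.flip_apply, ContinuousLinearMap.mul_apply']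

theorem Wiener.mul {f g : V → ℂ} (hf : Wiener f) (hg : Wiener g) : Wiener fun ξ => f ξ * g ξ where
  cont := hf.cont.mul hg.cont
  int := hf.int.mul_bdd (c := ∫ y, ‖sker g y‖) hg.cont.aestronglyMeasurable
    (ae_of_all _ fun ξ => hg.norm_le ξ)
  intK := (integrable_conv hf.intK hg.intK).congr
    (ae_of_all _ fun x => (Wiener.sker_mul hf.int hg x).symm)
  herm ξ := by rw [hf.herm, hg.herm, map_mul]

theorem Wiener.ker_mul {f g : V → ℂ} (hf : Wiener f) (hg : Wiener g) (x : V) :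
    ker (fun ξ => f ξ * g ξ) x = ∫ y, ker f (x - y) * ker g y := by
  have h := Wiener.sker_mul hf.int hg x
  rw [← ofReal_ker (hf.mul hg).herm] at h
  simp_rw [← ofReal_ker hf.herm, ← ofReal_ker hg.herm, ← Complex.ofReal_mul] at h
  rw [integral_complex_ofReal] at h
  exact Complex.ofReal_injective h

theorem Wiener.shift_int (hg : Wiener g) (x : V) :
    Integrable fun y => ker g (x - y) := hg.ker_int.comp_sub_left x

theorem Wiener.mul_bdd_int (hg : Wiener g) (hu : Measurable u) (hB : ∀ y, |u y| ≤ B) (x : V) :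
    Integrable fun y => ker g (x - y) * u y :=
  (hg.shift_int x).mul_bdd (c := B) hu.aestronglyMeasurable (ae_of_all _ hB)

theorem Wiener.integral_abs_shift (g : V → ℂ) (x : V) : ∫ y, |ker g (x - y)| = wnorm g :=
  integral_sub_left_eq_self (fun y => |ker g y|) volume x

theorem Wiener.abs_mop_le (hg : Wiener g) (hB : ∀ y, |u y| ≤ B) (x : V) : |mop g u x| ≤ wnorm g * B := by
  rw [← Wiener.integral_abs_shift g x, ← integral_mul_const]
  refine norm_integral_le_of_norm_le (f := fun y => ker g (x - y) * u y)
    ((hg.shift_int x).abs.mul_const B) (ae_of_all _ fun y => ?_)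
  rw [norm_mul]
  exact mul_le_mul_of_nonneg_left (hB y) (abs_nonneg _)

theorem measurable_mop (hg : Integrable g) (hu : Measurable u) : Measurable (mop g u) := by
  have : StronglyMeasurable (uncurry fun x y : V => ker g (x - y) * u y) := by
    refine Measurable.stronglyMeasurable ?_
    exact (((continuous_ker hg).measurable).comp (measurable_fst.sub measurable_snd)).mul
      (hu.comp measurable_snd)
  exact this.integral_prod_right.measurable

theorem mop_congr_ae (g : V → ℂ) {u v : V → ℝ} (h : u =ᵐ[volume] v) : mop g u = mop g v := by
  ext x
  refine integral_congr_ae ?_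
  filter_upwards [h] with y hy
  rw [hy]

theorem Wiener.integrable_adjoint (hg : Wiener g) {k : V → ℝ} (hk : Integrable k)
    {v : V → ℝ} (hv : Measurable v) (hB : ∀ y, |v y| ≤ B) :
    Integrable (fun p : V × V => k p.1 * ker g (p.1 - p.2) * v p.2) (volume.prod volume) := by
  have h1 : Integrable (fun p : V × V => k p.1 * ker g (p.1 - p.2)) (volume.prod volume) := by
    have h2 := hk.mul_prod hg.ker_int
    have hm : MeasurePreserving (fun p : V × V => (p.1, p.1 - p.2))
        (volume.prod volume) (volume.prod volume) :=
      (MeasurePreserving.id (volume : Measure V)).skew_product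
        (g := fun a b : V => a - b) (μc := (volume : Measure V))
        (μd := (volume : Measure V)) (by fun_prop)
        (ae_of_all _ fun a => (Measure.measurePreserving_sub_left volume a).map_eq)
    exact (hm.integrable_comp h2.aestronglyMeasurable).2 h2
  exact h1.mul_bdd (c := B) (hv.comp measurable_snd).aestronglyMeasurable 
    (ae_of_all _ fun _ => hB _)

theorem Wiener.mop_mop {f g : V → ℂ} (hf : Wiener f) (hg : Wiener g)
    (hu : Measurable u) (hB : ∀ y, |u y| ≤ B) (x : V) :
    mop f (mop g u) x = mop (fun ξ => f ξ * g ξ) u x := by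
  have hint := hg.integrable_adjoint (hf.shift_int x) hu hB
  calc mop f (mop g u) x = ∫ y, ∫ a, ker f (x - y) * ker g (y - a) * u a := by
        unfold mop
        congr 1
        ext y
        rw [← integral_const_mul]
        congr 1
        ext a
        ring
    _ = ∫ a, ∫ y, ker f (x - y) * ker g (y - a) * u a := by
        rw [integral_integral_swap hint]
    _ = _ := by
        unfold mop
        congr 1
        ext a
        rw [hf.ker_mul hg, ← integral_mul_const,
          ← integral_sub_right_eq_self (fun y => ker f (x - a - y) * ker g y * u a) a]
        congr 1
        ext y
        congr 3
        abel

theorem Wiener.zero : Wiener (fun _ : V => (0 : ℂ)) where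
  cont := continuous_const
  int := integrable_zero _ _ _
  intK := by
    have : sker (fun _ : V => (0 : ℂ)) = fun _ => 0 := by
      ext x; simp [sker_eq]
    rw [this]; exact integrable_zero _ _ _
  herm ξ := by simp

theorem sker_add {f g : V → ℂ} (hf : Integrable f) (hg : Integrable g) :
    sker (fun ξ => f ξ + g ξ) = fun x => sker f x + sker g x := by
  ext x
  simp only [sker_eq, mul_add]
  exact integral_add (wienerWave_integrable hf x) (wienerWave_integrable hg x)

theorem sker_const_mul (c : ℂ) (g : V → ℂ) : sker (fun ξ => c * g ξ) = fun x => c * sker g x := by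
  ext x
  rw [sker_eq, sker_eq, ← integral_const_mul]
  congr 1; ext; ring

theorem Wiener.add {f g : V → ℂ} (hf : Wiener f) (hg : Wiener g) : Wiener fun ξ => f ξ + g ξ where
  cont := hf.cont.add hg.cont
  int := hf.int.add hg.int
  intK := by rw [sker_add hf.int hg.int]; exact hf.intK.add hg.intK
  herm ξ := by rw [hf.herm, hg.herm, map_add]

theorem Wiener.const_mul (hg : Wiener g) (c : ℝ) : Wiener fun ξ => (c : ℂ) * g ξ where
  cont := continuous_const.mul hg.cont
  int := hg.int.const_mul _
  intK := by rw [sker_const_mul]; exact hg.intK.const_mul _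
  herm ξ := by rw [hg.herm, map_mul, conj_ofReal]

theorem ker_add {f g : V → ℂ} (hf : Integrable f) (hg : Integrable g) (x : V) :
    ker (fun ξ => f ξ + g ξ) x = ker f x + ker g x := by
  simp [ker, sker_add hf hg]

theorem ker_const_mul (c : ℝ) (g : V → ℂ) (x : V) :
    ker (fun ξ => (c : ℂ) * g ξ) x = c * ker g x := by
  simp [ker, sker_const_mul]

theorem Wiener.mop_add {f g : V → ℂ} (hf : Wiener f) (hg : Wiener g)
    (hu : Measurable u) (hB : ∀ y, |u y| ≤ B) (x : V) :
    mop (fun ξ => f ξ + g ξ) u x = mop f u x + mop g u x := by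
  unfold mop
  rw [← integral_add (hf.mul_bdd_int hu hB x) (hg.mul_bdd_int hu hB x)]
  congr 1; ext y
  rw [ker_add hf.int hg.int, add_mul]

theorem mop_const_mul (c : ℝ) (g : V → ℂ) (u : V → ℝ) (x : V) :
    mop (fun ξ => (c : ℂ) * g ξ) u x = c * mop g u x := by
  unfold mop
  rw [← integral_const_mul]
  congr 1; ext y
  rw [ker_const_mul, mul_assoc]

theorem integrable_of_hasSum {α ι F : Type*} [MeasurableSpace α] {μ : Measure α} [Countable ι]
    [NormedAddCommGroup F] {f : ι → α → F} {g : α → F} (hg : AEStronglyMeasurable g μ)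
    (hf : ∀ i, Integrable (f i) μ) (hs : ∀ᵐ x ∂μ, HasSum (fun i => f i x) (g x))
    (h1 : Summable fun i => ∫ x, ‖f i x‖ ∂μ) : Integrable g μ := by
  refine ⟨hg, ?_⟩
  have hle : ∫⁻ x, ‖g x‖ₑ ∂μ ≤ ∑' i, ∫⁻ x, ‖f i x‖ₑ ∂μ := by
    rw [← lintegral_tsum fun i => (hf i).aestronglyMeasurable.enorm]
    refine lintegral_mono_ae ?_
    filter_upwards [hs] with x hx
    rw [← hx.tsum_eq]
    exact enorm_tsum_le_tsum_enorm
  refine lt_of_le_of_lt hle ?_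
  have : ∀ i, ∫⁻ x, ‖f i x‖ₑ ∂μ = ofReal (∫ x, ‖f i x‖ ∂μ) := fun i => by
    rw [ofReal_integral_norm_eq_lintegral_enorm (hf i)]
  simp_rw [this]
  rw [← ENNReal.ofReal_tsum_of_nonneg (fun i => integral_nonneg fun _ => norm_nonneg _) h1]
  exact ofReal_lt_top

theorem hasSum_integral_of_hasSum {α ι F : Type*} [MeasurableSpace α] {μ : Measure α} [Countable ι]
    [NormedAddCommGroup F] [NormedSpace ℝ F] [CompleteSpace F] {f : ι → α → F} {g : α → F}
    (hf : ∀ i, Integrable (f i) μ) (hs : ∀ᵐ x ∂μ, HasSum (fun i => f i x) (g x))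
    (h1 : Summable fun i => ∫ x, ‖f i x‖ ∂μ) : HasSum (fun i => ∫ x, f i x ∂μ) (∫ x, g x ∂μ) := by
  have := hasSum_integral_of_summable_integral_norm hf h1
  convert this using 1
  refine integral_congr_ae ?_
  filter_upwards [hs] with x hx
  exact hx.tsum_eq.symm

theorem integral_norm_sc (g : V → ℂ) : ∫ ν : V, ‖g ((2 * π) • ν)‖ =
    |((2 * π) ^ d)⁻¹| * ∫ ξ, ‖g ξ‖ := by
  have := Measure.integral_comp_smul (volume : Measure V) (fun ξ => ‖g ξ‖) (2 * π)
  simpa using this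

/-- Absolutely convergent series in the Wiener algebra. -/
theorem Wiener.tsum {ι : Type*} [Countable ι] {f : ι → V → ℂ}
    (hf : ∀ i, Wiener (f i)) (hg : Continuous g) (hs : ∀ ξ, ξ ≠ 0 → HasSum (fun i => f i ξ) (g ξ))
    (herm : ∀ ξ, g (-ξ) = conj (g ξ)) (hne : Nontrivial V)
    (h1 : Summable fun i => ∫ ξ, ‖f i ξ‖) (h2 : Summable fun i => wnorm (f i)) :
    Wiener g ∧ (∀ x, HasSum (fun i => ker (f i) x) (ker g x)) := by
  have h0 : ∀ᵐ ξ : V, ξ ≠ 0 := by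
    simp [ae_iff]
  have hgint : Integrable g := integrable_of_hasSum hg.aestronglyMeasurable (fun i => (hf i).int)
    (h0.mono fun ξ hξ => hs ξ hξ) h1
  have hk : ∀ x, HasSum (fun i => sker (f i) x) (sker g x) := by
    intro x
    simp_rw [sker_eq]
    refine hasSum_integral_of_hasSum (fun i => wienerWave_integrable (hf i).int x) ?_ ?_
    · filter_upwards [h0] with ξ hξ
      exact (hs _ (smul_ne_zero two_pi_ne hξ)).mul_left _
    · simp_rw [norm_mul, norm_cexp_mul_I, one_mul, integral_norm_sc]
      exact h1.mul_left _
  have hki : Integrable (sker g) := by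
    refine integrable_of_hasSum (continuous_sker hgint).aestronglyMeasurable (fun i => (hf i).intK)
      (ae_of_all _ hk) ?_
    simpa only [(hf _).wnorm_eq] using h2
  refine ⟨⟨hg, hgint, hki, herm⟩, fun x => ?_⟩
  exact Complex.hasSum_re (hk x)

theorem hasSum_mop {ι : Type*} [Countable ι] {f : ι → V → ℂ}
    (hf : ∀ i, Wiener (f i)) (hk : ∀ x, HasSum (fun i => ker (f i) x) (ker g x))
    (h2 : Summable fun i => wnorm (f i)) (hu : Measurable u) (hB : ∀ y, |u y| ≤ B) (x : V) :
    HasSum (fun i => mop (f i) u x) (mop g u x) := by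
  refine hasSum_integral_of_hasSum (fun i => (hf i).mul_bdd_int hu hB x)
    (ae_of_all _ fun y => (hk (x - y)).mul_right _) ?_
  refine .of_nonneg_of_le (fun i => integral_nonneg fun _ => norm_nonneg _) (fun i => ?_)
    (h2.mul_right B)
  rw [← Wiener.integral_abs_shift (f i) x, ← integral_mul_const]
  refine integral_mono ((hf i).mul_bdd_int hu hB x).norm
    (((hf i).shift_int x).abs.mul_const B) fun y => ?_
  simp only [norm_mul]
  exact mul_le_mul_of_nonneg_left (hB y) (abs_nonneg _)

theorem wnorm_mul_le {f g : V → ℂ} (hf : Wiener f) (hg : Wiener g) :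
    wnorm (fun ξ => f ξ * g ξ) ≤ wnorm f * wnorm g := by
  have h1 : ∫ x, (∫ y, |ker f (x - y)| * |ker g y|) = wnorm f * wnorm g := by
    have := integral_convolution (ContinuousLinearMap.mul ℝ ℝ) hg.ker_int.abs hf.ker_int.abs
    simp only [convolution, ContinuousLinearMap.mul_apply'] at this
    rw [wnorm, wnorm, mul_comm, ← this]
    simp_rw [mul_comm]
  rw [← h1]
  refine integral_mono (hf.mul hg).ker_int.abs (integrable_conv_real hf.ker_int.abs hg.ker_int.abs)
    fun x => ?_
  simp only [hf.ker_mul hg]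
  refine (abs_integral_le_integral_abs).trans (le_of_eq ?_)
  simp_rw [abs_mul]

/-! ### Scaling -/

theorem sker_scale (g : V → ℂ) (hc : 0 < c) (x : V) :
    sker (fun ξ => g (c • ξ)) x = ((c ^ d)⁻¹ : ℝ) * sker g (c⁻¹ • x) := by
  rw [sker_eq, sker_eq]
  have := Measure.integral_comp_smul (volume : Measure V) (fun ν : V =>
    cis ν (c⁻¹ • x) * g ((2 * π) • ν)) c
  rw [finrank_euclideanSpace_fin, abs_of_pos (by positivity)] at this
  rw [Complex.real_smul] at this
  rw [← this]
  congr 1; ext ν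
  rw [smul_comm c, inner_smul_left, inner_smul_right]
  simp only [conj_trivial]
  rw [mul_inv_cancel_left₀ hc.ne']

theorem ker_scale (g : V → ℂ) (hc : 0 < c) (x : V) :
    ker (fun ξ => g (c • ξ)) x = (c ^ d)⁻¹ * ker g (c⁻¹ • x) := by
  rw [ker, sker_scale g hc, Complex.re_ofReal_mul]; rfl

theorem wnorm_scale (g : V → ℂ) (hc : 0 < c) : wnorm (fun ξ => g (c • ξ)) = wnorm g := by
  unfold wnorm
  simp_rw [ker_scale g hc, abs_mul]
  rw [integral_const_mul]
  have := Measure.integral_comp_smul (volume : Measure V) (fun x => |ker g x|) c⁻¹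
  rw [this, finrank_euclideanSpace_fin, inv_pow, inv_inv, smul_eq_mul, ← mul_assoc, ← abs_mul,
    inv_mul_cancel₀ (by positivity), abs_one, one_mul]

theorem Wiener.scale (hg : Wiener g) (hc : 0 < c) : Wiener fun ξ => g (c • ξ) where
  cont := hg.cont.comp (by fun_prop)
  int := (integrable_comp_smul_iff volume g hc.ne').2 hg.int
  intK := by
    have : sker (fun ξ => g (c • ξ)) = fun x => (((c ^ d)⁻¹ : ℝ) : ℂ) * sker g (c⁻¹ • x) :=
      funext fun x => sker_scale g hc x
    rw [this]
    exact ((integrable_comp_smul_iff volume (sker g) (inv_ne_zero hc.ne')).2 hg.intK).const_mul _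
  herm ξ := by rw [smul_neg, hg.herm]

/-! ### Kernel bounds -/

theorem exists_integral_fourierInv_le (d : ℕ) : ∃ (N : ℕ) (C : ℝ), 0 ≤ C ∧ ∀ f : 𝓢(E d, ℂ),
    ∫ x, ‖𝓕⁻ (f : E d → ℂ) x‖ ≤ C * ((Finset.Iic (N, N)).sup
      (schwartzSeminormFamily ℂ (E d) ℂ)) f := by
  let T : 𝓢(E d, ℂ) →L[ℂ] Lp ℂ 1 (volume : Measure (E d)) :=
    (SchwartzMap.toLpCLM ℂ ℂ 1 volume).comp (FourierTransform.fourierInvCLM ℂ 𝓢(E d, ℂ))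
  let q : Seminorm ℂ 𝓢(E d, ℂ) := (normSeminorm ℂ _).comp T.toLinearMap
  have hq : Continuous q := continuous_norm.comp T.continuous
  obtain ⟨s, C, -, hC⟩ := Seminorm.bound_of_continuous (schwartz_withSeminorms ℂ (E d) ℂ) q hq
  obtain ⟨N, hN⟩ : ∃ N : ℕ, s ⊆ Finset.Iic (N, N) := by
    refine ⟨s.sup fun p => max p.1 p.2, fun p hp => ?_⟩
    have := Finset.le_sup (f := fun p : ℕ × ℕ => max p.1 p.2) hp
    rw [Finset.mem_Iic]
    exact ⟨(le_max_left _ _).trans this, (le_max_right _ _).trans this⟩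
  refine ⟨N, C, C.2, fun f => ?_⟩
  have h1 : ∫ x, ‖𝓕⁻ (f : E d → ℂ) x‖ = q f := by
    change _ = ‖SchwartzMap.toLp (𝓕⁻ f) 1 volume‖
    rw [L1.norm_eq_integral_norm]
    refine integral_congr_ae ?_
    filter_upwards [SchwartzMap.coeFn_toLp (𝓕⁻ f) 1 volume] with x hx
    rw [hx, SchwartzMap.fourierInv_coe]
  rw [h1]
  refine (hC f).trans ?_
  rw [smul_apply, NNReal.smul_def, smul_eq_mul]
  exact mul_le_mul_of_nonneg_left (Seminorm.le_def.1 (Finset.sup_mono hN) f) C.2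

theorem wiener_of_schwartz (f : 𝓢(V, ℂ)) (herm : ∀ ξ, f (-ξ) = conj (f ξ)) :
    Wiener f ∧ wnorm f ≤ ∫ x, ‖𝓕⁻ (f : V → ℂ) x‖ := by
  have hpi : (0 : ℝ) < 2 * π := by positivity
  have hs : sker (fun ξ => f ((2 * π)⁻¹ • ξ)) = 𝓕⁻ (f : V → ℂ) := by
    ext x
    simp only [sker, inv_smul_smul₀ two_pi_ne]
  have hW : Wiener fun ξ => f ((2 * π)⁻¹ • ξ) := by
    refine ⟨f.continuous.comp (by fun_prop),
      (integrable_comp_smul_iff volume f (inv_ne_zero two_pi_ne)).2 f.integrable, ?_, ?_⟩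
    · rw [hs, ← SchwartzMap.fourierInv_coe]
      exact (𝓕⁻ f).integrable
    · intro ξ; rw [smul_neg, herm]
  have := hW.scale hpi
  simp only [inv_smul_smul₀ two_pi_ne] at this
  refine ⟨this, ?_⟩
  rw [← wnorm_scale (f : V → ℂ) (inv_pos.2 hpi), hW.wnorm_eq, hs]

/-- Smooth functions supported in the annulus `3/8 ≤ |ξ| ≤ 6`. -/
structure Annular (g : V → ℂ) : Prop where
  smooth : ContDiff ℝ ∞ g
  supp : ∀ ξ, g ξ ≠ 0 → 3 / 8 ≤ ‖ξ‖ ∧ ‖ξ‖ ≤ 6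

theorem Annular.hasCompactSupport (hg : Annular g) : HasCompactSupport g := by
  refine HasCompactSupport.intro (isCompact_closedBall (0 : V) 6) fun ξ hξ => ?_
  by_contra h
  exact hξ (by simpa using (hg.supp ξ h).2)

theorem isOpen_compl_annulus : IsOpen {ξ : V | ¬ (3 / 8 ≤ ‖ξ‖ ∧ ‖ξ‖ ≤ 6)} := by
  have : IsClosed {ξ : V | 3 / 8 ≤ ‖ξ‖ ∧ ‖ξ‖ ≤ 6} :=
    (isClosed_le continuous_const continuous_norm).inter
      (isClosed_le continuous_norm continuous_const)
  exact this.isOpen_compl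

theorem Annular.eventually_zero (hg : Annular g) {ξ : V}
    (h : ¬ (3 / 8 ≤ ‖ξ‖ ∧ ‖ξ‖ ≤ 6)) : g =ᶠ[𝓝 ξ] fun _ => 0 := by
  filter_upwards [isOpen_compl_annulus.mem_nhds h] with ζ hζ
  by_contra h'
  exact hζ (hg.supp ζ h')

/-- Multiplying by a function that is smooth away from the origin. -/
theorem Annular.mul (hg : Annular g) {m : V → ℂ}
    (hm : ∀ ξ, ξ ≠ 0 → ContDiffAt ℝ ∞ m ξ) : Annular fun ξ => m ξ * g ξ where
  smooth := by
    rw [contDiff_iff_contDiffAt]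
    intro ξ
    by_cases h : 3 / 8 ≤ ‖ξ‖ ∧ ‖ξ‖ ≤ 6
    · refine (hm ξ fun h0 => ?_).mul hg.smooth.contDiffAt
      rw [h0, norm_zero] at h
      norm_num at h
    · refine (contDiffAt_const (c := (0 : ℂ))).congr_of_eventuallyEq ?_
      filter_upwards [hg.eventually_zero h] with ζ hζ
      rw [hζ, mul_zero]
  supp ξ h := hg.supp ξ (right_ne_zero_of_mul h)

theorem contDiffAt_radial {F : ℝ → ℝ} (hF : ContDiff ℝ ∞ F) (ξ : V) (h : ξ ≠ 0) :
    ContDiffAt ℝ ∞ (fun ξ : V => ((F ‖ξ‖ : ℝ) : ℂ)) ξ :=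
  ofRealCLM.contDiff.contDiffAt.comp ξ (hF.contDiffAt.comp ξ (contDiffAt_norm ℝ h))

theorem exists_uniform_bound {X : Type*} {t : Set X} {a : ℕ → X → ℝ}
    (h : ∀ i, ∃ M, ∀ x ∈ t, a i x ≤ M) (N : ℕ) : ∃ M, 1 ≤ M ∧ ∀ i ≤ N, ∀ x ∈ t, a i x ≤ M := by
  choose M hM using h
  refine ⟨1 + ∑ i ∈ Finset.range (N + 1), |M i|, le_add_of_nonneg_right (by positivity),
    fun i hi x hx => (hM i x hx).trans ?_⟩
  have := single_le_sum (f := fun i => |M i|) (fun i _ => abs_nonneg _)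
    (Finset.mem_range.2 (Nat.lt_succ_of_le hi))
  linarith [le_abs_self (M i)]

/-- The kernel of `F(|D|) g(D)`, where `g` is supported in an annulus. -/
theorem Annular.radial_bound (hg : Annular g) (herm : ∀ ξ, g (-ξ) = conj (g ξ)) :
    ∃ (N : ℕ) (C : ℝ), 0 ≤ C ∧ ∀ F : ℝ → ℝ, ContDiff ℝ ∞ F → ∀ B : ℝ,
      (∀ i ≤ N, ∀ r ∈ Icc (3 / 8 : ℝ) 6, ‖iteratedFDeriv ℝ i F r‖ ≤ B) →
      Wiener (fun ξ => ((F ‖ξ‖ : ℝ) : ℂ) * g ξ) ∧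
        wnorm (fun ξ => ((F ‖ξ‖ : ℝ) : ℂ) * g ξ) ≤ C * B := by
  obtain ⟨N, C₀, hC₀, hC⟩ := exists_integral_fourierInv_le d
  set s : Set V := {0}ᶜ with hs
  have hso : IsOpen s := isOpen_compl_singleton
  have hus : UniqueDiffOn ℝ s := hso.uniqueDiffOn
  set K : Set V := {ξ | 3 / 8 ≤ ‖ξ‖ ∧ ‖ξ‖ ≤ 6} with hK
  have hKs : K ⊆ s := fun ξ h h0 => by
    rw [mem_singleton_iff] at h0
    rw [hK, mem_ofPred_eq, h0, norm_zero] at h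
    norm_num at h
  have hKc : IsCompact K := by
    refine (isCompact_closedBall (0 : V) 6).of_isClosed_subset
      ((isClosed_le continuous_const continuous_norm).inter
      (isClosed_le continuous_norm continuous_const)) fun ξ h => by simpa using h.2
  have hns : ContDiffOn ℝ ∞ (fun ξ : V => ‖ξ‖) s := fun ξ h =>
    (contDiffAt_norm ℝ h).contDiffWithinAt
  obtain ⟨M, hM1, hM⟩ := exists_uniform_bound (fun i => hKc.exists_bound_of_continuousOn
    ((hns.continuousOn_iteratedFDerivWithin (m := i) (by exact_mod_cast le_top) hus).mono hKs)) N
  obtain ⟨G, hG1, hG⟩ := exists_uniform_bound (fun i =>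
    ((hg.hasCompactSupport.iteratedFDeriv (𝕜 := ℝ) i).exists_bound_of_continuous
      (hg.smooth.continuous_iteratedFDeriv (by exact_mod_cast le_top))).imp
        fun M hM ξ _ => hM ξ) N (t := univ)
  set A : ℝ := ∑ n ∈ Finset.range (N + 1), ∑ i ∈ Finset.range (n + 1),
    (n.choose i : ℝ) * (i.factorial * M ^ i) * G with hA
  have hM0 : 0 ≤ M := by linarith
  have hG0 : 0 ≤ G := by linarith
  have hA0 : 0 ≤ A := by positivity
  refine ⟨N, C₀ * (6 ^ N * A), by positivity, fun F hF B hB => ?_⟩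
  have hB0 : 0 ≤ B := (norm_nonneg _).trans (hB 0 (Nat.zero_le _) 1 (by norm_num))
  have hann := hg.mul (contDiffAt_radial hF)
  set f : 𝓢(V, ℂ) := hann.hasCompactSupport.toSchwartzMap hann.smooth with hf
  have hfe : (f : V → ℂ) = fun ξ => ((F ‖ξ‖ : ℝ) : ℂ) * g ξ := rfl
  have hh : ∀ ξ, f (-ξ) = conj (f ξ) := fun ξ => by
    simp only [hfe, norm_neg, herm, map_mul, conj_ofReal]
  obtain ⟨h1, h2⟩ := wiener_of_schwartz f hh
  refine ⟨h1, h2.trans ((hC f).trans ?_)⟩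
  rw [mul_assoc C₀]
  refine mul_le_mul_of_nonneg_left ?_ hC₀
  refine Seminorm.finset_sup_apply_le (by positivity) fun p hp => ?_
  have hp' : p.1 ≤ N ∧ p.2 ≤ N := by simpa [Prod.le_def] using hp
  refine seminorm_le_bound ℂ p.1 p.2 f (by positivity) fun ξ => ?_
  by_cases hξ : ξ ∈ K
  swap
  · have : (f : V → ℂ) =ᶠ[𝓝 ξ] fun _ => 0 := hann.eventually_zero hξ
    rw [(this.iteratedFDeriv ℝ p.2).eq_of_nhds]
    simp only [iteratedFDeriv_fun_zero, Pi.zero_apply, norm_zero, mul_zero]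
    positivity
  have hξs := hKs hξ
  have hp6 : ‖ξ‖ ^ p.1 ≤ 6 ^ N :=
    (pow_le_pow_left₀ (norm_nonneg _) hξ.2 _).trans (pow_le_pow_right₀ (by norm_num) hp'.1)
  have hD : ‖iteratedFDeriv ℝ p.2 f ξ‖ ≤ A * B := by
    rw [← iteratedFDerivWithin_of_isOpen p.2 hso hξs, hfe]
    have hFs : ContDiffOn ℝ ∞ (fun ξ : V => ((F ‖ξ‖ : ℝ) : ℂ)) s := fun ξ h =>
      (contDiffAt_radial hF ξ h).contDiffWithinAt
    refine (norm_iteratedFDerivWithin_mul_le hFs hg.smooth.contDiffOn hus hξs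
      (by exact_mod_cast le_top)).trans ?_
    have hterm : ∀ i ∈ Finset.range (p.2 + 1), (p.2.choose i : ℝ) *
        ‖iteratedFDerivWithin ℝ i (fun ξ : V => ((F ‖ξ‖ : ℝ) : ℂ)) s ξ‖ *
        ‖iteratedFDerivWithin ℝ (p.2 - i) g s ξ‖ ≤
        (p.2.choose i : ℝ) * (i.factorial * M ^ i) * G * B := by
      intro i hi
      have hi' : i ≤ N := (Nat.lt_succ_iff.1 (Finset.mem_range.1 hi)).trans hp'.2
      have e1 : ‖iteratedFDerivWithin ℝ i (fun ξ : V => ((F ‖ξ‖ : ℝ) : ℂ)) s ξ‖ ≤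
          i.factorial * B * M ^ i := by
        have hc := norm_iteratedFDerivWithin_comp_le (n := i) (g := F)
          (f := fun ξ : V => ‖ξ‖) (s := s) (t := univ) (x := ξ) (N := ∞)
          hF.contDiffOn hns (by exact_mod_cast le_top) uniqueDiffOn_univ hus
          (mapsTo_univ _ _) hξs (C := B) (D := M) (fun k hk => by
            rw [iteratedFDerivWithin_univ]
            exact hB k (hk.trans hi') _ hξ)
          (fun k hk1 hk => (hM k (hk.trans hi') ξ hξ).trans (le_self_pow₀ hM1 (by omega)))
        have hl := Complex.ofRealLI.norm_iteratedFDerivWithin_comp_left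
          (f := fun ξ : V => F ‖ξ‖) (s := s) (n := ∞)
          ((hF.contDiffOn (s := univ)).comp hns (mapsTo_univ _ _) ξ hξs)
          hus hξs (i := i) (by exact_mod_cast le_top)
        exact hl.le.trans hc
      have e2 : ‖iteratedFDerivWithin ℝ (p.2 - i) g s ξ‖ ≤ G := by
        rw [iteratedFDerivWithin_of_isOpen _ hso hξs]
        exact hG _ ((Nat.sub_le _ _).trans hp'.2) ξ trivial
      calc _ ≤ (p.2.choose i : ℝ) * (i.factorial * B * M ^ i) * G := by gcongr
        _ = _ := by ring
    refine (sum_le_sum hterm).trans ?_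
    rw [← sum_mul]
    refine mul_le_mul_of_nonneg_right ?_ hB0
    exact single_le_sum (f := fun n : ℕ => ∑ i ∈ Finset.range (n + 1),
      (n.choose i : ℝ) * (i.factorial * M ^ i) * G) (fun n _ => by positivity)
      (Finset.mem_range.2 (Nat.lt_succ_of_le hp'.2))
  calc ‖ξ‖ ^ p.1 * ‖iteratedFDeriv ℝ p.2 f ξ‖ ≤ 6 ^ N * (A * B) := by gcongr
    _ = _ := by ring

theorem norm_iteratedFDeriv_exp (t : ℝ) (i : ℕ) (r : ℝ) :
    ‖iteratedFDeriv ℝ i (fun r => exp (-t * r)) r‖ = |t| ^ i * exp (-t * r) := by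
  rw [norm_iteratedFDeriv_eq_norm_iteratedDeriv, iteratedDeriv_exp_const_mul]
  simp

theorem Annular.heat_bound (hg : Annular g) (herm : ∀ ξ, g (-ξ) = conj (g ξ)) :
    ∃ C : ℝ, 0 ≤ C ∧ ∀ t : ℝ, 0 ≤ t → Wiener (fun ξ => ((exp (-t * ‖ξ‖) : ℝ) : ℂ) * g ξ) ∧
        wnorm (fun ξ => ((exp (-t * ‖ξ‖) : ℝ) : ℂ) * g ξ) ≤ C * exp (-(t / 4)) := by
  obtain ⟨N, C, hC0, hC⟩ := hg.radial_bound herm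
  set A : ℝ := ∑ i ∈ Finset.range (N + 1), (8 : ℝ) ^ i * i.factorial with hA
  refine ⟨C * A, by positivity, fun t ht => ?_⟩
  have := hC (fun r => exp (-t * r)) (by fun_prop) (A * exp (-(t / 4))) ?_
  · rwa [← mul_assoc] at this
  intro i hi r hr
  rw [norm_iteratedFDeriv_exp, abs_of_nonneg ht]
  have h1 : t ^ i ≤ (8 : ℝ) ^ i * i.factorial * exp (t / 8) := by
    have := Real.pow_div_factorial_le_exp (t / 8) (by positivity) i
    rw [div_le_iff₀ (by positivity), div_pow, div_le_iff₀ (by positivity)] at this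
    linarith
  have h2 : exp (-t * r) ≤ exp (-(t / 8)) * exp (-(t / 4)) := by
    rw [← Real.exp_add]
    refine Real.exp_le_exp.2 ?_
    nlinarith [hr.1]
  have h3 : (8 : ℝ) ^ i * i.factorial ≤ A :=
    single_le_sum (f := fun i : ℕ => (8 : ℝ) ^ i * i.factorial) (fun i _ => by positivity)
      (Finset.mem_range.2 (Nat.lt_succ_of_le hi))
  calc t ^ i * exp (-t * r) ≤ ((8 : ℝ) ^ i * i.factorial * exp (t / 8)) *
        (exp (-(t / 8)) * exp (-(t / 4))) := by gcongr
    _ = (8 : ℝ) ^ i * i.factorial * (exp (t / 8) * exp (-(t / 8))) * exp (-(t / 4)) := by ring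
    _ = (8 : ℝ) ^ i * i.factorial * exp (-(t / 4)) := by
        rw [← Real.exp_add, add_neg_cancel, Real.exp_zero, mul_one]
    _ ≤ _ := by gcongr

theorem Annular.heat_sub_one_bound (hg : Annular g) (herm : ∀ ξ, g (-ξ) = conj (g ξ)) :
    ∃ C : ℝ, 0 ≤ C ∧ ∀ t : ℝ, 0 ≤ t → t ≤ 1 →
      Wiener (fun ξ => ((exp (-t * ‖ξ‖) - 1 : ℝ) : ℂ) * g ξ) ∧
        wnorm (fun ξ => ((exp (-t * ‖ξ‖) - 1 : ℝ) : ℂ) * g ξ) ≤ C * t := by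
  obtain ⟨N, C, hC0, hC⟩ := hg.radial_bound herm
  refine ⟨C * 6, by positivity, fun t ht ht1 => ?_⟩
  have := hC (fun r => exp (-t * r) - 1) (by fun_prop) (6 * t) ?_
  · rwa [← mul_assoc] at this
  intro i hi r hr
  have he : exp (-t * r) ≤ 1 := Real.exp_le_one_iff.2 (by nlinarith [hr.1])
  rcases Nat.eq_zero_or_pos i with rfl | hpos
  · rw [norm_iteratedFDeriv_zero, norm_eq_abs, abs_of_nonpos (by linarith)]
    have := Real.add_one_le_exp (-t * r)
    nlinarith [hr.1, hr.2]
  · have : iteratedFDeriv ℝ i (fun r => exp (-t * r) - 1) r =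
        iteratedFDeriv ℝ i (fun r => exp (-t * r)) r := by
      rw [fun_iteratedFDeriv_sub_apply (by fun_prop) (by fun_prop),
        iteratedFDeriv_const_of_ne (by omega)]
      simp
    rw [this, norm_iteratedFDeriv_exp, abs_of_nonneg ht]
    have h1 : t ^ i ≤ t := pow_le_of_le_one ht ht1 (by omega)
    have := exp_pos (-t * r)
    have := pow_nonneg ht i
    nlinarith

/-! ### Homogeneous symbols and dyadic blocks -/

/-- Hermitian symbols, homogeneous of degree `σ` and smooth away from the origin. -/
structure Hom (σ : ℤ) (m : V → ℂ) : Prop where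
  smooth : ∀ ξ, ξ ≠ 0 → ContDiffAt ℝ ∞ m ξ
  hom : ∀ c : ℝ, 0 < c → ∀ ξ, m (c • ξ) = ((c ^ σ : ℝ) : ℂ) * m ξ
  herm : ∀ ξ, m (-ξ) = conj (m ξ)

/-- The symbol `e^{-s|ξ|}`. -/
def hsym (s : ℝ) (ξ : V) : ℂ := ((exp (-s * ‖ξ‖) : ℝ) : ℂ)

theorem hsym_herm (s : ℝ) (ξ : V) : hsym s (-ξ) = conj (hsym s ξ) := by
  simp only [hsym, norm_neg, conj_ofReal]

theorem continuous_hsym (s : ℝ) : Continuous (hsym (d := d) s) := by unfold hsym; fun_prop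

theorem Hom.mul {σ τ : ℤ} {m n : V → ℂ} (hm : Hom σ m) (hn : Hom τ n) :
    Hom (σ + τ) fun ξ => m ξ * n ξ where
  smooth ξ h := (hm.smooth ξ h).mul (hn.smooth ξ h)
  hom c hc ξ := by
    rw [hm.hom c hc, hn.hom c hc, zpow_add₀ hc.ne']
    push_cast; ring
  herm ξ := by rw [hm.herm, hn.herm, map_mul]

theorem hom_one : Hom 0 (one (d := d)).1 where
  smooth := one.smooth
  hom c _ ξ := by simp [one]
  herm ξ := by simp [one]

theorem hom_abs : Hom 1 (Λ).1 where
  smooth := (Λ).smooth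
  hom c hc ξ := by simp [Symbol.abs, norm_smul, abs_of_pos hc]
  herm ξ := by simp [Symbol.abs, conj_ofReal]

theorem hom_partialD (k : Fin d) : Hom 1 (partialD k).1 where
  smooth := (partialD k).smooth
  hom c hc ξ := by simp [partialD]; ring
  herm ξ := by simp [partialD, conj_ofReal]

theorem hom_riesz (k : Fin d) : Hom 0 (riesz k).1 where
  smooth := (riesz k).smooth
  hom c hc ξ := by
    simp only [riesz, norm_smul, PiLp.smul_apply, smul_eq_mul, zpow_zero, Complex.ofReal_one,
      one_mul, norm_eq_abs, abs_of_pos hc]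
    rw [mul_div_mul_left _ _ hc.ne']
  herm ξ := by simp [riesz, conj_ofReal, neg_div]

/-- The symbol `|ξ|⁻¹`. -/
def invAbs : Symbol d :=
  ⟨fun ξ => ((‖ξ‖⁻¹ : ℝ) : ℂ), fun ξ h =>
    ofRealCLM.contDiff.contDiffAt.comp ξ ((contDiffAt_norm ℝ h).inv (norm_ne_zero_iff.2 h))⟩

theorem hom_invAbs : Hom (-1) (invAbs (d := d)).1 where
  smooth := invAbs.smooth
  hom c hc ξ := by simp [invAbs, norm_smul, abs_of_pos hc]; ring
  herm ξ := by simp [invAbs, conj_ofReal]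

/-- The symbol `m(ξ) e^{-s|ξ|} χ(2^{-j}ξ)`. -/
def bsym (m : V → ℂ) (s : ℝ) (χ : V → ℂ) (j : ℤ) (ξ : V) : ℂ :=
  m ξ * hsym s ξ * χ ((2 : ℝ) ^ (-j) • ξ)

theorem two_zpow_pos (j : ℤ) : (0 : ℝ) < (2 : ℝ) ^ j := by positivity

theorem smul_smul_dyadic (j : ℤ) (ξ : V) : (2 : ℝ) ^ j • (2 : ℝ) ^ (-j) • ξ = ξ := by
  rw [smul_smul, ← zpow_add₀ two_ne_zero, add_neg_cancel, zpow_zero, one_smul]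

theorem Hom.bsym_eq {m : V → ℂ} (hm : Hom σ m) (s : ℝ) (χ : V → ℂ) (j : ℤ) (ξ : V) :
    bsym m s χ j ξ = ((((2 : ℝ) ^ j) ^ σ : ℝ) : ℂ) * (hsym (s * 2 ^ j) ((2 : ℝ) ^ (-j) • ξ) *
        (m ((2 : ℝ) ^ (-j) • ξ) * χ ((2 : ℝ) ^ (-j) • ξ))) := by
  have h1 : hsym s ξ = hsym (s * 2 ^ j) ((2 : ℝ) ^ (-j) • ξ) := by
    unfold hsym
    rw [norm_smul, norm_of_nonneg (two_zpow_pos _).le, zpow_neg]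
    congr 2
    field_simp
  have h2 : m ξ = ((((2 : ℝ) ^ j) ^ σ : ℝ) : ℂ) * m ((2 : ℝ) ^ (-j) • ξ) := by
    rw [← hm.hom _ (two_zpow_pos j), smul_smul_dyadic]
  rw [bsym, h1, h2]; ring

theorem Hom.block_bound {m : V → ℂ} (hm : Hom σ m) {χ : V → ℂ} (hχ : Annular χ)
    (herm : ∀ ξ, χ (-ξ) = conj (χ ξ)) :
    ∃ C : ℝ, 0 ≤ C ∧ ∀ (j : ℤ) (s : ℝ), 0 ≤ s → Wiener (bsym m s χ j) ∧
      wnorm (bsym m s χ j) ≤ C * ((2 : ℝ) ^ j) ^ σ * exp (-(s * 2 ^ j / 4)) ∧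
      ∫ ξ, ‖bsym m s χ j ξ‖ ≤ C * (((2 : ℝ) ^ j) ^ σ * ((2 : ℝ) ^ j) ^ d) *
        exp (-(s * 2 ^ j / 4)) := by
  have hA := hχ.mul hm.smooth
  have hAh : ∀ ξ, m (-ξ) * χ (-ξ) = conj (m ξ * χ ξ) := fun ξ => by
    rw [hm.herm, herm, map_mul]
  obtain ⟨C, hC0, hC⟩ := hA.heat_bound hAh
  have hint : Integrable fun ξ => m ξ * χ ξ :=
    hA.smooth.continuous.integrable_of_hasCompactSupport hA.hasCompactSupport
  refine ⟨C + ∫ ξ, ‖m ξ * χ ξ‖, by positivity, fun j s hs => ?_⟩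
  have ht : 0 ≤ s * 2 ^ j := by positivity
  obtain ⟨h1, h2⟩ := hC _ ht
  have h3 := h1.scale (two_zpow_pos (-j))
  have hf : bsym m s χ j = fun ξ => ((((2 : ℝ) ^ j) ^ σ : ℝ) : ℂ) *
      (hsym (s * 2 ^ j) ((2 : ℝ) ^ (-j) • ξ) *
        (m ((2 : ℝ) ^ (-j) • ξ) * χ ((2 : ℝ) ^ (-j) • ξ))) := funext (hm.bsym_eq s χ j)
  have hpos : (0 : ℝ) < ((2 : ℝ) ^ j) ^ σ := by positivity
  rw [hf]
  refine ⟨h3.const_mul _, ?_, ?_⟩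
  · have : wnorm (fun ξ : V => ((((2 : ℝ) ^ j) ^ σ : ℝ) : ℂ) *
      (hsym (s * 2 ^ j) ((2 : ℝ) ^ (-j) • ξ) * (m ((2 : ℝ) ^ (-j) • ξ) * χ ((2 : ℝ) ^ (-j) • ξ)))) =
        ((2 : ℝ) ^ j) ^ σ * wnorm (fun ξ => hsym (s * 2 ^ j) ξ * (m ξ * χ ξ)) := by
      rw [← wnorm_scale (fun ξ => hsym (s * 2 ^ j) ξ * (m ξ * χ ξ)) (two_zpow_pos (-j))]
      unfold wnorm
      simp_rw [ker_const_mul, abs_mul, abs_of_pos hpos]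
      rw [integral_const_mul]
    rw [this]
    have hI : 0 ≤ ∫ ξ, ‖m ξ * χ ξ‖ := by positivity
    calc _ ≤ ((2 : ℝ) ^ j) ^ σ * (C * exp (-(s * 2 ^ j / 4))) := by
          gcongr; exact h2
      _ = C * ((2 : ℝ) ^ j) ^ σ * exp (-(s * 2 ^ j / 4)) := by ring
      _ ≤ _ := by gcongr; linarith
  · have h4 := Measure.integral_comp_smul (volume : Measure V)
      (fun ξ => ‖hsym (s * 2 ^ j) ξ * (m ξ * χ ξ)‖) ((2 : ℝ) ^ (-j))
    rw [finrank_euclideanSpace_fin, abs_of_pos (by positivity), smul_eq_mul] at h4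
    simp_rw [norm_mul (_ : ℂ) (hsym _ _ * _), norm_real, norm_of_nonneg hpos.le]
    rw [integral_const_mul, h4]
    have h5 : ∫ ξ, ‖hsym (s * 2 ^ j) ξ * (m ξ * χ ξ)‖ ≤
        exp (-(s * 2 ^ j / 4)) * ∫ ξ, ‖m ξ * χ ξ‖ := by
      rw [← integral_const_mul]
      refine integral_mono_of_nonneg (ae_of_all _ fun _ => norm_nonneg _) (hint.norm.const_mul _)
        (ae_of_all _ fun ξ => ?_)
      simp only
      by_cases h0 : m ξ * χ ξ = 0
      · rw [h0, mul_zero, norm_zero, mul_zero]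
      · rw [norm_mul]
        refine mul_le_mul_of_nonneg_right ?_ (norm_nonneg _)
        rw [hsym, norm_real, norm_of_nonneg (exp_pos _).le]
        refine Real.exp_le_exp.2 ?_
        nlinarith [(hA.supp ξ h0).1]
    have e : (((2 : ℝ) ^ (-j)) ^ d)⁻¹ = ((2 : ℝ) ^ j) ^ d := by
      rw [zpow_neg, inv_pow, inv_inv]
    rw [e]
    calc _ ≤ ((2 : ℝ) ^ j) ^ σ * (((2 : ℝ) ^ j) ^ d *
          (exp (-(s * 2 ^ j / 4)) * ∫ ξ, ‖m ξ * χ ξ‖)) := by gcongr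
      _ = (∫ ξ, ‖m ξ * χ ξ‖) * (((2 : ℝ) ^ j) ^ σ * ((2 : ℝ) ^ j) ^ d) *
          exp (-(s * 2 ^ j / 4)) := by ring
      _ ≤ _ := by gcongr; linarith

theorem summable_dyadic_exp (k : ℕ) (hk : 1 ≤ k) (hs : 0 < s) :
    Summable fun j : ℤ => ((2 : ℝ) ^ j) ^ k * exp (-(s * 2 ^ j / 4)) := by
  have hg : Summable fun n : ℕ => (1 / 2 : ℝ) ^ n :=
    summable_geometric_of_lt_one (by norm_num) (by norm_num)
  refine Summable.of_nat_of_neg_add_one ?_ ?_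
  · refine .of_nonneg_of_le (fun n => by positivity) (fun n => ?_)
      (hg.mul_left ((k + 1).factorial * (4 / s) ^ (k + 1)))
    have h2 : (0 : ℝ) < (2 : ℝ) ^ (n : ℤ) := by positivity
    set x := (2 : ℝ) ^ (n : ℤ) with hx
    have := Real.pow_div_factorial_le_exp (s * x / 4) (by positivity) (k + 1)
    have hxe : (1 / 2 : ℝ) ^ n = x⁻¹ := by rw [hx, zpow_natCast, one_div, inv_pow]
    rw [hxe, Real.exp_neg]
    have he := exp_pos (s * x / 4)
    rw [← div_eq_mul_inv, ← div_eq_mul_inv, div_le_div_iff₀ he h2]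
    rw [div_le_iff₀ (by positivity)] at this
    calc x ^ k * x = (4 / s) ^ (k + 1) * (s * x / 4) ^ (k + 1) := by
          rw [← mul_pow, ← pow_succ]
          congr 1
          field_simp
      _ ≤ (4 / s) ^ (k + 1) * (exp (s * x / 4) * (k + 1).factorial) := by gcongr
      _ = _ := by ring
  · refine .of_nonneg_of_le (fun n => by positivity) (fun n => ?_) hg
    have hx : (2 : ℝ) ^ (-((n : ℤ) + 1)) = (1 / 2) ^ (n + 1) := by
      rw [zpow_neg, one_div, inv_pow]; norm_cast
    rw [hx]
    have h1 : exp (-(s * (1 / 2) ^ (n + 1) / 4)) ≤ 1 :=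
      Real.exp_le_one_iff.2 (by have : 0 < s * (1 / 2) ^ (n + 1) / 4 := by positivity
                                linarith)
    have h2 : ((1 / 2 : ℝ) ^ (n + 1)) ^ k ≤ (1 / 2) ^ (n + 1) :=
      pow_le_of_le_one (by positivity) (pow_le_one₀ (by norm_num) (by norm_num)) (by omega)
    have h3 : (1 / 2 : ℝ) ^ (n + 1) ≤ (1 / 2) ^ n :=
      pow_le_pow_of_le_one (by norm_num) (by norm_num) (by omega)
    calc _ ≤ ((1 / 2 : ℝ) ^ (n + 1)) ^ k * 1 := by gcongr
      _ ≤ _ := by linarith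

/-! ### The dyadic partition of unity -/

namespace LPCutoff

variable (ψ : LPCutoff d)

/-- The low frequency cut-off `ψ(2^{-j}ξ)`. -/
def low (j : ℤ) (ξ : V) : ℂ := ((ψ.1 ((2 : ℝ) ^ (-j) • ξ) : ℝ) : ℂ)

/-- `φ` as a complex function. -/
def ph (ξ : V) : ℂ := ((ψ.phi 0 ξ : ℝ) : ℂ)

/-- A fattened version of `φ`, equal to one on the support of `φ`. -/
def fat (ξ : V) : ℂ := ((ψ.1 ((4 : ℝ)⁻¹ • ξ) - ψ.1 ((2 : ℝ) • ξ) : ℝ) : ℂ)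

theorem even (ξ : V) : ψ.1 (-ξ) = ψ.1 ξ := ψ.radial _ _ (norm_neg ξ)

theorem eq_zero (ξ : V) (h : 4 / 3 ≤ ‖ξ‖) : ψ.1 ξ = 0 := by
  refine image_eq_zero_of_notMem_tsupport fun hm => ?_
  have := mem_ball_zero_iff.1 (ψ.support_subset hm)
  linarith

theorem phi_eq (j : ℤ) (ξ : V) : ((ψ.phi j ξ : ℝ) : ℂ) = ψ.ph ((2 : ℝ) ^ (-j) • ξ) := by
  simp [ph, phi]

theorem phi_eq_low (j : ℤ) (ξ : V) : ((ψ.phi j ξ : ℝ) : ℂ) = ψ.low (j + 1) ξ - ψ.low j ξ := by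
  unfold low phi
  rw [smul_smul, neg_add, zpow_add₀ two_ne_zero, zpow_neg_one, mul_comm, Complex.ofReal_sub]

theorem annular_ph : Annular ψ.ph where
  smooth := ofRealCLM.contDiff.comp (ψ.contDiff_phi 0)
  supp ξ h := by
    constructor
    · by_contra h'
      refine h ?_
      rw [ph, ψ.phi_eq_zero_of_small 0 ξ (by simp; linarith)]; rfl
    · by_contra h'
      refine h ?_
      rw [ph, ψ.phi_eq_zero_of_large 0 ξ (by simp; linarith)]; rfl

theorem annular_fat : Annular ψ.fat where
  smooth := ofRealCLM.contDiff.comp ((ψ.smooth.comp (contDiff_id.const_smul _)).sub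
    (ψ.smooth.comp (contDiff_id.const_smul _)))
  supp ξ h := by
    have e1 : ‖(4 : ℝ)⁻¹ • ξ‖ = ‖ξ‖ / 4 := by rw [norm_smul]; norm_num; ring
    have e2 : ‖(2 : ℝ) • ξ‖ = 2 * ‖ξ‖ := by rw [norm_smul]; norm_num
    constructor
    · by_contra h'
      refine h ?_
      rw [fat, ψ.eq_one _ (by rw [e1]; linarith), ψ.eq_one _ (by rw [e2]; linarith)]; simp
    · by_contra h'
      refine h ?_
      rw [fat, ψ.eq_zero _ (by rw [e1]; linarith), ψ.eq_zero _ (by rw [e2]; linarith)]; simp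

theorem ph_mul_fat (ξ : V) : ψ.ph ξ * ψ.fat ξ = ψ.ph ξ := by
  by_cases h : ψ.ph ξ = 0
  · rw [h, zero_mul]
  have h1 : 3 / 4 < ‖ξ‖ := by
    by_contra h'
    refine h ?_
    rw [ph, ψ.phi_eq_zero_of_small 0 ξ (by simp; linarith)]; rfl
  have h2 : ‖ξ‖ < 8 / 3 := by
    by_contra h'
    refine h ?_
    rw [ph, ψ.phi_eq_zero_of_large 0 ξ (by simp; linarith)]; rfl
  have e1 : ‖(4 : ℝ)⁻¹ • ξ‖ = ‖ξ‖ / 4 := by rw [norm_smul]; norm_num; ring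
  have e2 : ‖(2 : ℝ) • ξ‖ = 2 * ‖ξ‖ := by rw [norm_smul]; norm_num
  rw [fat, ψ.eq_one _ (by rw [e1]; linarith), ψ.eq_zero _ (by rw [e2]; linarith)]
  simp

theorem ph_herm (ξ : V) : ψ.ph (-ξ) = conj (ψ.ph ξ) := by
  simp [ph, phi, ψ.even, conj_ofReal]

theorem fat_herm (ξ : V) : ψ.fat (-ξ) = conj (ψ.fat ξ) := by
  rw [fat, fat, smul_neg, smul_neg, ψ.even, ψ.even, conj_ofReal]

theorem fat_eq (j : ℤ) (ξ : V) : ψ.fat ((2 : ℝ) ^ (-j) • ξ) =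
    ((ψ.phi (j - 1) ξ : ℝ) : ℂ) + ((ψ.phi j ξ : ℝ) : ℂ) + ((ψ.phi (j + 1) ξ : ℝ) : ℂ) := by
  simp only [phi_eq_low]
  have e1 : ψ.fat ((2 : ℝ) ^ (-j) • ξ) = ψ.low (j + 1 + 1) ξ - ψ.low (j - 1) ξ := by
    unfold fat low
    rw [smul_smul, smul_smul, ← Complex.ofReal_sub]
    congr 4
    · rw [show -(j + 1 + 1) = -j + -2 by ring, zpow_add₀ two_ne_zero]
      norm_num; ring
    · rw [show -(j - 1) = -j + 1 by ring, zpow_add₀ two_ne_zero]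
      norm_num; ring
  rw [e1]
  ring_nf

theorem hasCompactSupport : HasCompactSupport ψ.1 :=
  HasCompactSupport.of_support_subset_isCompact (isCompact_closedBall (0 : V) (4 / 3))
    ((subset_tsupport _).trans (ψ.support_subset.trans Metric.ball_subset_closedBall))

theorem wiener_low_zero : Wiener (ψ.low 0) := by
  have hc : HasCompactSupport fun ξ : V => ((ψ.1 ξ : ℝ) : ℂ) :=
    ψ.hasCompactSupport.comp_left (g := fun x : ℝ => (x : ℂ)) Complex.ofReal_zero
  have hs : ContDiff ℝ ∞ fun ξ : V => ((ψ.1 ξ : ℝ) : ℂ) :=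
    ofRealCLM.contDiff.comp ψ.smooth
  have h := (wiener_of_schwartz (hc.toSchwartzMap hs) fun ξ => by
    change ((ψ.1 (-ξ) : ℝ) : ℂ) = conj ((ψ.1 ξ : ℝ) : ℂ)
    rw [ψ.even, conj_ofReal]).1
  have e : ψ.low 0 = fun ξ : V => ((ψ.1 ξ : ℝ) : ℂ) := by
    ext ξ; simp [low]
  rw [e]; exact h

theorem low_eq (j : ℤ) : ψ.low j = fun ξ => ψ.low 0 ((2 : ℝ) ^ (-j) • ξ) := by
  ext ξ; simp [low]

theorem wiener_low (j : ℤ) : Wiener (ψ.low j) := by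
  rw [ψ.low_eq j]; exact ψ.wiener_low_zero.scale (two_zpow_pos _)

theorem wnorm_low (j : ℤ) : wnorm (ψ.low j) = wnorm (ψ.low 0) := by
  rw [ψ.low_eq j]; exact wnorm_scale _ (two_zpow_pos _)

theorem tendsto_low_atTop (ξ : V) : ∀ᶠ n : ℕ in atTop, ψ.low n ξ = 1 := by
  have : Tendsto (fun n : ℕ => ((1 / 2 : ℝ) ^ n) * ‖ξ‖) atTop (𝓝 (0 * ‖ξ‖)) :=
    (tendsto_pow_atTop_nhds_zero_of_lt_one (by norm_num) (by norm_num)).mul_const _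
  rw [zero_mul] at this
  filter_upwards [this.eventually (gt_mem_nhds (by norm_num : (0 : ℝ) < 3 / 4))] with n hn
  rw [low, ψ.eq_one, Complex.ofReal_one]
  rw [norm_smul, norm_of_nonneg (two_zpow_pos _).le, zpow_neg, zpow_natCast]
  rw [one_div, inv_pow] at hn
  exact hn.le

theorem tendsto_low_atBot {ξ : V} (h : ξ ≠ 0) : ∀ᶠ n : ℕ in atTop, ψ.low (-n) ξ = 0 := by
  have : Tendsto (fun n : ℕ => (2 : ℝ) ^ n * ‖ξ‖) atTop atTop :=
    (tendsto_pow_atTop_atTop_of_one_lt (by norm_num)).atTop_mul_const (norm_pos_iff.2 h)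
  filter_upwards [this.eventually_ge_atTop (4 / 3)] with n hn
  rw [low, ψ.eq_zero, Complex.ofReal_zero]
  rwa [norm_smul, norm_of_nonneg (two_zpow_pos _).le, neg_neg, zpow_natCast]

theorem hasSum_phi_nat (ξ : V) : HasSum (fun n : ℕ => ((ψ.phi n ξ : ℝ) : ℂ)) (1 - ψ.low 0 ξ) := by
  obtain ⟨N, hN⟩ := eventually_atTop.1 (ψ.tendsto_low_atTop ξ)
  have h0 : ∀ n ∉ Finset.range N, ((ψ.phi n ξ : ℝ) : ℂ) = 0 := fun n hn => by
    rw [Finset.mem_range, not_lt] at hn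
    have h1 := hN (n + 1) (by omega)
    push_cast at h1
    rw [phi_eq_low, h1, hN n hn, sub_self]
  have := hasSum_sum_of_ne_finset_zero (L := .unconditional ℕ) h0
  convert this using 1
  simp_rw [phi_eq_low]
  have h2 := Finset.sum_range_sub (fun n : ℕ => ψ.low n ξ) N
  push_cast at h2
  rw [h2, hN N le_rfl]

theorem hasSum_phi_neg {ξ : V} (h : ξ ≠ 0) :
    HasSum (fun n : ℕ => ((ψ.phi (-((n : ℤ) + 1)) ξ : ℝ) : ℂ)) (ψ.low 0 ξ) := by
  obtain ⟨N, hN⟩ := eventually_atTop.1 (ψ.tendsto_low_atBot h)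
  have e : ∀ n : ℕ, ((ψ.phi (-((n : ℤ) + 1)) ξ : ℝ) : ℂ) =
      ψ.low (-n) ξ - ψ.low (-((n : ℤ) + 1)) ξ := fun n => by
    rw [phi_eq_low]; congr 2; ring
  have h0 : ∀ n ∉ Finset.range N, ((ψ.phi (-((n : ℤ) + 1)) ξ : ℝ) : ℂ) = 0 := fun n hn => by
    rw [Finset.mem_range, not_lt] at hn
    have h1 := hN (n + 1) (by omega)
    push_cast at h1
    rw [e, hN n hn, h1, sub_self]
  have := hasSum_sum_of_ne_finset_zero (L := .unconditional ℕ) h0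
  convert this using 1
  simp_rw [e]
  have h2 := Finset.sum_range_sub' (fun n : ℕ => ψ.low (-n) ξ) N
  push_cast at h2
  rw [h2, hN N le_rfl]
  simp

theorem hasSum_phi {ξ : V} (h : ξ ≠ 0) : HasSum (fun j : ℤ => ((ψ.phi j ξ : ℝ) : ℂ)) 1 := by
  have := HasSum.of_nat_of_neg_add_one (f := fun j : ℤ => ((ψ.phi j ξ : ℝ) : ℂ))
    (ψ.hasSum_phi_nat ξ) (ψ.hasSum_phi_neg h)
  simpa using this

end LPCutoff

/-! ### Block operators -/

theorem nontrivial_E [NeZero d] : Nontrivial V := by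
  have : Nonempty (Fin d) := ⟨⟨0, Nat.pos_of_ne_zero (NeZero.ne d)⟩⟩
  infer_instance

/-- The symbol `φ(2^{-j}ξ)`. -/
def LPCutoff.phc (ψ : LP) (j : ℤ) (ξ : V) : ℂ := ((ψ.phi j ξ : ℝ) : ℂ)

/-- The dyadic block of a function. -/
def LPCutoff.del (ψ : LP) (j : ℤ) (u : V → ℝ) : V → ℝ := mop (ψ.phc j) u

open Muskat.LPCutoff (phc del)

theorem lpKernel_apply (ψ : LP) (m : Symbol d) (j : ℤ) (x y : V) :
    lpKernel ψ m j x y = ker (fun ξ => m.1 ξ * ψ.phc j ξ) (x - y) := by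
  change ((𝓕 ((hasCompactSupport_lpSymbol ψ m j x).toSchwartzMap
    (contDiff_lpSymbol ψ m j x)) : 𝓢(V, ℂ)) y).re = _
  rw [SchwartzMap.fourier_coe, Real.fourier_eq', ker, sker_eq]
  congr 2
  ext ν
  change _ • lpSymbol ψ m j x ν = _
  rw [smul_eq_mul, lpSymbol, ← mul_assoc, ← Complex.exp_add, ← add_mul, ← Complex.ofReal_add,
    inner_sub_right, real_inner_comm x ν, phc]
  congr 4
  ring

theorem funBlock_eq_mop (ψ : LP) (m : Symbol d) (j : ℤ) (u : V → ℝ) :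
    funBlock ψ m j u = mop (fun ξ => m.1 ξ * ψ.phc j ξ) u := by
  ext x
  simp only [funBlock, mop, lpKernel_apply]

theorem funBlock_one_eq (ψ : LP) (j : ℤ) (u : V → ℝ) : funBlock ψ one j u = ψ.del j u := by
  rw [funBlock_eq_mop]
  simp [one, del]

theorem phc_eq_bsym (ψ : LP) (j : ℤ) : ψ.phc j = bsym one.1 0 ψ.ph j := by
  ext ξ
  rw [bsym, ← ψ.phi_eq]; simp [one, hsym, phc]

theorem bsym_ph_eq (ψ : LP) (m : V → ℂ) (s : ℝ) (j : ℤ) :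
    bsym m s ψ.ph j = fun ξ => bsym m s ψ.fat j ξ * ψ.phc j ξ := by
  ext ξ
  rw [bsym, bsym, phc, ψ.phi_eq, mul_assoc _ (ψ.fat _), mul_comm (ψ.fat _), ψ.ph_mul_fat]

theorem Hom.wiener_bsym {m : V → ℂ} (hm : Hom σ m) (ψ : LP) (j : ℤ)
    (hs : 0 ≤ s) : Wiener (bsym m s ψ.ph j) := by
  obtain ⟨C, -, hC⟩ := hm.block_bound ψ.annular_ph ψ.ph_herm
  exact (hC j s hs).1

theorem wiener_phc (ψ : LP) (j : ℤ) : Wiener (ψ.phc j) := by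
  rw [phc_eq_bsym]; exact hom_one.wiener_bsym ψ j le_rfl

theorem wnorm_phc (ψ : LP) (j : ℤ) : wnorm (ψ.phc j) = wnorm (ψ.phc 0) := by
  have : ψ.phc j = fun ξ => ψ.phc 0 ((2 : ℝ) ^ (-j) • ξ) := by
    ext ξ; rw [phc, ψ.phi_eq]; rfl
  rw [this]; exact wnorm_scale _ (two_zpow_pos _)

theorem ofReal_wnorm (hg : Wiener g) : ofReal (wnorm g) = ∫⁻ x, ‖ker g x‖ₑ :=
  ofReal_integral_norm_eq_lintegral_enorm hg.ker_int

theorem Wiener.enorm_mop_le (hg : Wiener g) (u : V → ℝ) (x : V) :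
    ‖mop g u x‖ₑ ≤ ofReal (wnorm g) * ⨆ y, ‖u y‖ₑ := by
  calc ‖mop g u x‖ₑ ≤ ∫⁻ y, ‖ker g (x - y) * u y‖ₑ := enorm_integral_le_lintegral_enorm _
    _ ≤ ∫⁻ y, ‖ker g (x - y)‖ₑ * ⨆ y, ‖u y‖ₑ := by
        refine lintegral_mono fun y => ?_
        rw [enorm_mul]
        gcongr
        exact le_iSup (fun y => ‖u y‖ₑ) y
    _ = _ := by
        have hm : Measurable fun y => ‖ker g (x - y)‖ₑ :=
          ((continuous_ker hg.int).measurable.comp (measurable_const.sub measurable_id)).enorm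
        rw [lintegral_mul_const _ hm, ofReal_wnorm hg,
          lintegral_sub_left_eq_self (fun y => ‖ker g y‖ₑ) x]

theorem abs_le_toReal_iSup {α : Type*} {u : α → ℝ} (h : ⨆ x, ‖u x‖ₑ ≠ ⊤) (x : α) :
    |u x| ≤ (⨆ x, ‖u x‖ₑ).toReal := by
  have := toReal_mono h (le_iSup (fun x => ‖u x‖ₑ) x)
  simpa using this

/-- A multiplier that is homogeneous of degree `σ`, followed by `e^{-s|D|}`, on a dyadic block. -/
theorem Hom.block_le {m : V → ℂ} (hm : Hom σ m) (ψ : LP) :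
    ∃ C : ℝ≥0, ∀ (j : ℤ) (s : ℝ), 0 ≤ s → ∀ u : V → ℝ, Measurable u →
      ∀ B : ℝ, (∀ y, |u y| ≤ B) → ∀ x,
      ‖mop (bsym m s ψ.ph j) u x‖ₑ ≤ C * ofReal (((2 : ℝ) ^ j) ^ σ * exp (-(s * 2 ^ j / 4))) *
          ⨆ y, ‖ψ.del j u y‖ₑ := by
  obtain ⟨C, hC0, hC⟩ := hm.block_bound ψ.annular_fat ψ.fat_herm
  refine ⟨C.toNNReal, fun j s hs u hu B hB x => ?_⟩
  obtain ⟨h1, h2, -⟩ := hC j s hs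
  rw [bsym_ph_eq, ← h1.mop_mop (wiener_phc ψ j) hu hB]
  refine (h1.enorm_mop_le _ x).trans ?_
  change _ ≤ ofReal C * _ * _
  rw [← ofReal_mul hC0]
  refine mul_le_mul_left (ofReal_le_ofReal (h2.trans (le_of_eq ?_))) _
  rw [mul_assoc]

/-! ### The Poisson semigroup -/

theorem wiener_hsym_one [NeZero d] : Wiener (hsym (d := d) 1) := by
  obtain ⟨ψ⟩ := LPCutoff.nonempty d
  have := nontrivial_E (d := d)
  obtain ⟨C₁, hC₁0, hC₁⟩ := hom_one.block_bound ψ.annular_ph ψ.ph_herm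
  obtain ⟨C₂, hC₂0, hC₂⟩ := ψ.annular_ph.heat_sub_one_bound ψ.ph_herm
  have hd : 1 ≤ d := Nat.pos_of_ne_zero (NeZero.ne d)
  set f : ℤ → V → ℂ := fun j ξ => if 0 ≤ j then bsym one.1 1 ψ.ph j ξ else
    (hsym 1 ξ - 1) * ψ.phc j ξ with hf
  set G : ℝ → V → ℂ := fun t ζ => ((exp (-t * ‖ζ‖) - 1 : ℝ) : ℂ) * ψ.ph ζ with hG
  have hneg : ∀ n : ℕ, f (-((n : ℤ) + 1)) = fun ξ =>
      G (2 ^ (-((n : ℤ) + 1))) ((2 : ℝ) ^ (-(-((n : ℤ) + 1))) • ξ) := by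
    intro n
    ext ξ
    simp only [hf, hG]
    rw [if_neg (by omega), phc, ψ.phi_eq, hsym, norm_smul, norm_of_nonneg (two_zpow_pos _).le]
    have : (2 : ℝ) ^ (-((n : ℤ) + 1)) * 2 ^ (-(-((n : ℤ) + 1))) = 1 := by
      rw [← zpow_add₀ two_ne_zero, add_neg_cancel, zpow_zero]
    rw [neg_mul (2 ^ (-((n : ℤ) + 1)) : ℝ), ← mul_assoc, this, Complex.ofReal_sub, neg_mul,
      Complex.ofReal_one]
  have hpos : ∀ n : ℕ, f n = bsym one.1 1 ψ.ph n := fun n => funext fun ξ => if_pos (by omega)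
  have ht : ∀ n : ℕ, (2 : ℝ) ^ (-((n : ℤ) + 1)) ≤ (1 / 2) ^ n := by
    intro n
    rw [zpow_neg, one_div, inv_pow]
    gcongr
    rw [zpow_add₀ two_ne_zero, zpow_natCast, zpow_one]
    have : (0 : ℝ) < 2 ^ n := by positivity
    linarith
  have ht1 : ∀ n : ℕ, (2 : ℝ) ^ (-((n : ℤ) + 1)) ≤ 1 := fun n =>
    (ht n).trans (pow_le_one₀ (by norm_num) (by norm_num))
  have hg : Summable fun n : ℕ => (1 / 2 : ℝ) ^ n :=
    summable_geometric_of_lt_one (by norm_num) (by norm_num)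
  have hW : ∀ j, Wiener (f j) := by
    intro j
    obtain ⟨n, rfl | rfl⟩ : ∃ n : ℕ, j = n ∨ j = -((n : ℤ) + 1) := by
      rcases le_or_gt 0 j with h | h
      · exact ⟨j.toNat, Or.inl (by omega)⟩
      · exact ⟨(-j - 1).toNat, Or.inr (by omega)⟩
    · rw [hpos]; exact (hC₁ n 1 zero_le_one).1
    · rw [hneg]; exact (hC₂ _ (two_zpow_pos _).le (ht1 n)).1.scale (two_zpow_pos _)
  have hsum : ∀ ξ : V, ξ ≠ 0 → HasSum (fun j => f j ξ) (hsym 1 ξ - ψ.low 0 ξ) := by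
    intro ξ h
    have := HasSum.of_nat_of_neg_add_one (f := fun j => f j ξ)
      (m := hsym 1 ξ * (1 - ψ.low 0 ξ)) (m' := (hsym 1 ξ - 1) * ψ.low 0 ξ) ?_ ?_
    · convert this using 1; ring
    · refine ((ψ.hasSum_phi_nat ξ).mul_left _).congr_fun ?_
      intro n
      rw [hpos, bsym, ← ψ.phi_eq]; simp [one]
    · refine ((ψ.hasSum_phi_neg h).mul_left _).congr_fun ?_
      intro n
      simp only [hf]; rw [if_neg (by omega)]; rfl
  have hs1 := summable_dyadic_exp 1 le_rfl (zero_lt_one (α := ℝ))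
  have hsd := summable_dyadic_exp d hd (zero_lt_one (α := ℝ))
  have hw : Summable fun j => wnorm (f j) := by
    refine Summable.of_nat_of_neg_add_one ?_ ?_
    · refine .of_nonneg_of_le (fun _ => wnorm_nonneg _) (fun n => ?_)
        ((hs1.comp_injective Nat.cast_injective).mul_left C₁)
      rw [hpos]
      refine ((hC₁ n 1 zero_le_one).2.1).trans ?_
      simp only [zpow_zero, Function.comp, pow_one, mul_one]
      exact mul_le_mul_of_nonneg_left (le_mul_of_one_le_left (exp_pos _).le
        (one_le_zpow₀ one_le_two (by omega))) hC₁0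
    · refine .of_nonneg_of_le (fun _ => wnorm_nonneg _) (fun n => ?_) (hg.mul_left C₂)
      rw [hneg, wnorm_scale (G _) (two_zpow_pos _)]
      exact (hC₂ _ (two_zpow_pos _).le (ht1 n)).2.trans (mul_le_mul_of_nonneg_left (ht n) hC₂0)
  have hi : Summable fun j => ∫ ξ, ‖f j ξ‖ := by
    refine Summable.of_nat_of_neg_add_one ?_ ?_
    · refine .of_nonneg_of_le (fun _ => by positivity) (fun n => ?_)
        ((hsd.comp_injective Nat.cast_injective).mul_left C₁)
      rw [hpos]
      refine ((hC₁ n 1 zero_le_one).2.2).trans ?_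
      simp only [zpow_zero, Function.comp, one_mul]
      rw [mul_assoc]
    · refine .of_nonneg_of_le (fun _ => by positivity) (fun n => ?_) (hg.mul_left (∫ ξ, ‖ψ.ph ξ‖))
      rw [hneg]
      have h4 := Measure.integral_comp_smul (volume : Measure V)
        (fun ζ => ‖G (2 ^ (-((n : ℤ) + 1))) ζ‖) ((2 : ℝ) ^ (-(-((n : ℤ) + 1))))
      rw [h4, finrank_euclideanSpace_fin, abs_of_pos (by positivity), smul_eq_mul, mul_comm]
      have h5 : ∫ ζ, ‖G (2 ^ (-((n : ℤ) + 1))) ζ‖ ≤ ∫ ζ, ‖ψ.ph ζ‖ := by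
        have hint : Integrable ψ.ph :=
          ψ.annular_ph.smooth.continuous.integrable_of_hasCompactSupport
            ψ.annular_ph.hasCompactSupport
        refine integral_mono_of_nonneg (ae_of_all _ fun _ => norm_nonneg _) hint.norm
          (ae_of_all _ fun ζ => ?_)
        simp only [hG, norm_mul]
        refine mul_le_of_le_one_left (norm_nonneg _) ?_
        rw [norm_real, norm_eq_abs, abs_le]
        have h1 := exp_pos (-(2 ^ (-((n : ℤ) + 1))) * ‖ζ‖)
        have h2 : exp (-(2 ^ (-((n : ℤ) + 1))) * ‖ζ‖) ≤ 1 :=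
          Real.exp_le_one_iff.2 (by rw [neg_mul]; exact neg_nonpos.2 (by positivity))
        constructor <;> linarith
      have h6 : (((2 : ℝ) ^ (-(-((n : ℤ) + 1)))) ^ d)⁻¹ ≤ (1 / 2) ^ n := by
        rw [zpow_neg, inv_pow, inv_inv]
        refine le_trans ?_ (ht n)
        exact pow_le_of_le_one (two_zpow_pos _).le (ht1 n) (by omega)
      gcongr
  have hfin := Wiener.tsum (g := fun ξ => hsym 1 ξ - ψ.low 0 ξ) hW ((continuous_hsym 1).sub (ψ.wiener_low 0).cont) hsum
    (fun ξ => by rw [hsym_herm, (ψ.wiener_low 0).herm, map_sub]) ‹_› hi hw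
  have := hfin.1.add (ψ.wiener_low 0)
  simpa using this

theorem hsym_eq_scale (s : ℝ) (ξ : V) (hs : 0 < s) : hsym s ξ = hsym 1 (s • ξ) := by
  simp [hsym, norm_smul, abs_of_pos hs]

theorem wiener_hsym [NeZero d] (hs : 0 < s) : Wiener (hsym (d := d) s) := by
  rw [show hsym s = fun ξ : V => hsym 1 (s • ξ) from funext fun ξ => hsym_eq_scale s ξ hs]
  exact wiener_hsym_one.scale hs

theorem wnorm_hsym (hs : 0 < s) : wnorm (hsym (d := d) s) = wnorm (hsym (d := d) 1) := by
  rw [show hsym s = fun ξ : V => hsym 1 (s • ξ) from funext fun ξ => hsym_eq_scale s ξ hs]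
  exact wnorm_scale _ hs

/-- The multiplier `m(D) e^{-s|D|}`, with `m` homogeneous of degree one, is the sum of its dyadic
blocks. -/
theorem Hom.wiener_heat [NeZero d] {m : V → ℂ} (hm : Hom 1 m) (hc : Continuous m) (ψ : LP)
    (hs : 0 < s) : Wiener (fun ξ => m ξ * hsym s ξ) ∧
      (∀ x, HasSum (fun j => ker (bsym m s ψ.ph j) x) (ker (fun ξ => m ξ * hsym s ξ) x)) ∧
      Summable fun j => wnorm (bsym m s ψ.ph j) := by
  have := nontrivial_E (d := d)
  obtain ⟨C, hC0, hC⟩ := hm.block_bound ψ.annular_ph ψ.ph_herm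
  have hw : Summable fun j => wnorm (bsym m s ψ.ph j) := by
    refine .of_nonneg_of_le (fun _ => wnorm_nonneg _) (fun j => (hC j s hs.le).2.1) ?_
    refine ((summable_dyadic_exp 1 le_rfl hs).mul_left C).congr fun j => ?_
    rw [zpow_one, pow_one, mul_assoc]
  have hi : Summable fun j => ∫ ξ, ‖bsym m s ψ.ph j ξ‖ := by
    refine .of_nonneg_of_le (fun _ => by positivity) (fun j => (hC j s hs.le).2.2) ?_
    refine ((summable_dyadic_exp (d + 1) (by omega) hs).mul_left C).congr fun j => ?_
    rw [zpow_one, pow_succ]; ring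
  have := Wiener.tsum (g := fun ξ => m ξ * hsym s ξ) (fun j => (hC j s hs.le).1) (hc.mul (continuous_hsym s)) (fun ξ h => by
    have := (ψ.hasSum_phi h).mul_left (m ξ * hsym s ξ)
    rw [mul_one] at this
    refine this.congr_fun fun j => ?_
    rw [bsym, ← ψ.phi_eq]) (fun ξ => by rw [hm.herm, hsym_herm, map_mul]) ‹_› hi hw
  exact ⟨this.1, this.2, hw⟩

theorem Hom.wnorm_heat {m : V → ℂ} (hm : Hom 1 m) (hs : 0 < s) :
    wnorm (fun ξ => m ξ * hsym s ξ) = s⁻¹ * wnorm (fun ξ => m ξ * hsym 1 ξ) := by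
  have h1 : (fun ξ : V => m ξ * hsym s ξ) = fun ξ =>
      ((s⁻¹ : ℝ) : ℂ) * (fun ζ => m ζ * hsym 1 ζ) (s • ξ) := by
    ext ξ
    simp only
    rw [hm.hom s hs, ← hsym_eq_scale s ξ hs, zpow_one, mul_assoc, ← mul_assoc (_ : ℂ) (s : ℂ),
      ← Complex.ofReal_mul, inv_mul_cancel₀ hs.ne', Complex.ofReal_one, one_mul]
  rw [h1, ← wnorm_scale (fun ζ => m ζ * hsym 1 ζ) hs]
  unfold wnorm
  simp_rw [ker_const_mul, abs_mul, abs_of_pos (inv_pos.2 hs)]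
  rw [integral_const_mul]

/-! ### Products and frequency supports -/

theorem Wiener.integral_mul_mop (hg : Wiener g) {k : V → ℝ} (hk : Integrable k)
    {v : V → ℝ} (hv : Measurable v) (hB : ∀ y, |v y| ≤ B) :
    ∫ y, k y * mop g v y = ∫ b, (∫ y, k y * ker g (y - b)) * v b := by
  calc ∫ y, k y * mop g v y = ∫ y, ∫ b, k y * ker g (y - b) * v b := by
        congr 1; ext y
        rw [mop, ← integral_const_mul]
        congr 1; ext b; ring
    _ = ∫ b, ∫ y, k y * ker g (y - b) * v b :=
        integral_integral_swap (hg.integrable_adjoint hk hv hB)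
    _ = _ := by
        congr 1; ext b
        rw [integral_mul_const]

theorem abs_ker_le (x : V) : |ker g x| ≤ ∫ ν : V, ‖g ((2 * π) • ν)‖ :=
  (abs_ker_le_norm g x).trans (norm_sker_le x)

theorem Wiener.integral_wave {h : V → ℂ} (hh : Wiener h) (x θ : V) : ∫ y, sker h (x - y) * cis θ y =
      cis θ x * h ((2 * π) • θ) := by
  rw [← hh.fourier θ, ← integral_const_mul, ← integral_sub_left_eq_self (fun y => sker h (x - y) *
      cis θ y) volume x]
  congr 1; ext y
  rw [sub_sub_cancel, ← mul_assoc, ← Complex.exp_add, ← add_mul, ← Complex.ofReal_add, mul_comm,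
    inner_sub_right, real_inner_comm θ y]
  congr 4
  ring

/-- Three kernels whose frequency supports do not interact. -/
theorem integral_ker_mul_eq_zero {f g h : V → ℂ} (hf : Wiener f) (hg : Wiener g) (hh : Wiener h)
    (h0 : ∀ ξ ζ, f ξ * g ζ * h (ξ + ζ) = 0) (x a b : V) :
    ∫ y, ker h (x - y) * ker f (y - a) * ker g (y - b) = 0 := by
  have hF := Wiener.int' hf.int
  have hG := Wiener.int' hg.int
  set w : V × V → V → ℂ := fun p y =>
    cis p.1 (y - a) *
      cis p.2 (y - b) with hw
  have hprod : ∀ y, sker f (y - a) * sker g (y - b) = ∫ p : V × V,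
      w p y * (f ((2 * π) • p.1) * g ((2 * π) • p.2)) := by
    intro y
    rw [sker_eq, sker_eq, ← integral_prod_mul]
    congr 1; ext p
    simp only [hw]; ring
  have hint : Integrable (fun q : V × (V × V) => sker h (x - q.1) *
      (w q.2 q.1 * (f ((2 * π) • q.2.1) * g ((2 * π) • q.2.2))))
      (volume.prod volume) := by
    have h1 := (hh.intK.comp_sub_left x).mul_prod (hF.mul_prod hG)
    have h2 : Integrable (fun q : V × (V × V) => w q.2 q.1 * (sker h (x - q.1) *
      (f ((2 * π) • q.2.1) * g ((2 * π) • q.2.2)))) (volume.prod volume) := by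
      refine h1.bdd_mul (c := 1) ?_ (ae_of_all _ fun q => ?_)
      · simp only [hw]; fun_prop
      · simp only [hw]; rw [norm_mul, norm_cexp_mul_I, norm_cexp_mul_I, one_mul]
    refine h2.congr (ae_of_all _ fun q => ?_)
    simp only; ring
  have hc : ∫ y, sker h (x - y) * (sker f (y - a) * sker g (y - b)) = 0 := by
    calc _ = ∫ y, ∫ p : V × V, sker h (x - y) *
          (w p y * (f ((2 * π) • p.1) * g ((2 * π) • p.2))) := by
          congr 1; ext y
          rw [hprod, integral_const_mul]
      _ = ∫ p : V × V, ∫ y, sker h (x - y) * (w p y * (f ((2 * π) • p.1) * g ((2 * π) • p.2))) :=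
          integral_integral_swap hint
      _ = ∫ p : V × V, 0 := by
          congr 1; ext p
          have e : ∀ y, sker h (x - y) * (w p y * (f ((2 * π) • p.1) * g ((2 * π) • p.2))) =
              (sker h (x - y) * cis (p.1 + p.2) y) *
              (Complex.exp (((2 * π * (-(inner ℝ p.1 a) - inner ℝ p.2 b) : ℝ) : ℂ) *
                I) * (f ((2 * π) • p.1) * g ((2 * π) • p.2))) := by
            intro y
            have : w p y = cis (p.1 + p.2) y *
              Complex.exp (((2 * π * (-(inner ℝ p.1 a) - inner ℝ p.2 b) : ℝ) : ℂ) * I) := by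
              simp only [hw]
              rw [← Complex.exp_add, ← Complex.exp_add, ← add_mul, ← add_mul,
                ← Complex.ofReal_add, ← Complex.ofReal_add, inner_sub_right, inner_sub_right,
                inner_add_left]
              congr 3; ring
            rw [this]; ring
          simp_rw [e]
          rw [integral_mul_const, hh.integral_wave, smul_add]
          linear_combination cis (p.1 + p.2) x * (Complex.exp (((2 * π * (-(inner ℝ p.1 a) - inner ℝ p.2 b) : ℝ) : ℂ)
              * I)) * h0 ((2 * π) • p.1) ((2 * π) • p.2)
      _ = 0 := by simp
  have : ((∫ y, ker h (x - y) * ker f (y - a) * ker g (y - b) : ℝ) : ℂ) = 0 := by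
    rw [← integral_complex_ofReal, ← hc]
    congr 1; ext y
    rw [Complex.ofReal_mul, Complex.ofReal_mul, ofReal_ker hf.herm, ofReal_ker hg.herm,
      ofReal_ker hh.herm, mul_assoc]
  exact_mod_cast this

theorem mop_mul_mop_eq_zero {f g h : V → ℂ} (hf : Wiener f) (hg : Wiener g) (hh : Wiener h)
    (h0 : ∀ ξ ζ, f ξ * g ζ * h (ξ + ζ) = 0) {u v : V → ℝ} (hu : Measurable u)
    (hv : Measurable v) {U Y : ℝ} (hU : ∀ y, |u y| ≤ U) (hV : ∀ y, |v y| ≤ Y) (x : V) :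
    mop h (fun y => mop f u y * mop g v y) x = 0 := by
  have hk : Integrable fun y => ker h (x - y) * mop g v y :=
    hh.mul_bdd_int (measurable_mop hg.int hv) (hg.abs_mop_le hV) x
  have e : mop h (fun y => mop f u y * mop g v y) x =
      ∫ y, (ker h (x - y) * mop g v y) * mop f u y := by
    rw [mop]; congr 1; ext y; ring
  rw [e, hf.integral_mul_mop hk hu hU]
  have : ∀ a, ∫ y, ker h (x - y) * mop g v y * ker f (y - a) = 0 := by
    intro a
    have hk' : Integrable fun y => ker h (x - y) * ker f (y - a) :=
      (hh.shift_int x).mul_bdd (c := ∫ ν : V, ‖f ((2 * π) • ν)‖)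
        ((continuous_ker hf.int).comp (by fun_prop)).aestronglyMeasurable
        (ae_of_all _ fun y => abs_ker_le _)
    have := hg.integral_mul_mop hk' hv hV
    simp_rw [integral_ker_mul_eq_zero hf hg hh h0, zero_mul, integral_zero] at this
    rw [← this]
    congr 1; ext y; ring
  simp_rw [this, zero_mul, integral_zero]

/-! ### Approximate identities -/

theorem Wiener.integral_ker (hg : Wiener g) : ((∫ y, ker g y : ℝ) : ℂ) = g 0 := by
  have := hg.fourier 0
  simp only [inner_zero_right, mul_zero, Complex.ofReal_zero, zero_mul, Complex.exp_zero, one_mul,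
    smul_zero] at this
  rw [← this, ← integral_complex_ofReal]
  congr 1; ext y; rw [ofReal_ker hg.herm]

theorem Wiener.ae_tendsto_mop (hg : Wiener g) (hg0 : g 0 = 1)
    (hu : Measurable u) (hB : ∀ y, |u y| ≤ B) :
    ∀ᵐ x, Tendsto (fun s : ℝ => mop (fun ξ => g (s • ξ)) u x) (𝓝[>] 0) (𝓝 (u x)) := by
  have hloc : LocallyIntegrable u volume := (locallyIntegrable_const B).mono
    hu.aestronglyMeasurable (ae_of_all _ fun y => (hB y).trans (le_abs_self B))
  have hk1 : ∫ y, ker g y = 1 := by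
    have := hg.integral_ker
    rw [hg0] at this
    exact_mod_cast this
  set M : ℝ := ∫ ν : V, ‖g ((2 * π) • ν)‖ with hM
  have hM0 : 0 ≤ M := by positivity
  filter_upwards [IsUnifLocDoublingMeasure.ae_tendsto_average_norm_sub volume hloc 1] with x hx
  have hd : ∀ s : ℝ, ∀ h, |u (x - s • h) - u x| ≤ 2 * B := fun s h =>
    (abs_sub _ _).trans (by linarith [hB x, hB (x - s • h)])
  have hform : ∀ s : ℝ, 0 < s → mop (fun ξ => g (s • ξ)) u x - u x =
      ∫ h, ker g h * (u (x - s • h) - u x) := by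
    intro s hs
    have e1 : mop (fun ξ => g (s • ξ)) u x = ∫ h, ker g h * u (x - s • h) := by
      rw [mop, ← integral_sub_left_eq_self _ volume x]
      simp_rw [sub_sub_cancel, ker_scale g hs]
      have := Measure.integral_comp_smul (volume : Measure V)
        (fun h => (s ^ d)⁻¹ * ker g (s⁻¹ • h) * u (x - h)) s
      rw [finrank_euclideanSpace_fin, abs_of_pos (by positivity), smul_eq_mul,
        eq_inv_mul_iff_mul_eq₀ (by positivity)] at this
      rw [← this, ← integral_const_mul]
      congr 1; ext h
      rw [inv_smul_smul₀ hs.ne', ← mul_assoc, ← mul_assoc, mul_inv_cancel₀ (by positivity), one_mul]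
    have hi1 : Integrable fun h => ker g h * u (x - s • h) :=
      hg.ker_int.mul_bdd (c := B) (hu.comp (by fun_prop)).aestronglyMeasurable
        (ae_of_all _ fun _ => hB _)
    rw [e1]
    conv_lhs => rw [← one_mul (u x), ← hk1, ← integral_mul_const]
    rw [← integral_sub hi1 (hg.ker_int.mul_const _)]
    congr 1; ext h; ring
  rw [← tendsto_sub_nhds_zero_iff]
  refine Metric.tendsto_nhds.2 fun ε hε => ?_
  obtain ⟨R, hR0, hR⟩ : ∃ R : ℝ, 0 < R ∧
      2 * B * ∫ h in (closedBall (0 : V) R)ᶜ, |ker g h| < ε / 2 := by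
    have ht : Tendsto (fun n : ℕ => ∫ h in (closedBall (0 : V) n)ᶜ, |ker g h|) atTop (𝓝 0) := by
      have := tendsto_setIntegral_of_antitone (μ := volume) (f := fun h => |ker g h|)
        (s := fun n : ℕ => (closedBall (0 : V) n)ᶜ)
        (fun n => Metric.isClosed_closedBall.measurableSet.compl)
        (fun m n hmn => compl_subset_compl.2
          (Metric.closedBall_subset_closedBall (by exact_mod_cast hmn)))
        ⟨0, hg.ker_int.abs.integrableOn⟩
      have he : (⋂ n : ℕ, (closedBall (0 : V) n)ᶜ) = ∅ := by
        rw [← compl_iUnion, Metric.iUnion_closedBall_nat, compl_univ]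
      rwa [he, setIntegral_empty] at this
    obtain ⟨n, hn, hn1⟩ := (((ht.const_mul (2 * B)).eventually_lt_const (u := ε / 2)
      (by simpa using hε)).and (eventually_ge_atTop 1)).exists
    exact ⟨n, by exact_mod_cast hn1, hn⟩
  have hpos : ∀ᶠ s in 𝓝[>] (0 : ℝ), 0 < s * R :=
    eventually_mem_nhdsWithin.mono fun s hs => mul_pos hs hR0
  have hav := hx (l := 𝓝[>] (0 : ℝ)) (fun _ => x) (fun s => s * R)
    (tendsto_nhdsWithin_iff.2 ⟨((continuous_mul_const R).tendsto' 0 0 (zero_mul R)).mono_left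
      nhdsWithin_le_nhds, hpos⟩) (hpos.mono fun s hs => by simpa using hs.le)
  set c : ℝ := volume.real (closedBall (0 : V) R) with hc
  filter_upwards [self_mem_nhdsWithin, (hav.const_mul (M * c)).eventually_lt_const
    (u := ε / 2) (by simpa using hε)] with s (hs0 : (0 : ℝ) < s) hs2
  rw [Real.dist_eq, sub_zero, hform s hs0]
  have hint : Integrable fun h => |ker g h * (u (x - s • h) - u x)| := by
    refine (hg.ker_int.mul_bdd (c := 2 * B)
      ((hu.comp (by fun_prop)).sub measurable_const).aestronglyMeasurable (ae_of_all _ (hd s))).abs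
  have hball : MeasurableSet (closedBall (0 : V) R) :=
    Metric.isClosed_closedBall.measurableSet
  refine (abs_integral_le_integral_abs).trans_lt ?_
  rw [← integral_add_compl hball hint]
  have h1 : ∫ h in (closedBall (0 : V) R)ᶜ, |ker g h * (u (x - s • h) - u x)| ≤
      2 * B * ∫ h in (closedBall (0 : V) R)ᶜ, |ker g h| := by
    rw [← integral_const_mul]
    refine integral_mono hint.integrableOn (hg.ker_int.abs.integrableOn.const_mul _) fun h => ?_
    simp only
    rw [abs_mul, mul_comm]
    exact mul_le_mul_of_nonneg_right (hd s h) (abs_nonneg _)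
  have h2 : ∫ h in closedBall (0 : V) R, |ker g h * (u (x - s • h) - u x)| ≤
      M * c * ⨍ y in closedBall x (s * R), ‖u y - u x‖ := by
    have h3 : ∫ h in closedBall (0 : V) R, |ker g h * (u (x - s • h) - u x)| ≤
        M * ∫ h in closedBall (0 : V) R, |u (x - s • h) - u x| := by
      rw [← integral_const_mul]
      have hi : IntegrableOn (fun h => |u (x - s • h) - u x|) (closedBall (0 : V) R) := by
        refine Measure.integrableOn_of_bounded (M := 2 * B) measure_closedBall_lt_top.ne
          (((hu.comp (by fun_prop)).sub measurable_const).abs).aestronglyMeasurable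
          (ae_of_all _ fun h => (abs_abs _).trans_le (hd s h))
      refine integral_mono hint.integrableOn (hi.const_mul _) fun h => ?_
      simp only
      rw [abs_mul]
      exact mul_le_mul_of_nonneg_right (abs_ker_le _) (abs_nonneg _)
    refine h3.trans (le_of_eq ?_)
    rw [mul_assoc, setAverage_eq, smul_eq_mul]
    congr 1
    have e1 : volume.real (closedBall x (s * R)) = s ^ d * c := by
      rw [hc, measureReal_def, measureReal_def, Measure.addHaar_closedBall_mul volume x hs0.le hR0.le,
        finrank_euclideanSpace_fin, toReal_mul, ENNReal.toReal_ofReal (by positivity)]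
    have hc0 : 0 < c := ENNReal.toReal_pos (Metric.measure_closedBall_pos volume _ hR0).ne'
      measure_closedBall_lt_top.ne
    rw [e1, ← mul_assoc, mul_inv, mul_comm (s ^ d)⁻¹, ← mul_assoc, mul_inv_cancel₀ hc0.ne', one_mul]
    have e2 := Measure.integral_comp_smul (volume : Measure V)
      ((closedBall (0 : V) (s * R)).indicator fun h => |u (x - h) - u x|) s
    rw [finrank_euclideanSpace_fin, abs_of_pos (by positivity), smul_eq_mul] at e2
    rw [← integral_indicator hball, ← integral_indicator Metric.isClosed_closedBall.measurableSet,
      ← integral_sub_left_eq_self (fun y => (closedBall x (s * R)).indicator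
        (fun y => ‖u y - u x‖) y) volume x]
    convert e2 using 1
    · congr 1; ext h
      simp only [indicator, Metric.mem_closedBall, dist_zero_right, norm_smul,
        norm_of_nonneg hs0.le, mul_le_mul_iff_right₀ hs0]
    · congr 2; ext h
      simp only [indicator, Metric.mem_closedBall, dist_zero_right, dist_self_sub_left, norm_eq_abs]
  linarith

/-! ### The product estimate -/

theorem low_mul_low_phc (ψ : LP) (j : ℤ) (ξ ζ : V) :
    ψ.low (j - 2) ξ * ψ.low (j - 2) ζ * ψ.phc j (ξ + ζ) = 0 := by
  have hz : ∀ ξ : V, 2 ^ j ≤ 3 * ‖ξ‖ → ψ.low (j - 2) ξ = 0 := fun ξ h => by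
    rw [LPCutoff.low, ψ.eq_zero, Complex.ofReal_zero]
    rw [norm_smul, norm_of_nonneg (two_zpow_pos _).le, neg_sub, sub_eq_add_neg,
      zpow_add₀ two_ne_zero, zpow_neg]
    have := two_zpow_pos j
    rw [mul_assoc, mul_comm _ ‖ξ‖, ← div_eq_mul_inv]
    have h2 : 1 / 3 ≤ ‖ξ‖ / 2 ^ j := by rw [le_div_iff₀ this]; linarith
    norm_num
    linarith
  by_cases h1 : 2 ^ j ≤ 3 * ‖ξ‖
  · rw [hz ξ h1]; simp
  by_cases h2 : 2 ^ j ≤ 3 * ‖ζ‖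
  · rw [hz ζ h2]; simp
  push Not at h1 h2
  have : ψ.phc j (ξ + ζ) = 0 := by
    rw [phc, ψ.phi_eq_zero_of_small, Complex.ofReal_zero]
    have h3 := norm_add_le ξ ζ
    have := two_zpow_pos j
    rw [zpow_neg, inv_mul_le_iff₀ this]
    linarith
  rw [this, mul_zero]

theorem low_succ (ψ : LP) (k : ℤ) : ψ.low (k + 1) = fun ξ => ψ.low k ξ + ψ.phc k ξ := by
  ext ξ; rw [phc, ψ.phi_eq_low]; ring

theorem LPCutoff.low_zero_zero (ψ : LP) : ψ.low 0 0 = 1 := by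
  rw [low, ψ.eq_one _ (by rw [smul_zero, norm_zero]; norm_num), Complex.ofReal_one]

theorem ae_tendsto_low (ψ : LP) (m : ℤ) (hu : Measurable u) (hB : ∀ y, |u y| ≤ B) :
    ∀ᵐ x, Tendsto (fun n : ℕ => mop (ψ.low (m + n)) u x) atTop (𝓝 (u x)) := by
  filter_upwards [(ψ.wiener_low 0).ae_tendsto_mop ψ.low_zero_zero hu hB] with x hx
  have ht : Tendsto (fun n : ℕ => (2 : ℝ) ^ (-(m + n))) atTop (𝓝[>] 0) := by
    refine tendsto_nhdsWithin_iff.2 ⟨?_, Eventually.of_forall fun n => two_zpow_pos _⟩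
    have h1 : Tendsto (fun n : ℕ => (2 : ℝ) ^ (-m) * (1 / 2) ^ n) atTop (𝓝 ((2 : ℝ) ^ (-m) * 0)) :=
      (tendsto_pow_atTop_nhds_zero_of_lt_one (by norm_num) (by norm_num)).const_mul _
    rw [mul_zero] at h1
    refine h1.congr fun n => ?_
    rw [neg_add, zpow_add₀ two_ne_zero, zpow_neg _ (n : ℤ), zpow_natCast, one_div, inv_pow]
  refine (hx.comp ht).congr fun n => ?_
  rw [ψ.low_eq (m + n)]; rfl

theorem ofReal_wnorm_low (ψ : LP) {U : ℝ} (hU : ∀ y, |u y| ≤ U)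
    (k : ℤ) (y : V) : |mop (ψ.low k) u y| ≤ wnorm (ψ.low 0) * U := by
  rw [← ψ.wnorm_low k]; exact (ψ.wiener_low k).abs_mop_le hU y

/-- A dyadic block of a product only involves the higher blocks of the factors. -/
theorem LPCutoff.del_mul_le (ψ : LP) : ∃ C : ℝ≥0, ∀ (j : ℤ) (u v : V → ℝ),
    Measurable u → Measurable v → ∀ U Y : ℝ, (∀ y, |u y| ≤ U) → (∀ y, |v y| ≤ Y) → ∀ x,
    ‖ψ.del j (fun y => u y * v y) x‖ₑ ≤ C * ∑' n : ℕ, ((⨆ y, ‖ψ.del (j - 2 + n) u y‖ₑ) * ofReal Y +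
        ofReal U * ⨆ y, ‖ψ.del (j - 2 + n) v y‖ₑ) := by
  set L : ℝ := wnorm (ψ.low 0) with hL
  have hL0 : 0 ≤ L := wnorm_nonneg _
  refine ⟨(wnorm (ψ.phc 0) * L).toNNReal, fun j u v hu hv U Y hU hV x => ?_⟩
  have hU0 : 0 ≤ U := (abs_nonneg _).trans (hU 0)
  have hV0 : 0 ≤ Y := (abs_nonneg _).trans (hV 0)
  set S : ℕ → V → ℝ := fun n y =>
    mop (ψ.low (j - 2 + n)) u y * mop (ψ.low (j - 2 + n)) v y with hS
  have hSm : ∀ n, Measurable (S n) := fun n =>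
    (measurable_mop (ψ.wiener_low _).int hu).mul (measurable_mop (ψ.wiener_low _).int hv)
  have hSb : ∀ n y, |S n y| ≤ L * U * (L * Y) := fun n y => by
    rw [hS, abs_mul]
    exact mul_le_mul (ofReal_wnorm_low ψ hU _ y) (ofReal_wnorm_low ψ hV _ y) (abs_nonneg _)
      (by positivity)
  have hW := wiener_phc ψ j
  have hlim : Tendsto (fun n => ψ.del j (S n) x) atTop (𝓝 (ψ.del j (fun y => u y * v y) x)) := by
    refine tendsto_integral_of_dominated_convergence
      (fun y => |ker (ψ.phc j) (x - y)| * (L * U * (L * Y))) (fun n => (hW.mul_bdd_int (hSm n)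
        (hSb n) x).aestronglyMeasurable)
      ((hW.shift_int x).abs.mul_const _) (fun n => ae_of_all _ fun y => ?_) ?_
    · rw [norm_mul]
      exact mul_le_mul_of_nonneg_left (hSb n y) (norm_nonneg _)
    · filter_upwards [ae_tendsto_low ψ (j - 2) hu hU, ae_tendsto_low ψ (j - 2) hv hV] with y h1 h2
      exact (h1.mul h2).const_mul _
  set a : ℕ → ℝ≥0∞ := fun n => (⨆ y, ‖ψ.del (j - 2 + n) u y‖ₑ) * ofReal Y +
        ofReal U * ⨆ y, ‖ψ.del (j - 2 + n) v y‖ₑ with ha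
  have hstep : ∀ n, ‖ψ.del j (S (n + 1)) x - ψ.del j (S n) x‖ₑ ≤
      ofReal (wnorm (ψ.phc 0) * L) * a n := by
    intro n
    have e1 : ψ.del j (S (n + 1)) x - ψ.del j (S n) x = ψ.del j (fun y => S (n + 1) y - S n y) x := by
      unfold del mop
      rw [← integral_sub (hW.mul_bdd_int (hSm _) (hSb _) x) (hW.mul_bdd_int (hSm _) (hSb _) x)]
      congr 1; ext y; ring
    rw [e1]
    refine (hW.enorm_mop_le _ x).trans ?_
    rw [wnorm_phc, ofReal_mul (wnorm_nonneg _), mul_assoc]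
    refine mul_le_mul_right (iSup_le fun y => ?_) _
    have e2 : S (n + 1) y - S n y = ψ.del (j - 2 + n) u y * mop (ψ.low (j - 2 + (n + 1))) v y +
        mop (ψ.low (j - 2 + n)) u y * ψ.del (j - 2 + n) v y := by
      simp only [hS]
      push_cast
      rw [← add_assoc, low_succ, (ψ.wiener_low _).mop_add (wiener_phc ψ _)
        hu hU, (ψ.wiener_low _).mop_add (wiener_phc ψ _) hv hV]
      unfold del
      ring
    have hlow : ∀ (w : V → ℝ) (W : ℝ), (∀ y, |w y| ≤ W) → ∀ k : ℤ,
        ‖mop (ψ.low k) w y‖ₑ ≤ ofReal L * ofReal W := fun w W hW k => by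
      rw [← ofReal_mul hL0, Real.enorm_eq_ofReal_abs]
      exact ofReal_le_ofReal (ofReal_wnorm_low ψ hW k y)
    rw [e2]
    refine (enorm_add_le _ _).trans ?_
    rw [enorm_mul, enorm_mul, ha, mul_add]
    refine add_le_add ?_ ?_
    · calc _ ≤ (⨆ y, ‖ψ.del (j - 2 + n) u y‖ₑ) * (ofReal L * ofReal Y) :=
            mul_le_mul' (le_iSup (fun y => ‖ψ.del (j - 2 + n) u y‖ₑ) y) (hlow v Y hV _)
        _ = _ := by ring
    · calc _ ≤ (ofReal L * ofReal U) * (⨆ y, ‖ψ.del (j - 2 + n) v y‖ₑ) :=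
            mul_le_mul' (hlow u U hU _) (le_iSup (fun y => ‖ψ.del (j - 2 + n) v y‖ₑ) y)
        _ = _ := by ring
  have hzero : ψ.del j (S 0) x = 0 := by
    have := mop_mul_mop_eq_zero (ψ.wiener_low (j - 2)) (ψ.wiener_low (j - 2)) hW
      (low_mul_low_phc ψ j) hu hv hU hV x
    simpa [hS, del] using this
  have hN : ∀ N, ‖ψ.del j (S N) x‖ₑ ≤ ∑ n ∈ Finset.range N, ofReal (wnorm (ψ.phc 0) * L) * a n := by
    intro N
    have := Finset.sum_range_sub (fun n => ψ.del j (S n) x) N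
    rw [hzero, sub_zero] at this
    rw [← this]
    exact (enorm_sum_le _ _).trans (sum_le_sum fun n _ => hstep n)
  refine le_of_tendsto ((continuous_enorm.tendsto _).comp hlim) (.of_forall fun N => ?_)
  refine (hN N).trans ?_
  change _ ≤ ofReal _ * _
  rw [← ENNReal.tsum_mul_left]
  exact ENNReal.sum_le_tsum _

/-! ### Continuity of dyadic blocks -/

theorem lintegral_sub_shift_le {K : V → ℝ} (hK : ContDiff ℝ 1 K) (h : V) :
    ∫⁻ a, ‖K (a + h) - K a‖ₑ ≤ ‖h‖ₑ * ∫⁻ a, ‖fderiv ℝ K a‖ₑ := by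
  have hc : Continuous (fderiv ℝ K) := hK.continuous_fderiv one_ne_zero
  have h1 : ∀ a, ‖K (a + h) - K a‖ₑ ≤ ∫⁻ t in Ioc (0 : ℝ) 1, ‖h‖ₑ * ‖fderiv ℝ K (a + t • h)‖ₑ := by
    intro a
    have hd : ∀ t ∈ uIcc (0 : ℝ) 1, HasDerivAt (fun t : ℝ => K (a + t • h))
        (fderiv ℝ K (a + t • h) h) t := fun t _ => by
      have h2 : HasDerivAt (fun t : ℝ => a + t • h) h t := by
        simpa using ((hasDerivAt_id t).smul_const h).const_add a
      exact ((hK.differentiable one_ne_zero _).hasFDerivAt).comp_hasDerivAt t h2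
    have := intervalIntegral.integral_eq_sub_of_hasDerivAt hd
      (Continuous.intervalIntegrable (by fun_prop) _ _)
    simp only [one_smul, zero_smul, add_zero] at this
    rw [← this, intervalIntegral.integral_of_le zero_le_one]
    refine (enorm_integral_le_lintegral_enorm _).trans (lintegral_mono fun t => ?_)
    rw [mul_comm]
    exact ContinuousLinearMap.le_opENorm _ _
  have hm : Measurable (uncurry fun (a : V) (t : ℝ) =>
      ‖h‖ₑ * ‖fderiv ℝ K (a + t • h)‖ₑ) := by
    have : Continuous fun p : V × ℝ => fderiv ℝ K (p.1 + p.2 • h) := by fun_prop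
    exact measurable_const.mul this.enorm.measurable
  calc _ ≤ ∫⁻ a, ∫⁻ t in Ioc (0 : ℝ) 1, ‖h‖ₑ * ‖fderiv ℝ K (a + t • h)‖ₑ := lintegral_mono h1
    _ = ∫⁻ t in Ioc (0 : ℝ) 1, ∫⁻ a, ‖h‖ₑ * ‖fderiv ℝ K (a + t • h)‖ₑ :=
        lintegral_lintegral_swap hm.aemeasurable
    _ = ∫⁻ t in Ioc (0 : ℝ) 1, ‖h‖ₑ * ∫⁻ a, ‖fderiv ℝ K a‖ₑ := by
        congr 1; ext t
        rw [lintegral_const_mul _ (by fun_prop),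
          lintegral_add_right_eq_self (fun a => ‖fderiv ℝ K a‖ₑ)]
    _ = _ := by simp

theorem mop_scale (g : V → ℂ) (hc : 0 < c) (u : V → ℝ) (x : V) :
    mop (fun ξ => g (c • ξ)) u x = mop g (fun y => u (c • y)) (c⁻¹ • x) := by
  have := Measure.integral_comp_smul (volume : Measure V)
    (fun y => ker (fun ξ => g (c • ξ)) (x - y) * u y) c
  rw [finrank_euclideanSpace_fin, abs_of_pos (by positivity), smul_eq_mul,
    eq_inv_mul_iff_mul_eq₀ (by positivity)] at this
  rw [mop, ← this, mop, ← integral_const_mul]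
  congr 1; ext y
  rw [ker_scale g hc, ← mul_assoc, ← mul_assoc, mul_inv_cancel₀ (by positivity), one_mul, smul_sub,
    inv_smul_smul₀ hc.ne']

/-- Lipschitz bound for the dyadic blocks of a bounded function. -/
theorem Hom.block_lipschitz (hm : Hom σ m.1) (ψ : LP) :
    ∃ C : ℝ, 0 ≤ C ∧ ∀ (j : ℤ) (u : V → ℝ), Measurable u → ∀ B : ℝ, (∀ y, |u y| ≤ B) →
      ∀ x x' : V, |mop (bsym m.1 0 ψ.ph j) u x - mop (bsym m.1 0 ψ.ph j) u x'| ≤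
        C * (((2 : ℝ) ^ j) ^ σ * 2 ^ j) * B * ‖x - x'‖ := by
  set g : V → ℂ := bsym m.1 0 ψ.ph 0 with hg
  have hgW : Wiener g := hm.wiener_bsym ψ 0 le_rfl
  set κ : 𝓢(V, ℝ) := lpKernel ψ m 0 0 with hκ
  have hκe : ∀ a, ker g a = κ (-a) := fun a => by
    rw [hκ, lpKernel_apply, zero_sub, neg_neg]
    congr 1; ext ξ
    rw [hg, bsym, phc, ψ.phi_eq, hsym]; simp
  have hK : ContDiff ℝ 1 (ker g) := by
    rw [show ker g = fun a => κ (-a) from funext hκe]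
    exact (κ.smooth 1).comp contDiff_neg
  have hfin : ∫⁻ a, ‖fderiv ℝ (ker g) a‖ₑ < ⊤ := by
    have h1 : Integrable fun a => fderiv ℝ κ a := (SchwartzMap.fderivCLM ℝ V ℝ κ).integrable
    have h2 : fderiv ℝ (ker g) = fun a => -(fderiv ℝ κ (-a)) := by
      rw [show ker g = fun a => κ (-a) from funext hκe]
      ext1 a
      have h3 := (κ.differentiable (x := -a)).hasFDerivAt.comp a ((hasFDerivAt_id a).neg)
      refine h3.fderiv.trans ?_
      ext v; simp
    rw [h2]
    exact (h1.comp_neg.neg).2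
  set C := (∫⁻ a, ‖fderiv ℝ (ker g) a‖ₑ).toReal with hC
  have hint : ∀ x, Integrable fun y => ker g (x - y) := hgW.shift_int
  have hzero : ∀ (u : V → ℝ), Measurable u → ∀ B : ℝ, (∀ y, |u y| ≤ B) → ∀ x x',
      |mop g u x - mop g u x'| ≤ C * B * ‖x - x'‖ := by
    intro u hu B hB x x'
    have e1 : mop g u x - mop g u x' = ∫ y, (ker g (x - y) - ker g (x' - y)) * u y := by
      rw [mop, mop, ← integral_sub (hgW.mul_bdd_int hu hB x) (hgW.mul_bdd_int hu hB x')]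
      congr 1; ext y; ring
    have h3 : ∫ y, |ker g (x - y) - ker g (x' - y)| ≤ C * ‖x - x'‖ := by
      have h4 := lintegral_sub_shift_le hK (x - x')
      have h5 : ∫ y, |ker g (x - y) - ker g (x' - y)| =
          (∫⁻ a, ‖ker g (a + (x - x')) - ker g a‖ₑ).toReal := by
        rw [← integral_sub_left_eq_self _ volume x']
        rw [← integral_norm_eq_lintegral_enorm]
        · congr 1; ext a
          rw [norm_eq_abs]
          congr 3 <;> abel
        · exact (((continuous_ker hgW.int).comp (by fun_prop)).sub
            (continuous_ker hgW.int)).aestronglyMeasurable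
      rw [h5, hC, ← toReal_enorm (x - x'), mul_comm, ← toReal_mul]
      exact toReal_mono (mul_ne_top enorm_ne_top hfin.ne) h4
    calc |mop g u x - mop g u x'| ≤ ∫ y, |ker g (x - y) - ker g (x' - y)| * B := by
          rw [e1]
          refine norm_integral_le_of_norm_le (f := fun y => (ker g (x - y) - ker g (x' - y)) * u y)
            (((hint x).sub (hint x')).abs.mul_const B) (ae_of_all _ fun y => ?_)
          rw [norm_mul]
          exact mul_le_mul_of_nonneg_left (hB y) (abs_nonneg _)
      _ ≤ C * ‖x - x'‖ * B := by
          rw [integral_mul_const]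
          exact mul_le_mul_of_nonneg_right h3 ((abs_nonneg _).trans (hB 0))
      _ = _ := by ring
  refine ⟨C, toReal_nonneg, fun j u hu B hB x x' => ?_⟩
  have hsc : bsym m.1 0 ψ.ph j = fun ξ => ((((2 : ℝ) ^ j) ^ σ : ℝ) : ℂ) *
      (fun ζ => g ((2 : ℝ) ^ (-j) • ζ)) ξ := by
    ext ξ
    rw [hm.bsym_eq, hg]
    simp only [bsym, zero_mul, neg_zero, zpow_zero, one_smul, hsym]
    ring
  have hc := two_zpow_pos (-j)
  rw [hsc, mop_const_mul, mop_const_mul, mop_scale g hc, mop_scale g hc, ← mul_sub, abs_mul,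
    abs_of_pos (by positivity : (0 : ℝ) < ((2 : ℝ) ^ j) ^ σ)]
  have := hzero (fun y => u ((2 : ℝ) ^ (-j) • y)) (by fun_prop) B
    (fun _ => hB _) (((2 : ℝ) ^ (-j))⁻¹ • x) (((2 : ℝ) ^ (-j))⁻¹ • x')
  rw [← smul_sub, norm_smul, zpow_neg, inv_inv, norm_of_nonneg (two_zpow_pos _).le] at this
  rw [zpow_neg, inv_inv]
  calc _ ≤ ((2 : ℝ) ^ j) ^ σ * (C * B * (2 ^ j * ‖x - x'‖)) :=
        mul_le_mul_of_nonneg_left this (by positivity)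
    _ = _ := by ring

theorem continuous_block (hm : Hom σ m.1) (ψ : LP) (j : ℤ) (hu : Measurable u) (hB : ∀ y, |u y| ≤ B) :
    Continuous (mop (bsym m.1 0 ψ.ph j) u) := by
  obtain ⟨C, hC0, hC⟩ := hm.block_lipschitz ψ
  have hB0 := (abs_nonneg _).trans (hB 0)
  refine LipschitzWith.continuous (K := (C * (((2 : ℝ) ^ j) ^ σ * 2 ^ j) * B).toNNReal) ?_
  refine LipschitzWith.of_dist_le_mul fun x x' => ?_
  rw [Real.dist_eq, dist_eq_norm, Real.coe_toNNReal _ (by positivity)]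
  exact hC j u hu B hB x x'

theorem continuous_del (ψ : LP) (j : ℤ) (hu : Measurable u)
    (hB : ∀ y, |u y| ≤ B) : Continuous (ψ.del j u) := by
  unfold del
  rw [phc_eq_bsym]
  exact continuous_block hom_one ψ j hu hB

/-! ### Norms in time -/

/-- The norm of `L^q(J)` of a nonnegative function of `z`. -/
def tn (q : ℝ≥0∞) (b : ℝ → ℝ≥0∞) : ℝ≥0∞ := eLpNorm b q (volume.restrict (Iio 0))

theorem tn_one (b : ℝ → ℝ≥0∞) : tn 1 b = ∫⁻ z in Iio 0, b z := by
  rw [tn, eLpNorm_one_eq_lintegral_enorm]; simp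

theorem tn_top (b : ℝ → ℝ≥0∞) : tn ⊤ b = essSup b (volume.restrict (Iio 0)) := by
  rw [tn, eLpNorm_exponent_top, eLpNormEssSup_eq_essSup_enorm]; simp

theorem tn_mono_ae {q : ℝ≥0∞} {a b : ℝ → ℝ≥0∞} (h : ∀ᵐ z ∂(volume.restrict (Iio 0)), a z ≤ b z) :
    tn q a ≤ tn q b :=
  eLpNorm_mono_enorm_ae (h.mono fun z hz => by simpa using hz)

theorem tn_mono {q : ℝ≥0∞} {a b : ℝ → ℝ≥0∞} (h : ∀ z < 0, a z ≤ b z) : tn q a ≤ tn q b :=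
  tn_mono_ae ((ae_restrict_iff' measurableSet_Iio).2 (ae_of_all _ h))

theorem tn_congr_ae {q : ℝ≥0∞} {a b : ℝ → ℝ≥0∞}
    (h : ∀ᵐ z ∂(volume.restrict (Iio 0)), a z = b z) : tn q a = tn q b :=
  le_antisymm (tn_mono_ae (h.mono fun _ e => e.le)) (tn_mono_ae (h.mono fun _ e => e.ge))

theorem tn_const_mul {q : ℝ≥0∞} (hq : q = 1 ∨ q = ⊤) (c : ℝ≥0∞) {b : ℝ → ℝ≥0∞}
    (hb : Measurable b) : tn q (fun z => c * b z) = c * tn q b := by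
  rcases hq with rfl | rfl
  · rw [tn_one, tn_one, lintegral_const_mul _ hb]
  · rw [tn_top, tn_top, ENNReal.essSup_const_mul]

theorem tn_tsum_le {ι : Type*} [Countable ι] {q : ℝ≥0∞} (hq : q = 1 ∨ q = ⊤)
    {b : ι → ℝ → ℝ≥0∞} (hb : ∀ i, Measurable (b i)) :
    tn q (fun z => ∑' i, b i z) ≤ ∑' i, tn q (b i) := by
  rcases hq with rfl | rfl
  · simp only [tn_one]
    rw [lintegral_tsum fun i => (hb i).aemeasurable]
  · simp only [tn_top]
    refine essSup_le_of_ae_le _ ?_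
    filter_upwards [ae_all_iff.2 fun i =>
      ENNReal.ae_le_essSup (μ := volume.restrict (Iio (0 : ℝ))) (b i)] with z hz
    exact tsum_le_tsum hz

theorem tn_add_le {q : ℝ≥0∞} (hq : q = 1 ∨ q = ⊤) {a b : ℝ → ℝ≥0∞} (ha : Measurable a) :
    tn q (fun z => a z + b z) ≤ tn q a + tn q b := by
  rcases hq with rfl | rfl
  · simp only [tn_one]
    rw [lintegral_add_left ha]
  · simp only [tn_top]
    exact ENNReal.essSup_add_le a b

/-! ### Bounded measurable functions of `(x, z)` -/

/-- Measurable functions that are bounded everywhere. -/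
structure Cl (u : Fn) : Prop where
  meas : Measurable u
  bdd : ∃ B, ∀ p, |u p| ≤ B

/-- The supremum of `|u|`. -/
def supN (u : Fn) : ℝ≥0∞ := ⨆ p, ‖u p‖ₑ

theorem enorm_le_supN (u : Fn) (p : V × ℝ) : ‖u p‖ₑ ≤ supN u :=
  le_iSup (fun p => ‖u p‖ₑ) p

theorem Cl.supN_lt_top {u : Fn} (hu : Cl u) : supN u < ⊤ := by
  obtain ⟨B, hB⟩ := hu.bdd
  refine lt_of_le_of_lt (iSup_le fun p => ?_) (ofReal_lt_top (r := B))
  rw [Real.enorm_eq_ofReal_abs]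
  exact ofReal_le_ofReal (hB p)

theorem abs_le_supN {u : Fn} (hu : supN u < ⊤) (p : V × ℝ) :
    |u p| ≤ (supN u).toReal := by
  rw [← norm_eq_abs, ← toReal_enorm]
  exact toReal_mono hu.ne (enorm_le_supN u p)

theorem Cl.of_supN {u : Fn} (hm : Measurable u) (hu : supN u < ⊤) : Cl u :=
  ⟨hm, _, abs_le_supN hu⟩

theorem Cl.slice {u : Fn} (hu : Cl u) (z : ℝ) : Measurable fun y => u (y, z) :=
  hu.meas.comp (by fun_prop)

theorem Cl.zero : Cl (fun _ : V × ℝ => (0 : ℝ)) := ⟨measurable_const, 0, by simp⟩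

theorem Cl.add {u v : Fn} (hu : Cl u) (hv : Cl v) : Cl fun p => u p + v p := by
  obtain ⟨B, hB⟩ := hu.bdd
  obtain ⟨B', hB'⟩ := hv.bdd
  exact ⟨hu.meas.add hv.meas, B + B', fun p => (abs_add_le _ _).trans (add_le_add (hB p) (hB' p))⟩

theorem Cl.neg {u : Fn} (hu : Cl u) : Cl fun p => -u p := by
  obtain ⟨B, hB⟩ := hu.bdd
  exact ⟨hu.meas.neg, B, fun p => by rw [abs_neg]; exact hB p⟩

theorem Cl.sub {u v : Fn} (hu : Cl u) (hv : Cl v) : Cl fun p => u p - v p := by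
  simpa only [sub_eq_add_neg] using hu.add hv.neg

theorem Cl.mul {u v : Fn} (hu : Cl u) (hv : Cl v) : Cl fun p => u p * v p := by
  obtain ⟨B, hB⟩ := hu.bdd
  obtain ⟨B', hB'⟩ := hv.bdd
  refine ⟨hu.meas.mul hv.meas, B * B', fun p => ?_⟩
  rw [abs_mul]
  exact mul_le_mul (hB p) (hB' p) (abs_nonneg _) ((abs_nonneg _).trans (hB p))

theorem Cl.sum {ι : Type*} (s : Finset ι) {u : ι → Fn} (hu : ∀ i, Cl (u i)) :
    Cl fun p => ∑ i ∈ s, u i p := by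
  classical
  induction s using Finset.induction_on with
  | empty => simpa using Cl.zero
  | insert a s ha ih => simpa only [sum_insert ha] using (hu a).add ih

theorem supN_add_le (u v : Fn) : supN (fun p => u p + v p) ≤ supN u + supN v :=
  iSup_le fun p => (enorm_add_le _ _).trans (add_le_add (enorm_le_supN u p) (enorm_le_supN v p))

theorem supN_neg (u : Fn) : supN (fun p => -u p) = supN u := by
  simp only [supN, enorm_neg]

theorem supN_sub_le (u v : Fn) : supN (fun p => u p - v p) ≤ supN u + supN v := by
  simpa only [sub_eq_add_neg, supN_neg] using supN_add_le u (fun p => -v p)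

theorem supN_mul_le (u v : Fn) : supN (fun p => u p * v p) ≤ supN u * supN v :=
  iSup_le fun p => by
    rw [enorm_mul]; exact mul_le_mul' (enorm_le_supN u p) (enorm_le_supN v p)

theorem supN_sum_le {ι : Type*} (s : Finset ι) (u : ι → Fn) :
    supN (fun p => ∑ i ∈ s, u i p) ≤ ∑ i ∈ s, supN (u i) :=
  iSup_le fun p => (enorm_sum_le _ _).trans (sum_le_sum fun i _ => enorm_le_supN (u i) p)

theorem measurable_mop_slice (hg : Integrable g) {u : Fn}
    (hu : Measurable u) : Measurable fun p : V × ℝ => mop g (fun y => u (y, p.2)) p.1 := by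
  have h : Measurable fun q : (V × ℝ) × V => ker g (q.1.1 - q.2) * u (q.2, q.1.2) :=
    ((continuous_ker hg).measurable.comp (by fun_prop)).mul (hu.comp (by fun_prop))
  exact (h.stronglyMeasurable.integral_prod_right').measurable

theorem measurable_iSup_enorm {u : Fn} (hu : Measurable u)
    (hc : ∀ z, Continuous fun x => u (x, z)) : Measurable fun z => ⨆ x, ‖u (x, z)‖ₑ := by
  have h : ∀ z, ⨆ x, ‖u (x, z)‖ₑ = ⨆ n : ℕ, ‖u (TopologicalSpace.denseSeq V n, z)‖ₑ := by
    intro z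
    refine le_antisymm (iSup_le fun x => ?_) (iSup_le fun n => le_iSup (fun x => ‖u (x, z)‖ₑ) _)
    have hcl : IsClosed {x : V | ‖u (x, z)‖ₑ ≤ ⨆ n : ℕ, ‖u (TopologicalSpace.denseSeq V n, z)‖ₑ} :=
      isClosed_le (hc z).enorm continuous_const
    have := (TopologicalSpace.denseRange_denseSeq V).induction_on (p := fun x =>
      ‖u (x, z)‖ₑ ≤ ⨆ n : ℕ, ‖u (TopologicalSpace.denseSeq V n, z)‖ₑ) x hcl
      (fun n => le_iSup (fun n => ‖u (TopologicalSpace.denseSeq V n, z)‖ₑ) n)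
    exact this
  simp only [h]
  exact Measurable.iSup fun n => (hu.comp (by fun_prop)).enorm

/-- The supremum of the `j`-th dyadic block at height `z`. -/
def bn (ψ : LP) (j : ℤ) (u : Fn) (z : ℝ) : ℝ≥0∞ :=
  ⨆ x, ‖ψ.del j (fun y => u (y, z)) x‖ₑ

theorem enorm_del_le_bn (ψ : LP) (j : ℤ) (u : Fn) (x : V) (z : ℝ) :
    ‖ψ.del j (fun y => u (y, z)) x‖ₑ ≤ bn ψ j u z :=
  le_iSup (fun x => ‖ψ.del j (fun y => u (y, z)) x‖ₑ) x

theorem measurable_bn (ψ : LP) (j : ℤ) {u : Fn} (hu : Cl u) : Measurable (bn ψ j u) := by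
  obtain ⟨B, hB⟩ := hu.bdd
  exact measurable_iSup_enorm (u := fun p => ψ.del j (fun y => u (y, p.2)) p.1)
    (measurable_mop_slice (wiener_phc ψ j).int hu.meas) fun z =>
    continuous_del ψ j (hu.slice z) (fun y => hB (y, z))

theorem cheminLerner_eq (ψ : LP) (q : ℝ≥0∞) (s : ℝ) (u : Fn) :
    CL ψ q s u = ∑' j : ℤ, ofReal ((2 : ℝ) ^ (s * j)) * tn q (bn ψ j u) := by
  simp only [cheminLerner, funBlock_one_eq]; rfl

theorem halfVol_eq : μJ = volume.prod (volume.restrict (Iio 0)) := by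
  have : (ℍ : Set (V × ℝ)) = univ ×ˢ Iio 0 := by ext p; simp [halfSpace]
  rw [halfVol, this, Measure.volume_eq_prod, ← Measure.prod_restrict, Measure.restrict_univ]

theorem ae_slice {Q : V × ℝ → Prop} (h : ∀ᵐ p ∂μJ, Q p) :
    ∀ᵐ z ∂(volume.restrict (Iio 0)), ∀ᵐ y : V, Q (y, z) := by
  rw [halfVol_eq] at h
  have h2 : ∀ᵐ p ∂((volume.restrict (Iio (0 : ℝ))).prod (volume : Measure V)), Q p.swap := by
    rw [← Measure.prod_swap] at h
    exact ae_of_ae_map measurable_swap.aemeasurable h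
  exact Measure.ae_ae_of_ae_prod h2

theorem cheminLerner_congr (ψ : LP) (q : ℝ≥0∞) (s : ℝ) {u v : Fn}
    (h : u =ᵐ[μJ] v) : CL ψ q s u = CL ψ q s v := by
  simp only [cheminLerner_eq]
  congr 1; ext j
  congr 1
  refine tn_congr_ae ((ae_slice h).mono fun z hz => ?_)
  unfold bn del
  congr 1; ext x
  rw [mop_congr_ae (ψ.phc j) (u := fun y => u (y, z)) (v := fun y => v (y, z)) hz]

/-- Bounds on the Chemin-Lerner norm from bounds on the blocks. -/
theorem cheminLerner_le_of_bn_le (ψ : LP) {q : ℝ≥0∞} (s : ℝ) {u : Fn}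
    {b : ℤ → ℝ → ℝ≥0∞} (h : ∀ j, ∀ z < 0, bn ψ j u z ≤ b j z) :
    CL ψ q s u ≤ ∑' j : ℤ, ofReal ((2 : ℝ) ^ (s * j)) * tn q (b j) := by
  rw [cheminLerner_eq]
  exact tsum_le_tsum fun j => mul_le_mul_right (tn_mono (h j)) _

theorem bn_tsum_le (ψ : LP) {ι : Type*} [Countable ι] {u : ι → Fn}
    {v : Fn} (hu : ∀ i, Cl (u i)) (hs : ∑' i, supN (u i) < ⊤)
    (hv : ∀ p, HasSum (fun i => u i p) (v p)) (j : ℤ) (z : ℝ) :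
    bn ψ j v z ≤ ∑' i, bn ψ j (u i) z := by
  refine iSup_le fun x => ?_
  have hW := wiener_phc ψ j
  have hb : ∀ i p, |u i p| ≤ (supN (u i)).toReal := fun i p => abs_le_supN (hu i).supN_lt_top p
  have hint : ∀ i, Integrable fun y => ker (ψ.phc j) (x - y) * u i (y, z) := fun i =>
    hW.mul_bdd_int ((hu i).slice z) (fun y => hb i (y, z)) x
  have hsum : HasSum (fun i => ψ.del j (fun y => u i (y, z)) x) (ψ.del j (fun y => v (y, z)) x) := by
    refine hasSum_integral_of_hasSum (f := fun i y => ker (ψ.phc j) (x - y) * u i (y, z)) hint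
      (ae_of_all _ fun y => (hv (y, z)).mul_left _) ?_
    refine .of_nonneg_of_le (fun i => integral_nonneg fun _ => norm_nonneg _) (fun i => ?_)
      ((summable_toReal hs.ne).mul_left (wnorm (ψ.phc j)))
    rw [← Wiener.integral_abs_shift (ψ.phc j) x, ← integral_mul_const]
    refine integral_mono (hint i).norm ((hW.shift_int x).abs.mul_const _) fun y => ?_
    rw [norm_mul]
    exact mul_le_mul_of_nonneg_left (hb i _) (norm_nonneg _)
  rw [← hsum.tsum_eq]
  refine (enorm_tsum_le_tsum_enorm).trans (tsum_le_tsum fun i => enorm_del_le_bn _ _ _ _ _)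

theorem cheminLerner_tsum_le (ψ : LP) {q : ℝ≥0∞} (hq : q = 1 ∨ q = ⊤) (s : ℝ)
    {ι : Type*} [Countable ι] {u : ι → Fn} {v : Fn} (hu : ∀ i, Cl (u i)) (hs : ∑' i, supN (u i) < ⊤)
    (hv : ∀ p, HasSum (fun i => u i p) (v p)) : CL ψ q s v ≤ ∑' i, CL ψ q s (u i) := by
  refine (cheminLerner_le_of_bn_le ψ s fun j z _ => bn_tsum_le ψ hu hs hv j z).trans ?_
  simp only [cheminLerner_eq]
  rw [ENNReal.tsum_comm]
  refine tsum_le_tsum fun j => ?_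
  rw [ENNReal.tsum_mul_left]
  exact mul_le_mul_right (tn_tsum_le hq fun i => measurable_bn ψ j (hu i)) _

theorem cheminLerner_neg (ψ : LP) {q : ℝ≥0∞} (s : ℝ) (u : Fn) :
    CL ψ q s (fun p => -u p) = CL ψ q s u := by
  simp only [cheminLerner_eq]
  congr 1; ext j
  congr 2
  ext z
  unfold bn del mop
  simp only [mul_neg, integral_neg, enorm_neg]

theorem tsum_ofReal_two_rpow_lt_top (hs : 0 < s) :
    ∑' n : ℕ, ofReal ((2 : ℝ) ^ (s * (2 - n))) < ⊤ := by
  have h : Summable fun n : ℕ => (2 : ℝ) ^ (s * (2 - n)) := by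
    have h1 : (2 : ℝ) ^ (-s) < 1 := Real.rpow_lt_one_of_one_lt_of_neg one_lt_two (by linarith)
    refine ((summable_geometric_of_lt_one (by positivity) h1).mul_left ((2 : ℝ) ^ (s * 2))).congr
      fun n => ?_
    rw [← Real.rpow_natCast, ← Real.rpow_mul (by norm_num), ← rpow_add (by norm_num)]
    congr 1; ring
  rw [← ENNReal.ofReal_tsum_of_nonneg (fun n => by positivity) h]
  exact ofReal_lt_top

/-- The product estimate in Chemin-Lerner spaces of positive regularity. -/
theorem cheminLerner_mul_le (ψ : LP) (hs : 0 < s) : ∃ C : ℝ≥0, ∀ q : ℝ≥0∞,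
    q = 1 ∨ q = ⊤ → ∀ u v : Fn, Cl u → Cl v →
    CL ψ q s (fun p => u p * v p) ≤ C * (CL ψ q s u * supN v + supN u * CL ψ q s v) := by
  obtain ⟨C, hC⟩ := ψ.del_mul_le
  set S := ∑' n : ℕ, ofReal ((2 : ℝ) ^ (s * (2 - n)))
  have hS : S ≠ ⊤ := (tsum_ofReal_two_rpow_lt_top hs).ne
  refine ⟨C * S.toNNReal, fun q hq u v hu hv => ?_⟩
  have hum := fun j => measurable_bn ψ j hu
  have hvm := fun j => measurable_bn ψ j hv
  have h1 : ∀ j, ∀ z < (0 : ℝ), bn ψ j (fun p => u p * v p) z ≤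
      C * ∑' n : ℕ, (supN v * bn ψ (j - 2 + n) u z + supN u * bn ψ (j - 2 + n) v z) := by
    intro j z _
    refine iSup_le fun x => (hC j (fun y => u (y, z)) (fun y => v (y, z)) (hu.slice z) (hv.slice z)
      _ _ (fun y => abs_le_supN hu.supN_lt_top _) (fun y => abs_le_supN hv.supN_lt_top _) x).trans ?_
    rw [ENNReal.ofReal_toReal hu.supN_lt_top.ne, ENNReal.ofReal_toReal hv.supN_lt_top.ne]
    refine mul_le_mul_right (tsum_le_tsum fun n => ?_) _
    rw [mul_comm]; rfl
  refine (cheminLerner_le_of_bn_le ψ s h1).trans ?_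
  set F : ℤ → ℝ≥0∞ := fun k => ofReal ((2 : ℝ) ^ (s * k)) *
    (supN v * tn q (bn ψ k u) + supN u * tn q (bn ψ k v)) with hF
  have h2 : ∀ j : ℤ, ofReal ((2 : ℝ) ^ (s * j)) * tn q (fun z =>
      C * ∑' n : ℕ, (supN v * bn ψ (j - 2 + n) u z + supN u * bn ψ (j - 2 + n) v z)) ≤
      C * ∑' n : ℕ, ofReal ((2 : ℝ) ^ (s * (2 - n))) * F (j - 2 + n) := by
    intro j
    rw [tn_const_mul hq _ (b := fun z => ∑' n : ℕ, (supN v * bn ψ (j - 2 + n) u z +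
      supN u * bn ψ (j - 2 + n) v z)) (Measurable.tsum fun n =>
      ((hum _).const_mul _).add ((hvm _).const_mul _)), mul_left_comm]
    refine mul_le_mul_right ?_ _
    refine (mul_le_mul_right (tn_tsum_le hq fun n =>
      ((hum _).const_mul _).add ((hvm _).const_mul _)) _).trans ?_
    rw [← ENNReal.tsum_mul_left]
    refine tsum_le_tsum fun n => ?_
    rw [hF]
    dsimp only
    rw [← mul_assoc, ← ofReal_mul (by positivity), ← rpow_add (by norm_num)]
    have : s * (2 - n) + s * ((j - 2 + n : ℤ) : ℝ) = s * j := by push_cast; ring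
    rw [this]
    refine mul_le_mul_right ?_ _
    refine (tn_add_le hq ((hum _).const_mul _)).trans ?_
    rw [tn_const_mul hq _ (hum _), tn_const_mul hq _ (hvm _)]
  refine (tsum_le_tsum h2).trans ?_
  rw [ENNReal.tsum_mul_left, ENNReal.tsum_comm]
  have h3 : ∀ n : ℕ, ∑' j : ℤ, ofReal ((2 : ℝ) ^ (s * (2 - n))) * F (j - 2 + n) =
      ofReal ((2 : ℝ) ^ (s * (2 - n))) * ∑' k, F k := by
    intro n
    rw [ENNReal.tsum_mul_left]
    congr 1
    rw [← (Equiv.addRight (-2 + (n : ℤ))).tsum_eq F]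
    congr 1; ext j
    simp only [Equiv.coe_addRight]
    congr 1; ring
  simp only [h3]
  rw [ENNReal.tsum_mul_right]
  have h4 : ∑' k, F k = CL ψ q s u * supN v + supN u * CL ψ q s v := by
    simp only [cheminLerner_eq, hF]
    rw [mul_comm _ (supN v), ← ENNReal.tsum_mul_left, ← ENNReal.tsum_mul_left, ← tsum_add]
    congr 1; ext k; ring
  rw [h4, coe_mul, ENNReal.coe_toNNReal hS, mul_assoc]

/-! ### Tempered distributions and integrals of Schwartz functions -/

/-- Indices of the quantities `|x|^k D^n κ(x)(m_0, …, m_{n-1})`, with `(k, n) ∈ s` and `|m_l| ≤ 1`. -/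
structure JetIndex (d : ℕ) (s : Finset (ℕ × ℕ)) where
  idx : ℕ × ℕ
  mem : idx ∈ s
  pt : E d
  dir : ℕ → E d
  norm_dir : ∀ l, ‖dir l‖ ≤ 1

instance (s : Finset (ℕ × ℕ)) : TopologicalSpace (JetIndex d s) := ⊥

instance (s : Finset (ℕ × ℕ)) : DiscreteTopology (JetIndex d s) := ⟨rfl⟩

theorem abs_iteratedFDeriv_apply_le (n : ℕ) (κ : 𝓢(V, ℝ)) (x : V) {m : Fin n → V}
    (hm : ∀ l, ‖m l‖ ≤ 1) : |iteratedFDeriv ℝ n κ x m| ≤ ‖iteratedFDeriv ℝ n κ x‖ := by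
  refine ((iteratedFDeriv ℝ n κ x).le_opNorm m).trans ?_
  exact mul_le_of_le_one_right (norm_nonneg _)
    (Finset.prod_le_one (fun l _ => norm_nonneg _) fun l _ => hm l)

/-- The collection of the weighted derivatives of a Schwartz function. -/
def schwartzJet (s : Finset (ℕ × ℕ)) : 𝓢(V, ℝ) →ₗ[ℝ]
    BoundedContinuousFunction (JetIndex d s) ℝ where
  toFun κ := BoundedContinuousFunction.ofNormedAddCommGroupDiscrete
    (fun a => ‖a.pt‖ ^ a.idx.1 * iteratedFDeriv ℝ a.idx.2 κ a.pt fun l => a.dir l)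
    ((s.sup (schwartzSeminormFamily ℝ V ℝ)) κ) fun a => by
      rw [norm_mul, norm_of_nonneg (by positivity)]
      refine (mul_le_mul_of_nonneg_left (abs_iteratedFDeriv_apply_le _ _ _
        fun l => a.norm_dir l) (by positivity)).trans ?_
      refine (le_seminorm ℝ a.idx.1 a.idx.2 κ _).trans ?_
      exact Seminorm.le_finset_sup_apply (p := schwartzSeminormFamily ℝ V ℝ) a.mem
  map_add' κ μ := by
    ext1 a
    change _ * (iteratedFDeriv ℝ a.idx.2 (κ + μ : V → ℝ) a.pt fun l => a.dir l) = _ * _ + _ * _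
    rw [iteratedFDeriv_add_apply (κ.smooth _).contDiffAt (μ.smooth _).contDiffAt]
    simp [mul_add]
  map_smul' c κ := by
    ext1 a
    change _ * (iteratedFDeriv ℝ a.idx.2 (c • κ : V → ℝ) a.pt fun l => a.dir l) = c * (_ * _)
    rw [iteratedFDeriv_const_smul_apply (κ.smooth _).contDiffAt]
    simp [mul_left_comm]

theorem schwartzJet_apply (s : Finset (ℕ × ℕ)) (κ : 𝓢(V, ℝ)) (a : JetIndex d s) :
    schwartzJet s κ a = ‖a.pt‖ ^ a.idx.1 * iteratedFDeriv ℝ a.idx.2 κ a.pt fun l => a.dir l := rfl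

theorem norm_schwartzJet_le (s : Finset (ℕ × ℕ)) (κ : 𝓢(V, ℝ)) :
    ‖schwartzJet s κ‖ ≤ (s.sup (schwartzSeminormFamily ℝ V ℝ)) κ := by
  refine (BoundedContinuousFunction.norm_le (apply_nonneg _ _)).2 fun a => ?_
  rw [schwartzJet_apply, norm_mul, norm_of_nonneg (by positivity)]
  refine (mul_le_mul_of_nonneg_left (abs_iteratedFDeriv_apply_le _ _ _
    fun l => a.norm_dir l) (by positivity)).trans ?_
  refine (le_seminorm ℝ a.idx.1 a.idx.2 κ _).trans ?_
  exact Seminorm.le_finset_sup_apply (p := schwartzSeminormFamily ℝ V ℝ) a.mem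

theorem sup_seminorm_le_norm_schwartzJet (s : Finset (ℕ × ℕ)) (κ : 𝓢(V, ℝ)) :
    (s.sup (schwartzSeminormFamily ℝ V ℝ)) κ ≤ ‖schwartzJet s κ‖ := by
  refine Seminorm.finset_sup_apply_le (norm_nonneg _) fun i hi => ?_
  refine seminorm_le_bound ℝ i.1 i.2 κ (norm_nonneg _) fun x => ?_
  have h1 : ∀ m : Fin i.2 → V, (∀ l, ‖m l‖ ≤ 1) →
      ‖x‖ ^ i.1 * |iteratedFDeriv ℝ i.2 κ x m| ≤ ‖schwartzJet s κ‖ := by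
    intro m hm
    have := (schwartzJet s κ).norm_coe_le_norm ⟨i, hi, x,
      fun l => if h : l < i.2 then m ⟨l, h⟩ else 0, fun l => by split_ifs <;> simp [hm]⟩
    rw [schwartzJet_apply, norm_mul, norm_of_nonneg (by positivity)] at this
    simpa using this
  rcases eq_or_lt_of_le (show 0 ≤ ‖x‖ ^ i.1 by positivity) with h0 | h0
  · rw [← h0, zero_mul]; exact norm_nonneg _
  rw [mul_comm, ← le_div_iff₀ h0]
  refine ContinuousMultilinearMap.opNorm_le_bound (by positivity) fun m => ?_
  by_cases hz : ∃ l, m l = 0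
  · obtain ⟨l, hl⟩ := hz
    rw [ContinuousMultilinearMap.map_coord_zero _ l hl, norm_zero]
    positivity
  push Not at hz
  have h2 : m = fun l => ‖m l‖ • (‖m l‖⁻¹ • m l) := by
    ext1 l
    rw [smul_inv_smul₀ (norm_ne_zero_iff.2 (hz l))]
  rw [h2, ContinuousMultilinearMap.map_smul_univ, norm_smul, ← h2, mul_comm]
  refine mul_le_mul ?_ (by simp) (norm_nonneg _) (by positivity)
  rw [le_div_iff₀ h0, mul_comm]
  refine h1 _ fun l => ?_
  rw [norm_smul, norm_inv, norm_norm, inv_mul_cancel₀ (norm_ne_zero_iff.2 (hz l))]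

theorem continuous_of_le_seminorm {F : Type*} [NormedAddCommGroup F] [NormedSpace ℝ F]
    (T : 𝓢(V, ℝ) →ₗ[ℝ] F) (s : Finset (ℕ × ℕ))
    (h : ∀ κ, ‖T κ‖ ≤ (s.sup (schwartzSeminormFamily ℝ V ℝ)) κ) : Continuous T := by
  refine (schwartz_withSeminorms ℝ V ℝ).continuous_normedSpace_rng F T ⟨s, 1, ?_⟩
  intro κ
  rw [one_smul]
  exact h κ

theorem hasDerivAt_iteratedFDeriv_line (κ : 𝓢(V, ℝ)) (n : ℕ) (x : V) (m : Fin (n + 1) → V)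
    (t : ℝ) : HasDerivAt (fun t : ℝ => iteratedFDeriv ℝ n κ (x + t • m 0) (Fin.tail m))
      (iteratedFDeriv ℝ (n + 1) κ (x + t • m 0) m) t := by
  have h3 : Differentiable ℝ (iteratedFDeriv ℝ n κ) :=
    (κ.smooth (n + 1)).differentiable_iteratedFDeriv (by exact_mod_cast Nat.lt_succ_self n)
  have h2 : HasDerivAt (fun t : ℝ => x + t • m 0) (m 0) t := by
    simpa using ((hasDerivAt_id t).smul_const (m 0)).const_add x
  have h4 := (h3 (x + t • m 0)).hasFDerivAt.comp_hasDerivAt t h2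
  rw [iteratedFDeriv_succ_apply_left]
  exact ((ContinuousMultilinearMap.apply ℝ (fun _ : Fin n => V) ℝ
    (Fin.tail m)).hasFDerivAt).comp_hasDerivAt t h4

theorem iteratedFDeriv_integral {κ : V → 𝓢(V, ℝ)} (hκ : Continuous κ) {k : V → ℝ}
    (hk : AEStronglyMeasurable k)
    (hint : ∀ p n, Integrable fun y => |k y| * SchwartzMap.seminorm ℝ p n (κ y))
    {κ' : 𝓢(V, ℝ)} (hval : ∀ x, κ' x = ∫ y, k y * κ y x) (n : ℕ) (x : V) (m : Fin n → V)
    (hm : ∀ l, ‖m l‖ ≤ 1) :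
    iteratedFDeriv ℝ n κ' x m = ∫ y, k y * iteratedFDeriv ℝ n (κ y) x m := by
  have hcont : ∀ n x (m : Fin n → V), (∀ l, ‖m l‖ ≤ 1) →
      Continuous fun y => iteratedFDeriv ℝ n (κ y) x m := fun n x m hm => by
    set T : 𝓢(V, ℝ) →ₗ[ℝ] ℝ :=
      { toFun := fun κ => iteratedFDeriv ℝ n κ x m
        map_add' := fun κ μ => by
          change iteratedFDeriv ℝ n (κ + μ : V → ℝ) x m = _
          rw [iteratedFDeriv_add_apply (κ.smooth _).contDiffAt (μ.smooth _).contDiffAt]; rfl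
        map_smul' := fun c κ => by
          change iteratedFDeriv ℝ n (c • κ : V → ℝ) x m = _
          rw [iteratedFDeriv_const_smul_apply (κ.smooth _).contDiffAt]; rfl }
    have hT : Continuous T := continuous_of_le_seminorm T {(0, n)} fun κ => by
      rw [Finset.sup_singleton]
      exact (abs_iteratedFDeriv_apply_le n κ x hm).trans (norm_iteratedFDeriv_le_seminorm ℝ κ n x)
    exact hT.comp hκ
  have hmeas : ∀ n x (m : Fin n → V), (∀ l, ‖m l‖ ≤ 1) →
      AEStronglyMeasurable fun y => k y * iteratedFDeriv ℝ n (κ y) x m := fun n x m hm =>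
    hk.mul (hcont n x m hm).aestronglyMeasurable
  have hB : ∀ n x (m : Fin n → V), (∀ l, ‖m l‖ ≤ 1) → ∀ y,
      ‖k y * iteratedFDeriv ℝ n (κ y) x m‖ ≤ |k y| * SchwartzMap.seminorm ℝ 0 n (κ y) :=
    fun n x m hm y => by
      rw [norm_mul]
      exact mul_le_mul_of_nonneg_left ((abs_iteratedFDeriv_apply_le n _ x hm).trans
        (norm_iteratedFDeriv_le_seminorm ℝ (κ y) n x)) (norm_nonneg _)
  induction n generalizing x with
  | zero => simp [hval]
  | succ n ih =>
    have h0 := hasDerivAt_iteratedFDeriv_line κ' n x m 0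
    simp only [ih _ (Fin.tail m) fun l => hm _] at h0
    have h1 := (hasDerivAt_integral_of_dominated_loc_of_deriv_le (μ := volume) (x₀ := (0 : ℝ))
      (F := fun t y => k y * iteratedFDeriv ℝ n (κ y) (x + t • m 0) (Fin.tail m))
      (F' := fun t y => k y * iteratedFDeriv ℝ (n + 1) (κ y) (x + t • m 0) m) univ_mem
      (.of_forall fun t => hmeas n _ (Fin.tail m) fun l => hm _)
      ((hint 0 n).mono' (hmeas n _ (Fin.tail m) fun l => hm _)
        (ae_of_all _ (hB n _ (Fin.tail m) fun l => hm _)))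
      (hmeas (n + 1) _ m hm) (ae_of_all _ fun y t _ => hB (n + 1) _ m hm y) (hint 0 (n + 1))
      (ae_of_all _ fun y t _ => (hasDerivAt_iteratedFDeriv_line (κ y) n x m t).const_mul (k y))).2
    have h2 := h0.unique h1
    simpa using h2

/-- A tempered distribution commutes with integrals of Schwartz functions. -/
theorem TemperedDist.apply_integral (f : TD) {κ : V → 𝓢(V, ℝ)} (hκ : Continuous κ)
    {k : V → ℝ} (hk : AEStronglyMeasurable k)
    (hint : ∀ p n, Integrable fun y => |k y| * SchwartzMap.seminorm ℝ p n (κ y))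
    {κ' : 𝓢(V, ℝ)} (hval : ∀ x, κ' x = ∫ y, k y * κ y x) : f κ' = ∫ y, k y * f (κ y) := by
  obtain ⟨s, C, -, hC⟩ := Seminorm.bound_of_continuous (schwartz_withSeminorms ℝ V ℝ)
    ((normSeminorm ℝ ℝ).comp f.toLinearMap) (by
      change Continuous fun κ => ‖f κ‖
      exact f.continuous.norm)
  set ι : 𝓢(V, ℝ) →ₗ[ℝ] BoundedContinuousFunction (JetIndex d s) ℝ := schwartzJet s with hι
  have hb : ∀ μ, |f μ| ≤ C * ‖ι μ‖ := fun μ => by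
    refine (hC μ).trans ?_
    change C * (s.sup (schwartzSeminormFamily ℝ V ℝ)) μ ≤ _
    exact mul_le_mul_of_nonneg_left (sup_seminorm_le_norm_schwartzJet s μ) C.2
  have hker : LinearMap.ker ι ≤ LinearMap.ker f.toLinearMap := fun μ hμ => by
    have h1 := hb μ
    rw [LinearMap.mem_ker.1 hμ, norm_zero, mul_zero] at h1
    exact LinearMap.mem_ker.2 (abs_eq_zero.1 (le_antisymm h1 (abs_nonneg _)))
  set g : LinearMap.range ι →ₗ[ℝ] ℝ :=
    (LinearMap.ker ι).liftQ f.toLinearMap hker ∘ₗ ι.quotKerEquivRange.symm.toLinearMap with hgdef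
  have hg : ∀ μ, g ⟨ι μ, μ, rfl⟩ = f μ := fun μ => by
    have : ι.quotKerEquivRange.symm ⟨ι μ, μ, rfl⟩ = (LinearMap.ker ι).mkQ μ :=
      LinearMap.quotKerEquivRange_symm_apply_image ι μ _
    rw [hgdef, LinearMap.comp_apply, LinearEquiv.coe_coe, this, Submodule.mkQ_apply,
      Submodule.liftQ_apply]
    rfl
  have hgb : ∀ w : LinearMap.range ι, ‖g w‖ ≤ C * ‖w‖ := by
    rintro ⟨_, μ, rfl⟩
    rw [hg]
    exact hb μ
  obtain ⟨G, hG, -⟩ := exists_extension_norm_eq (LinearMap.range ι) (g.mkContinuous C hgb)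
  have hGf : ∀ μ, G (ι μ) = f μ := fun μ => by
    rw [← hg μ]; exact hG ⟨ι μ, μ, rfl⟩
  have hcont : Continuous fun y => ι (κ y) :=
    (continuous_of_le_seminorm ι s (norm_schwartzJet_le s)).comp hκ
  have hI : Integrable fun y => k y • ι (κ y) := by
    refine (integrable_finsetSum s fun i _ => hint i.1 i.2).mono'
      (hk.smul hcont.aestronglyMeasurable) (ae_of_all _ fun y => ?_)
    rw [norm_smul, ← mul_sum]
    refine mul_le_mul_of_nonneg_left ((norm_schwartzJet_le s (κ y)).trans ?_) (norm_nonneg _)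
    refine Seminorm.finset_sup_apply_le (sum_nonneg fun i _ => apply_nonneg _ _) fun i hi => ?_
    exact single_le_sum (f := fun i : ℕ × ℕ => SchwartzMap.seminorm ℝ i.1 i.2 (κ y))
      (fun i _ => apply_nonneg _ _) hi
  have hkey : ∫ y, k y • ι (κ y) = ι κ' := by
    ext1 a
    refine ((BoundedContinuousFunction.evalCLM ℝ a).integral_comp_comm hI).symm.trans ?_
    change ∫ y, k y * (‖a.pt‖ ^ a.idx.1 * iteratedFDeriv ℝ a.idx.2 (κ y) a.pt fun l => a.dir l) =
      ‖a.pt‖ ^ a.idx.1 * iteratedFDeriv ℝ a.idx.2 κ' a.pt fun l => a.dir l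
    rw [iteratedFDeriv_integral hκ hk hint hval _ _ _ fun l => a.norm_dir l, ← integral_const_mul]
    congr 1; ext1 y
    ring
  rw [← hGf κ', ← hkey, ← G.integral_comp_comm hI]
  congr 1; ext y
  rw [map_smul, hGf, smul_eq_mul]

/-! ### Translations of Schwartz functions -/

theorem seminorm_translate_le (κ : 𝓢(V, ℝ)) (k n : ℕ) (a : V) :
    SchwartzMap.seminorm ℝ k n (κ.compSubConstCLM ℝ a) ≤
      2 ^ k * (SchwartzMap.seminorm ℝ k n κ + ‖a‖ ^ k * SchwartzMap.seminorm ℝ 0 n κ) := by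
  refine seminorm_le_bound ℝ k n _ (mul_nonneg (by positivity) (add_nonneg (apply_nonneg _ _)
      (mul_nonneg (by positivity) (apply_nonneg _ _)))) fun x => ?_
  have h1 : iteratedFDeriv ℝ n (κ.compSubConstCLM ℝ a) x = iteratedFDeriv ℝ n κ (x - a) :=
    iteratedFDeriv_comp_sub n a x
  rw [h1]
  have h2 : ‖x‖ ^ k ≤ 2 ^ k * (‖x - a‖ ^ k + ‖a‖ ^ k) := by
    have h3 : ‖x‖ ≤ ‖x - a‖ + ‖a‖ := by simpa using norm_add_le (x - a) a
    refine (pow_le_pow_left₀ (norm_nonneg _) h3 k).trans ?_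
    refine (add_pow_le (norm_nonneg _) (norm_nonneg _) k).trans ?_
    exact mul_le_mul_of_nonneg_right (pow_le_pow_right₀ (by norm_num) (Nat.sub_le k 1))
      (by positivity)
  calc _ ≤ 2 ^ k * (‖x - a‖ ^ k + ‖a‖ ^ k) * ‖iteratedFDeriv ℝ n κ (x - a)‖ :=
        mul_le_mul_of_nonneg_right h2 (norm_nonneg _)
    _ = 2 ^ k * (‖x - a‖ ^ k * ‖iteratedFDeriv ℝ n κ (x - a)‖ +
          ‖a‖ ^ k * ‖iteratedFDeriv ℝ n κ (x - a)‖) := by ring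
    _ ≤ _ := by
        gcongr
        · exact le_seminorm ℝ k n κ _
        · exact norm_iteratedFDeriv_le_seminorm ℝ κ n _

theorem continuous_translate (κ : 𝓢(V, ℝ)) : Continuous fun a => κ.compSubConstCLM ℝ a := by
  have h0 : Tendsto (fun a => κ.compSubConstCLM ℝ a) (𝓝 0) (𝓝 κ) := by
    rw [(schwartz_withSeminorms ℝ V ℝ).tendsto_nhds]
    rintro ⟨k, n⟩ ε hε
    set M := 2 ^ k * (SchwartzMap.seminorm ℝ k (n + 1) κ + SchwartzMap.seminorm ℝ 0 (n + 1) κ)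
    have hM : 0 ≤ M := mul_nonneg (by positivity) (add_nonneg (apply_nonneg _ _) (apply_nonneg _ _))
    have hb : ∀ a : V, ‖a‖ ≤ 1 → SchwartzMap.seminorm ℝ k n (κ.compSubConstCLM ℝ a - κ) ≤
        M * ‖a‖ := by
      intro a ha
      refine seminorm_le_bound ℝ k n _ (by positivity) fun x => ?_
      have h1 : iteratedFDeriv ℝ n (κ.compSubConstCLM ℝ a - κ : 𝓢(V, ℝ)) x =
          iteratedFDeriv ℝ n κ (x - a) - iteratedFDeriv ℝ n κ x := by
        rw [← iteratedFDeriv_comp_sub n a x]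
        exact iteratedFDeriv_sub_apply ((κ.compSubConstCLM ℝ a).smooth n).contDiffAt
          (κ.smooth n).contDiffAt
      have hdiff : Differentiable ℝ (iteratedFDeriv ℝ n κ) :=
        (κ.smooth (n + 1)).differentiable_iteratedFDeriv (by exact_mod_cast Nat.lt_succ_self n)
      have h2 := (convex_closedBall x ‖a‖).norm_image_sub_le_of_norm_fderiv_le (𝕜 := ℝ)
        (f := fun w => ‖x‖ ^ k • iteratedFDeriv ℝ n κ w) (C := M) (x := x) (y := x - a)
        (fun w _ => (hdiff w).fun_const_smul _) (fun w hw => by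
          rw [fderiv_fun_const_smul (hdiff w), norm_smul, norm_fderiv_iteratedFDeriv,
            norm_of_nonneg (by positivity)]
          have h3 : ‖x‖ ^ k ≤ 2 ^ k * (‖w‖ ^ k + 1) := by
            have h4 : ‖x‖ ≤ ‖w‖ + 1 := by
              rw [mem_closedBall_iff_norm'] at hw
              linarith [norm_sub_norm_le x w]
            refine (pow_le_pow_left₀ (norm_nonneg _) h4 k).trans ?_
            refine (add_pow_le (norm_nonneg _) zero_le_one k).trans ?_
            rw [one_pow]
            exact mul_le_mul_of_nonneg_right (pow_le_pow_right₀ (by norm_num) (Nat.sub_le k 1))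
              (by positivity)
          calc _ ≤ 2 ^ k * (‖w‖ ^ k + 1) * ‖iteratedFDeriv ℝ (n + 1) κ w‖ :=
                mul_le_mul_of_nonneg_right h3 (norm_nonneg _)
            _ = 2 ^ k * (‖w‖ ^ k * ‖iteratedFDeriv ℝ (n + 1) κ w‖ +
                ‖iteratedFDeriv ℝ (n + 1) κ w‖) := by ring
            _ ≤ M := by
                refine mul_le_mul_of_nonneg_left (add_le_add ?_ ?_) (by positivity)
                · exact le_seminorm ℝ k (n + 1) κ w
                · exact norm_iteratedFDeriv_le_seminorm ℝ κ (n + 1) w)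
        (Metric.mem_closedBall_self (norm_nonneg _)) (by simp)
      rw [h1]
      rw [← smul_sub, norm_smul, norm_of_nonneg (by positivity)] at h2
      simpa using h2
    have h6 : Tendsto (fun a : V => M * ‖a‖) (𝓝 0) (𝓝 0) :=
      (continuous_const.mul continuous_norm).tendsto' 0 0 (by simp)
    filter_upwards [h6.eventually (gt_mem_nhds hε), Metric.closedBall_mem_nhds (0 : V) one_pos]
      with a ha ha1
    exact (hb a (by simpa using ha1)).trans_lt ha
  refine continuous_iff_continuousAt.2 fun b => ?_
  have h1 : Tendsto (fun a => a - b) (𝓝 b) (𝓝 0) :=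
    (continuous_sub_right b).tendsto' b 0 (sub_self b)
  have h2 := ((SchwartzMap.compSubConstCLM ℝ b).continuous.tendsto κ).comp (h0.comp h1)
  refine h2.congr fun a => ?_
  simp [SchwartzMap.compSubConstCLM_comp]

/-! ### Dyadic blocks of tempered distributions -/

theorem measurable_ker_family {X : Type*} [MeasurableSpace X] {g : X → V → ℂ}
    (hg : Measurable (uncurry g)) : Measurable fun p : X × V => ker (g p.1) p.2 := by
  unfold ker
  refine Complex.measurable_re.comp ?_
  simp only [sker_eq]
  have h : Measurable fun q : (X × V) × V =>
      cis q.2 q.1.2 * g q.1.1 ((2 * π) • q.2) := by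
    refine Measurable.mul ?_ (hg.comp (f := fun q : (X × V) × V =>
      (q.1.1, (2 * π) • q.2)) (by fun_prop))
    have h1 : Measurable fun q : (X × V) × V => inner ℝ q.2 q.1.2 := by
      have : Measurable fun p : V × V => inner ℝ p.1 p.2 := continuous_inner.measurable
      exact this.comp (f := fun q : (X × V) × V => (q.2, q.1.2)) (by fun_prop)
    exact Complex.measurable_exp.comp ((measurable_ofReal.comp (h1.const_mul _)).mul_const _)
  exact (h.stronglyMeasurable.integral_prod_right').measurable

theorem Hom.measurable {m : V → ℂ} (hm : Hom σ m) : Measurable m :=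
  measurable_of_continuousOn_compl_singleton 0 fun ξ hξ =>
    (hm.smooth ξ hξ).continuousAt.continuousWithinAt

theorem measurable_bsym {m : V → ℂ} (hm : Hom σ m) {χ : V → ℂ} (hχ : Continuous χ)
    (j : ℤ) : Measurable (uncurry fun s => bsym m s χ j) := by
  unfold bsym hsym
  refine ((hm.measurable.comp measurable_snd).mul ?_).mul
    (hχ.measurable.comp (f := fun p : ℝ × V => (2 : ℝ) ^ (-j) • p.2) (by fun_prop))
  exact measurable_ofReal.comp (by fun_prop)

theorem measurable_mul_hsym {m : V → ℂ} (hm : Measurable m) :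
    Measurable (uncurry fun (s : ℝ) ξ => m ξ * hsym s ξ) := by
  unfold hsym
  exact (hm.comp measurable_snd).mul (measurable_ofReal.comp (by fun_prop))

theorem lpKernel_eq_translate (ψ : LP) (m : Symbol d) (j : ℤ) (x : V) :
    lpKernel ψ m j x = (lpKernel ψ m j 0).compSubConstCLM ℝ x := by
  ext y
  rw [SchwartzMap.compSubConstCLM_apply, lpKernel_apply, lpKernel_apply]
  congr 1; abel

theorem continuous_lpKernel (ψ : LP) (m : Symbol d) (j : ℤ) : Continuous (lpKernel ψ m j) := by
  rw [show lpKernel ψ m j = fun x => (lpKernel ψ m j 0).compSubConstCLM ℝ x from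
    funext (lpKernel_eq_translate ψ m j)]
  exact continuous_translate _

theorem continuous_distBlock (ψ : LP) (m : Symbol d) (j : ℤ) (f : TD) :
    Continuous (distBlock ψ m j f) :=
  f.continuous.comp (continuous_lpKernel ψ m j)

theorem distBlock_congr (ψ : LP) {m m' : Symbol d} {j j' : ℤ}
    (h : ∀ ξ, m.1 ξ * ψ.phc j ξ = m'.1 ξ * ψ.phc j' ξ) (f : TD) (x : V) :
    distBlock ψ m j f x = distBlock ψ m' j' f x := by
  unfold distBlock
  congr 1
  ext y
  rw [lpKernel_apply, lpKernel_apply]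
  congr 1
  exact funext h

theorem Hom.annular_block {m : V → ℂ} (hm : Hom σ m) (ψ : LP) (j : ℤ) :
    Wiener fun ξ => m ξ * ψ.phc j ξ := by
  have := hm.wiener_bsym ψ j le_rfl
  refine (congrArg Wiener ?_).mp this
  ext ξ
  rw [bsym, phc, ψ.phi_eq, hsym]; simp

/-- Multipliers with Schwartz kernels commute with tempered distributions. -/
theorem mop_distBlock (ψ : LP) (hg : Wiener g) {x : V} {K : 𝓢(V, ℝ)}
    (hK : ∀ y, K y = ker g (x - y)) {j : ℤ}
    (hm : Wiener fun ξ => m.1 ξ * ψ.phc j ξ) {m' : Symbol d} {j' : ℤ}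
    (h : ∀ ξ, g ξ * (m.1 ξ * ψ.phc j ξ) = m'.1 ξ * ψ.phc j' ξ) (f : TD) :
    mop g (distBlock ψ m j f) x = distBlock ψ m' j' f x := by
  refine (TemperedDist.apply_integral f (κ := lpKernel ψ m j) (continuous_lpKernel ψ m j)
    (k := fun y => ker g (x - y)) ?_ ?_ ?_).symm
  · exact ((continuous_ker hg.int).comp (by fun_prop)).aestronglyMeasurable
  · intro p n
    set κ := lpKernel ψ m j 0
    have hb : Integrable fun y => |K y| * (2 ^ p * (SchwartzMap.seminorm ℝ p n κ +
        ‖y‖ ^ p * SchwartzMap.seminorm ℝ 0 n κ)) := by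
      have h1 := (K.integrable_pow_mul volume 0).mul_const (2 ^ p * SchwartzMap.seminorm ℝ p n κ)
      have h2 := (K.integrable_pow_mul volume p).mul_const (2 ^ p * SchwartzMap.seminorm ℝ 0 n κ)
      refine (h1.add h2).congr (ae_of_all _ fun y => ?_)
      simp only [Pi.add_apply, pow_zero, one_mul, norm_eq_abs]
      ring
    have hmeas : AEStronglyMeasurable fun y => |ker g (x - y)| *
        SchwartzMap.seminorm ℝ p n (lpKernel ψ m j y) := by
      refine ((((continuous_ker hg.int).comp (by fun_prop)).abs).mul ?_).aestronglyMeasurable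
      exact ((schwartz_withSeminorms ℝ V ℝ).continuous_seminorm (p, n)).comp
        (continuous_lpKernel ψ m j)
    refine hb.mono' hmeas (ae_of_all _ fun y => ?_)
    rw [norm_mul, norm_eq_abs, abs_abs, ← hK y, norm_of_nonneg (apply_nonneg _ _),
      lpKernel_eq_translate]
    exact mul_le_mul_of_nonneg_left (seminorm_translate_le _ p n y) (abs_nonneg _)
  · intro w
    rw [lpKernel_apply]
    simp only [← h]
    rw [hg.ker_mul hm, ← integral_sub_right_eq_self _ w]
    congr 1; ext y
    rw [lpKernel_apply]
    congr 2; abel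

/-- The frequency localization `φ_i` as a symbol. -/
def phiSym (ψ : LP) (i : ℤ) : Symbol d :=
  ⟨ψ.phc i, fun _ _ => ofRealCLM.contDiff.contDiffAt.comp _ (ψ.contDiff_phi i).contDiffAt⟩

theorem mop_block_distBlock (ψ : LP) {σ τ : ℤ} {n m : Symbol d} (hn : Hom σ n.1)
    (hm : Hom τ m.1) {s t : ℝ} (hs : 0 ≤ s) (ht : 0 ≤ t) (i j : ℤ) (f : TD) (x : V) :
    mop (bsym n.1 s ψ.ph i) (distBlock ψ (m.mul (heat t)) j f) x =
      distBlock ψ (((n.mul (heat s)).mul (phiSym ψ i)).mul (m.mul (heat t))) j f x := by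
  refine mop_distBlock ψ (hn.wiener_bsym ψ i hs) (K := lpKernel ψ (n.mul (heat s)) i x)
    (fun y => ?_) ?_ (fun ξ => ?_) f
  · rw [lpKernel_apply]
    congr 1; ext ξ
    rw [bsym, phc, ψ.phi_eq]; rfl
  · refine (congrArg Wiener ?_).mp (hm.wiener_bsym ψ j ht)
    ext ξ
    rw [bsym, phc, ψ.phi_eq]; rfl
  · rw [bsym, ← ψ.phi_eq]
    simp only [Symbol.mul, phiSym, phc]
    change _ * hsym s ξ * _ * _ = _ * hsym s ξ * _ * _ * _
    ring

theorem measurable_distBlock (ψ : LP) (m : Symbol d) (j : ℤ) (f : TD) :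
    Measurable (distBlock ψ m j f) := (continuous_distBlock ψ m j f).measurable

theorem mop_fat_distBlock (ψ : LP) {n m : Symbol d} (hn : Hom σ n.1) (j : ℤ)
    (hm : Wiener fun ξ => m.1 ξ * ψ.phc j ξ) (hs : 0 ≤ s) {m' : Symbol d}
    (h : ∀ ξ, ξ ≠ 0 → m'.1 ξ = n.1 ξ * hsym s ξ * m.1 ξ) (f : TD) (x : V) :
    mop (bsym n.1 s ψ.fat j) (distBlock ψ m j f) x = distBlock ψ m' j f x := by
  obtain ⟨C, -, hC⟩ := hn.block_bound ψ.annular_fat ψ.fat_herm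
  have hph : ∀ i ξ, bsym n.1 s ψ.ph i ξ = (n.mul (heat s)).1 ξ * ψ.phc i ξ :=
    fun i ξ => by rw [bsym, phc, ψ.phi_eq]; rfl
  have hsum : bsym n.1 s ψ.fat j = fun ξ => bsym n.1 s ψ.ph (j - 1) ξ +
      bsym n.1 s ψ.ph j ξ + bsym n.1 s ψ.ph (j + 1) ξ := by
    ext ξ
    simp only [bsym]
    rw [ψ.fat_eq, ψ.phi_eq, ψ.phi_eq, ψ.phi_eq]
    ring
  refine mop_distBlock ψ (hC j s hs).1 (K := lpKernel ψ (n.mul (heat s)) (j - 1) x +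
    lpKernel ψ (n.mul (heat s)) j x + lpKernel ψ (n.mul (heat s)) (j + 1) x)
    (fun y => ?_) hm (fun ξ => ?_) f
  · rw [add_apply, add_apply, lpKernel_apply, lpKernel_apply, lpKernel_apply, hsum]
    have hW := fun i => (hn.wiener_bsym ψ i hs)
    rw [ker_add ((hW _).add (hW _)).int (hW _).int, ker_add (hW _).int (hW _).int]
    simp only [← hph]
  · by_cases hξ : ξ = 0
    · subst hξ
      have : ψ.phc j 0 = 0 := by
        rw [phc, ψ.phi_eq_zero_of_small _ _ (by rw [norm_zero]; norm_num), Complex.ofReal_zero]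
      rw [this]; ring
    · rw [h ξ hξ, bsym, phc, ψ.phi_eq]
      have := ψ.ph_mul_fat ((2 : ℝ) ^ (-j) • ξ)
      linear_combination n.1 ξ * hsym s ξ * m.1 ξ * this

theorem Hom.distBlock_le {n : Symbol d} (hn : Hom σ n.1) (ψ : LP) :
    ∃ C : ℝ≥0, ∀ {τ : ℤ} {m : Symbol d}, Hom τ m.1 → ∀ {s : ℝ}, 0 ≤ s → ∀ {m' : Symbol d},
      (∀ ξ, ξ ≠ 0 → m'.1 ξ = n.1 ξ * hsym s ξ * m.1 ξ) →
      ∀ (j : ℤ) (f : TD) (x : V), ‖distBlock ψ m' j f x‖ₑ ≤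
        C * ofReal (((2 : ℝ) ^ j) ^ σ * exp (-(s * 2 ^ j / 4))) * ⨆ y, ‖distBlock ψ m j f y‖ₑ := by
  obtain ⟨C, hC0, hC⟩ := hn.block_bound ψ.annular_fat ψ.fat_herm
  refine ⟨C.toNNReal, fun {_ _} hm {s} hs {m'} h j f x => ?_⟩
  rw [← mop_fat_distBlock ψ hn j (hm.annular_block ψ j) hs h]
  refine ((hC j s hs).1.enorm_mop_le _ x).trans (mul_le_mul_left ?_ _)
  change _ ≤ ofReal C * _
  rw [← ofReal_mul hC0, ← mul_assoc]
  exact ofReal_le_ofReal (hC j s hs).2.1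

/-- The supremum of `|D|Δ_j f`. -/
def dn (ψ : LP) (f : TD) (j : ℤ) : ℝ≥0∞ :=
  ⨆ y, ‖distBlock ψ Λ j f y‖ₑ

theorem besovNorm_abs (ψ : LP) (s : ℝ) (f : TD) :
    besovNorm ψ s Λ f = ∑' j : ℤ, ofReal ((2 : ℝ) ^ (s * j)) * dn ψ f j := rfl

theorem besovNorm_abs_zero (ψ : LP) (f : TD) : β ψ f = ∑' j : ℤ, dn ψ f j := by
  simp [besovNorm_abs]

theorem two_zpow_eq_rpow (j : ℤ) : (2 : ℝ) ^ j = (2 : ℝ) ^ (j : ℝ) := (Real.rpow_intCast 2 j).symm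

theorem besovNorm_abs_lt_top (ψ : LP) (s : ℝ)
    (hf : MemBesov ψ (1 + s) f) : besovNorm ψ s Λ f < ⊤ := by
  obtain ⟨C, hC⟩ := hom_abs.distBlock_le ψ
  refine lt_of_le_of_lt (b := C * besovNorm ψ (1 + s) one f) ?_ (mul_lt_top coe_lt_top hf)
  rw [besovNorm, besovNorm, ← ENNReal.tsum_mul_left]
  refine tsum_le_tsum fun j => ?_
  have h1 : ⨆ x, ‖distBlock ψ Λ j f x‖ₑ ≤ C * ofReal ((2 : ℝ) ^ (j : ℝ)) *
      ⨆ x, ‖distBlock ψ one j f x‖ₑ := iSup_le fun x => by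
    have := hC hom_one (le_refl 0) (m' := Λ) (fun ξ _ => by simp [hsym, one]) j f x
    rwa [zero_mul, zero_div, neg_zero, Real.exp_zero, mul_one, zpow_one, two_zpow_eq_rpow] at this
  refine (mul_le_mul_right h1 _).trans (le_of_eq ?_)
  rw [add_mul, one_mul, rpow_add (by norm_num), ofReal_mul (by positivity)]
  ring

/-- `m(D) e^{z|D|} f`, for a symbol `m` homogeneous of degree one. -/
def harm (ψ : LP) (m : Symbol d) (f : TD) (p : V × ℝ) : ℝ :=
  if p.2 < 0 then ∑' j : ℤ, distBlock ψ (m.mul (heat (-p.2))) j f p.1 else 0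

theorem gradH_apply (ψ : LP) (η : TD) {p : V × ℝ} (hp : p.2 < 0) (k : Fin d) :
    gradH ψ η p k = harm ψ (partialD k) η p := by
  simp [harm, hp, gradH]

theorem absDH_apply (ψ : LP) (η : TD) {p : V × ℝ} (hp : p.2 < 0) : absDH ψ η p = harm ψ Λ η p := by
  simp [harm, hp, absDH]

theorem Hom.mul_invAbs {m : V → ℂ} (hm : Hom 1 m) : Hom 0 (fun ξ => m ξ * invAbs.1 ξ) := by
  simpa using hm.mul hom_invAbs

theorem Hom.harm_block_le (hm : Hom 1 m.1) (ψ : LP) :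
    ∃ C : ℝ≥0, ∀ {s : ℝ}, 0 ≤ s → ∀ (j : ℤ) (f : TD) (x : V),
      ‖distBlock ψ (m.mul (heat s)) j f x‖ₑ ≤ C * ofReal (exp (-(s * 2 ^ j / 4))) * dn ψ f j := by
  obtain ⟨C, hC⟩ := Hom.distBlock_le (n := m.mul invAbs) hm.mul_invAbs ψ
  refine ⟨C, fun {s} hs j f x => ?_⟩
  have := hC hom_abs hs (m' := m.mul (heat s)) (fun ξ hξ => by
    have hn : ((‖ξ‖ : ℝ) : ℂ) ≠ 0 := ofReal_ne_zero.2 (norm_ne_zero_iff.2 hξ)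
    simp only [Symbol.mul, invAbs, Symbol.abs, Complex.ofReal_inv]
    change _ * hsym s ξ = _
    field_simp) j f x
  simpa [dn] using this

theorem ENNReal_exp_neg_le_one (hs : 0 ≤ s) (j : ℤ) : ofReal (exp (-(s * 2 ^ j / 4))) ≤ 1 := by
  rw [← ENNReal.ofReal_one]
  refine ofReal_le_ofReal (Real.exp_le_one_iff.2 ?_)
  have := two_zpow_pos j
  have : 0 ≤ s * 2 ^ j := by positivity
  linarith

theorem tsum_dn_lt_top (hf : β ψ f < ⊤) : ∑' j, dn ψ f j < ⊤ := by
  rwa [besovNorm_abs_zero] at hf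

theorem dn_lt_top (hf : β ψ f < ⊤) (j : ℤ) : dn ψ f j < ⊤ :=
  lt_of_le_of_lt (ENNReal.le_tsum j) (tsum_dn_lt_top hf)

theorem Hom.summable_harm (hm : Hom 1 m.1) (hf : β ψ f < ⊤) (hs : 0 ≤ s) (x : V) :
    Summable fun j : ℤ => distBlock ψ (m.mul (heat s)) j f x := by
  obtain ⟨C, hC⟩ := hm.harm_block_le ψ
  refine Summable.of_norm_bounded (g := fun j => (C * dn ψ f j).toReal)
    (summable_toReal ?_) fun j => ?_
  · rw [ENNReal.tsum_mul_left]
    exact mul_ne_top coe_ne_top (tsum_dn_lt_top hf).ne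
  · rw [← toReal_enorm]
    refine toReal_mono (mul_ne_top coe_ne_top (dn_lt_top hf j).ne) ?_
    refine (hC hs j f x).trans (mul_le_mul_left ?_ _)
    exact mul_le_of_le_one_right' (ENNReal_exp_neg_le_one hs j)

theorem Hom.harm_le (hm : Hom 1 m.1) (ψ : LP) : ∃ C : ℝ≥0, ∀ f : TD, β ψ f < ⊤ →
      supN (harm ψ m f) ≤ C * β ψ f := by
  obtain ⟨C, hC⟩ := hm.harm_block_le ψ
  refine ⟨C, fun f hf => iSup_le fun p => ?_⟩
  rw [harm]
  split_ifs with hp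
  · rw [besovNorm_abs_zero, ← ENNReal.tsum_mul_left]
    refine enorm_tsum_le_tsum_enorm.trans (tsum_le_tsum fun j => ?_)
    refine (hC (by linarith) j f p.1).trans (mul_le_mul_left ?_ _)
    exact mul_le_of_le_one_right' (ENNReal_exp_neg_le_one (by linarith) j)
  · simp

theorem Hom.measurable_harm (hm : Hom 1 m.1) (ψ : LP) (f : TD) : Measurable (harm ψ m f) := by
  have h : harm ψ m f = fun p => ∑' j : ℤ, if p.2 < 0 then
      mop (bsym (m.mul invAbs).1 (-p.2) ψ.fat j) (distBlock ψ Λ j f) p.1 else 0 := by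
    ext p
    rw [harm]
    split_ifs with hp
    · congr 1; ext j
      rw [mop_fat_distBlock ψ (n := m.mul invAbs) hm.mul_invAbs j (hom_abs.annular_block ψ j) (by linarith)
        (m' := m.mul (heat (-p.2))) fun ξ hξ => ?_]
      have hn : ((‖ξ‖ : ℝ) : ℂ) ≠ 0 := ofReal_ne_zero.2 (norm_ne_zero_iff.2 hξ)
      simp only [Symbol.mul, invAbs, Symbol.abs, Complex.ofReal_inv]
      change _ * hsym _ ξ = _
      field_simp
    · simp
  rw [h]
  refine Measurable.tsum fun j => ?_
  refine Measurable.ite (measurableSet_lt measurable_snd measurable_const) ?_ measurable_const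
  have h1 := measurable_ker_family (measurable_bsym (m := (m.mul invAbs).1) hm.mul_invAbs
    (χ := ψ.fat) ψ.annular_fat.smooth.continuous j)
  have h2 : Measurable fun q : (V × ℝ) × V =>
      ker (bsym (m.mul invAbs).1 (-q.1.2) ψ.fat j) (q.1.1 - q.2) * distBlock ψ Λ j f q.2 :=
    (h1.comp (f := fun q : (V × ℝ) × V => (-q.1.2, q.1.1 - q.2)) (by fun_prop)).mul
      ((measurable_distBlock ψ _ j f).comp measurable_snd)
  exact (h2.stronglyMeasurable.integral_prod_right').measurable

theorem Hom.cl_harm (hm : Hom 1 m.1) (hf : β ψ f < ⊤) : Cl (harm ψ m f) := by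
  obtain ⟨C, hC⟩ := hm.harm_le ψ
  exact Cl.of_supN (hm.measurable_harm ψ f) ((hC f hf).trans_lt (mul_lt_top coe_lt_top hf))

theorem bsym_one_zero (χ : V → ℂ) (j : ℤ) :
    bsym (one (d := d)).1 0 χ j = fun ξ => χ ((2 : ℝ) ^ (-j) • ξ) := by
  ext ξ; simp [bsym, hsym, one]

theorem phc_mul_phc (ψ : LP) {i j : ℤ} (h : i + 1 < j) (ξ : V) : ψ.phc i ξ * ψ.phc j ξ = 0 := by
  by_cases h1 : (2 : ℝ) ^ (-j) * ‖ξ‖ ≤ 3 / 4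
  · rw [phc, phc, ψ.phi_eq_zero_of_small j ξ h1]; simp
  · rw [phc, ψ.phi_eq_zero_of_large i ξ ?_]
    · simp
    push Not at h1
    have h2 : (2 : ℝ) ^ (-i) = 2 ^ (j - i) * 2 ^ (-j) := by
      rw [← zpow_add₀ two_ne_zero]; congr 1; ring
    have h3 : (2 : ℝ) ^ (2 : ℤ) ≤ 2 ^ (j - i) := zpow_le_zpow_right₀ (by norm_num) (by lia)
    rw [h2, mul_assoc]
    norm_num at h3
    nlinarith

theorem phc_mul_phc' (ψ : LP) {i j : ℤ} (h : i ≠ j - 1) (h' : i ≠ j) (h'' : i ≠ j + 1)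
    (ξ : V) : ψ.phc i ξ * ψ.phc j ξ = 0 := by
  rcases lt_or_gt_of_ne h' with h1 | h1
  · exact phc_mul_phc ψ (by lia) ξ
  · rw [mul_comm]; exact phc_mul_phc ψ (by lia) ξ

theorem distBlock_eq_zero (ψ : LP) {j : ℤ} (h : ∀ ξ, m.1 ξ * ψ.phc j ξ = 0) (f : TD) (x : V) :
    distBlock ψ m j f x = 0 := by
  have : lpKernel ψ m j x = 0 := by
    ext y
    rw [lpKernel_apply, show (fun ξ => m.1 ξ * ψ.phc j ξ) = fun _ => 0 from funext h]
    simp [ker, sker_eq]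
  rw [distBlock, this, map_zero]

theorem Hom.abs_distBlock_le (hm : Hom 1 m.1) (ψ : LP) :
    ∃ C : ℝ≥0, ∀ {f : TD}, β ψ f < ⊤ → ∀ {s : ℝ}, 0 ≤ s →
      ∀ (j : ℤ) (x : V), |distBlock ψ (m.mul (heat s)) j f x| ≤ C * (dn ψ f j).toReal := by
  obtain ⟨C, hC⟩ := hm.harm_block_le ψ
  refine ⟨C, fun {f} hf {s} hs j x => ?_⟩
  rw [← norm_eq_abs, ← toReal_enorm]
  have h1 : ((C : ℝ≥0∞) * dn ψ f j).toReal = C * (dn ψ f j).toReal := by simp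
  rw [← h1]
  refine toReal_mono (mul_ne_top coe_ne_top (dn_lt_top hf j).ne) ?_
  refine (hC hs j f x).trans (mul_le_mul_left ?_ _)
  exact mul_le_of_le_one_right' (ENNReal_exp_neg_le_one hs j)

theorem Hom.wiener_mul_heat (hm : Hom σ m.1) (ψ : LP) (j : ℤ) (hs : 0 ≤ s) : Wiener fun ξ => (m.mul (heat s)).1 ξ * ψ.phc j ξ := by
  refine (congrArg Wiener ?_).mp (hm.wiener_bsym ψ j hs)
  ext ξ
  rw [bsym, phc, ψ.phi_eq]; rfl

/-- The dyadic blocks of `m(D) e^{z|D|} f`. -/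
theorem Hom.del_harm (hm : Hom 1 m.1) (hf : β ψ f < ⊤) (i : ℤ) (hz : z < 0) (x : V) :
    ψ.del i (fun y => harm ψ m f (y, z)) x = distBlock ψ (m.mul (heat (-z))) i f x := by
  have hs : 0 ≤ -z := by linarith
  obtain ⟨C, hC⟩ := hm.abs_distBlock_le ψ
  have hW := wiener_phc ψ i
  have hb := hC hf hs
  have hme := fun j => measurable_distBlock ψ (m.mul (heat (-z))) j f
  have hint : ∀ j, Integrable fun y => ker (ψ.phc i) (x - y) *
      distBlock ψ (m.mul (heat (-z))) j f y := fun j =>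
    hW.mul_bdd_int (hme j) (hb j) x
  have hsum : HasSum (fun j => mop (ψ.phc i) (distBlock ψ (m.mul (heat (-z))) j f) x)
      (ψ.del i (fun y => harm ψ m f (y, z)) x) := by
    refine hasSum_integral_of_hasSum (f := fun j y => ker (ψ.phc i) (x - y) *
      distBlock ψ (m.mul (heat (-z))) j f y) hint (ae_of_all _ fun y => ?_) ?_
    · simp only [harm, hz, if_true]
      exact (hm.summable_harm hf hs y).hasSum.mul_left _
    · refine .of_nonneg_of_le (fun i => integral_nonneg fun _ => norm_nonneg _) (fun j => ?_)
        (((summable_toReal (tsum_dn_lt_top hf).ne).mul_left (C : ℝ)).mul_left (wnorm (ψ.phc i)))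
      rw [← Wiener.integral_abs_shift (ψ.phc i) x, ← integral_mul_const]
      refine integral_mono (hint j).norm ((hW.shift_int x).abs.mul_const _) fun y => ?_
      rw [norm_mul]
      exact mul_le_mul_of_nonneg_left (hb j y) (norm_nonneg _)
  have hcomm : ∀ j, mop (ψ.phc i) (distBlock ψ (m.mul (heat (-z))) j f) x =
      mop (ψ.phc j) (distBlock ψ (m.mul (heat (-z))) i f) x := by
    intro j
    rw [phc_eq_bsym, phc_eq_bsym, mop_block_distBlock ψ hom_one hm le_rfl hs,
      mop_block_distBlock ψ hom_one hm le_rfl hs]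
    refine distBlock_congr ψ (fun ξ => ?_) f x
    simp only [Symbol.mul, phiSym]
    ring
  have hzero : ∀ j, j ∉ ({i - 1, i, i + 1} : Finset ℤ) →
      mop (ψ.phc j) (distBlock ψ (m.mul (heat (-z))) i f) x = 0 := by
    intro j hj
    simp only [Finset.mem_insert, Finset.mem_singleton, not_or] at hj
    rw [phc_eq_bsym, mop_block_distBlock ψ hom_one hm le_rfl hs]
    refine distBlock_eq_zero ψ (fun ξ => ?_) f x
    have := phc_mul_phc' ψ hj.1 hj.2.1 hj.2.2 ξ
    simp only [Symbol.mul, phiSym]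
    linear_combination ((one (d := d)).1 ξ * (heat 0).1 ξ * (m.1 ξ * (heat (-z)).1 ξ)) * this
  simp only [hcomm] at hsum
  rw [hsum.unique (hasSum_sum_of_ne_finset_zero hzero)]
  have hfat := mop_fat_distBlock ψ hom_one i (hm.wiener_mul_heat ψ i hs) (le_refl (0 : ℝ))
    (m' := m.mul (heat (-z))) (fun ξ _ => by simp [hsym, one]) f x
  rw [← hfat, bsym_one_zero]
  have hfat2 : (fun ξ : V => ψ.fat ((2 : ℝ) ^ (-i) • ξ)) =
      fun ξ => ψ.phc (i - 1) ξ + ψ.phc i ξ + ψ.phc (i + 1) ξ := funext fun ξ => ψ.fat_eq i ξ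
  rw [hfat2, ((wiener_phc ψ _).add (wiener_phc ψ _)).mop_add (wiener_phc ψ _) (hme i)
    (hb i), (wiener_phc ψ _).mop_add (wiener_phc ψ _) (hme i) (hb i),
    sum_insert (by simp; lia), sum_insert (by simp), sum_singleton, add_assoc]

theorem Hom.bn_harm_le (hm : Hom 1 m.1) (ψ : LP) :
    ∃ C : ℝ≥0, ∀ f : TD, β ψ f < ⊤ → ∀ (i : ℤ) (z : ℝ), z < 0 →
      bn ψ i (harm ψ m f) z ≤ C * dn ψ f i * ofReal (exp (z * (2 ^ i / 4))) := by
  obtain ⟨C, hC⟩ := hm.harm_block_le ψ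
  refine ⟨C, fun f hf i z hz => iSup_le fun x => ?_⟩
  rw [hm.del_harm hf i hz]
  refine (hC (by linarith) i f x).trans (le_of_eq ?_)
  rw [show -(-z * 2 ^ i / 4) = z * (2 ^ i / 4) by ring]
  ring

theorem lintegral_exp_Iio {a : ℝ} (ha : 0 < a) :
    ∫⁻ z in Iio 0, ofReal (exp (z * a)) = ofReal a⁻¹ := by
  have h := integrableOn_exp_mul_Iic ha 0
  rw [← Measure.restrict_congr_set (Iio_ae_eq_Iic (μ := volume) (a := (0 : ℝ))).symm]
  simp only [mul_comm _ a]
  rw [← ofReal_integral_eq_lintegral_ofReal h (ae_of_all _ fun z => (exp_pos _).le),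
    integral_exp_mul_Iic ha]
  simp

theorem two_rpow_succ_mul (s : ℝ) (i : ℤ) : ofReal ((2 : ℝ) ^ ((s + 1) * i)) *
    ofReal ((2 : ℝ) ^ i / 4)⁻¹ = 4 * ofReal ((2 : ℝ) ^ (s * i)) := by
  have : (4 : ℝ≥0∞) = ofReal 4 := by norm_num
  rw [this, ← ofReal_mul (by positivity), ← ofReal_mul (by positivity), add_mul,
    one_mul, rpow_add (by norm_num), two_zpow_eq_rpow]
  congr 1
  field_simp

theorem Hom.cheminLerner_harm_le (hm : Hom 1 m.1) (ψ : LP) :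
    ∃ C : ℝ≥0, ∀ f : TD, β ψ f < ⊤ → ∀ s : ℝ, CL ψ ⊤ s (harm ψ m f) ≤ C * besovNorm ψ s Λ f ∧
      CL ψ 1 (s + 1) (harm ψ m f) ≤ C * besovNorm ψ s Λ f := by
  obtain ⟨C, hC⟩ := hm.bn_harm_le ψ
  have hexp : ∀ i : ℤ, Measurable fun z : ℝ => ofReal (exp (z * (2 ^ i / 4))) :=
    fun i => by fun_prop
  refine ⟨4 * C, fun f hf s => ⟨?_, ?_⟩⟩
  · refine (cheminLerner_le_of_bn_le ψ s fun j z hz => hC f hf j z hz).trans ?_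
    rw [besovNorm_abs, ← ENNReal.tsum_mul_left]
    refine tsum_le_tsum fun j => ?_
    rw [mul_left_comm]
    refine mul_le_mul_right ?_ _
    rw [tn_const_mul (Or.inr rfl) _ (hexp j)]
    have h1 : tn ⊤ (fun z : ℝ => ofReal (exp (z * (2 ^ j / 4)))) ≤ 1 := by
      rw [tn_top]
      refine essSup_le_of_ae_le _ ((ae_restrict_iff' measurableSet_Iio).2 (ae_of_all _ fun z hz => ?_))
      have := ENNReal_exp_neg_le_one (s := -z) (by simpa using (mem_Iio.1 hz).le) j
      rwa [show -(-z * 2 ^ j / 4) = z * (2 ^ j / 4) by ring] at this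
    calc _ ≤ (C : ℝ≥0∞) * dn ψ f j * 1 := mul_le_mul_right h1 _
      _ ≤ _ := by
        rw [mul_one]
        refine mul_le_mul_left ?_ _
        norm_cast
        exact le_mul_of_one_le_left' (by norm_num)
  · refine (cheminLerner_le_of_bn_le ψ (s + 1) fun j z hz => hC f hf j z hz).trans ?_
    rw [besovNorm_abs, ← ENNReal.tsum_mul_left]
    refine tsum_le_tsum fun j => le_of_eq ?_
    rw [tn_const_mul (Or.inl rfl) _ (hexp j), tn_one,
      lintegral_exp_Iio (by have := two_zpow_pos j; positivity), mul_left_comm, two_rpow_succ_mul]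
    push_cast
    ring

/-! ### Parabolic-type integral operators -/

/-- The kernel `2^i e^{-s 2^i/4}` that controls the `i`-th block of `m(D) e^{-s|D|}`. -/
def kap (i : ℤ) (s : ℝ) : ℝ≥0∞ := ofReal ((2 : ℝ) ^ i * exp (-(s * 2 ^ i / 4)))

theorem measurable_kap (i : ℤ) : Measurable (kap i) := by unfold kap; fun_prop

theorem kap_le {i : ℤ} (hs : 0 ≤ s) : kap i s ≤ ofReal ((2 : ℝ) ^ i) := by
  rw [kap, ofReal_mul (two_zpow_pos i).le]
  exact mul_le_of_le_one_right' (ENNReal_exp_neg_le_one hs i)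

theorem lintegral_kap_abs_le (i : ℤ) : ∫⁻ t, kap i |t| ≤ 8 := by
  have h2 := two_zpow_pos i
  have hI : ∫⁻ t in Iio (0 : ℝ), kap i |t| = 4 := by
    have h1 : ∀ t ∈ Iio (0 : ℝ), kap i |t| =
        ofReal ((2 : ℝ) ^ i) * ofReal (exp (t * (2 ^ i / 4))) := fun t ht => by
      rw [kap, abs_of_neg (mem_Iio.1 ht), ofReal_mul h2.le]
      congr 3; ring
    rw [setLIntegral_congr_fun measurableSet_Iio h1, lintegral_const_mul _ (by fun_prop),
      lintegral_exp_Iio (by positivity), ← ofReal_mul h2.le]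
    rw [show (2 : ℝ) ^ i * (2 ^ i / 4)⁻¹ = 4 by field_simp]
    norm_num
  have hJ : ∫⁻ t in Ici (0 : ℝ), kap i |t| = 4 := by
    rw [← hI, ← Measure.restrict_congr_set (Iio_ae_eq_Iic (μ := volume) (a := (0 : ℝ))).symm]
    have h3 := (Measure.measurePreserving_neg (volume : Measure ℝ)).setLIntegral_comp_preimage
      (s := Iic 0) measurableSet_Iic (f := fun t => kap i |t|)
      ((measurable_kap i).comp (by fun_prop))
    simpa using h3
  rw [← lintegral_add_compl _ (measurableSet_Iio (a := (0 : ℝ))), compl_Iio, hI, hJ]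
  norm_num

/-- The operator `q ↦ ∫_{τ ∈ S z} m(D) e^{-|z - τ||D|} q(τ) dτ`. -/
def zop (m : V → ℂ) (S : ℝ → Set ℝ) (q : Fn) (p : V × ℝ) : ℝ :=
  ∫ τ in S p.2, mop (fun ξ => m ξ * hsym |p.2 - τ| ξ) (fun y => q (y, τ)) p.1

theorem measurable_mop_heat {m : V → ℂ} (hm : Measurable m)
    (hq : Measurable q) : Measurable fun p : (V × ℝ) × ℝ =>
      mop (fun ξ => m ξ * hsym |p.1.2 - p.2| ξ) (fun y => q (y, p.2)) p.1.1 := by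
  have h1 := measurable_ker_family (measurable_mul_hsym hm)
  have h2 : Measurable fun r : ((V × ℝ) × ℝ) × V =>
      ker (fun ξ => m ξ * hsym |r.1.1.2 - r.1.2| ξ) (r.1.1.1 - r.2) * q (r.2, r.1.2) :=
    (h1.comp (f := fun r : ((V × ℝ) × ℝ) × V => (|r.1.1.2 - r.1.2|, r.1.1.1 - r.2))
      (by fun_prop)).mul (hq.comp (by fun_prop))
  exact (h2.stronglyMeasurable.integral_prod_right').measurable

theorem measurable_zop {m : V → ℂ} (hm : Measurable m) {S : ℝ → Set ℝ}
    (hS : MeasurableSet {p : ℝ × ℝ | p.2 ∈ S p.1}) (hq : Measurable q) :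
    Measurable (zop m S q) := by
  have h1 : Measurable (({r : (V × ℝ) × ℝ | r.2 ∈ S r.1.2}).indicator fun p : (V × ℝ) × ℝ =>
      mop (fun ξ => m ξ * hsym |p.1.2 - p.2| ξ) (fun y => q (y, p.2)) p.1.1) :=
    (measurable_mop_heat hm hq).indicator (hS.preimage (f := fun r : (V × ℝ) × ℝ => (r.1.2, r.2))
      (by fun_prop))
  have h2 : zop m S q = fun p => ∫ τ, ({r : (V × ℝ) × ℝ | r.2 ∈ S r.1.2}).indicator
      (fun p : (V × ℝ) × ℝ => mop (fun ξ => m ξ * hsym |p.1.2 - p.2| ξ)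
        (fun y => q (y, p.2)) p.1.1) (p, τ) := by
    ext p
    rw [zop, ← integral_indicator (show MeasurableSet (S p.2) from
      hS.preimage (f := fun τ : ℝ => (p.2, τ)) (by fun_prop))]
    rfl
  rw [h2]
  exact (h1.stronglyMeasurable.integral_prod_right').measurable

/-- The bound of `m(D) e^{-s|D|} q(τ)` by dyadic blocks. -/
def dyadicBound (ψ : LP) (q : Fn) (s τ : ℝ) : ℝ≥0∞ := ∑' i : ℤ, kap i s * bn ψ i q τ

theorem cheminLerner_one_eq (ψ : LP) (s : ℝ) (q : Fn) :
    CL ψ 1 s q = ∑' i : ℤ, ofReal ((2 : ℝ) ^ (s * i)) * ∫⁻ τ in Iio 0, bn ψ i q τ := by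
  simp only [cheminLerner_eq, tn_one]

theorem lintegral_dyadicBound_le (ψ : LP) (hq : Cl q) {s : ℝ → ℝ}
    (hsm : Measurable s) (hs : ∀ τ, 0 ≤ s τ) :
    ∫⁻ τ in Iio 0, dyadicBound ψ q (s τ) τ ≤ CL ψ 1 1 q := by
  unfold dyadicBound
  rw [lintegral_tsum (f := fun i τ => kap i (s τ) * bn ψ i q τ) fun i =>
    (((measurable_kap i).comp hsm).mul (measurable_bn ψ i hq)).aemeasurable, cheminLerner_one_eq]
  refine tsum_le_tsum fun i => ?_
  rw [← lintegral_const_mul _ (measurable_bn ψ i hq)]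
  refine lintegral_mono fun τ => mul_le_mul_left ?_ _
  rw [one_mul, ← two_zpow_eq_rpow]
  exact kap_le (hs τ)

theorem Hom.heat_le [NeZero d] (hm : Hom 1 m.1)
    (hc : Continuous m.1) (ψ : LP) : ∃ C : ℝ≥0, ∀ q : Fn, Cl q → ∀ s : ℝ, 0 < s → ∀ (x : V) (τ : ℝ),
    ‖mop (fun ξ => m.1 ξ * hsym s ξ) (fun y => q (y, τ)) x‖ₑ ≤ C * dyadicBound ψ q s τ := by
  obtain ⟨C, hC⟩ := hm.block_le ψ
  refine ⟨C, fun q hq s hs x τ => ?_⟩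
  obtain ⟨B, hB⟩ := hq.bdd
  obtain ⟨-, h2, h3⟩ := hm.wiener_heat hc ψ hs
  have h4 := hasSum_mop (fun j => hm.wiener_bsym ψ j hs.le) h2 h3 (hq.slice τ)
    (fun y => hB (y, τ)) x
  rw [← h4.tsum_eq, dyadicBound, ← ENNReal.tsum_mul_left]
  refine enorm_tsum_le_tsum_enorm.trans (tsum_le_tsum fun j => ?_)
  have := hC j s hs.le (fun y => q (y, τ)) (hq.slice τ) B (fun y => hB (y, τ)) x
  rwa [zpow_one, mul_assoc] at this

theorem ae_ne_restrict (S : Set ℝ) (z : ℝ) : ∀ᵐ τ ∂(volume.restrict S), τ ≠ z :=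
  ae_restrict_of_ae (by simp [ae_iff])

theorem Hom.heat_lintegral_le [NeZero d] (hm : Hom 1 m.1)
    (hc : Continuous m.1) (ψ : LP) : ∃ C : ℝ≥0, ∀ q : Fn, Cl q → ∀ (x : V) (z : ℝ),
    ∀ S ⊆ Iio (0 : ℝ), ∫⁻ τ in S, ‖mop (fun ξ => m.1 ξ * hsym |z - τ| ξ)
      (fun y => q (y, τ)) x‖ₑ ≤ C * CL ψ 1 1 q := by
  obtain ⟨C, hC⟩ := hm.heat_le hc ψ
  refine ⟨C, fun q hq x z S hS => ?_⟩
  refine (lintegral_mono_set hS).trans ?_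
  calc _ ≤ ∫⁻ τ in Iio 0, C * dyadicBound ψ q |z - τ| τ := by
        refine lintegral_mono_ae ((ae_ne_restrict _ z).mono fun τ hτ => ?_)
        exact hC q hq _ (abs_pos.2 (sub_ne_zero.2 hτ.symm)) x τ
    _ ≤ _ := by
        rw [lintegral_const_mul' _ _ coe_ne_top]
        exact mul_le_mul_right (lintegral_dyadicBound_le ψ hq (by fun_prop) fun _ => abs_nonneg _) _

theorem Hom.heat_integrableOn [NeZero d] (hm : Hom 1 m.1)
    (hc : Continuous m.1) (ψ : LP) (hq : Cl q) (hq1 : CL ψ 1 1 q < ⊤)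
    (x : V) (z : ℝ) {S : Set ℝ} (hS : S ⊆ Iio 0) :
    IntegrableOn (fun τ => mop (fun ξ => m.1 ξ * hsym |z - τ| ξ) (fun y => q (y, τ)) x) S := by
  obtain ⟨C, hC⟩ := hm.heat_lintegral_le hc ψ
  refine ⟨((measurable_mop_heat hm.measurable hq.meas).comp
    (f := fun τ : ℝ => ((x, z), τ)) (by fun_prop)).aestronglyMeasurable, ?_⟩
  exact (hC q hq x z S hS).trans_lt (mul_lt_top coe_lt_top hq1)

theorem Hom.supN_zop_le [NeZero d] (hm : Hom 1 m.1)
    (hc : Continuous m.1) (ψ : LP) : ∃ C : ℝ≥0, ∀ q : Fn, Cl q → ∀ S : ℝ → Set ℝ,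
    (∀ z, S z ⊆ Iio 0) → supN (zop m.1 S q) ≤ C * CL ψ 1 1 q := by
  obtain ⟨C, hC⟩ := hm.heat_lintegral_le hc ψ
  exact ⟨C, fun q hq S hS => iSup_le fun p =>
    (enorm_integral_le_lintegral_enorm _).trans (hC q hq p.1 p.2 _ (hS p.2))⟩

theorem Hom.cl_zop [NeZero d] (hm : Hom 1 m.1)
    (hc : Continuous m.1) (ψ : LP) {S : ℝ → Set ℝ} (hSm : MeasurableSet {p : ℝ × ℝ | p.2 ∈ S p.1})
    (hS : ∀ z, S z ⊆ Iio 0) (hq : Cl q) (hq1 : CL ψ 1 1 q < ⊤) : Cl (zop m.1 S q) := by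
  obtain ⟨C, hC⟩ := hm.supN_zop_le hc ψ
  exact Cl.of_supN (measurable_zop hm.measurable hSm hq.meas)
    ((hC q hq S hS).trans_lt (mul_lt_top coe_lt_top hq1))

theorem Hom.mop_zop [NeZero d] (hm : Hom 1 m.1)
    (hc : Continuous m.1) (ψ : LP) (hg : Wiener g) (hq : Cl q)
    (hq1 : CL ψ 1 1 q < ⊤) {S : ℝ → Set ℝ} (hS : ∀ z, S z ⊆ Iio 0) (x : V) (z : ℝ) :
    mop g (fun y => zop m.1 S q (y, z)) x =
      ∫ τ in S z, mop (fun ξ => g ξ * (m.1 ξ * hsym |z - τ| ξ)) (fun y => q (y, τ)) x := by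
  obtain ⟨C, hC⟩ := hm.heat_lintegral_le hc ψ
  obtain ⟨B, hB⟩ := hq.bdd
  have hmeas : AEStronglyMeasurable (uncurry fun (y : V) (τ : ℝ) => ker g (x - y) *
      mop (fun ξ => m.1 ξ * hsym |z - τ| ξ) (fun y => q (y, τ)) y)
      (volume.prod (volume.restrict (S z))) := by
    refine Measurable.aestronglyMeasurable (Measurable.mul
      ((continuous_ker hg.int).measurable.comp (by fun_prop)) ?_)
    exact (measurable_mop_heat hm.measurable hq.meas).comp
      (f := fun r : V × ℝ => ((r.1, z), r.2)) (by fun_prop)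
  have hint : Integrable (uncurry fun (y : V) (τ : ℝ) => ker g (x - y) *
      mop (fun ξ => m.1 ξ * hsym |z - τ| ξ) (fun y => q (y, τ)) y)
      (volume.prod (volume.restrict (S z))) := by
    refine ⟨hmeas, ?_⟩
    rw [HasFiniteIntegral, lintegral_prod _ hmeas.enorm]
    refine lt_of_le_of_lt (lintegral_mono fun y => (?_ : _ ≤ ‖ker g (x - y)‖ₑ *
      (C * CL ψ 1 1 q))) ?_
    · simp only [uncurry, enorm_mul]
      rw [lintegral_const_mul' _ _ enorm_ne_top]
      exact mul_le_mul_right (hC q hq y z _ (hS z)) _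
    · rw [lintegral_mul_const' _ _ (mul_ne_top coe_ne_top hq1.ne)]
      exact mul_lt_top (hg.shift_int x).2 (mul_lt_top coe_lt_top hq1)
  have h1 := integral_integral_swap hint
  calc _ = ∫ y, ∫ τ in S z, ker g (x - y) *
        mop (fun ξ => m.1 ξ * hsym |z - τ| ξ) (fun y => q (y, τ)) y := by
        rw [mop]
        simp only [zop, integral_const_mul]
    _ = _ := by
        rw [h1]
        refine integral_congr_ae ((ae_ne_restrict _ z).mono fun τ hτ => ?_)
        exact hg.mop_mop (hm.wiener_heat hc ψ (abs_pos.2 (sub_ne_zero.2 hτ.symm))).1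
          (hq.slice τ) (fun y => hB (y, τ)) x

theorem Hom.del_zop [NeZero d] (hm : Hom 1 m.1) (hc : Continuous m.1) (ψ : LP) (hq : Cl q)
    (hq1 : CL ψ 1 1 q < ⊤) {S : ℝ → Set ℝ} (hS : ∀ z, S z ⊆ Iio 0) (i : ℤ) (x : V)
    (z : ℝ) : ψ.del i (fun y => zop m.1 S q (y, z)) x =
      ∫ τ in S z, mop (bsym m.1 |z - τ| ψ.ph i) (fun y => q (y, τ)) x := by
  rw [del, hm.mop_zop hc ψ (wiener_phc ψ i) hq hq1 hS]
  congr 1; ext τ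
  congr 1; ext ξ
  rw [bsym, phc, ψ.phi_eq]
  ring

theorem Hom.bn_zop_le [NeZero d] (hm : Hom 1 m.1)
    (hc : Continuous m.1) (ψ : LP) : ∃ C : ℝ≥0, ∀ q : Fn, Cl q → CL ψ 1 1 q < ⊤ →
    ∀ S : ℝ → Set ℝ, (∀ z, S z ⊆ Iio 0) → ∀ (i : ℤ) (z : ℝ), bn ψ i (zop m.1 S q) z ≤
      C * ∫⁻ τ in Iio 0, kap i |z - τ| * bn ψ i q τ := by
  obtain ⟨C, hC⟩ := hm.block_le ψ
  refine ⟨C, fun q hq hq1 S hS i z => iSup_le fun x => ?_⟩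
  obtain ⟨B, hB⟩ := hq.bdd
  rw [hm.del_zop hc ψ hq hq1 hS]
  refine (enorm_integral_le_lintegral_enorm _).trans ((lintegral_mono_set (hS z)).trans ?_)
  rw [← lintegral_const_mul' _ _ coe_ne_top]
  refine lintegral_mono fun τ => ?_
  have := hC i |z - τ| (abs_nonneg _) (fun y => q (y, τ)) (hq.slice τ) B (fun y => hB (y, τ)) x
  rwa [zpow_one, mul_assoc] at this

theorem Hom.cheminLerner_zop_le [NeZero d] (hm : Hom 1 m.1)
    (hc : Continuous m.1) (ψ : LP) : ∃ C : ℝ≥0, ∀ q : Fn, Cl q →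
    CL ψ 1 1 q < ⊤ → ∀ S : ℝ → Set ℝ, (∀ z, S z ⊆ Iio 0) → ∀ s : ℝ,
      CL ψ 1 s (zop m.1 S q) ≤ C * CL ψ 1 s q ∧ CL ψ ⊤ s (zop m.1 S q) ≤ C * CL ψ 1 (s + 1) q := by
  obtain ⟨C, hC⟩ := hm.bn_zop_le hc ψ
  refine ⟨8 * C, fun q hq hq1 S hS s => ⟨?_, ?_⟩⟩
  · refine (cheminLerner_le_of_bn_le ψ s fun j z _ => hC q hq hq1 S hS j z).trans ?_
    rw [cheminLerner_one_eq, ← ENNReal.tsum_mul_left]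
    refine tsum_le_tsum fun i => ?_
    rw [tn_one, lintegral_const_mul' _ _ coe_ne_top, mul_left_comm]
    push_cast
    rw [mul_comm 8, mul_assoc, mul_left_comm 8]
    refine mul_le_mul_right (mul_le_mul_right ?_ _) _
    have hmk : Measurable (uncurry fun z τ : ℝ => kap i |z - τ| * bn ψ i q τ) :=
      ((measurable_kap i).comp (by fun_prop)).mul ((measurable_bn ψ i hq).comp measurable_snd)
    rw [lintegral_lintegral_swap hmk.aemeasurable, ← lintegral_const_mul _ (measurable_bn ψ i hq)]
    refine lintegral_mono fun τ => ?_
    rw [lintegral_mul_const (f := fun x => kap i |x - τ|) _ ((measurable_kap i).comp (by fun_prop))]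
    refine mul_le_mul_left ?_ _
    refine (setLIntegral_le_lintegral _ _).trans ?_
    rw [lintegral_sub_right_eq_self (fun t => kap i |t|) τ]
    exact lintegral_kap_abs_le i
  · refine (cheminLerner_le_of_bn_le ψ s fun j z _ => hC q hq hq1 S hS j z).trans ?_
    rw [cheminLerner_one_eq, ← ENNReal.tsum_mul_left]
    refine tsum_le_tsum fun i => ?_
    have h1 : tn ⊤ (fun z => (C : ℝ≥0∞) * ∫⁻ τ in Iio 0, kap i |z - τ| * bn ψ i q τ) ≤
        C * (ofReal ((2 : ℝ) ^ i) * ∫⁻ τ in Iio 0, bn ψ i q τ) := by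
      rw [tn_top]
      refine essSup_le_of_ae_le _ (ae_of_all _ fun z => mul_le_mul_right ?_ _)
      rw [← lintegral_const_mul _ (measurable_bn ψ i hq)]
      exact lintegral_mono fun τ => mul_le_mul_left (kap_le (abs_nonneg _)) _
    refine (mul_le_mul_right h1 _).trans ?_
    rw [add_mul, one_mul, rpow_add (by norm_num), ofReal_mul (by positivity), two_zpow_eq_rpow]
    calc _ = (C : ℝ≥0∞) * (ofReal (2 ^ (s * i)) * ofReal (2 ^ (i : ℝ)) *
          ∫⁻ τ in Iio 0, bn ψ i q τ) := by ring
      _ ≤ _ := mul_le_mul_left (by norm_cast; exact le_mul_of_one_le_left' (by norm_num)) _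

/-! ### One-parameter families of multipliers -/

theorem ker_eq_re (g : V → ℂ) (x : V) : ker g x = (sker g x).re := rfl

theorem ker_sub {f g : V → ℂ} (hf : Integrable f) (hg : Integrable g) (x : V) :
    ker (fun ξ => f ξ - g ξ) x = ker f x - ker g x := by
  have h1 := ker_add hf (g := fun ξ => ((-1 : ℝ) : ℂ) * g ξ) (hg.const_mul _) x
  rw [ker_const_mul] at h1
  rw [sub_eq_add_neg (ker f x), ← neg_one_mul, ← h1]
  congr 1; ext ξ
  push_cast; ring

theorem sker_sub_eq_integral {g g' : ℝ → V → ℂ} {a b : ℝ} (hab : a ≤ b)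
    (hga : Integrable (g a)) (hgb : Integrable (g b)) (hm : Measurable (uncurry g'))
    (hd : ∀ t ∈ Icc a b, ∀ ξ, HasDerivAt (fun t => g t ξ) (g' t ξ) t) {D : V → ℝ}
    (hD : Integrable D) (hb : ∀ t ∈ Icc a b, ∀ ξ, ‖g' t ξ‖ ≤ D ξ) (x : V) :
    ker (g b) x - ker (g a) x = ∫ t in Ioc a b, ker (g' t) x := by
  have hslice : ∀ t, Measurable (g' t) := fun t => hm.comp (f := fun ξ => (t, ξ)) (by fun_prop)
  have hFTC : ∀ ξ, g b ξ - g a ξ = ∫ t in Ioc a b, g' t ξ := by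
    intro ξ
    rw [← intervalIntegral.integral_of_le hab]
    refine (intervalIntegral.integral_eq_sub_of_hasDerivAt (f := fun t => g t ξ) ?_ ?_).symm
    · rw [uIcc_of_le hab]
      exact fun t ht => hd t ht ξ
    · rw [intervalIntegrable_iff_integrableOn_Ioc_of_le hab]
      refine Integrable.mono' (g := fun _ => D ξ) (integrable_const _)
        (hm.comp (f := fun t : ℝ => (t, ξ)) (by fun_prop)).aestronglyMeasurable ?_
      exact (ae_restrict_iff' measurableSet_Ioc).2 (ae_of_all _ fun t ht => hb t (Ioc_subset_Icc_self ht) ξ)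
  have hD' : Integrable fun ν : V => D ((2 * π) • ν) := hD.comp_smul two_pi_ne
  have hwm : Measurable fun p : V × ℝ => cis p.1 x * g' p.2 ((2 * π) • p.1) := by
    refine Measurable.mul ?_ (hm.comp (f := fun p : V × ℝ => (p.2, (2 * π) • p.1)) (by fun_prop))
    have h1 : Continuous fun p : V × ℝ => inner ℝ p.1 x := by fun_prop
    exact Complex.measurable_exp.comp
      ((measurable_ofReal.comp (h1.measurable.const_mul _)).mul_const _)
  have hint : Integrable (uncurry fun (ν : V) (t : ℝ) => cis ν x * g' t ((2 * π) • ν))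
      (volume.prod (volume.restrict (Ioc a b))) := by
    refine Integrable.mono' (g := fun p : V × ℝ => D ((2 * π) • p.1) * 1)
      (hD'.mul_prod (integrable_const (1 : ℝ))) hwm.aestronglyMeasurable ?_
    have hae : ∀ᵐ p : V × ℝ ∂(volume.prod (volume.restrict (Ioc a b))), p.2 ∈ Ioc a b := by
      have := Measure.quasiMeasurePreserving_snd (μ := (volume : Measure V))
        (ν := volume.restrict (Ioc a b))
      exact this.ae (ae_restrict_mem measurableSet_Ioc)
    filter_upwards [hae] with p hp
    rw [uncurry, norm_mul, norm_cexp_mul_I, one_mul, mul_one]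
    exact hb p.2 (Ioc_subset_Icc_self hp) _
  have hswap := integral_integral_swap hint
  have h2 : sker (fun ξ => g b ξ - g a ξ) x = ∫ t in Ioc a b, sker (g' t) x := by
    simp only [sker_eq, ← hswap, hFTC]
    congr 1; ext ν
    rw [← integral_const_mul]
  rw [← ker_sub hgb hga, ker_eq_re, h2]
  have hI : Integrable (fun t => sker (g' t) x) (volume.restrict (Ioc a b)) := by
    simp only [sker_eq]
    exact hint.integral_prod_right
  exact ((Complex.reCLM.integral_comp_comm hI)).symm

/-- The fundamental theorem of calculus for a family of multipliers. -/
theorem mop_sub_eq_integral {g g' : ℝ → V → ℂ} {a b : ℝ} (hab : a ≤ b)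
    (hga : Wiener (g a)) (hgb : Wiener (g b)) (hW : ∀ t ∈ Icc a b, Wiener (g' t))
    (hm : Measurable (uncurry g'))
    (hd : ∀ t ∈ Icc a b, ∀ ξ, HasDerivAt (fun t => g t ξ) (g' t ξ) t) {D : V → ℝ}
    (hD : Integrable D) (hb : ∀ t ∈ Icc a b, ∀ ξ, ‖g' t ξ‖ ≤ D ξ)
    {M : ℝ} (hM : ∀ t ∈ Icc a b, wnorm (g' t) ≤ M) (hu : Measurable u)
    (hB : ∀ y, |u y| ≤ B) (x : V) :
    mop (g b) u x - mop (g a) u x = ∫ t in a..b, mop (g' t) u x := by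
  rw [intervalIntegral.integral_of_le hab]
  have hB0 : 0 ≤ B := (abs_nonneg _).trans (hB 0)
  have hk := measurable_ker_family hm
  have hmeas : Measurable (uncurry fun (t : ℝ) (y : V) => ker (g' t) (x - y) * u y) :=
    (hk.comp (f := fun p : ℝ × V => (p.1, x - p.2)) (by fun_prop)).mul (hu.comp measurable_snd)
  have hint : Integrable (uncurry fun (t : ℝ) (y : V) => ker (g' t) (x - y) * u y)
      ((volume.restrict (Ioc a b)).prod volume) := by
    rw [integrable_prod_iff hmeas.aestronglyMeasurable]
    refine ⟨?_, ?_⟩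
    · refine (ae_restrict_iff' measurableSet_Ioc).2 (ae_of_all _ fun t ht => ?_)
      exact (hW t (Ioc_subset_Icc_self ht)).mul_bdd_int hu hB x
    · refine Integrable.mono' (g := fun _ => M * B) (integrable_const _)
        (hmeas.stronglyMeasurable.norm.integral_prod_right).aestronglyMeasurable ?_
      refine (ae_restrict_iff' measurableSet_Ioc).2 (ae_of_all _ fun t ht => ?_)
      have hWt := hW t (Ioc_subset_Icc_self ht)
      rw [norm_of_nonneg (integral_nonneg fun _ => norm_nonneg _)]
      calc _ ≤ ∫ y, |ker (g' t) (x - y)| * B := by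
            refine integral_mono (hWt.mul_bdd_int hu
              hB x).norm ((hWt.shift_int x).abs.mul_const _) fun y => ?_
            simp only [uncurry, norm_mul]
            exact mul_le_mul_of_nonneg_left (hB y) (norm_nonneg _)
        _ ≤ M * B := by
            rw [integral_mul_const, Wiener.integral_abs_shift]
            exact mul_le_mul_of_nonneg_right (hM t (Ioc_subset_Icc_self ht)) hB0
  calc _ = ∫ y, (ker (g b) (x - y) - ker (g a) (x - y)) * u y := by
        rw [mop, mop, ← integral_sub (hgb.mul_bdd_int hu hB x) (hga.mul_bdd_int hu hB x)]
        congr 1; ext y; ring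
    _ = ∫ y, ∫ t in Ioc a b, ker (g' t) (x - y) * u y := by
        congr 1; ext y
        rw [sker_sub_eq_integral hab hga.int hgb.int hm hd hD hb, integral_mul_const]
    _ = _ := (integral_integral_swap hint).symm

/-- Derivatives of families of multipliers. -/
theorem hasDerivAt_mop {g g' g'' : ℝ → V → ℂ} {a b : ℝ}
    (hg : ∀ t ∈ Icc a b, Wiener (g t)) (hg' : ∀ t ∈ Icc a b, Wiener (g' t))
    (hg'' : ∀ t ∈ Icc a b, Wiener (g'' t))
    (hm : Measurable (uncurry g')) (hm' : Measurable (uncurry g''))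
    (hd : ∀ t ∈ Icc a b, ∀ ξ, HasDerivAt (fun t => g t ξ) (g' t ξ) t)
    (hd' : ∀ t ∈ Icc a b, ∀ ξ, HasDerivAt (fun t => g' t ξ) (g'' t ξ) t) {D D' : V → ℝ}
    (hD : Integrable D) (hb : ∀ t ∈ Icc a b, ∀ ξ, ‖g' t ξ‖ ≤ D ξ)
    (hD' : Integrable D') (hb' : ∀ t ∈ Icc a b, ∀ ξ, ‖g'' t ξ‖ ≤ D' ξ)
    {M M' : ℝ} (hM : ∀ t ∈ Icc a b, wnorm (g' t) ≤ M) (hM' : ∀ t ∈ Icc a b, wnorm (g'' t) ≤ M') (hu : Measurable u)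
    (hB : ∀ y, |u y| ≤ B) (x : V) {t : ℝ} (ht : t ∈ Ioo a b) :
    HasDerivAt (fun t => mop (g t) u x) (mop (g' t) u x) t := by
  have hB0 : 0 ≤ B := (abs_nonneg _).trans (hB 0)
  have hab : a ≤ b := (ht.1.trans ht.2).le
  have hsub : ∀ {s r : ℝ}, s ∈ Icc a b → r ∈ Icc a b → Icc s r ⊆ Icc a b := fun hs hr =>
    Icc_subset_Icc hs.1 hr.2
  have hlip : ∀ s ∈ Icc a b, ∀ r ∈ Icc a b, s ≤ r →
      |mop (g' r) u x - mop (g' s) u x| ≤ M' * B * |r - s| := by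
    intro s hs r hr hsr
    have hS := hsub hs hr
    rw [mop_sub_eq_integral hsr (hg' s hs) (hg' r hr) (fun t ht => hg'' t (hS ht)) hm'
      (fun t ht => hd' t (hS ht)) hD' (fun t ht => hb' t (hS ht)) (fun t ht => hM' t (hS ht)) hu hB]
    refine intervalIntegral.norm_integral_le_of_norm_le_const
      (f := fun t => mop (g'' t) u x) fun τ hτ => ?_
    rw [uIoc_of_le hsr] at hτ
    have hτ' := hS (Ioc_subset_Icc_self hτ)
    exact ((hg'' τ hτ').abs_mop_le hB x).trans (mul_le_mul_of_nonneg_right (hM' τ hτ') hB0)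
  have hcont : ContinuousOn (fun t => mop (g' t) u x) (Icc a b) := by
    have hL : LipschitzOnWith (M' * B).toNNReal (fun t => mop (g' t) u x) (Icc a b) := by
      have hM0 : 0 ≤ M' := (wnorm_nonneg _).trans (hM' a (left_mem_Icc.2 hab))
      refine LipschitzOnWith.of_dist_le_mul fun s hs r hr => ?_
      rw [Real.coe_toNNReal _ (by positivity), Real.dist_eq, Real.dist_eq]
      rcases le_total s r with h | h
      · rw [abs_sub_comm, abs_sub_comm s r]
        exact hlip s hs r hr h
      · exact hlip r hr s hs h
    exact hL.continuousOn
  have hnhds : Icc a b ∈ 𝓝 t := Icc_mem_nhds ht.1 ht.2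
  have hev : (fun s => mop (g s) u x) =ᶠ[𝓝 t]
      fun s => mop (g a) u x + ∫ r in a..s, mop (g' r) u x := by
    filter_upwards [hnhds] with s hs
    have ha := left_mem_Icc.2 hab
    have hS := hsub ha hs
    rw [← mop_sub_eq_integral hs.1 (hg a ha) (hg s hs) (fun t ht => hg' t (hS ht)) hm
      (fun t ht => hd t (hS ht)) hD (fun t ht => hb t (hS ht)) (fun t ht => hM t (hS ht)) hu hB]
    ring
  refine HasDerivAt.congr_of_eventuallyEq ?_ hev
  refine HasDerivAt.const_add _ ?_
  have hI : IntervalIntegrable (fun t => mop (g' t) u x) volume a t := by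
    refine ContinuousOn.intervalIntegrable (hcont.mono ?_)
    rw [uIcc_of_le ht.1.le]
    exact Icc_subset_Icc_right ht.2.le
  have hS : StronglyMeasurableAtFilter (fun t => mop (g' t) u x) (𝓝 t) volume :=
    ⟨Icc a b, hnhds, hcont.aestronglyMeasurable measurableSet_Icc⟩
  exact intervalIntegral.integral_hasDerivAt_right hI hS (hcont.continuousAt hnhds)

/-! ### Heat-type families -/

theorem hasDerivAt_hsym (t : ℝ) (ξ : V) :
    HasDerivAt (fun t => hsym t ξ) (-((‖ξ‖ : ℝ) : ℂ) * hsym t ξ) t := by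
  have h1 : HasDerivAt (fun t : ℝ => exp (-t * ‖ξ‖)) (exp (-t * ‖ξ‖) * (-1 * ‖ξ‖)) t :=
    (((hasDerivAt_id t).neg).mul_const ‖ξ‖).exp
  have h2 := h1.ofReal_comp
  refine h2.congr_deriv ?_
  simp only [hsym]
  push_cast
  ring

theorem norm_hsym_le {a t : ℝ} (h : a ≤ t) (ξ : V) : ‖hsym t ξ‖ ≤ ‖hsym a ξ‖ := by
  simp only [hsym, norm_real, norm_eq_abs, Real.abs_exp]
  exact Real.exp_le_exp.2 (by nlinarith [norm_nonneg ξ])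

theorem hsym_add (s t : ℝ) (ξ : V) : hsym (s + t) ξ = hsym s ξ * hsym t ξ := by
  simp only [hsym, ← Complex.ofReal_mul, ← Real.exp_add]
  congr 2; ring

theorem hsym_half (s : ℝ) (ξ : V) : hsym s ξ = hsym (s / 2) ξ * hsym (s / 2) ξ := by
  rw [← hsym_add]; congr 1; ring

theorem continuous_abs_symbol : Continuous (Λ).1 := by
  unfold Symbol.abs; fun_prop

theorem continuous_partialD (k : Fin d) : Continuous (partialD k).1 := by
  unfold partialD
  exact continuous_const.mul (Complex.continuous_ofReal.comp (by fun_prop))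

theorem Hom.wiener_mul_mul_heat [NeZero d] {m n : V → ℂ} (hm : Hom 1 m) (hn : Hom 1 n)
    (hmc : Continuous m) (hnc : Continuous n) (ψ : LP) (hs : 0 < s) :
    Wiener (fun ξ => m ξ * n ξ * hsym s ξ) ∧ wnorm (fun ξ => m ξ * n ξ * hsym s ξ) ≤
      4 * s⁻¹ ^ 2 * (wnorm (fun ξ => m ξ * hsym 1 ξ) * wnorm (fun ξ => n ξ * hsym 1 ξ)) := by
  have h2 : 0 < s / 2 := by positivity
  have e : (fun ξ => m ξ * n ξ * hsym s ξ) =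
      fun ξ => (m ξ * hsym (s / 2) ξ) * (n ξ * hsym (s / 2) ξ) := by
    ext ξ; rw [hsym_half s]; ring
  have w1 := (hm.wiener_heat hmc ψ h2).1
  have w2 := (hn.wiener_heat hnc ψ h2).1
  rw [e]
  refine ⟨w1.mul w2, (wnorm_mul_le w1 w2).trans (le_of_eq ?_)⟩
  rw [hm.wnorm_heat h2, hn.wnorm_heat h2]
  field_simp
  ring

theorem hasDerivAt_mop_hsym [NeZero d] (ψ : LP) (hu : Measurable u)
    (hB : ∀ y, |u y| ≤ B) (x : V) (hs : 0 < s) :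
    HasDerivAt (fun s => mop (hsym s) u x) (-mop (fun ξ => (Λ).1 ξ * hsym s ξ) u x) s := by
  have hA := hom_abs (d := d)
  have hAc := continuous_abs_symbol (d := d)
  have h2 : 0 < s / 2 := by positivity
  have hpos : ∀ {t}, t ∈ Icc (s / 2) (2 * s) → 0 < t := fun ht => h2.trans_le ht.1
  have hneg : ∀ t, (fun ξ : V => -((‖ξ‖ : ℝ) : ℂ) * hsym t ξ) =
      fun ξ => ((-1 : ℝ) : ℂ) * ((Λ).1 ξ * hsym t ξ) := fun t => by
    ext ξ; simp [Symbol.abs]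
  have hw1 : ∀ {t : ℝ}, 0 < t → Wiener fun ξ : V => -((‖ξ‖ : ℝ) : ℂ) * hsym t ξ := fun ht => by
    rw [hneg]; exact ((hA.wiener_heat hAc ψ ht).1).const_mul (-1)
  have hwn : ∀ t, wnorm (fun ξ : V => -((‖ξ‖ : ℝ) : ℂ) * hsym t ξ) =
      wnorm fun ξ => (Λ).1 ξ * hsym t ξ := fun t => by
    rw [hneg, wnorm, wnorm]
    congr 1; ext y
    rw [ker_const_mul, neg_one_mul, abs_neg]
  have hmeas1 : Measurable (uncurry fun (t : ℝ) (ξ : V) => -((‖ξ‖ : ℝ) : ℂ) * hsym t ξ) :=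
    measurable_mul_hsym (m := fun ξ : V => -((‖ξ‖ : ℝ) : ℂ)) (by fun_prop)
  have hmeas2 : Measurable (uncurry fun (t : ℝ) (ξ : V) =>
      (Λ).1 ξ * (Λ).1 ξ * hsym t ξ) :=
    measurable_mul_hsym (hA.measurable.mul hA.measurable)
  have key := hasDerivAt_mop (g := fun s => hsym (d := d) s)
    (g' := fun t (ξ : V) => -((‖ξ‖ : ℝ) : ℂ) * hsym t ξ)
    (g'' := fun t (ξ : V) => (Λ).1 ξ * (Λ).1 ξ * hsym t ξ)
    (a := s / 2) (b := 2 * s) (D := fun ξ => ‖-((‖ξ‖ : ℝ) : ℂ) * hsym (s / 2) ξ‖)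
    (D' := fun ξ => ‖(Λ).1 ξ * (Λ).1 ξ * hsym (s / 2) ξ‖)
    (M := (s / 2)⁻¹ * wnorm (fun ξ => (Λ).1 ξ * hsym 1 ξ))
    (M' := 4 * (s / 2)⁻¹ ^ 2 * (wnorm (fun ξ => (Λ).1 ξ * hsym 1 ξ) *
      wnorm (fun ξ => (Λ).1 ξ * hsym 1 ξ)))
    (fun t ht => wiener_hsym (hpos ht)) (fun t ht => hw1 (hpos ht))
    (fun t ht => (hA.wiener_mul_mul_heat hA hAc hAc ψ (hpos ht)).1) hmeas1 hmeas2
    (fun t _ ξ => hasDerivAt_hsym t ξ)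
    (fun t _ ξ => by
      refine ((hasDerivAt_hsym t ξ).const_mul (-((‖ξ‖ : ℝ) : ℂ))).congr_deriv ?_
      simp only [Symbol.abs]; ring)
    (hw1 h2).int.norm
    (fun t ht ξ => by
      rw [norm_mul, norm_mul]
      exact mul_le_mul_of_nonneg_left (norm_hsym_le ht.1 ξ) (norm_nonneg _))
    (hA.wiener_mul_mul_heat hA hAc hAc ψ h2).1.int.norm
    (fun t ht ξ => by
      rw [norm_mul, norm_mul _ (hsym (s / 2) ξ)]
      exact mul_le_mul_of_nonneg_left (norm_hsym_le ht.1 ξ) (norm_nonneg _))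
    (fun t ht => by
      rw [hwn, hA.wnorm_heat (hpos ht)]
      exact mul_le_mul_of_nonneg_right (inv_anti₀ h2 ht.1) (wnorm_nonneg _))
    (fun t ht => by
      refine (hA.wiener_mul_mul_heat hA hAc hAc ψ (hpos ht)).2.trans ?_
      have := inv_anti₀ h2 ht.1
      have h0 := wnorm_nonneg (fun ξ => (Λ).1 ξ * hsym 1 ξ)
      have h1 : 0 ≤ t⁻¹ := inv_nonneg.2 (hpos ht).le
      gcongr)
    hu hB x (t := s) ⟨by linarith, by linarith⟩
  refine key.congr_deriv ?_
  rw [hneg, mop_const_mul, neg_one_mul]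

/-! ### Translations -/

/-- The symbol of the translation by `t e`, composed with `g`. -/
def modul (e : V) (t : ℝ) (g : V → ℂ) (ξ : V) : ℂ :=
  Complex.exp (((t * inner ℝ e ξ : ℝ) : ℂ) * I) * g ξ

/-- The symbol of the derivative in the direction `e`. -/
def dirD (e ξ : V) : ℂ := I * ((inner ℝ e ξ : ℝ) : ℂ)

theorem ker_modul (e : V) (t : ℝ) (g : V → ℂ) (x : V) :
    sker (modul e t g) x = sker g (x + t • e) := by
  rw [sker_eq, sker_eq]
  congr 1; ext ν
  rw [modul, ← mul_assoc, ← Complex.exp_add]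
  congr 2
  rw [inner_add_right, inner_smul_right, inner_smul_right, real_inner_comm e ν]
  push_cast
  ring

theorem mop_modul (e : V) (t : ℝ) (g : V → ℂ) (u : V → ℝ) (x : V) :
    mop (modul e t g) u x = mop g u (x + t • e) := by
  unfold mop ker
  congr 1; ext y
  rw [ker_modul]
  congr 3; abel

theorem Wiener.modul (hg : Wiener g) (e : V) (t : ℝ) : Wiener (modul e t g) where
  cont := by
    have := hg.cont
    unfold Muskat.modul
    exact (Complex.continuous_exp.comp ((Complex.continuous_ofReal.comp (by fun_prop)).mul
      continuous_const)).mul this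
  int := by
    refine hg.int.norm.mono' ?_ (ae_of_all _ fun ξ => ?_)
    · refine AEStronglyMeasurable.mul ?_ hg.int.aestronglyMeasurable
      exact (Complex.continuous_exp.comp ((Complex.continuous_ofReal.comp (by fun_prop)).mul
        continuous_const)).aestronglyMeasurable
    · rw [Muskat.modul, norm_mul, norm_cexp_mul_I, one_mul]
  intK := by
    rw [show sker (Muskat.modul e t g) = fun x => sker g (x + t • e) from funext (ker_modul e t g)]
    exact hg.intK.comp_add_right _
  herm ξ := by
    rw [Muskat.modul, Muskat.modul, hg.herm, map_mul, ← Complex.exp_conj, map_mul,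
      conj_ofReal, Complex.conj_I, inner_neg_right]
    push_cast
    congr 2; ring

theorem wnorm_modul (e : V) (t : ℝ) (g : V → ℂ) : wnorm (modul e t g) = wnorm g := by
  unfold wnorm ker
  simp only [ker_modul]
  exact integral_add_right_eq_self (fun x => |(sker g x).re|) (t • e)

theorem hasDerivAt_modul (e : V) (t : ℝ) (g : V → ℂ) (ξ : V) :
    HasDerivAt (fun t => modul e t g ξ) (modul e t (fun ξ => dirD e ξ * g ξ) ξ) t := by
  unfold modul dirD
  have h1 : HasDerivAt (fun t : ℝ => ((t * inner ℝ e ξ : ℝ) : ℂ) * I)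
      (((1 * inner ℝ e ξ : ℝ) : ℂ) * I) t :=
    (((hasDerivAt_id t).mul_const (inner ℝ e ξ)).ofReal_comp).mul_const I
  refine (h1.cexp.mul_const (g ξ)).congr_deriv ?_
  push_cast; ring

theorem measurable_modul (e : V) (hg : Measurable g) :
    Measurable (uncurry fun t => modul e t g) := by
  unfold modul
  have h1 : Continuous fun p : ℝ × V => p.1 * inner ℝ e p.2 := by fun_prop
  exact (Complex.measurable_exp.comp
    ((measurable_ofReal.comp h1.measurable).mul_const _)).mul (hg.comp measurable_snd)

theorem norm_modul (e : V) (t : ℝ) (g : V → ℂ) (ξ : V) : ‖modul e t g ξ‖ = ‖g ξ‖ := by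
  rw [modul, norm_mul, norm_cexp_mul_I, one_mul]

/-- Directional derivatives of `g(D) u`. -/
theorem hasDerivAt_mop_line {e : V} (hg : Wiener g)
    (hg' : Wiener fun ξ => dirD e ξ * g ξ) (hg'' : Wiener fun ξ => dirD e ξ * (dirD e ξ * g ξ)) (hu : Measurable u) (hB : ∀ y, |u y| ≤ B) (x : V) (t : ℝ) :
    HasDerivAt (fun t : ℝ => mop g u (x + t • e)) (mop (fun ξ => dirD e ξ * g ξ) u (x + t • e)) t := by
  simp only [← mop_modul]
  exact hasDerivAt_mop (g := fun t => modul e t g)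
    (g' := fun t => modul e t fun ξ => dirD e ξ * g ξ)
    (g'' := fun t => modul e t fun ξ => dirD e ξ * (dirD e ξ * g ξ)) (a := t - 1) (b := t + 1)
    (fun t _ => hg.modul e t) (fun t _ => hg'.modul e t) (fun t _ => hg''.modul e t)
    (measurable_modul e hg'.cont.measurable) (measurable_modul e hg''.cont.measurable)
    (fun t _ ξ => hasDerivAt_modul e t _ ξ) (fun t _ ξ => hasDerivAt_modul e t _ ξ)
    hg'.int.norm (fun t _ ξ => (norm_modul e t _ ξ).le)
    hg''.int.norm (fun t _ ξ => (norm_modul e t _ ξ).le)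
    (fun t _ => (wnorm_modul e t _).le) (fun t _ => (wnorm_modul e t _).le) hu hB x
    ⟨by linarith, by linarith⟩

theorem dirD_single (k : Fin d) (ξ : V) : dirD (single k 1) ξ = (partialD k).1 ξ := by
  rw [dirD, EuclideanSpace.inner_single_left]
  simp [partialD]

theorem hasDerivAt_mop_hsym_line [NeZero d] (ψ : LP) (k : Fin d)
    (hu : Measurable u) (hB : ∀ y, |u y| ≤ B) (x : V) (hs : 0 < s) (t : ℝ) :
    HasDerivAt (fun t : ℝ => mop (hsym s) u (x + t • single k 1))
      (mop (fun ξ => (partialD k).1 ξ * hsym s ξ) u (x + t • single k 1)) t := by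
  have h := hom_partialD k
  have hc := continuous_partialD k
  simp only [← dirD_single]
  refine hasDerivAt_mop_line (wiener_hsym hs) ?_ ?_ hu hB x t
  · simp only [dirD_single]
    exact (h.wiener_heat hc ψ hs).1
  · simp only [dirD_single, ← mul_assoc]
    exact (h.wiener_mul_mul_heat h hc hc ψ hs).1

/-! ### The harmonic extension -/

theorem Hom.distBlock_heat_eq (hm : Hom 1 m.1) (ψ : LP) (hs : 0 ≤ s) (j : ℤ) (f : TD) (x : V) :
    distBlock ψ (m.mul (heat s)) j f x =
      mop (bsym (m.mul invAbs).1 s ψ.fat j) (distBlock ψ Λ j f) x := by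
  refine (mop_fat_distBlock ψ (n := m.mul invAbs) hm.mul_invAbs j (hom_abs.annular_block ψ j) hs
    (m' := m.mul (heat s)) (fun ξ hξ => ?_) f x).symm
  have hn : ((‖ξ‖ : ℝ) : ℂ) ≠ 0 := ofReal_ne_zero.2 (norm_ne_zero_iff.2 hξ)
  simp only [Symbol.mul, invAbs, Symbol.abs, Complex.ofReal_inv]
  change _ * hsym _ ξ = _
  field_simp

theorem distBlock_heat_eq (ψ : LP) (hs : 0 ≤ s) (j : ℤ) (f : TD) (x : V) :
    distBlock ψ (heat s) j f x = mop (bsym invAbs.1 s ψ.fat j) (distBlock ψ Λ j f) x := by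
  refine (mop_fat_distBlock ψ (n := invAbs) hom_invAbs j (hom_abs.annular_block ψ j) hs
    (m' := heat s) (fun ξ hξ => ?_) f x).symm
  have hn : ((‖ξ‖ : ℝ) : ℂ) ≠ 0 := ofReal_ne_zero.2 (norm_ne_zero_iff.2 hξ)
  simp only [invAbs, Symbol.abs, Complex.ofReal_inv]
  change hsym _ ξ = _
  field_simp

theorem distBlock_one_eq_heat (ψ : LP) (j : ℤ) (f : TD) (x : V) :
    distBlock ψ one j f x = distBlock ψ (heat 0) j f x :=
  distBlock_congr ψ (fun ξ => by simp [one, heat]) f x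

theorem abs_distBlock_abs_le (hf : β ψ f < ⊤) (j : ℤ) (y : V) :
    |distBlock ψ Λ j f y| ≤ (dn ψ f j).toReal :=
  abs_le_toReal_iSup (dn_lt_top hf j).ne y

theorem hasDerivAt_bsym (m : V → ℂ) (χ : V → ℂ) (j : ℤ) (t : ℝ) (ξ : V) :
    HasDerivAt (fun t => bsym m t χ j ξ)
      (((-1 : ℝ) : ℂ) * bsym (fun ξ => (Λ).1 ξ * m ξ) t χ j ξ) t := by
  refine (((hasDerivAt_hsym t ξ).const_mul (m ξ)).mul_const _).congr_deriv ?_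
  simp only [bsym, Symbol.abs]
  push_cast; ring

theorem norm_bsym_le {a t : ℝ} (h : a ≤ t) (m : V → ℂ) (χ : V → ℂ) (j : ℤ) (ξ : V) :
    ‖bsym m t χ j ξ‖ ≤ ‖bsym m a χ j ξ‖ := by
  simp only [bsym, norm_mul]
  exact mul_le_mul_of_nonneg_right (mul_le_mul_of_nonneg_left (norm_hsym_le h ξ) (norm_nonneg _))
    (norm_nonneg _)

theorem wnorm_neg_one_mul (g : V → ℂ) : wnorm (fun ξ => ((-1 : ℝ) : ℂ) * g ξ) = wnorm g := by
  unfold wnorm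
  congr 1; ext y
  rw [ker_const_mul, neg_one_mul, abs_neg]

theorem exp_block_le_one (hs : 0 ≤ s) (j : ℤ) : exp (-(s * 2 ^ j / 4)) ≤ 1 := by
  refine Real.exp_le_one_iff.2 ?_
  have := two_zpow_pos j
  have : 0 ≤ s * 2 ^ j := by positivity
  linarith

theorem measurable_const_mul_family {g : ℝ → V → ℂ} (h : Measurable (uncurry g))
    (c : ℂ) : Measurable (uncurry fun t ξ => c * g t ξ) :=
  h.const_mul c

/-- Time regularity of the blocks of the harmonic extension. -/
theorem distBlock_heat_sub_le (ψ : LP) : ∃ C : ℝ, 0 ≤ C ∧ ∀ {f : TD},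
    β ψ f < ⊤ → ∀ {s : ℝ}, 0 ≤ s → ∀ (j : ℤ) (x : V),
      |distBlock ψ (heat s) j f x - distBlock ψ (heat 0) j f x| ≤ C * s * (dn ψ f j).toReal := by
  have hA : Hom 0 fun ξ => (Λ).1 ξ * invAbs.1 ξ :=
    hom_abs.mul_invAbs
  obtain ⟨C0, -, h0⟩ := hom_invAbs.block_bound ψ.annular_fat ψ.fat_herm
  obtain ⟨C, hC0, hC⟩ := hA.block_bound ψ.annular_fat ψ.fat_herm
  refine ⟨C, hC0, fun {f} hf {s} hs j x => ?_⟩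
  have hM : ∀ t ∈ Icc 0 s, wnorm (fun ξ => ((-1 : ℝ) : ℂ) *
      bsym (fun ξ => (Λ).1 ξ * invAbs.1 ξ) t ψ.fat j ξ) ≤ C :=
    fun t ht => by
      rw [wnorm_neg_one_mul]
      refine (hC j t ht.1).2.1.trans ?_
      rw [zpow_zero, mul_one]
      exact mul_le_of_le_one_right hC0 (exp_block_le_one ht.1 j)
  rw [distBlock_heat_eq ψ hs, distBlock_heat_eq ψ le_rfl,
    mop_sub_eq_integral (g := fun t => bsym invAbs.1 t ψ.fat j) hs (h0 j 0 le_rfl).1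
      (h0 j s hs).1 (fun t ht => (hC j t ht.1).1.const_mul (-1))
      (measurable_const_mul_family (measurable_bsym hA ψ.annular_fat.smooth.continuous j) _)
      (fun t _ ξ => hasDerivAt_bsym _ _ j t ξ) (hC j 0 le_rfl).1.int.norm (fun t ht ξ => by
        simpa using norm_bsym_le ht.1 _ ψ.fat j ξ) hM
      (measurable_distBlock ψ _ j f) (abs_distBlock_abs_le hf j)]
  have := intervalIntegral.norm_integral_le_of_norm_le_const (a := 0) (b := s)
    (C := C * (dn ψ f j).toReal) (f := fun t => mop (fun ξ => ((-1 : ℝ) : ℂ) *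
      bsym (fun ξ => (Λ).1 ξ * invAbs.1 ξ) t ψ.fat j ξ) (distBlock ψ Λ j f) x) fun t ht => by
    rw [uIoc_of_le hs] at ht
    have ht' := Ioc_subset_Icc_self ht
    exact (((hC j t ht'.1).1.const_mul (-1)).abs_mop_le (abs_distBlock_abs_le hf j) x).trans
      (mul_le_mul_of_nonneg_right (hM t ht') toReal_nonneg)
  refine this.trans (le_of_eq ?_)
  rw [sub_zero, abs_of_nonneg hs]; ring

theorem bsym_fat_eq (ψ : LP) (m : V → ℂ) (s : ℝ) (j : ℤ) :
    bsym m s ψ.fat j = fun ξ => bsym m s ψ.ph (j - 1) ξ + bsym m s ψ.ph j ξ +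
      bsym m s ψ.ph (j + 1) ξ := by
  ext ξ
  simp only [bsym]
  rw [ψ.fat_eq, ψ.phi_eq, ψ.phi_eq, ψ.phi_eq]
  ring

theorem distBlock_one_lipschitz (ψ : LP) : ∃ C : ℝ, 0 ≤ C ∧ ∀ {f : TD},
    β ψ f < ⊤ → ∀ (j : ℤ) (x x' : V),
      |distBlock ψ (heat 0) j f x - distBlock ψ (heat 0) j f x'| ≤
        C * ‖x - x'‖ * (dn ψ f j).toReal := by
  obtain ⟨C, hC0, hC⟩ := (hom_invAbs (d := d)).block_lipschitz ψ
  refine ⟨3 * C, by positivity, fun {f} hf j x x' => ?_⟩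
  have hW := fun i => (hom_invAbs (d := d)).wiener_bsym ψ i (le_refl 0)
  have hu := (measurable_distBlock ψ Λ j f)
  have hB := (abs_distBlock_abs_le hf j)
  rw [distBlock_heat_eq ψ le_rfl, distBlock_heat_eq ψ le_rfl, bsym_fat_eq,
    ((hW _).add (hW _)).mop_add (hW _) hu hB, (hW _).mop_add (hW _) hu hB,
    ((hW _).add (hW _)).mop_add (hW _) hu hB, (hW _).mop_add (hW _) hu hB]
  have h1 : ∀ i : ℤ, C * (((2 : ℝ) ^ i) ^ (-1 : ℤ) * 2 ^ i) * (dn ψ f j).toReal * ‖x - x'‖ =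
      C * (dn ψ f j).toReal * ‖x - x'‖ := fun i => by
    rw [zpow_neg_one, inv_mul_cancel₀ (two_zpow_pos i).ne', mul_one]
  have h2 := hC (j - 1) _ hu _ hB x x'
  have h3 := hC j _ hu _ hB x x'
  have h4 := hC (j + 1) _ hu _ hB x x'
  rw [h1] at h2 h3 h4
  rw [abs_le] at h2 h3 h4 ⊢
  constructor <;> nlinarith [h2.1, h2.2, h3.1, h3.2, h4.1, h4.2]

theorem harmExt_term_le (ψ : LP) : ∃ C : ℝ, 0 ≤ C ∧ ∀ {f : TD},
    β ψ f < ⊤ → ∀ (x : V) {z : ℝ}, z < 0 → ∀ j : ℤ,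
      |distBlock ψ (heat (-z)) j f x - distBlock ψ one j f 0| ≤
        C * (‖x‖ + |z|) * (dn ψ f j).toReal := by
  obtain ⟨C, hC0, hC⟩ := distBlock_heat_sub_le ψ
  obtain ⟨C', hC0', hC'⟩ := distBlock_one_lipschitz ψ
  refine ⟨C + C', by positivity, fun {f} hf x {z} hz j => ?_⟩
  have h1 := hC hf (s := -z) (by linarith) j x
  have h2 := hC' hf j x 0
  rw [sub_zero] at h2
  rw [distBlock_one_eq_heat, abs_of_neg hz]
  have h3 : 0 ≤ (dn ψ f j).toReal := toReal_nonneg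
  have h4 : 0 ≤ C' * -z * (dn ψ f j).toReal := by
    have : 0 ≤ -z := by linarith
    positivity
  have h5 : 0 ≤ C * ‖x‖ * (dn ψ f j).toReal := by positivity
  rw [abs_le] at h1 h2 ⊢
  constructor <;> nlinarith [h1.1, h1.2, h2.1, h2.2]

theorem summable_dn (hf : β ψ f < ⊤) :
    Summable fun j => (dn ψ f j).toReal := summable_toReal (tsum_dn_lt_top hf).ne

theorem summable_harmExt (hf : β ψ f < ⊤) (x : V) (hz : z < 0) :
    Summable fun j : ℤ => distBlock ψ (heat (-z)) j f x - distBlock ψ one j f 0 := by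
  obtain ⟨C, -, hC⟩ := harmExt_term_le ψ
  exact Summable.of_norm_bounded (g := fun j => C * (‖x‖ + |z|) * (dn ψ f j).toReal)
    ((summable_dn hf).mul_left _) fun j => hC hf x hz j

theorem abs_harmExt_le (hf : β ψ f < ⊤) : ∃ C : ℝ, ∀ (x : V) (z : ℝ), z < 0 →
      |harmExt ψ f (x, z)| ≤ C * (‖x‖ + |z|) := by
  obtain ⟨C, -, hC⟩ := harmExt_term_le ψ
  refine ⟨∑' j, C * (dn ψ f j).toReal, fun x z hz => ?_⟩
  rw [← tsum_mul_right]
  refine tsum_of_norm_bounded (f := fun j : ℤ => distBlock ψ (heat (-z)) j f x -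
    distBlock ψ one j f 0) (((summable_dn hf).mul_left C).mul_right _).hasSum fun j => ?_
  refine (hC hf x hz j).trans (le_of_eq ?_)
  ring

theorem measurable_harmExt (ψ : LP) (f : TD) :
    Measurable fun p : V × ℝ => if p.2 < 0 then harmExt ψ f p else 0 := by
  have h : (fun p : V × ℝ => if p.2 < 0 then harmExt ψ f p else 0) = fun p => ∑' j : ℤ,
      if p.2 < 0 then mop (bsym invAbs.1 (-p.2) ψ.fat j)
        (distBlock ψ Λ j f) p.1 - distBlock ψ one j f 0 else 0 := by
    ext p
    split_ifs with hp
    · rw [harmExt]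
      congr 1; ext j
      rw [distBlock_heat_eq ψ (by linarith)]
    · simp
  rw [h]
  refine Measurable.tsum fun j => ?_
  refine Measurable.ite (measurableSet_lt measurable_snd measurable_const) ?_ measurable_const
  refine Measurable.sub_const ?_ _
  have h1 := measurable_ker_family (measurable_bsym (hom_invAbs (d := d))
    (χ := ψ.fat) ψ.annular_fat.smooth.continuous j)
  have h2 : Measurable fun q : (V × ℝ) × V =>
      ker (bsym invAbs.1 (-q.1.2) ψ.fat j) (q.1.1 - q.2) * distBlock ψ Λ j f q.2 :=
    (h1.comp (f := fun q : (V × ℝ) × V => (-q.1.2, q.1.1 - q.2)) (by fun_prop)).mul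
      ((measurable_distBlock ψ _ j f).comp measurable_snd)
  exact (h2.stronglyMeasurable.integral_prod_right').measurable

theorem hasDerivAt_distBlock_line (ψ : LP) (hf : β ψ f < ⊤) (k : Fin d) (hs : 0 ≤ s) (j : ℤ) (x : V)
    (t : ℝ) : HasDerivAt (fun t : ℝ => distBlock ψ (heat s) j f (x + t • single k 1))
      (distBlock ψ ((partialD k).mul (heat s)) j f (x + t • single k 1)) t := by
  have h0 := hom_invAbs (d := d)
  have h1 := (hom_partialD k).mul_invAbs
  have h2 := (hom_partialD k).mul h1
  obtain ⟨_, _, w0⟩ := h0.block_bound ψ.annular_fat ψ.fat_herm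
  obtain ⟨_, _, w1⟩ := h1.block_bound ψ.annular_fat ψ.fat_herm
  obtain ⟨_, _, w2⟩ := h2.block_bound ψ.annular_fat ψ.fat_herm
  have e1 : (fun ξ => dirD (single k 1) ξ * bsym invAbs.1 s ψ.fat j ξ) =
      bsym ((partialD k).mul invAbs).1 s ψ.fat j := by
    ext ξ; simp only [bsym, Symbol.mul, dirD_single]; ring
  have e2 : (fun ξ => dirD (single k 1) ξ * (dirD (single k 1) ξ * bsym invAbs.1 s ψ.fat j ξ)) =
      bsym (fun ξ => (partialD k).1 ξ * ((partialD k).1 ξ * invAbs.1 ξ)) s ψ.fat j := by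
    ext ξ; simp only [bsym, dirD_single]; ring
  simp only [distBlock_heat_eq ψ hs, (hom_partialD k).distBlock_heat_eq ψ hs]
  rw [← e1]
  exact hasDerivAt_mop_line (w0 j s hs).1 (by rw [e1]; exact (w1 j s hs).1)
    (by rw [e2]; exact (w2 j s hs).1) (measurable_distBlock ψ _ j f) (abs_distBlock_abs_le hf j) x t

theorem hasDerivAt_distBlock_time (ψ : LP) (hf : β ψ f < ⊤) (j : ℤ) (x : V) (hz : z < 0) :
    HasDerivAt (fun z : ℝ => distBlock ψ (heat (-z)) j f x)
      (distBlock ψ ((Λ).mul (heat (-z))) j f x) z := by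
  have h0 := hom_invAbs (d := d)
  have h1 : Hom 0 fun ξ => (Λ).1 ξ * invAbs.1 ξ :=
    hom_abs.mul_invAbs
  have h2 : Hom (1 + 0) fun ξ => (Λ).1 ξ * ((Λ).1 ξ * invAbs.1 ξ) := hom_abs.mul h1
  obtain ⟨_, _, w0⟩ := h0.block_bound ψ.annular_fat ψ.fat_herm
  obtain ⟨C1, hC1, w1⟩ := h1.block_bound ψ.annular_fat ψ.fat_herm
  obtain ⟨C2, hC2, w2⟩ := h2.block_bound ψ.annular_fat ψ.fat_herm
  have hc := ψ.annular_fat.smooth.continuous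
  have hs : 0 < -z := by linarith
  have key := hasDerivAt_mop (g := fun t => bsym invAbs.1 t ψ.fat j)
    (g' := fun t ξ => ((-1 : ℝ) : ℂ) * bsym (fun ξ => (Λ).1 ξ * invAbs.1 ξ) t ψ.fat j ξ)
    (g'' := fun t ξ => ((-1 : ℝ) : ℂ) * (((-1 : ℝ) : ℂ) * bsym (fun ξ =>
      (Λ).1 ξ * ((Λ).1 ξ * invAbs.1 ξ)) t ψ.fat j ξ)) (a := 0) (b := -z + 1)
    (M := C1) (M' := C2 * ((2 : ℝ) ^ j) ^ (1 + 0 : ℤ))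
    (fun t ht => (w0 j t ht.1).1) (fun t ht => (w1 j t ht.1).1.const_mul (-1))
    (fun t ht => ((w2 j t ht.1).1.const_mul (-1)).const_mul (-1))
    (measurable_const_mul_family (measurable_bsym h1 hc j) _)
    (measurable_const_mul_family (measurable_const_mul_family (measurable_bsym h2 hc j) _) _)
    (fun t _ ξ => hasDerivAt_bsym _ _ j t ξ)
    (fun t _ ξ => (hasDerivAt_bsym _ _ j t ξ).const_mul _)
    (w1 j 0 le_rfl).1.int.norm (fun t ht ξ => by simpa using norm_bsym_le ht.1 _ ψ.fat j ξ)
    (w2 j 0 le_rfl).1.int.norm (fun t ht ξ => by simpa using norm_bsym_le ht.1 _ ψ.fat j ξ)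
    (fun t ht => by
      rw [wnorm_neg_one_mul]
      refine (w1 j t ht.1).2.1.trans ?_
      rw [zpow_zero, mul_one]
      exact mul_le_of_le_one_right hC1 (exp_block_le_one ht.1 j))
    (fun t ht => by
      rw [wnorm_neg_one_mul, wnorm_neg_one_mul]
      refine (w2 j t ht.1).2.1.trans ?_
      have := two_zpow_pos j
      exact mul_le_of_le_one_right (by positivity) (exp_block_le_one ht.1 j))
    (measurable_distBlock ψ _ j f) (abs_distBlock_abs_le hf j) x (t := -z) ⟨hs, by linarith⟩
  have h3 := key.scomp z (hasDerivAt_neg z)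
  rw [mop_const_mul, smul_eq_mul, neg_one_mul, neg_one_mul, neg_neg] at h3
  rw [hom_abs.distBlock_heat_eq ψ hs.le]
  refine h3.congr_of_eventuallyEq ?_
  filter_upwards [Iio_mem_nhds hz] with w hw
  rw [distBlock_heat_eq ψ (by linarith [mem_Iio.1 hw])]
  rfl

theorem hasDerivAt_harmExt_line (hf : β ψ f < ⊤) (k : Fin d) (x : V) (hz : z < 0) (t : ℝ) :
    HasDerivAt (fun t : ℝ => harmExt ψ f (x + t • single k 1, z))
      (harm ψ (partialD k) f (x + t • single k 1, z)) t := by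
  obtain ⟨C, hC⟩ := (hom_partialD k).abs_distBlock_le ψ
  have hs : 0 ≤ -z := by linarith
  simp only [harmExt, harm, hz, if_true]
  exact hasDerivAt_tsum (u := fun j => C * (dn ψ f j).toReal) ((summable_dn hf).mul_left _)
    (g := fun j t => distBlock ψ (heat (-z)) j f (x + t • single k 1) - distBlock ψ one j f 0)
    (fun j t => (hasDerivAt_distBlock_line ψ hf k hs j x t).sub_const _)
    (fun j t => hC hf hs j _) (y₀ := 0) (summable_harmExt hf _ hz) t

theorem hasDerivAt_harmExt_time (hf : β ψ f < ⊤) (x : V) (hz : z < 0) :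
    HasDerivAt (fun z : ℝ => harmExt ψ f (x, z)) (harm ψ Λ f (x, z)) z := by
  obtain ⟨C, hC⟩ := hom_abs.abs_distBlock_le ψ
  simp only [harmExt, harm, hz, if_true]
  exact hasDerivAt_tsum_of_isPreconnected (u := fun j => C * (dn ψ f j).toReal)
    ((summable_dn hf).mul_left _) isOpen_Iio isPreconnected_Iio
    (g := fun j z => distBlock ψ (heat (-z)) j f x - distBlock ψ one j f 0)
    (fun j y hy => (hasDerivAt_distBlock_time ψ hf j x hy).sub_const _)
    (fun j y hy => hC hf (by linarith [mem_Iio.1 hy]) j _) (mem_Iio.2 hz)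
    (summable_harmExt hf _ hz) (mem_Iio.2 hz)

/-! ### Weak derivatives on the half space -/

/-- Measurable functions of at most linear growth. -/
structure Tame (g : Fn) : Prop where
  meas : Measurable g
  growth : ∃ C : ℝ, ∀ p, |g p| ≤ C * (1 + ‖p‖)

theorem Cl.tame {u : Fn} (hu : Cl u) : Tame u := by
  obtain ⟨B, hB⟩ := hu.bdd
  refine ⟨hu.meas, B, fun p => (hB p).trans ?_⟩
  have : 0 ≤ B := (abs_nonneg _).trans (hB p)
  nlinarith [norm_nonneg p]

theorem Tame.sub {g h : Fn} (hg : Tame g) (hh : Tame h) : Tame fun p => g p - h p := by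
  obtain ⟨C, hC⟩ := hg.growth
  obtain ⟨D, hD⟩ := hh.growth
  refine ⟨hg.meas.sub hh.meas, C + D, fun p => (abs_sub _ _).trans ?_⟩
  linarith [hC p, hD p]

theorem Tame.integrable_mul_of_continuous {g : Fn} (hg : Tame g) {φ : Fn}
    (hφ : Continuous φ) (hs : HasCompactSupport φ) : Integrable fun p => g p * φ p := by
  obtain ⟨C, hC⟩ := hg.growth
  have h1 : Integrable fun p : V × ℝ => (C * (1 + ‖p‖)) * φ p :=
    Continuous.integrable_of_hasCompactSupport (by fun_prop) hs.mul_left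
  refine h1.norm.mono' (hg.meas.mul hφ.measurable).aestronglyMeasurable (ae_of_all _ fun p => ?_)
  rw [norm_mul, norm_mul]
  exact mul_le_mul_of_nonneg_right ((hC p).trans (le_abs_self _)) (norm_nonneg _)

theorem Tame.integrable_mul {g : Fn} (hg : Tame g) (φ : 𝓣) : Integrable fun p => g p * φ p :=
  hg.integrable_mul_of_continuous φ.continuous φ.hasCompactSupport

/-- `G` is the weak derivative of `g` in the direction `e` on the half space. -/
def WeakDeriv (e : V × ℝ) (g G : Fn) : Prop :=
  ∀ φ : 𝓣, ∫ p, g p * (∂_{e} φ : 𝓣) p = -∫ p, G p * φ p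

theorem hasLineDerivAt_testFunction (φ : 𝓣) (e p : V × ℝ) :
    HasLineDerivAt ℝ φ ((∂_{e} φ : 𝓣) p) p e := by
  have h1 : (∂_{e} φ : 𝓣) p = lineDeriv ℝ φ p e := by
    rw [TestFunction.lineDerivOp_eq_lineDerivCLM ℝ, TestFunction.lineDerivCLM_apply_of_le]
    simp
  rw [h1]
  have hd : Differentiable ℝ φ := φ.contDiff.differentiable (by simp)
  exact (hd p).lineDifferentiableAt.hasLineDerivAt

theorem WeakDeriv.add {e : V × ℝ} {g G h H : Fn} (hg : Tame g) (hG : Tame G)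
    (hh : Tame h) (hH : Tame H) (h1 : WeakDeriv e g G) (h2 : WeakDeriv e h H) :
    WeakDeriv e (fun p => g p + h p) fun p => G p + H p := fun φ => by
  simp only [add_mul]
  rw [integral_add (hg.integrable_mul _) (hh.integrable_mul _),
    integral_add (hG.integrable_mul _) (hH.integrable_mul _), h1, h2]
  ring

theorem WeakDeriv.sub {e : V × ℝ} {g G h H : Fn} (hg : Tame g) (hG : Tame G)
    (hh : Tame h) (hH : Tame H) (h1 : WeakDeriv e g G) (h2 : WeakDeriv e h H) :
    WeakDeriv e (fun p => g p - h p) fun p => G p - H p := fun φ => by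
  simp only [sub_mul]
  rw [integral_sub (hg.integrable_mul _) (hh.integrable_mul _),
    integral_sub (hG.integrable_mul _) (hH.integrable_mul _), h1, h2]
  ring

theorem weakDeriv_of_hasLineDerivAt {e : V × ℝ} {g G : Fn} (hg : Tame g) (hG : Tame G)
    (h : ∀ p : V × ℝ, p.2 < 0 → HasLineDerivAt ℝ g (G p) p e) : WeakDeriv e g G := fun φ => by
  have : (volume : Measure (V × ℝ)).IsAddHaarMeasure := by
    rw [Measure.volume_eq_prod]; infer_instance
  exact integral_bilinear_hasLineDerivAt_right_eq_neg_left_of_integrable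
    (B := ContinuousLinearMap.mul ℝ ℝ) (f := g) (f' := G) (g := φ) (hG.integrable_mul φ)
    (hg.integrable_mul (∂_{e} φ)) (hg.integrable_mul φ) (fun p hp => h p (φ.tsupport_subset hp))
    (fun p _ => hasLineDerivAt_testFunction φ e p)

/-- The harmonic extension, set to zero outside the half space. -/
def harmU (ψ : LP) (f : TD) (p : V × ℝ) : ℝ :=
  if p.2 < 0 then harmExt ψ f p else 0

theorem tame_harmU (hf : β ψ f < ⊤) : Tame (harmU ψ f) := by
  obtain ⟨C, hC⟩ := abs_harmExt_le hf
  refine ⟨measurable_harmExt ψ f, 2 * |C|, fun p => ?_⟩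
  rw [harmU]
  split_ifs with hp
  · refine (hC p.1 p.2 hp).trans ?_
    have h1 := norm_fst_le p
    have h2 := norm_snd_le p
    rw [norm_eq_abs] at h2
    have h3 : 0 ≤ ‖p.1‖ + |p.2| := by positivity
    nlinarith [le_abs_self C, abs_nonneg C]
  · rw [abs_zero]; positivity

theorem weakDeriv_harmU_line (hf : β ψ f < ⊤) (k : Fin d) :
    WeakDeriv ((single k (1 : ℝ), (0 : ℝ)) : V × ℝ) (harmU ψ f) (harm ψ (partialD k) f) := by
  refine weakDeriv_of_hasLineDerivAt (tame_harmU hf) ((hom_partialD k).cl_harm hf).tame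
    fun p hp => ?_
  have h1 := hasDerivAt_harmExt_line hf k p.1 hp 0
  rw [zero_smul, add_zero] at h1
  rw [HasLineDerivAt]
  refine h1.congr_of_eventuallyEq (.of_forall fun t => ?_)
  have e : p + t • ((single k (1 : ℝ), (0 : ℝ)) : V × ℝ) =
      (p.1 + t • single k 1, p.2) := Prod.ext rfl (by simp)
  simp only [e, harmU, hp, if_true]

theorem weakDeriv_harmU_time (hf : β ψ f < ⊤) :
    WeakDeriv ((0, 1) : V × ℝ) (harmU ψ f) (harm ψ Λ f) := by
  refine weakDeriv_of_hasLineDerivAt (tame_harmU hf) (hom_abs.cl_harm hf).tame fun p hp => ?_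
  have h1 := hasDerivAt_harmExt_time hf p.1 hp
  have h2 : HasDerivAt (fun t : ℝ => p.2 + t) 1 0 := (hasDerivAt_id 0).const_add p.2
  have h3 := HasDerivAt.scomp (g₁ := fun z : ℝ => harmExt ψ f (p.1, z)) (h := fun t : ℝ => p.2 + t)
    (0 : ℝ) (by simpa using h1) h2
  rw [one_smul] at h3
  rw [HasLineDerivAt]
  refine h3.congr_of_eventuallyEq ?_
  have h4 : ∀ᶠ t : ℝ in 𝓝 0, p.2 + t < 0 := by
    refine (h2.continuousAt.eventually_lt continuousAt_const ?_)
    simpa using hp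
  filter_upwards [h4] with t ht
  have e : p + t • ((0, 1) : V × ℝ) = (p.1, p.2 + t) := Prod.ext (by simp) (by simp)
  simp only [e, harmU, ht, if_true, Function.comp]

/-! ### The Duhamel integral -/

/-- `∫_z^0 e^{(z - τ)|D|} q(τ) dτ`. -/
def duh (q : Fn) : Fn := zop (fun _ => 1) (fun z => Ioo z 0) q

theorem duh_apply (q : Fn) (p : V × ℝ) :
    duh q p = ∫ τ in Ioo p.2 0, mop (hsym |p.2 - τ|) (fun y => q (y, τ)) p.1 := by
  simp only [duh, zop, one_mul]

theorem measurableSet_Ioo_family : MeasurableSet {p : ℝ × ℝ | p.2 ∈ Ioo p.1 0} :=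
  (measurableSet_lt measurable_fst measurable_snd).inter
    (measurableSet_lt measurable_snd measurable_const)

theorem abs_mop_hsym_le [NeZero d] (hB : ∀ p, |q p| ≤ B) (x : V)
    {z τ : ℝ} (h : z ≠ τ) : |mop (hsym |z - τ|) (fun y => q (y, τ)) x| ≤
      wnorm (hsym (d := d) 1) * B := by
  have hs : 0 < |z - τ| := abs_pos.2 (sub_ne_zero.2 h)
  rw [← wnorm_hsym hs]
  exact (wiener_hsym hs).abs_mop_le (fun y => hB (y, τ)) x

theorem measurable_mop_hsym (hq : Measurable q) :
    Measurable fun p : (V × ℝ) × ℝ => mop (hsym |p.1.2 - p.2|) (fun y => q (y, p.2)) p.1.1 := by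
  have := measurable_mop_heat (m := fun _ => 1) measurable_const hq
  simpa only [one_mul] using this

theorem tame_duh [NeZero d] (hq : Cl q) : Tame (duh q) := by
  obtain ⟨B, hB⟩ := hq.bdd
  have hB0 : 0 ≤ B := (abs_nonneg _).trans (hB 0)
  refine ⟨measurable_zop measurable_const measurableSet_Ioo_family hq.meas,
    wnorm (hsym (d := d) 1) * B, fun p => ?_⟩
  rw [duh_apply]
  have h1 := norm_setIntegral_le_of_norm_le_const (μ := volume) (s := Ioo p.2 0)
    (f := fun τ => mop (hsym |p.2 - τ|) (fun y => q (y, τ)) p.1)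
    (C := wnorm (hsym (d := d) 1) * B) (by simp) fun τ hτ => abs_mop_hsym_le hB p.1 hτ.1.ne
  refine h1.trans ?_
  have h0 := wnorm_nonneg (hsym (d := d) 1)
  refine mul_le_mul_of_nonneg_left ?_ (by positivity)
  rw [Measure.real, Real.volume_Ioo, zero_sub]
  have h2 := norm_snd_le p
  rw [norm_eq_abs] at h2
  have h3 : (ofReal (-p.2)).toReal ≤ |p.2| := by
    rw [ENNReal.toReal_ofReal']
    exact max_le (neg_le_abs _) (abs_nonneg _)
  linarith

theorem weakDeriv_duh_line [NeZero d] (ψ : LP) (hq : Cl q) (hq1 : CL ψ 1 1 q < ⊤) (k : Fin d) :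
    WeakDeriv ((single k (1 : ℝ), (0 : ℝ)) : V × ℝ) (duh q)
      (zop (partialD k).1 (fun z => Ioo z 0) q) := by
  obtain ⟨B, hB⟩ := hq.bdd
  have hm := hom_partialD k
  have hc := continuous_partialD k
  have hsub : ∀ z : ℝ, Ioo z 0 ⊆ Iio 0 := fun z τ h => h.2
  refine weakDeriv_of_hasLineDerivAt (tame_duh hq)
    (hm.cl_zop hc ψ measurableSet_Ioo_family hsub hq hq1).tame fun p hp => ?_
  obtain ⟨C, hC⟩ := hm.heat_le hc ψ
  set z := p.2
  have hae : ∀ᵐ τ ∂(volume.restrict (Ioo z 0)), τ ∈ Ioo z 0 := ae_restrict_mem measurableSet_Ioo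
  have hbm : Measurable fun τ => dyadicBound ψ q |z - τ| τ :=
    Measurable.tsum (f := fun (i : ℤ) (τ : ℝ) => kap i |z - τ| * bn ψ i q τ) fun i =>
      ((measurable_kap i).comp (by fun_prop)).mul (measurable_bn ψ i hq)
  have hbl : ∫⁻ τ in Ioo z 0, C * dyadicBound ψ q |z - τ| τ < ⊤ := by
    rw [lintegral_const_mul _ hbm]
    refine mul_lt_top coe_lt_top (((lintegral_mono_set (hsub z)).trans
      (lintegral_dyadicBound_le ψ hq (s := fun τ => |z - τ|) (by fun_prop)
        fun τ => abs_nonneg _)).trans_lt hq1)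
  have hfin := ae_lt_top (hbm.const_mul (C : ℝ≥0∞)) hbl.ne
  have key := hasDerivAt_integral_of_dominated_loc_of_deriv_le (μ := volume.restrict (Ioo z 0))
    (F := fun t τ => mop (hsym |z - τ|) (fun y => q (y, τ)) (p.1 + t • single k 1))
    (F' := fun t τ => mop (fun ξ => (partialD k).1 ξ * hsym |z - τ| ξ)
      (fun y => q (y, τ)) (p.1 + t • single k 1)) (x₀ := (0 : ℝ)) (s := univ)
    (bound := fun τ => (C * dyadicBound ψ q |z - τ| τ).toReal) univ_mem
    (.of_forall fun t => ((measurable_mop_hsym hq.meas).comp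
      (f := fun τ : ℝ => ((p.1 + t • single k 1, z), τ)) (by fun_prop)).aestronglyMeasurable) ?_
    ((measurable_mop_heat hm.measurable hq.meas).comp
      (f := fun τ : ℝ => ((p.1 + (0 : ℝ) • single k 1, z), τ))
        (by fun_prop)).aestronglyMeasurable ?_
    (integrable_toReal_of_lintegral_ne_top (hbm.const_mul _).aemeasurable hbl.ne) ?_
  · rw [HasLineDerivAt]
    have h2 := key.2
    rw [zero_smul, add_zero] at h2
    refine h2.congr_of_eventuallyEq (.of_forall fun t => ?_)
    simp [duh_apply, z]
  · refine Measure.integrableOn_of_bounded (M := wnorm (hsym (d := d) 1) * B) (by simp)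
      ((measurable_mop_hsym hq.meas).comp (f := fun τ : ℝ => ((p.1 + (0 : ℝ) • single k 1, z), τ))
        (by fun_prop)).aestronglyMeasurable ?_
    filter_upwards [hae] with τ hτ
    exact abs_mop_hsym_le hB _ hτ.1.ne
  · filter_upwards [hae, hfin] with τ hτ hf t _
    have := hC q hq |z - τ| (abs_pos.2 (sub_ne_zero.2 hτ.1.ne)) (p.1 + t • single k 1) τ
    rw [← toReal_enorm]
    exact toReal_mono hf.ne this
  · filter_upwards [hae] with τ hτ t _
    exact hasDerivAt_mop_hsym_line ψ k (hq.slice τ) (fun y => hB (y, τ)) p.1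
      (abs_pos.2 (sub_ne_zero.2 hτ.1.ne)) t

theorem ae_tendsto_mop_hsym [NeZero d] (hu : Measurable u) (hB : ∀ y, |u y| ≤ B) (τ : ℝ) :
    ∀ᵐ x, Tendsto (fun z : ℝ => mop (hsym |z - τ|) u x) (𝓝[<] τ) (𝓝 (u x)) := by
  filter_upwards [wiener_hsym_one.ae_tendsto_mop (by simp [hsym]) hu hB] with x hx
  have h1 : Tendsto (fun z : ℝ => |z - τ|) (𝓝[<] τ) (𝓝[>] 0) := by
    refine tendsto_nhdsWithin_iff.2 ⟨?_, ?_⟩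
    · have : Continuous fun z : ℝ => |z - τ| := by fun_prop
      have h2 := (this.tendsto τ).mono_left (nhdsWithin_le_nhds (s := Iio τ))
      simpa using h2
    · filter_upwards [self_mem_nhdsWithin] with z hz
      exact abs_pos.2 (sub_ne_zero.2 (mem_Iio.1 hz).ne)
  refine (hx.comp h1).congr' ?_
  filter_upwards [self_mem_nhdsWithin] with z hz
  have hs : 0 < |z - τ| := abs_pos.2 (sub_ne_zero.2 (mem_Iio.1 hz).ne)
  simp only [Function.comp]
  congr 1
  ext ξ
  rw [hsym_eq_scale _ ξ hs]

/-- The time derivative of `e^{(z - τ)|D|} u`, tested against `φ`. -/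
theorem integral_heat_test [NeZero d] (ψ : LP) (hu : Measurable u)
    (hB : ∀ y, |u y| ≤ B) (φ : 𝓣) (τ : ℝ) (x : V)
    (hlim : Tendsto (fun z : ℝ => mop (hsym |z - τ|) u x) (𝓝[<] τ) (𝓝 (u x)))
    (hint : IntegrableOn (fun z => mop (hsym |z - τ|) u x * (∂_{((0, 1) : V × ℝ)} φ :
        𝓣) (x, z) + mop (fun ξ => (Λ).1 ξ * hsym |z - τ| ξ) u x * φ (x, z)) (Iio τ)) :
    ∫ z in Iio τ, (mop (hsym |z - τ|) u x * (∂_{((0, 1) : V × ℝ)} φ :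
        𝓣) (x, z) + mop (fun ξ => (Λ).1 ξ * hsym |z - τ| ξ) u x * φ (x, z)) = u x * φ (x, τ) := by
  rw [← integral_Iic_eq_integral_Iio]
  have h1 := integral_Iic_of_hasDerivAt_of_tendsto (a := τ) (m := 0)
    (f := fun z => if z < τ then mop (hsym |z - τ|) u x * φ (x, z) else u x * φ (x, τ))
    (f' := fun z => mop (hsym |z - τ|) u x * (∂_{((0, 1) : V × ℝ)} φ :
        𝓣) (x, z) + mop (fun ξ => (Λ).1 ξ *
          hsym |z - τ| ξ) u x * φ (x, z)) ?_ ?_ ((integrableOn_Iic_iff_integrableOn_Iio).2 hint) ?_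
  · rw [h1]; simp
  · rw [← continuousWithinAt_Iio_iff_Iic, ContinuousWithinAt]
    simp only [lt_irrefl, if_false]
    have hφ : Continuous fun z : ℝ => φ (x, z) := φ.continuous.comp (by fun_prop)
    refine (hlim.mul ((hφ.tendsto τ).mono_left nhdsWithin_le_nhds)).congr' ?_
    filter_upwards [self_mem_nhdsWithin] with z hz
    rw [if_pos (mem_Iio.1 hz)]
  · intro z hz
    have hs : 0 < τ - z := by linarith [mem_Iio.1 hz]
    have h2 := (hasDerivAt_mop_hsym ψ hu hB x hs).scomp z ((hasDerivAt_id z).const_sub τ)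
    have h3 := hasLineDerivAt_testFunction φ ((0, 1) : V × ℝ) (x, z)
    rw [HasLineDerivAt] at h3
    have h4 : HasDerivAt (fun w => φ (x, w)) ((∂_{((0, 1) : V × ℝ)} φ : 𝓣) (x, z)) z := by
      have h5 := HasDerivAt.scomp (h := fun w => w - z) z (by simpa using h3)
        ((hasDerivAt_id z).sub_const z)
      rw [one_smul] at h5
      refine h5.congr_of_eventuallyEq (.of_forall fun w => ?_)
      simp
    have e : |z - τ| = τ - z := by rw [abs_sub_comm, abs_of_pos hs]
    refine ((h2.mul h4).congr_deriv ?_).congr_of_eventuallyEq ?_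
    · simp only [e, smul_eq_mul, Function.comp]
      ring
    · filter_upwards [Iio_mem_nhds (mem_Iio.1 hz)] with w hw
      have hw' := mem_Iio.1 hw
      simp only [if_pos hw', abs_sub_comm w τ, abs_of_pos (sub_pos.2 hw')]
      rfl
  · obtain ⟨R, hR⟩ := φ.hasCompactSupport.isCompact.isBounded.exists_norm_le
    refine tendsto_const_nhds.congr' ?_
    filter_upwards [Iio_mem_atBot τ, Iio_mem_atBot (-R)] with z hz hz'
    have h0 : φ (x, z) = 0 := by
      refine image_eq_zero_of_notMem_tsupport fun h => ?_
      have h2 := (norm_snd_le (x, z)).trans (hR _ h)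
      rw [norm_eq_abs] at h2
      linarith [neg_abs_le z, mem_Iio.1 hz']
    simp [mem_Iio.1 hz, h0]

theorem integrable_triangle {g : (V × ℝ) × ℝ → ℝ} (hg : Measurable g) {c : V × ℝ → ℝ≥0∞}
    (hc : ∀ p, ∫⁻ τ in Ioo p.2 0, ‖g (p, τ)‖ₑ ≤ c p) {φ : Fn} (hφ : Measurable φ)
    (h : ∫⁻ p, c p * ‖φ p‖ₑ < ⊤) :
    Integrable (fun r : (V × ℝ) × ℝ => (Ioo r.1.2 0).indicator (fun τ => g (r.1, τ) * φ r.1) r.2)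
      (volume.prod volume) := by
  have hS : MeasurableSet {r : (V × ℝ) × ℝ | r.2 ∈ Ioo r.1.2 0} :=
    measurableSet_Ioo_family.preimage (f := fun r : (V × ℝ) × ℝ => (r.1.2, r.2)) (by fun_prop)
  have hm : Measurable fun r : (V × ℝ) × ℝ =>
      (Ioo r.1.2 0).indicator (fun τ => g (r.1, τ) * φ r.1) r.2 :=
    (hg.mul (hφ.comp measurable_fst)).indicator hS
  refine ⟨hm.aestronglyMeasurable, ?_⟩
  rw [HasFiniteIntegral, lintegral_prod _ hm.enorm.aemeasurable]
  refine lt_of_le_of_lt (lintegral_mono fun p => ?_) h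
  have e : ∀ τ, ‖(Ioo p.2 0).indicator (fun τ => g (p, τ) * φ p) τ‖ₑ =
      (Ioo p.2 0).indicator (fun τ => ‖g (p, τ)‖ₑ * ‖φ p‖ₑ) τ := fun τ => by
    rw [enorm_indicator_eq_indicator_enorm]
    simp only [enorm_mul]
  simp only [e]
  have hgp : Measurable fun τ : ℝ => g (p, τ) := hg.comp (by fun_prop)
  rw [lintegral_indicator measurableSet_Ioo, lintegral_mul_const _ hgp.enorm]
  exact mul_le_mul_left (hc p) _

theorem weakDeriv_duh_time [NeZero d] (ψ : LP) (hq : Cl q) (hq1 : CL ψ 1 1 q < ⊤) :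
    WeakDeriv ((0, 1) : V × ℝ) (duh q)
      (fun p => zop (Λ).1 (fun z => Ioo z 0) q p - q p) := fun φ => by
  obtain ⟨B, hB⟩ := hq.bdd
  have hB0 : 0 ≤ B := (abs_nonneg _).trans (hB 0)
  have hA := hom_abs (d := d)
  have hAc := continuous_abs_symbol (d := d)
  have hsub : ∀ z : ℝ, Ioo z 0 ⊆ Iio 0 := fun z τ h => h.2
  set φ' : 𝓣 := ∂_{((0, 1) : V × ℝ)} φ with hφ'
  set g1 : (V × ℝ) × ℝ → ℝ := fun r => mop (hsym |r.1.2 - r.2|) (fun y => q (y, r.2)) r.1.1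
  set g2 : (V × ℝ) × ℝ → ℝ := fun r => mop (fun ξ => (Λ).1 ξ *
    hsym |r.1.2 - r.2| ξ) (fun y => q (y, r.2)) r.1.1
  have hg1 : Measurable g1 := measurable_mop_hsym hq.meas
  have hg2 : Measurable g2 := measurable_mop_heat hA.measurable hq.meas
  set F1 : (V × ℝ) × ℝ → ℝ := fun r => (Ioo r.1.2 0).indicator (fun τ => g1 (r.1, τ) * φ' r.1) r.2
  set F2 : (V × ℝ) × ℝ → ℝ := fun r => (Ioo r.1.2 0).indicator (fun τ => g2 (r.1, τ) * φ r.1) r.2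
  have hM := wnorm_nonneg (hsym (d := d) 1)
  have hF1 : Integrable F1 (volume.prod volume) := by
    refine integrable_triangle hg1 (c := fun p => ‖wnorm (hsym (d := d) 1) * B * p.2‖ₑ)
      (fun p => ?_) φ'.continuous.measurable ?_
    · calc ∫⁻ τ in Ioo p.2 0, ‖g1 (p, τ)‖ₑ
          ≤ ∫⁻ _ in Ioo p.2 0, ofReal (wnorm (hsym (d := d) 1) * B) :=
            setLIntegral_mono measurable_const fun τ hτ => by
              rw [← ofReal_norm]
              exact ofReal_le_ofReal (abs_mop_hsym_le hB p.1 hτ.1.ne)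
        _ ≤ _ := by
            rw [setLIntegral_const, Real.volume_Ioo, ← ofReal_mul (by positivity),
              ← ofReal_norm, norm_mul, norm_of_nonneg (by positivity)]
            refine ofReal_le_ofReal (mul_le_mul_of_nonneg_left ?_ (by positivity))
            rw [zero_sub]
            exact neg_le_abs _
    · have hc : Continuous fun p : V × ℝ => wnorm (hsym (d := d) 1) * B * p.2 * φ' p := by
        have := φ'.continuous
        fun_prop
      have h1 := (hc.integrable_of_hasCompactSupport (μ := volume)
        φ'.hasCompactSupport.mul_left).hasFiniteIntegral
      simpa only [HasFiniteIntegral, enorm_mul] using h1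
  have hF2 : Integrable F2 (volume.prod volume) := by
    obtain ⟨C, hC⟩ := hA.heat_lintegral_le hAc ψ
    refine integrable_triangle hg2 (c := fun _ => C * CL ψ 1 1 q)
      (fun p => hC q hq p.1 p.2 _ (hsub _)) φ.continuous.measurable ?_
    rw [lintegral_const_mul _ φ.continuous.measurable.enorm]
    exact mul_lt_top (mul_lt_top coe_lt_top hq1)
      (φ.continuous.integrable_of_hasCompactSupport φ.hasCompactSupport).hasFiniteIntegral
  have e1 : ∀ p, ∫ τ, F1 (p, τ) = duh q p * φ' p := fun p => by
    simp only [F1, g1]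
    rw [integral_indicator measurableSet_Ioo, integral_mul_const, duh_apply]
  have e2 : ∀ p, ∫ τ, F2 (p, τ) = zop (Λ).1 (fun z => Ioo z 0) q p * φ p :=
    fun p => by
      simp only [F2, g2]
      rw [integral_indicator measurableSet_Ioo, integral_mul_const, zop]
  have hF : Integrable (fun r => F1 r + F2 r) (volume.prod volume) := hF1.add hF2
  have key : ∀ᵐ τ : ℝ, ∫ p : V × ℝ, (F1 (p, τ) + F2 (p, τ)) = ∫ x, q (x, τ) * φ (x, τ) := by
    filter_upwards [hF.prod_left_ae] with τ hτ
    rw [Measure.volume_eq_prod] at hτ ⊢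
    rw [integral_prod _ hτ]
    refine integral_congr_ae ?_
    filter_upwards [hτ.prod_right_ae, ae_tendsto_mop_hsym (hq.slice τ) (fun y => hB (y, τ)) τ]
      with x hx hlim
    rcases lt_or_ge τ 0 with h0 | h0
    · have e3 : ∀ z, F1 ((x, z), τ) + F2 ((x, z), τ) = (Iio τ).indicator (fun z =>
          mop (hsym |z - τ|) (fun y => q (y, τ)) x * φ' (x, z) +
            mop (fun ξ => (Λ).1 ξ * hsym |z - τ| ξ)
              (fun y => q (y, τ)) x * φ (x, z)) z := fun z => by
        by_cases hz : z < τ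
        · simp [F1, F2, g1, g2, indicator, hz, h0]
        · simp [F1, F2, g1, g2, indicator, hz]
      simp only [e3] at hx ⊢
      rw [integral_indicator measurableSet_Iio]
      exact integral_heat_test ψ (hq.slice τ) (fun y => hB (y, τ)) φ τ x hlim
        ((integrable_indicator_iff measurableSet_Iio).1 hx)
    · have e3 : ∀ z, F1 ((x, z), τ) + F2 ((x, z), τ) = 0 := fun z => by
        simp [F1, F2, indicator, h0.not_gt]
      have e4 : φ (x, τ) = 0 := image_eq_zero_of_notMem_tsupport fun h =>
        h0.not_gt (φ.tsupport_subset h)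
      simp [e3, e4]
  have hqφ := hq.tame.integrable_mul φ
  have e5 : ∫ p, q p * φ p = ∫ τ, ∫ x, q (x, τ) * φ (x, τ) := by
    rw [Measure.volume_eq_prod] at hqφ ⊢
    rw [integral_prod_symm _ hqφ]
  have e6 : ∫ p, ∫ τ, (F1 (p, τ) + F2 (p, τ)) = ∫ p, q p * φ p := by
    rw [integral_integral_swap (f := fun p τ => F1 (p, τ) + F2 (p, τ)) hF, e5]
    exact integral_congr_ae key
  have e7 : ∫ p, ∫ τ, (F1 (p, τ) + F2 (p, τ)) = ∫ p, (duh q p * φ' p +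
      zop (Λ).1 (fun z => Ioo z 0) q p * φ p) := by
    refine integral_congr_ae ?_
    filter_upwards [hF1.prod_right_ae, hF2.prod_right_ae] with p h1 h2
    rw [integral_add h1 h2, e1, e2]
  have t1 := (tame_duh hq).integrable_mul φ'
  have hZ := (hA.cl_zop hAc ψ measurableSet_Ioo_family hsub hq hq1).tame
  have t2 := hZ.integrable_mul φ
  rw [integral_add t1 t2, e6] at e7
  simp only [sub_mul]
  rw [integral_sub t2 hqφ]
  linarith

theorem ae_eq_of_isGivenBy {u : 𝓓'(ℍ, ℝ)} {g G : Fn} (hg : LocallyIntegrableOn g (ℍ : Set (V × ℝ)))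
    (hG : LocallyIntegrableOn G (ℍ : Set (V × ℝ)))
    (h1 : IsGivenBy u g) (h2 : IsGivenBy u G) : g =ᵐ[μJ] G := by
  have h3 := IsOpen.ae_eq_zero_of_integral_contDiff_smul_eq_zero (μ := volume)
    (f := fun p => g p - G p) (ℍ).isOpen (hg.sub hG) fun φ hφ hs ht => ?_
  · rw [halfVol, Filter.EventuallyEq, ae_restrict_iff' (ℍ).isOpen.measurableSet]
    filter_upwards [h3] with p hp hm
    linarith [hp hm]
  · set Φ : 𝓣 := ⟨φ, hφ, hs, ht⟩
    have hi : ∀ {f : Fn}, LocallyIntegrableOn f (ℍ : Set (V × ℝ)) →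
        Integrable fun p => f p * Φ p := fun {f} hf => by
      have := TestFunction.integrable_bilin (ContinuousLinearMap.mul ℝ ℝ) hf Φ
      simpa [mul_comm] using this
    have e := (h1 Φ).symm.trans (h2 Φ)
    have e' : ∀ p, φ p • (g p - G p) = g p * Φ p - G p * Φ p := fun p => by
      change φ p * _ = g p * φ p - G p * φ p
      ring
    simp only [e']
    rw [integral_sub (hi hg) (hi hG), e, sub_self]

theorem Tame.locallyIntegrable {g : Fn} (hg : Tame g) : LocallyIntegrable g := by
  obtain ⟨C, hC⟩ := hg.growth
  have hc : Continuous fun p : V × ℝ => C * (1 + ‖p‖) := by fun_prop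
  refine (hc.locallyIntegrable (μ := volume)).mono hg.meas.aestronglyMeasurable
    (ae_of_all _ fun p => ?_)
  exact (hC p).trans (le_abs_self _)

/-- The distribution given by a locally integrable function. -/
def distOf (g : Fn) : 𝓓'(ℍ, ℝ) :=
  UniformConvergenceCLM.ofFun _ _ _ (TestFunction.integralAgainstBilinCLM (ContinuousLinearMap.mul ℝ ℝ) volume g)

theorem Tame.isGivenBy_distOf {g : Fn} (hg : Tame g) : IsGivenBy (distOf g) g := fun φ => by
  have h := TestFunction.integralAgainstBilinCLM_eq_integral (B := ContinuousLinearMap.mul ℝ ℝ)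
    (hg.locallyIntegrable.locallyIntegrableOn (ℍ : Set (V × ℝ))) (f := φ)
  refine Eq.trans (b := ∫ p, ContinuousLinearMap.mul ℝ ℝ (φ p) (g p)) h ?_
  simp [mul_comm]

theorem WeakDeriv.isGivenBy {e : V × ℝ} {g G : Fn} (h : WeakDeriv e g G) (hv : IsGivenBy v g) : IsGivenBy (∂_{e} v) G := fun φ => by
  rw [Distribution.lineDerivOp_apply_apply, map_neg, hv, h, neg_neg]

/-! ### Square function estimates for lacunary multipliers -/

theorem Wiener.lintegral_ker_mul (hg : Wiener g) {w : V → ℝ≥0∞}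
    (hw : Measurable w) : ∫⁻ x, ∫⁻ y, ‖ker g (x - y)‖ₑ * w y = ofReal (wnorm g) * ∫⁻ y, w y := by
  have hk : Measurable (ker g) := (continuous_ker hg.int).measurable
  have hm : Measurable (uncurry fun x y : V => ‖ker g (x - y)‖ₑ * w y) :=
    ((hk.comp (by fun_prop : Measurable fun p : V × V => p.1 - p.2)).enorm).mul
      (hw.comp measurable_snd)
  rw [lintegral_lintegral_swap hm.aemeasurable, ← lintegral_const_mul _ hw]
  congr 1; ext y
  have hy : Measurable fun x => ‖ker g (x - y)‖ₑ := (hk.comp (by fun_prop)).enorm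
  rw [lintegral_mul_const _ hy, lintegral_sub_right_eq_self (fun x => ‖ker g x‖ₑ) y, wnorm,
    ofReal_integral_eq_lintegral_ofReal hg.ker_int.abs (ae_of_all _ fun x => abs_nonneg _)]
  congr 2; ext x
  rw [← norm_eq_abs, ofReal_norm]

theorem enorm_mop_le_lintegral (g : V → ℂ) (v : V → ℝ) (x : V) :
    ‖mop g v x‖ₑ ≤ ∫⁻ y, ‖ker g (x - y)‖ₑ * ‖v y‖ₑ := by
  refine (enorm_integral_le_lintegral_enorm _).trans (le_of_eq ?_)
  simp only [enorm_mul]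

theorem Wiener.integrable_mop (hg : Wiener g) {v : V → ℝ} (hv : Measurable v)
    (hi : Integrable v) : Integrable (mop g v) := by
  refine ⟨(measurable_mop hg.int hv).aestronglyMeasurable, ?_⟩
  refine (lintegral_mono (enorm_mop_le_lintegral g v)).trans_lt ?_
  rw [hg.lintegral_ker_mul hv.enorm]
  exact mul_lt_top ofReal_lt_top hi.hasFiniteIntegral

theorem eLpNorm_two_sq {α : Type*} [MeasurableSpace α] (μ : Measure α) (f : α → ℝ) :
    eLpNorm f 2 μ ^ 2 = ∫⁻ x, ‖f x‖ₑ ^ 2 ∂μ := by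
  have h := eLpNorm_nnreal_pow_eq_lintegral (f := f) (μ := μ) (p := 2) two_ne_zero
  simpa using h

/-- Young's inequality in `L²`. -/
theorem Wiener.l2_mop_le (hg : Wiener g) {v : V → ℝ} (hv : Measurable v) (hB : ∀ y, |v y| ≤ B) :
    eLpNorm (mop g v) 2 volume ≤ ofReal (wnorm g) * eLpNorm v 2 volume := by
  have hA := wnorm_nonneg g
  rw [← ENNReal.pow_le_pow_left_iff two_ne_zero, mul_pow, eLpNorm_two_sq, eLpNorm_two_sq, sq (ofReal _),
    mul_assoc, ← hg.lintegral_ker_mul (hv.enorm.pow_const 2), ← lintegral_const_mul' _ _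
      ofReal_ne_top]
  refine lintegral_mono fun x => ?_
  have h1 : Integrable fun y => |ker g (x - y)| := (hg.shift_int x).abs
  have hb : ∀ y, ‖|v y|‖ ≤ B := fun y => by rw [norm_eq_abs, abs_abs]; exact hB y
  have h2 : Integrable fun y => |ker g (x - y)| * |v y| :=
    h1.mul_bdd hv.abs.aestronglyMeasurable (ae_of_all _ hb)
  have h3 : Integrable fun y => |ker g (x - y)| * |v y| * |v y| :=
    h2.mul_bdd hv.abs.aestronglyMeasurable (ae_of_all _ hb)
  set a := ∫ y, |ker g (x - y)| * |v y| with ha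
  set A := wnorm g with hAd
  have hA1 : ∫ y, |ker g (x - y)| = A := Wiener.integral_abs_shift g x
  have ha0 : 0 ≤ a := integral_nonneg fun y => by positivity
  have hma : |mop g v x| ≤ a := by
    refine (abs_integral_le_integral_abs (f := fun y => ker g (x - y) * v y)).trans (le_of_eq ?_)
    simp only [abs_mul]; rfl
  have hsq : a ^ 2 ≤ A * ∫ y, |ker g (x - y)| * |v y| * |v y| := by
    rcases hA.eq_or_lt with h0 | h0
    · have h4 : a ≤ A * B := by
        rw [← hA1, ← integral_mul_const]
        exact integral_mono h2 (h1.mul_const B) fun y =>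
          mul_le_mul_of_nonneg_left (hB y) (abs_nonneg _)
      rw [← h0, zero_mul] at h4
      rw [← h0, zero_mul, le_antisymm h4 ha0]; norm_num
    · have h5 : 0 ≤ ∫ y, |ker g (x - y)| * (A * |v y| - a) ^ 2 :=
        integral_nonneg fun y => by positivity
      have e : ∀ y, |ker g (x - y)| * (A * |v y| - a) ^ 2 =
          A ^ 2 * (|ker g (x - y)| * |v y| * |v y|) - 2 * A * a * (|ker g (x - y)| * |v y|) +
            a ^ 2 * |ker g (x - y)| := fun y => by ring
      simp only [e] at h5
      have i3 := h3.const_mul (A ^ 2)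
      have i2 := h2.const_mul (2 * A * a)
      rw [integral_add (f := fun y => A ^ 2 * (|ker g (x - y)| * |v y| * |v y|) -
        2 * A * a * (|ker g (x - y)| * |v y|)) (i3.sub i2) (h1.const_mul _),
        integral_sub i3 i2, integral_const_mul, integral_const_mul,
        integral_const_mul, hA1, ← ha] at h5
      have h6 : 0 ≤ A * (A * (∫ y, |ker g (x - y)| * |v y| * |v y|) - a ^ 2) := by nlinarith
      linarith [nonneg_of_mul_nonneg_right h6 h0]
  have h7 : ∫⁻ y, ‖ker g (x - y)‖ₑ * ‖v y‖ₑ ^ 2 =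
      ofReal (∫ y, |ker g (x - y)| * |v y| * |v y|) := by
    rw [ofReal_integral_eq_lintegral_ofReal h3 (ae_of_all _ fun y => by positivity)]
    congr 1; ext y
    rw [ofReal_mul (by positivity), ofReal_mul (abs_nonneg _), ← norm_eq_abs,
      ← norm_eq_abs, ofReal_norm, ofReal_norm, mul_assoc, sq]
  rw [h7, ← ofReal_mul hA, ← ofReal_norm, ← ofReal_pow (norm_nonneg _)]
  refine ofReal_le_ofReal (le_trans ?_ hsq)
  exact pow_le_pow_left₀ (norm_nonneg _) hma 2

theorem ker_neg_symbol (g : V → ℂ) (x : V) : ker (fun ξ => g (-ξ)) x = ker g (-x) := by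
  simp only [ker]
  rw [sker_eq, sker_eq, ← integral_neg_eq_self]
  congr 2
  ext ν
  simp [smul_neg]

theorem Wiener.neg (hg : Wiener g) : Wiener fun ξ => g (-ξ) where
  cont := hg.cont.comp continuous_neg
  int := hg.int.comp_neg
  intK := by
    have h := hg.intK.comp_neg
    refine h.congr (ae_of_all _ fun x => ?_)
    simp only
    rw [sker_eq, sker_eq, ← integral_neg_eq_self]
    congr 1
    ext ν
    simp [smul_neg]
  herm ξ := hg.herm (-ξ)

theorem Wiener.adjoint (hg : Wiener g) {k : V → ℝ} (hk : Integrable k)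
    {v : V → ℝ} (hv : Measurable v) (hB : ∀ y, |v y| ≤ B) :
    ∫ y, k y * mop g v y = ∫ y, mop (fun ξ => g (-ξ)) k y * v y := by
  rw [hg.integral_mul_mop hk hv hB]
  congr 1; ext b
  congr 1
  rw [mop]
  congr 1; ext y
  rw [ker_neg_symbol, neg_sub, mul_comm]

section Hilbert

variable {H : Type*} [NormedAddCommGroup H] [InnerProductSpace ℝ H]

theorem norm_sum_sq_le_of_lacunary (s : Finset ℤ) (a : ℤ → H)
    (ha : ∀ i j, 2 ≤ |i - j| → inner ℝ (a i) (a j) = 0) :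
    ‖∑ j ∈ s, a j‖ ^ 2 ≤ 3 * ∑ j ∈ s, ‖a j‖ ^ 2 := by
  classical
  have hcard : ∀ i : ℤ, ∑ j ∈ s, (if |i - j| < 2 then (1 : ℝ) else 0) ≤ 3 := fun i => by
    rw [← Finset.sum_filter, Finset.sum_const, nsmul_eq_mul, mul_one]
    have : (s.filter fun j => |i - j| < 2) ⊆ Finset.Icc (i - 1) (i + 1) := fun j hj => by
      have := (Finset.mem_filter.1 hj).2
      rw [abs_lt] at this
      exact Finset.mem_Icc.2 ⟨by omega, by omega⟩
    have h2 := Finset.card_le_card this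
    rw [Int.card_Icc] at h2
    have h3 : (i + 1 + 1 - (i - 1)).toNat = 3 := by omega
    rw [h3] at h2
    exact_mod_cast h2
  have hterm : ∀ i j, inner ℝ (a i) (a j) ≤ (if |i - j| < 2 then (1 : ℝ) else 0) * (‖a i‖ ^ 2 / 2) +
        (if |j - i| < 2 then (1 : ℝ) else 0) * (‖a j‖ ^ 2 / 2) := fun i j => by
    rw [abs_sub_comm j i]
    split_ifs with h
    · have := real_inner_le_norm (a i) (a j)
      nlinarith [sq_nonneg (‖a i‖ - ‖a j‖)]
    · rw [ha i j (not_lt.1 h)]; simp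
  rw [← real_inner_self_eq_norm_sq, sum_inner]
  simp only [inner_sum]
  refine (sum_le_sum fun i _ => sum_le_sum fun j _ => hterm i j).trans ?_
  simp only [sum_add_distrib]
  rw [sum_comm (f := fun i j => (if |j - i| < 2 then (1 : ℝ) else 0) * (‖a j‖ ^ 2 / 2)),
    mul_sum, ← sum_add_distrib]
  refine sum_le_sum fun i _ => ?_
  simp only [← sum_mul]
  nlinarith [hcard i, sq_nonneg ‖a i‖]

theorem norm_sum_le_of_lacunary (s : Finset ℤ) (a b : ℤ → H) (F : H) {M : ℝ} (hM : 0 ≤ M)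
    (ha : ∀ i j, 2 ≤ |i - j| → inner ℝ (a i) (a j) = 0)
    (hb : ∀ i j, 2 ≤ |i - j| → inner ℝ (b i) (b j) = 0)
    (hab : ∀ j, ‖a j‖ ^ 2 = inner ℝ F (b j)) (hle : ∀ j, ‖b j‖ ≤ M * ‖a j‖) :
    ‖∑ j ∈ s, a j‖ ≤ 3 * M * ‖F‖ := by
  set X := ∑ j ∈ s, ‖a j‖ ^ 2 with hX
  have hX0 : 0 ≤ X := sum_nonneg fun j _ => by positivity
  have h1 : X ≤ ‖F‖ * ‖∑ j ∈ s, b j‖ := by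
    rw [hX, sum_congr rfl fun j _ => hab j, ← inner_sum]
    exact real_inner_le_norm _ _
  have h2 : ‖∑ j ∈ s, b j‖ ^ 2 ≤ 3 * M ^ 2 * X := by
    refine (norm_sum_sq_le_of_lacunary s b hb).trans ?_
    have h : ∑ j ∈ s, ‖b j‖ ^ 2 ≤ M ^ 2 * X := by
      rw [hX, mul_sum]
      refine sum_le_sum fun j _ => ?_
      rw [← mul_pow]
      exact pow_le_pow_left₀ (norm_nonneg _) (hle j) 2
    linarith
  have h3 := norm_sum_sq_le_of_lacunary s a ha
  have h4 : X ≤ 3 * M ^ 2 * ‖F‖ ^ 2 := by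
    rcases hX0.eq_or_lt with h0 | h0
    · rw [← h0]; positivity
    · have h5 : X * X ≤ (3 * M ^ 2 * ‖F‖ ^ 2) * X := by
        calc X * X ≤ (‖F‖ * ‖∑ j ∈ s, b j‖) * (‖F‖ * ‖∑ j ∈ s, b j‖) := by gcongr
          _ = ‖F‖ ^ 2 * ‖∑ j ∈ s, b j‖ ^ 2 := by ring
          _ ≤ ‖F‖ ^ 2 * (3 * M ^ 2 * X) := by gcongr
          _ = _ := by ring
      exact le_of_mul_le_mul_right h5 h0
  refine abs_le_of_sq_le_sq' ?_ (by positivity) |>.2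
  nlinarith

end Hilbert

theorem inner_toLp {f g : V → ℝ} (hf : MemLp f 2 volume) (hg : MemLp g 2 volume) :
    inner ℝ (hf.toLp f) (hg.toLp g) = ∫ x, f x * g x := by
  rw [L2.inner_def]
  refine integral_congr_ae ?_
  filter_upwards [hf.coeFn_toLp, hg.coeFn_toLp] with x h1 h2
  rw [h1, h2]
  simp [mul_comm]

theorem memLp_two_of_bdd {f : V → ℝ} (hf : Measurable f) (hi : Integrable f)
    (hB : ∀ y, |f y| ≤ B) : MemLp f 2 volume := by
  rw [memLp_two_iff_integrable_sq hf.aestronglyMeasurable]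
  simp only [sq]
  exact hi.mul_bdd hf.aestronglyMeasurable (ae_of_all _ hB)

/-- `L²` boundedness of sums of lacunary multipliers. -/
theorem l2_sum_mop_le {g : ℤ → V → ℂ} (hg : ∀ j, Wiener (g j))
    (h0 : ∀ i j, 2 ≤ |i - j| → ∀ ξ, g i ξ * g j ξ = 0) {M : ℝ} (hM : ∀ j, wnorm (g j) ≤ M)
    {f : V → ℝ} (hf : Measurable f) (hi : Integrable f) (hB : ∀ y, |f y| ≤ B)
    (s : Finset ℤ) : eLpNorm (fun x => ∑ j ∈ s, mop (g j) f x) 2 volume ≤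
      ofReal (3 * M) * eLpNorm f 2 volume := by
  have hM0 : 0 ≤ M := (wnorm_nonneg _).trans (hM 0)
  have mem : ∀ {k : V → ℂ}, Wiener k → MemLp (mop k f) 2 volume := fun {k} hk =>
    memLp_two_of_bdd (measurable_mop hk.int hf) (hk.integrable_mop hf hi) (hk.abs_mop_le hB)
  have hF := memLp_two_of_bdd hf hi hB
  have hmul : ∀ {k l : V → ℂ}, Wiener k → Wiener l →
      ∫ x, mop k f x * mop l f x = ∫ x, mop (fun ξ => l (-ξ) * k ξ) f x * f x := by
    intro k l hk hl
    rw [hl.adjoint (hk.integrable_mop hf hi) hf hB]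
    congr 1; ext x
    rw [hl.neg.mop_mop hk hf hB]
  have horth : ∀ {k l : V → ℂ}, Wiener k → Wiener l → (∀ ξ, k ξ * l ξ = 0) →
      ∫ x, mop k f x * mop l f x = 0 := by
    intro k l hk hl h
    have e : (fun ξ => l (-ξ) * k ξ) = fun _ => 0 := by
      ext ξ
      rw [hl.herm]
      rcases mul_eq_zero.1 (h ξ) with h | h <;> simp [h]
    rw [hmul hk hl, e]
    simp [mop, ker, sker_eq]
  set h : ℤ → V → ℂ := fun j ξ => g j (-ξ) * g j ξ
  have hh : ∀ j, Wiener (h j) := fun j => (hg j).neg.mul (hg j)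
  have hab : ∀ j, mop (h j) f = mop (fun ξ => g j (-ξ)) (mop (g j) f) := fun j => by
    ext x; rw [(hg j).neg.mop_mop (hg j) hf hB]
  have key := norm_sum_le_of_lacunary s (fun j => (mem (hg j)).toLp _)
    (fun j => (mem (hh j)).toLp _) (hF.toLp f) hM0
    (fun i j hij => by rw [inner_toLp]; exact horth (hg i) (hg j) (h0 i j hij)) (fun i j hij => by
      rw [inner_toLp]
      refine horth (hh i) (hh j) fun ξ => ?_
      have := h0 i j hij ξ
      simp only [h]
      linear_combination (g i (-ξ) * g j (-ξ)) * this)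
    (fun j => by
      rw [← real_inner_self_eq_norm_sq, inner_toLp, inner_toLp, hmul (hg j) (hg j)]
      simp only [mul_comm, h])
    (fun j => by
      rw [Lp.norm_toLp, Lp.norm_toLp, ← ENNReal.toReal_ofReal hM0, ← toReal_mul]
      refine toReal_mono (mul_ne_top ofReal_ne_top (mem (hg j)).2.ne) ?_
      rw [hab]
      refine ((hg j).neg.l2_mop_le (measurable_mop (hg j).int hf)
        ((hg j).abs_mop_le hB)).trans (mul_le_mul_left (ofReal_le_ofReal ?_) _)
      refine le_trans (le_of_eq ?_) (hM j)
      simp only [wnorm, ker_neg_symbol]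
      exact integral_neg_eq_self (fun x => |ker (g j) x|) volume)
  have hsum : MemLp (fun x => ∑ j ∈ s, mop (g j) f x) 2 volume :=
    memLp_finsetSum s fun j _ => mem (hg j)
  have e : ∑ j ∈ s, (mem (hg j)).toLp _ = hsum.toLp _ := by
    refine Lp.ext ?_
    have h1 : ∀ᵐ x, ∀ j ∈ s, (mem (hg j)).toLp (mop (g j) f) x = mop (g j) f x :=
      (Finset.eventually_all s).2 fun j _ => (mem (hg j)).coeFn_toLp
    filter_upwards [Lp.coeFn_finsetSum s fun j => (mem (hg j)).toLp (mop (g j) f),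
      hsum.coeFn_toLp, h1] with x h2 h3 h4
    rw [h2, h3, Finset.sum_apply]
    exact sum_congr rfl h4
  rw [e, Lp.norm_toLp, Lp.norm_toLp, ← ENNReal.toReal_ofReal (by positivity : 0 ≤ 3 * M),
    ← toReal_mul] at key
  exact (ENNReal.toReal_le_toReal hsum.2.ne (mul_ne_top ofReal_ne_top hF.2.ne)).1 key

/-- The symbol `m(ξ) φ(2^{-j} ξ)` with `m` homogeneous of degree zero is a rescaled function. -/
theorem Hom.bsym_zero_scale {m : V → ℂ} (hm : Hom 0 m) (χ : V → ℂ) (j : ℤ) :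
    bsym m 0 χ j = fun ξ => bsym m 0 χ 0 ((2 : ℝ) ^ (-j) • ξ) := by
  ext ξ
  rw [hm.bsym_eq, hm.bsym_eq]
  simp [hsym]

theorem Hom.integrable_moment (_ : Hom σ m.1) (ψ : LP) (j : ℤ) :
    Integrable fun w : V => ‖w‖ * |ker (bsym m.1 0 ψ.ph j) w| := by
  have h := ((lpKernel ψ m j 0).integrable_pow_mul volume 1).comp_neg
  refine h.congr (ae_of_all _ fun w => ?_)
  simp only [pow_one, norm_neg, lpKernel_apply, zero_sub, neg_neg, norm_eq_abs]
  congr 3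
  ext ξ
  rw [bsym, phc, ψ.phi_eq]
  simp [hsym]

theorem integral_moment_scale (g : V → ℂ) (hc : 0 < c) :
    ∫ w, ‖w‖ * |ker (fun ξ => g (c • ξ)) w| = c * ∫ w, ‖w‖ * |ker g w| := by
  have e : ∀ w : V, ‖w‖ * |ker (fun ξ => g (c • ξ)) w| =
      (c * (c ^ d)⁻¹) * (‖c⁻¹ • w‖ * |ker g (c⁻¹ • w)|) := fun w => by
    rw [ker_scale g hc, norm_smul, abs_mul, abs_of_pos (by positivity : 0 < (c ^ d)⁻¹),
      norm_of_nonneg (by positivity)]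
    field_simp
  simp only [e]
  rw [integral_const_mul, Measure.integral_comp_smul volume (fun w : V => ‖w‖ * |ker g w|),
    finrank_euclideanSpace_fin, smul_eq_mul, abs_of_pos (by positivity), inv_pow, inv_inv,
    ← mul_assoc, mul_assoc c, inv_mul_cancel₀ (by positivity), mul_one]

theorem summable_two_zpow_neg_abs : Summable fun j : ℤ => (2 : ℝ) ^ (-|j|) := by
  refine Summable.of_nat_of_neg ?_ ?_
  · refine (summable_geometric_two).congr fun n => ?_
    simp [zpow_neg]
  · refine (summable_geometric_two).congr fun n => ?_
    simp [zpow_neg]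

theorem mop_sub_right (hg : Wiener g) {u v : V → ℝ} (hu : Measurable u)
    (hv : Measurable v) {B B' : ℝ} (hB : ∀ y, |u y| ≤ B) (hB' : ∀ y, |v y| ≤ B') (x : V) :
    mop g (fun y => u y - v y) x = mop g u x - mop g v x := by
  unfold mop
  simp only [mul_sub]
  exact integral_sub (hg.mul_bdd_int hu hB x) (hg.mul_bdd_int hv hB' x)

theorem mop_add_right (hg : Wiener g) {u v : V → ℝ} (hu : Measurable u)
    (hv : Measurable v) {B B' : ℝ} (hB : ∀ y, |u y| ≤ B) (hB' : ∀ y, |v y| ≤ B') (x : V) :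
    mop g (fun y => u y + v y) x = mop g u x + mop g v x := by
  unfold mop
  simp only [mul_add]
  exact integral_add (hg.mul_bdd_int hu hB x) (hg.mul_bdd_int hv hB' x)

theorem mop_sum_right {ι : Type*} (hg : Wiener g) (s : Finset ι) {u : ι → V → ℝ}
    (hu : ∀ i, Measurable (u i)) {B : ι → ℝ} (hB : ∀ i y, |u i y| ≤ B i) (x : V) :
    mop g (fun y => ∑ i ∈ s, u i y) x = ∑ i ∈ s, mop g (u i) x := by
  unfold mop
  simp only [mul_sum]
  exact integral_finsetSum s fun i _ =>
    hg.mul_bdd_int (hu i) (hB i) x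

theorem mop_neg_right (g : V → ℂ) (u : V → ℝ) (x : V) : mop g (fun y => -u y) x = -mop g u x := by
  unfold mop
  simp only [mul_neg]
  exact integral_neg _

theorem volume_ball_eq (x : V) (r : ℝ) : volume (ball x r) = volume (ball (0 : V) r) :=
  Measure.addHaar_ball_center volume x r

/-- Uniform local `L²` bounds for high frequency sums. -/
theorem Hom.local_l2_le (hm : Hom 0 m.1) (ψ : LP) (B : ℝ) :
    ∃ C : ℝ≥0∞, C < ⊤ ∧ ∀ u : V → ℝ, Measurable u → (∀ y, |u y| ≤ B) → ∀ s : Finset ℤ,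
      (∀ j ∈ s, 0 ≤ j) → ∀ x₀ : V, eLpNorm (fun x => ∑ j ∈ s, mop (bsym m.1 0 ψ.ph j) u x) 2
        (volume.restrict (ball x₀ 1)) ≤ C := by
  obtain ⟨M, -, hM⟩ := hm.block_bound ψ.annular_ph ψ.ph_herm
  set g : ℤ → V → ℂ := fun j => bsym m.1 0 ψ.ph j with hgdef
  have hg : ∀ j, Wiener (g j) := fun j => (hM j 0 le_rfl).1
  have hgM : ∀ j, wnorm (g j) ≤ M := fun j => by simpa using (hM j 0 le_rfl).2.1
  have h0 : ∀ i j, 2 ≤ |i - j| → ∀ ξ, g i ξ * g j ξ = 0 := fun i j hij ξ => by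
    have := phc_mul_phc' ψ (i := i) (j := j) (by rintro rfl; simp at hij) (by rintro rfl; simp at hij)
      (by rintro rfl; simp at hij) ξ
    rw [phc, phc, ψ.phi_eq, ψ.phi_eq] at this
    simp only [g, bsym]
    linear_combination (m.1 ξ * hsym 0 ξ * (m.1 ξ * hsym 0 ξ)) * this
  set K := ∫ w, ‖w‖ * |ker (g 0) w| with hK
  have hK0 : 0 ≤ K := integral_nonneg fun w => by positivity
  have hKj : ∀ j, ∫ w, ‖w‖ * |ker (g j) w| = (2 : ℝ) ^ (-j) * K := fun j => by
    rw [hK, ← integral_moment_scale _ (two_zpow_pos _)]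
    simp only [g]
    rw [hm.bsym_zero_scale ψ.ph j]
  set Y : ℝ → ℝ≥0∞ := fun r => volume (ball (0 : V) r) ^ (2 : ℝ)⁻¹ with hV
  have hVt : ∀ r, Y r < ⊤ := fun r => ENNReal.rpow_lt_top_of_nonneg (by norm_num) measure_ball_lt_top.ne
  set T := ∑' j : ℤ, (2 : ℝ) ^ (-|j|) with hT
  refine ⟨ofReal (3 * M) * (Y 2 * ofReal B) + Y 1 * ofReal (B * (T * K)),
    add_lt_top.2 ⟨mul_lt_top ofReal_lt_top (mul_lt_top (hVt 2)
      ofReal_lt_top), mul_lt_top (hVt 1) ofReal_lt_top⟩, ?_⟩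
  intro u hu hB s hs x₀
  have hB0 : 0 ≤ B := (abs_nonneg _).trans (hB 0)
  set f : V → ℝ := (ball x₀ 2).indicator u with hf
  have hfm : Measurable f := hu.indicator measurableSet_ball
  have hfB : ∀ y, |f y| ≤ B := fun y => by
    by_cases hy : y ∈ ball x₀ 2 <;> simp [hf, hy, hB y, hB0]
  have hfi : Integrable f := by
    rw [hf, integrable_indicator_iff measurableSet_ball]
    exact Measure.integrableOn_of_bounded (M := B) measure_ball_lt_top.ne hu.aestronglyMeasurable
      (ae_of_all _ hB)
  set f' : V → ℝ := fun y => u y - f y with hf'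
  have hf'm : Measurable f' := hu.sub hfm
  have hf'v : ∀ y, |f' y| ≤ B ∧ (y ∈ ball x₀ 2 → f' y = 0) := fun y => by
    by_cases hy : y ∈ ball x₀ 2 <;> simp [hf', hf, hy, hB y, hB0]
  have hsplit : (fun x => ∑ j ∈ s, mop (g j) u x) =
      (fun x => ∑ j ∈ s, mop (g j) f x) + fun x => ∑ j ∈ s, mop (g j) f' x := by
    ext x
    rw [Pi.add_apply, ← sum_add_distrib]
    refine sum_congr rfl fun j _ => ?_
    rw [hf', mop_sub_right (hg j) hu hfm hB hfB]
    ring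
  have hmeas : ∀ {v : V → ℝ}, Measurable v →
      Measurable fun x => ∑ j ∈ s, mop (g j) v x := fun {v} hv =>
    Finset.measurable_fun_sum s fun j _ => measurable_mop (hg j).int hv
  rw [hsplit]
  refine (eLpNorm_add_le (hmeas hfm).aestronglyMeasurable (hmeas hf'm).aestronglyMeasurable
    (by norm_num)).trans (add_le_add ?_ ?_)
  · refine (eLpNorm_mono_measure _ Measure.restrict_le_self).trans
      ((l2_sum_mop_le hg h0 hgM hfm hfi hfB s).trans (mul_le_mul_right ?_ _))
    rw [hf, eLpNorm_indicator_eq_eLpNorm_restrict measurableSet_ball]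
    refine (eLpNorm_le_of_ae_bound (ae_of_all _ hB)).trans (le_of_eq ?_)
    rw [Measure.restrict_apply_univ, volume_ball_eq]
    simp [hV]
  · have hpt : ∀ᵐ x ∂(volume.restrict (ball x₀ 1)), ‖∑ j ∈ s, mop (g j) f' x‖ ≤ B * (T * K) := by
      filter_upwards [ae_restrict_mem measurableSet_ball] with x hx
      have hj : ∀ j ∈ s, ‖mop (g j) f' x‖ ≤ B * ((2 : ℝ) ^ (-|j|) * K) := fun j hjs => by
        rw [abs_of_nonneg (hs j hjs), ← hKj, ← integral_sub_left_eq_self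
          (fun w => ‖w‖ * |ker (g j) w|) volume x, ← integral_const_mul]
        refine norm_integral_le_of_norm_le (((hm.integrable_moment ψ j).comp_sub_left x).const_mul B)
          (ae_of_all _ fun y => ?_)
        rw [norm_mul]
        by_cases hy : y ∈ ball x₀ 2
        · rw [(hf'v y).2 hy, norm_zero, mul_zero]; positivity
        · have h1 : 1 ≤ ‖x - y‖ := by
            rw [Metric.mem_ball] at hx hy
            have := dist_triangle y x x₀
            rw [← dist_eq_norm, dist_comm]
            linarith
          calc ‖ker (g j) (x - y)‖ * ‖f' y‖ ≤ (‖x - y‖ * |ker (g j) (x - y)|) * B := by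
                refine mul_le_mul ?_ (hf'v y).1 (norm_nonneg _) (by positivity)
                rw [norm_eq_abs]
                exact le_mul_of_one_le_left (abs_nonneg _) h1
            _ = _ := mul_comm _ _
      refine (norm_sum_le _ _).trans ((sum_le_sum hj).trans ?_)
      rw [← mul_sum, ← sum_mul]
      refine mul_le_mul_of_nonneg_left (mul_le_mul_of_nonneg_right ?_ hK0) hB0
      exact summable_two_zpow_neg_abs.sum_le_tsum s fun j _ => (two_zpow_pos _).le
    refine (eLpNorm_le_of_ae_bound hpt).trans (le_of_eq ?_)
    rw [Measure.restrict_apply_univ, volume_ball_eq]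
    simp [hV]

/-- The weight `(1 + |x|)^{-(d + 3)}`. -/
def wt (x : V) : ℝ≥0∞ := ofReal ((1 + ‖x‖) ^ (-((d : ℝ) + 3)))

theorem measurable_wt : Measurable (wt (d := d)) := by unfold wt; fun_prop

theorem lintegral_wt_lt_top : ∫⁻ x : V, wt x < ⊤ :=
  finite_integral_one_add_norm (by rw [finrank_euclideanSpace_fin]; linarith)

theorem wt_le {x y : V} (h : y ∈ ball x 1) : wt y ≤ ofReal (2 ^ ((d : ℝ) + 3)) * wt x := by
  rw [wt, wt, ← ofReal_mul (by positivity)]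
  refine ofReal_le_ofReal ?_
  have hx : 0 < 1 + ‖x‖ := by positivity
  have hy : 0 < 1 + ‖y‖ := by positivity
  have h1 : (1 + ‖x‖) / 2 ≤ 1 + ‖y‖ := by
    have h2 : ‖x‖ ≤ ‖y‖ + dist y x := by
      rw [dist_comm, dist_eq_norm]
      linarith [norm_sub_norm_le x y]
    rw [Metric.mem_ball] at h
    linarith [norm_nonneg y]
  have h3 := Real.rpow_le_rpow_of_nonpos (by positivity) h1
    (by have : (0 : ℝ) ≤ d := Nat.cast_nonneg d
        linarith : -((d : ℝ) + 3) ≤ 0)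
  refine h3.trans (le_of_eq ?_)
  rw [Real.div_rpow hx.le zero_le_two, Real.rpow_neg zero_le_two, div_inv_eq_mul, mul_comm]

/-- A weighted integral is bounded by the supremum of the integrals over unit balls. -/
theorem exists_lintegral_wt_le (d : ℕ) : ∃ A : ℝ≥0∞, A < ⊤ ∧ ∀ (h : E d → ℝ≥0∞), Measurable h →
    ∀ C : ℝ≥0∞, (∀ x₀, ∫⁻ y in ball x₀ 1, h y ≤ C) → ∫⁻ y, wt y * h y ≤ A * C := by
  set c := volume (ball (0 : E d) 1) with hc
  have hc0 : c ≠ 0 := (Metric.measure_ball_pos volume 0 one_pos).ne'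
  have hct : c ≠ ⊤ := measure_ball_lt_top.ne
  set D := ofReal (2 ^ ((d : ℝ) + 3))
  refine ⟨c⁻¹ * (D * ∫⁻ x : E d, wt x), mul_lt_top (ENNReal.inv_lt_top.2
    (pos_iff_ne_zero.2 hc0)) (mul_lt_top ofReal_lt_top lintegral_wt_lt_top), fun h hh C hC => ?_⟩
  have hS : MeasurableSet {p : E d × E d | p.2 ∈ ball p.1 1} :=
    measurableSet_lt (f := fun p : E d × E d => dist p.2 p.1) (by fun_prop) measurable_const
  have hm : Measurable (uncurry fun x y : E d =>
      (ball x 1).indicator (fun y => D * wt x * h y) y) :=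
    (((measurable_const.mul (measurable_wt.comp measurable_fst)).mul
      (hh.comp measurable_snd))).indicator hS
  have key : c * ∫⁻ y, wt y * h y ≤ (D * ∫⁻ x : E d, wt x) * C := by
    calc c * ∫⁻ y, wt y * h y = ∫⁻ y, c * (wt y * h y) :=
          (lintegral_const_mul _ (measurable_wt.mul hh)).symm
      _ ≤ ∫⁻ y, ∫⁻ x, (ball x 1).indicator (fun y => D * wt x * h y) y := by
          refine lintegral_mono fun y => ?_
          rw [hc, ← volume_ball_eq y, ← setLIntegral_one, ← lintegral_indicator measurableSet_ball,
            ← lintegral_mul_const _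
              ((measurable_const (a := (1 : ℝ≥0∞))).indicator measurableSet_ball)]
          refine lintegral_mono fun x => ?_
          by_cases hx : x ∈ ball y 1
          · have hy : y ∈ ball x 1 := Metric.mem_ball_comm.1 hx
            simp only [indicator_of_mem hx, indicator_of_mem hy, one_mul]
            exact mul_le_mul_left (wt_le hy) _
          · simp [indicator_of_notMem hx]
      _ = ∫⁻ x, ∫⁻ y, (ball x 1).indicator (fun y => D * wt x * h y) y :=
          (lintegral_lintegral_swap hm.aemeasurable).symm
      _ ≤ ∫⁻ x, D * wt x * C := by
          refine lintegral_mono fun x => ?_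
          rw [lintegral_indicator measurableSet_ball, lintegral_const_mul _ hh]
          exact mul_le_mul_right (hC x) _
      _ = _ := by
          rw [lintegral_mul_const _ (measurable_wt.const_mul D), lintegral_const_mul _ measurable_wt]
  calc ∫⁻ y, wt y * h y = c⁻¹ * (c * ∫⁻ y, wt y * h y) := by
        rw [← mul_assoc, ENNReal.inv_mul_cancel hc0 hct, one_mul]
    _ ≤ c⁻¹ * ((D * ∫⁻ x : E d, wt x) * C) := mul_le_mul_right key _
    _ = _ := (mul_assoc _ _ _).symm

/-- The finite measure with density `wt`. -/
def wmeas (d : ℕ) : Measure (E d) := volume.withDensity wt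

theorem isFiniteMeasure_wmeas : IsFiniteMeasure (wmeas d) :=
  isFiniteMeasure_withDensity lintegral_wt_lt_top.ne

theorem lintegral_wmeas {h : V → ℝ≥0∞} (hh : Measurable h) :
    ∫⁻ x, h x ∂(wmeas d) = ∫⁻ x, wt x * h x :=
  lintegral_withDensity_eq_lintegral_mul _ measurable_wt hh

/-- Almost everywhere convergence of a sequence bounded in `L²` of a finite measure. -/
theorem tendsto_eLpNorm_one_of_bounded_two {α : Type*} [MeasurableSpace α] {μ : Measure α}
    [IsFiniteMeasure μ] {f : ℕ → α → ℝ} {h : α → ℝ} (hf : ∀ n, AEStronglyMeasurable (f n) μ)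
    (hh : MemLp h 1 μ) {C : ℝ≥0∞} (hC : C < ⊤) (hb : ∀ n, eLpNorm (f n) 2 μ ≤ C)
    (hlim : ∀ᵐ x ∂μ, Tendsto (fun n => f n x) atTop (𝓝 (h x))) :
    Tendsto (fun n => eLpNorm (f n - h) 1 μ) atTop (𝓝 0) := by
  refine tendsto_Lp_finite_of_tendsto_ae le_rfl ENNReal.one_ne_top hf hh (fun ε hε => ?_) hlim
  refine ⟨(ε / (C.toReal + 1)) ^ 2, by positivity, fun n s hs hμ => ?_⟩
  rw [eLpNorm_indicator_eq_eLpNorm_restrict hs]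
  refine (eLpNorm_le_eLpNorm_mul_rpow_measure_univ (q := 2) (by norm_num) (hf n).restrict).trans ?_
  rw [Measure.restrict_apply_univ]
  have e : (1 / (1 : ℝ≥0∞).toReal - 1 / (2 : ℝ≥0∞).toReal) = (2 : ℝ)⁻¹ := by norm_num
  have h1 : μ s ^ (2 : ℝ)⁻¹ ≤ ofReal (ε / (C.toReal + 1)) := by
    refine (ENNReal.rpow_le_rpow hμ (by norm_num)).trans (le_of_eq ?_)
    rw [ofReal_pow (by positivity), ← ENNReal.rpow_natCast, ← ENNReal.rpow_mul]
    norm_num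
  rw [e]
  calc _ ≤ C * ofReal (ε / (C.toReal + 1)) :=
        mul_le_mul' ((eLpNorm_mono_measure _ Measure.restrict_le_self).trans (hb n)) h1
    _ = ofReal (C.toReal * (ε / (C.toReal + 1))) := by
        rw [ofReal_mul toReal_nonneg, ENNReal.ofReal_toReal hC.ne]
    _ ≤ ofReal ε := by
        refine ofReal_le_ofReal ?_
        have := toReal_nonneg (a := C)
        rw [mul_div_assoc', div_le_iff₀ (by positivity)]
        nlinarith

theorem eLpNorm_wmeas_linear_lt_top (A : ℝ) :
    eLpNorm (fun x : V => A * (1 + ‖x‖)) 2 (wmeas d) < ⊤ := by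
  have h1 : eLpNorm (fun x : V => A * (1 + ‖x‖)) 2 (wmeas d) ^ 2 < ⊤ := by
    rw [eLpNorm_two_sq, lintegral_wmeas (by fun_prop)]
    have e : ∀ x : V, wt x * ‖A * (1 + ‖x‖)‖ₑ ^ 2 =
        ofReal (A ^ 2) * ofReal ((1 + ‖x‖) ^ (-((d : ℝ) + 1))) := fun x => by
      have hx : 0 < 1 + ‖x‖ := by positivity
      rw [wt, ← ofReal_norm, ← ofReal_pow (norm_nonneg _), ← ofReal_mul (by positivity),
        ← ofReal_mul (by positivity), norm_eq_abs, sq_abs, mul_pow]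
      congr 1
      have : (1 + ‖x‖) ^ (-((d : ℝ) + 1)) = (1 + ‖x‖) ^ (-((d : ℝ) + 3)) * (1 + ‖x‖) ^ 2 := by
        rw [← Real.rpow_natCast, ← rpow_add hx]
        congr 1; push_cast; ring
      rw [this]; ring
    simp only [e]
    rw [lintegral_const_mul' _ _ ofReal_ne_top]
    exact mul_lt_top ofReal_lt_top
      (finite_integral_one_add_norm (by rw [finrank_euclideanSpace_fin]; linarith))
  by_contra h
  rw [not_lt_top_iff.1 h] at h1
  simp at h1

theorem Hom.wmeas_l2_le (hm : Hom 0 m.1) (ψ : LP) (B : ℝ) :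
    ∃ C : ℝ≥0∞, C < ⊤ ∧ ∀ u : V → ℝ, Measurable u → (∀ y, |u y| ≤ B) → ∀ s : Finset ℤ,
      (∀ j ∈ s, 0 ≤ j) →
      eLpNorm (fun x => ∑ j ∈ s, mop (bsym m.1 0 ψ.ph j) u x) 2 (wmeas d) ≤ C := by
  obtain ⟨C, hC, h⟩ := hm.local_l2_le ψ B
  obtain ⟨A, hA, h'⟩ := exists_lintegral_wt_le d
  refine ⟨1 + A * C ^ 2, add_lt_top.2 ⟨ENNReal.one_lt_top, mul_lt_top hA
    (ENNReal.pow_lt_top hC)⟩, fun u hu hB s hs => ?_⟩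
  have hmeas : Measurable fun x => ∑ j ∈ s, mop (bsym m.1 0 ψ.ph j) u x :=
    Finset.measurable_fun_sum s fun j _ => measurable_mop (hm.wiener_bsym ψ j le_rfl).int hu
  set X := eLpNorm (fun x => ∑ j ∈ s, mop (bsym m.1 0 ψ.ph j) u x) 2 (wmeas d) with hX
  have h1 : X ^ 2 ≤ A * C ^ 2 := by
    rw [hX, eLpNorm_two_sq, lintegral_wmeas (hmeas.enorm.pow_const 2)]
    refine h' _ (hmeas.enorm.pow_const 2) _ fun x₀ => ?_
    rw [← eLpNorm_two_sq]
    exact pow_le_pow_left₀ (zero_le) (h u hu hB s hs x₀) 2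
  rcases le_total X 1 with h2 | h2
  · exact h2.trans le_self_add
  · exact (le_self_pow₀ h2 two_ne_zero).trans (h1.trans le_add_self)

theorem exists_ker_le_wt (ψ : LP) (m : Symbol d) (j : ℤ) (x : V) : ∃ C : ℝ≥0, ∀ y,
    ‖ker (fun ξ => m.1 ξ * ψ.phc j ξ) (x - y)‖ₑ ≤ C * wt y := by
  set κ := lpKernel ψ m j x
  set C := 2 ^ (d + 3) * (Finset.Iic (d + 3, 0)).sup (fun m => SchwartzMap.seminorm ℝ m.1 m.2) κ
    with hC
  have hC0 : 0 ≤ C := by rw [hC]; positivity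
  refine ⟨C.toNNReal, fun y => ?_⟩
  have h1 := SchwartzMap.one_add_le_sup_seminorm_apply (𝕜 := ℝ) (m := (d + 3, 0)) (k := d + 3)
    (n := 0) le_rfl le_rfl κ y
  rw [norm_iteratedFDeriv_zero] at h1
  rw [← lpKernel_apply, ← ofReal_norm, wt]
  change _ ≤ ofReal C * _
  rw [← ofReal_mul hC0]
  refine ofReal_le_ofReal ?_
  have hy : 0 < 1 + ‖y‖ := by positivity
  have e : (1 + ‖y‖) ^ (-((d : ℝ) + 3)) = ((1 + ‖y‖) ^ (d + 3))⁻¹ := by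
    rw [Real.rpow_neg hy.le, ← Real.rpow_natCast]
    push_cast; rfl
  rw [e, ← div_eq_mul_inv, le_div_iff₀ (by positivity), mul_comm]
  exact h1

/-- Frequency localization of a dyadic sum. -/
theorem Hom.sum_mop_phc {m : V → ℂ} (hm : Hom σ m) (ψ : LP)
    (hu : Measurable u) (hB : ∀ y, |u y| ≤ B) (i : ℤ) {s : Finset ℤ}
    (h1 : i - 1 ∈ s) (h2 : i ∈ s) (h3 : i + 1 ∈ s) (x : V) :
    ∑ j ∈ s, mop (ψ.phc i) (mop (bsym m 0 ψ.ph j) u) x = mop (bsym m 0 ψ.ph i) u x := by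
  have hW := fun j => hm.wiener_bsym ψ j (le_refl 0)
  have hP := wiener_phc ψ i
  have e : ∀ j, mop (ψ.phc i) (mop (bsym m 0 ψ.ph j) u) x =
      mop (fun ξ => ψ.phc i ξ * bsym m 0 ψ.ph j ξ) u x := fun j => hP.mop_mop (hW j) hu hB x
  have hsub : ({i - 1, i, i + 1} : Finset ℤ) ⊆ s := by
    intro j hj
    simp only [Finset.mem_insert, Finset.mem_singleton] at hj
    rcases hj with rfl | rfl | rfl <;> assumption
  rw [← Finset.sum_subset hsub fun j _ hj => ?_]
  · rw [sum_insert (by simp; lia), sum_insert (by simp), sum_singleton, e, e, e,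
      ← (hP.mul (hW _)).mop_add (hP.mul (hW _)) hu hB,
      ← (hP.mul (hW _)).mop_add ((hP.mul (hW _)).add (hP.mul (hW _))) hu hB]
    conv_rhs => rw [bsym_ph_eq ψ m 0 i, bsym_fat_eq]
    congr 1; ext ξ
    ring
  · rw [e]
    simp only [Finset.mem_insert, Finset.mem_singleton, not_or] at hj
    have h0 : (fun ξ => ψ.phc i ξ * bsym m 0 ψ.ph j ξ) = fun _ => 0 := by
      ext ξ
      have := phc_mul_phc' ψ hj.1 hj.2.1 hj.2.2 ξ
      rw [phc, phc, ψ.phi_eq, ψ.phi_eq] at this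
      rw [phc, ψ.phi_eq, bsym]
      linear_combination (m ξ * hsym 0 ξ) * this
    rw [h0]
    simp [mop, ker, sker_eq]

/-- If the dyadic sum of a zeroth order multiplier applied to bounded functions converges almost
everywhere to a bounded function, then its terms are the dyadic blocks of the sum. -/
theorem del_eq_of_hasSum (ψ : LP) {m : Fin d → Symbol d} (hm : ∀ k, Hom 0 (m k).1)
    {u : Fin d → V → ℝ} (hu : ∀ k, Measurable (u k)) (hB : ∀ k y, |u k y| ≤ B)
    {h : V → ℝ} (hh : Measurable h) {B' : ℝ} (hB' : ∀ y, |h y| ≤ B')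
    (hs : ∀ᵐ x, HasSum (fun j : ℤ => ∑ k, mop (bsym (m k).1 0 ψ.ph j) (u k) x) (h x))
    (i : ℤ) (x : V) : ψ.del i h x = ∑ k, mop (bsym (m k).1 0 ψ.ph i) (u k) x := by
  have := isFiniteMeasure_wmeas (d := d)
  have hW := fun k j => (hm k).wiener_bsym ψ j (le_refl 0)
  set T : Fin d → ℤ → V → ℝ := fun k j => mop (bsym (m k).1 0 ψ.ph j) (u k) with hT
  have hTm : ∀ k j, Measurable (T k j) := fun k j => measurable_mop (hW k j).int (hu k)
  have hTB : ∀ k j y, |T k j y| ≤ wnorm (bsym (m k).1 0 ψ.ph j) * B := fun k j y =>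
    (hW k j).abs_mop_le (hB k) y
  set b : ℤ → V → ℝ := fun j x => ∑ k, T k j x with hb
  have hbm : ∀ j, Measurable (b j) := fun j => Finset.measurable_fun_sum _ fun k _ => hTm k j
  have hbB : ∀ j y, |b j y| ≤ ∑ k, wnorm (bsym (m k).1 0 ψ.ph j) * B := fun j y =>
    (Finset.abs_sum_le_sum_abs _ _).trans (sum_le_sum fun k _ => hTB k j y)
  set S : ℕ → V → ℝ := fun N x => ∑ j ∈ Finset.Icc (-(N : ℤ)) N, b j x with hS
  have hSm : ∀ N, Measurable (S N) := fun N => Finset.measurable_fun_sum _ fun j _ => hbm j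
  have hSB : ∀ N y, |S N y| ≤ ∑ j ∈ Finset.Icc (-(N : ℤ)) N,
      ∑ k, wnorm (bsym (m k).1 0 ψ.ph j) * B := fun N y =>
    (Finset.abs_sum_le_sum_abs _ _).trans (sum_le_sum fun j _ => hbB j y)
  -- low frequencies
  choose L hL0 hL using fun k => (hm k).block_lipschitz ψ
  set C₁ := ∑ k, L k * B with hC₁
  have hlip : ∀ j x x', |b j x - b j x'| ≤ C₁ * (2 : ℝ) ^ j * ‖x - x'‖ := fun j x x' => by
    simp only [hb]
    rw [← Finset.sum_sub_distrib, hC₁, sum_mul, sum_mul]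
    refine (Finset.abs_sum_le_sum_abs _ _).trans (sum_le_sum fun k _ => ?_)
    have := hL k j (u k) (hu k) B (hB k) x x'
    rw [zpow_zero, one_mul] at this
    exact this.trans_eq (by ring)
  obtain ⟨x₀, hx₀⟩ := hs.exists
  set A := ∑' j, |b j x₀|
  have hA : Summable fun j => |b j x₀| := hx₀.summable.abs
  set T₀ := ∑' j : ℤ, (2 : ℝ) ^ (-|j|)
  have hT₀ : 0 ≤ T₀ := tsum_nonneg fun j => (two_zpow_pos _).le
  have hC₁' : 0 ≤ C₁ := sum_nonneg fun k _ => mul_nonneg (hL0 k) ((abs_nonneg _).trans (hB k 0))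
  have hlow : ∀ s : Finset ℤ, (∀ j ∈ s, j < 0) → ∀ x, |∑ j ∈ s, b j x| ≤
      (A + C₁ * T₀ * (1 + ‖x₀‖)) * (1 + ‖x‖) := fun s hsn x => by
    have hA0 : 0 ≤ A := tsum_nonneg fun j => abs_nonneg _
    have h1 : ∀ j ∈ s, |b j x| ≤ |b j x₀| + C₁ * ‖x - x₀‖ * (2 : ℝ) ^ (-|j|) := fun j hj => by
      rw [abs_of_neg (hsn j hj), neg_neg]
      linarith [abs_sub_abs_le_abs_sub (b j x) (b j x₀), hlip j x x₀]
    have h4 : ∑ j ∈ s, |b j x₀| ≤ A := hA.sum_le_tsum s fun j _ => abs_nonneg _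
    have h5 : ∑ j ∈ s, (2 : ℝ) ^ (-|j|) ≤ T₀ :=
      summable_two_zpow_neg_abs.sum_le_tsum s fun j _ => (two_zpow_pos _).le
    calc |∑ j ∈ s, b j x| ≤ ∑ j ∈ s, |b j x| := Finset.abs_sum_le_sum_abs _ _
      _ ≤ ∑ j ∈ s, (|b j x₀| + C₁ * ‖x - x₀‖ * (2 : ℝ) ^ (-|j|)) := sum_le_sum h1
      _ ≤ A + C₁ * ‖x - x₀‖ * T₀ := by
          rw [sum_add_distrib, ← mul_sum]
          gcongr
      _ ≤ A + C₁ * (‖x‖ + ‖x₀‖) * T₀ := by gcongr; exact norm_sub_le _ _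
      _ ≤ _ := by
          have : 0 ≤ A * ‖x‖ + C₁ * T₀ * (1 + ‖x‖ * ‖x₀‖) := by positivity
          linarith
  -- high frequencies
  choose H hHt hH using fun k => (hm k).wmeas_l2_le ψ B
  set A' := A + C₁ * T₀ * (1 + ‖x₀‖)
  set C₂ := eLpNorm (fun x : V => A' * (1 + ‖x‖)) 2 (wmeas d) + ∑ k, H k with hC₂
  have hC₂t : C₂ < ⊤ := add_lt_top.2 ⟨eLpNorm_wmeas_linear_lt_top A', sum_lt_top.2 fun k _ => hHt k⟩
  have hbound : ∀ N, eLpNorm (S N) 2 (wmeas d) ≤ C₂ := fun N => by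
    set s := Finset.Icc (-(N : ℤ)) N
    have hsplit : S N = (fun x => ∑ j ∈ s with j < 0, b j x) +
        ∑ k, fun x => ∑ j ∈ s with ¬ j < 0, T k j x := by
      ext x
      simp only [hS, Pi.add_apply, Finset.sum_apply]
      rw [← Finset.sum_filter_add_sum_filter_not s fun j => j < 0]
      congr 1
      exact sum_comm
    rw [hsplit]
    refine (eLpNorm_add_le (Finset.measurable_fun_sum _ fun j _ => hbm j).aestronglyMeasurable
      (Finset.aestronglyMeasurable_sum _ fun k _ => (Finset.measurable_fun_sum _
        fun j _ => hTm k j).aestronglyMeasurable) (by norm_num)).trans (add_le_add ?_ ?_)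
    · exact eLpNorm_mono_real (hlow _ fun j hj => (Finset.mem_filter.1 hj).2)
    · refine (eLpNorm_sum_le (fun k _ => (Finset.measurable_fun_sum _
        fun j _ => hTm k j).aestronglyMeasurable) (by norm_num)).trans (sum_le_sum fun k _ => ?_)
      exact hH k (u k) (hu k) (hB k) _ fun j hj => not_lt.1 (Finset.mem_filter.1 hj).2
  have hlim : ∀ᵐ x ∂(wmeas d), Tendsto (fun N => S N x) atTop (𝓝 (h x)) :=
    (hs.filter_mono (withDensity_absolutelyContinuous _ _).ae_le).mono fun x hx =>
      hx.comp Finset.tendsto_Icc_neg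
  have hL1 := tendsto_eLpNorm_one_of_bounded_two (fun N => (hSm N).aestronglyMeasurable)
    (MemLp.of_bound hh.aestronglyMeasurable B' (ae_of_all _ hB')) hC₂t hbound hlim
  obtain ⟨K, hK⟩ := exists_ker_le_wt ψ one i x
  have hP := wiener_phc ψ i
  have hdiff : ∀ N, ‖mop (ψ.phc i) (S N) x - mop (ψ.phc i) h x‖ₑ ≤
      K * eLpNorm (S N - h) 1 (wmeas d) := fun N => by
    rw [← mop_sub_right hP (hSm N) hh (hSB N) hB', eLpNorm_one_eq_lintegral_enorm,
      lintegral_wmeas ((hSm N).sub hh).enorm, ← lintegral_const_mul' _ _ coe_ne_top]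
    refine (enorm_mop_le_lintegral _ _ x).trans (lintegral_mono fun y => ?_)
    rw [← mul_assoc]
    refine mul_le_mul_left ?_ _
    simpa [one] using hK y
  have hconv : Tendsto (fun N => mop (ψ.phc i) (S N) x) atTop (𝓝 (mop (ψ.phc i) h x)) := by
    rw [tendsto_iff_edist_tendsto_0]
    simp only [edist_eq_enorm_sub]
    have h0 : Tendsto (fun N => (K : ℝ≥0∞) * eLpNorm (S N - h) 1 (wmeas d)) atTop (𝓝 0) := by
      have := ENNReal.Tendsto.const_mul (a := (K : ℝ≥0∞)) hL1 (Or.inr coe_ne_top)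
      rwa [mul_zero] at this
    exact tendsto_of_tendsto_of_tendsto_of_le_of_le tendsto_const_nhds h0 (fun _ => zero_le) hdiff
  refine tendsto_nhds_unique hconv (tendsto_const_nhds.congr' ?_)
  filter_upwards [eventually_ge_atTop (i.natAbs + 1)] with N hN
  have hmem : ∀ j, |j - i| ≤ 1 → j ∈ Finset.Icc (-(N : ℤ)) N := fun j hj => by
    rw [abs_le] at hj
    exact Finset.mem_Icc.2 ⟨by omega, by omega⟩
  rw [hS, mop_sum_right hP _ hbm hbB]
  have e : ∀ j, mop (ψ.phc i) (b j) x = ∑ k, mop (ψ.phc i) (T k j) x := fun j =>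
    mop_sum_right hP _ (fun k => hTm k j) (fun k => hTB k j) x
  simp only [e]
  rw [sum_comm]
  exact sum_congr rfl fun k _ => ((hm k).sum_mop_phc ψ (hu k) (hB k) i (hmem _ (by simp))
    (hmem _ (by simp)) (hmem _ (by simp)) x).symm

/-! ### The horizontal gradient is curl-free -/

theorem testFunction_lineDeriv_apply (φ : 𝓣) (e p : V × ℝ) : (∂_{e} φ : 𝓣) p = fderiv ℝ φ p e := by
  have hd : Differentiable ℝ φ := φ.contDiff.differentiable (by simp)
  exact (hasLineDerivAt_testFunction φ e p).unique ((hd p).hasFDerivAt.hasLineDerivAt e)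

theorem two_le_infty : (2 : WithTop ℕ∞) ≤ ((⊤ : ℕ∞) : WithTop ℕ∞) :=
  WithTop.coe_le_coe.2 (le_top : (2 : ℕ∞) ≤ ⊤)

theorem testFunction_lineDeriv_comm (φ : 𝓣) (e e' : V × ℝ) :
    (∂_{e} (∂_{e'} φ : 𝓣) : 𝓣) = ∂_{e'} (∂_{e} φ : 𝓣) := by
  ext p
  have h2 : Differentiable ℝ (fderiv ℝ φ) := (φ.contDiff.fderiv_right (m := 1) two_le_infty).differentiable (by simp)
  have key : ∀ a b : V × ℝ, (∂_{a} (∂_{b} φ : 𝓣) : 𝓣) p =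
      fderiv ℝ (fderiv ℝ φ) p a b := fun a b => by
    have h1 : ((∂_{b} φ : 𝓣) : Fn) = fun q => fderiv ℝ φ q b :=
      funext fun q => testFunction_lineDeriv_apply φ b q
    rw [testFunction_lineDeriv_apply, h1, fderiv_clm_apply (h2 p) (by fun_prop)]
    simp
  rw [key, key]
  exact (φ.contDiff.contDiffAt.isSymmSndFDerivAt (by
    rw [minSmoothness_of_isRCLikeNormedField]; exact two_le_infty)).eq e e'

theorem ae_curl_slice {u w : Fn} (hu : Cl u) (hw : Cl w)
    {e e' : V} (h1 : IsGivenBy (∂_{((e, (0 : ℝ)) : V × ℝ)} v) u)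
    (h2 : IsGivenBy (∂_{((e', (0 : ℝ)) : V × ℝ)} v) w) {ρ : V → ℝ} (hρ : ContDiff ℝ ∞ ρ)
    (hs : HasCompactSupport ρ) : ∀ᵐ z ∂(volume.restrict (Iio (0 : ℝ))),
      ∫ y, u (y, z) * fderiv ℝ ρ y e' = ∫ y, w (y, z) * fderiv ℝ ρ y e := by
  have hc : ∀ a : V, Continuous fun y => fderiv ℝ ρ y a := fun a =>
    (hρ.continuous_fderiv (by simp)).clm_apply continuous_const
  have hcs : ∀ a : V, HasCompactSupport fun y => fderiv ℝ ρ y a := fun a =>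
    hs.fderiv_apply ℝ a
  have hI : ∀ {g : Fn}, Cl g → ∀ (z : ℝ) (a : V),
      Integrable fun y => g (y, z) * fderiv ℝ ρ y a := fun {g} hg z a => by
    obtain ⟨B, hB⟩ := hg.bdd
    exact ((hc a).integrable_of_hasCompactSupport (hcs a)).bdd_mul (c := B)
      (hg.slice z).aestronglyMeasurable (ae_of_all _ fun y => hB _)
  set F : ℝ → ℝ := fun z => ∫ y, (u (y, z) * fderiv ℝ ρ y e' - w (y, z) * fderiv ℝ ρ y e) with hF
  have hFm : StronglyMeasurable F := by
    have h := ((hu.meas.mul ((hc e').measurable.comp measurable_fst)).sub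
      (hw.meas.mul ((hc e).measurable.comp measurable_fst))).stronglyMeasurable
    exact (h.comp_measurable measurable_swap).integral_prod_right'
  have hFl : LocallyIntegrable F := by
    obtain ⟨B, hB⟩ := hu.bdd
    obtain ⟨B', hB'⟩ := hw.bdd
    refine (locallyIntegrable_const (μ := volume)
      (∫ y, (B * |fderiv ℝ ρ y e'| + B' * |fderiv ℝ ρ y e|))).mono hFm.aestronglyMeasurable
      (ae_of_all _ fun z => ?_)
    refine le_trans ?_ (le_abs_self _)
    refine norm_integral_le_of_norm_le ?_ (ae_of_all _ fun y => ?_)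
    · exact ((((hc e').integrable_of_hasCompactSupport (hcs e')).abs).const_mul B).add
        ((((hc e).integrable_of_hasCompactSupport (hcs e)).abs).const_mul B')
    · refine (norm_sub_le _ _).trans ?_
      rw [norm_mul, norm_mul]
      exact add_le_add (mul_le_mul_of_nonneg_right (hB _) (abs_nonneg _))
        (mul_le_mul_of_nonneg_right (hB' _) (abs_nonneg _))
  have h0 := IsOpen.ae_eq_zero_of_integral_contDiff_smul_eq_zero (μ := volume) (f := F)
    (U := Iio (0 : ℝ)) isOpen_Iio (hFl.locallyIntegrableOn _) fun θ hθ hθs hθt => ?_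
  · rw [ae_restrict_iff' measurableSet_Iio]
    filter_upwards [h0] with z hz hm
    have := hz hm
    rw [hF] at this
    simp only at this
    rwa [integral_sub (hI hu z e') (hI hw z e), sub_eq_zero] at this
  · set Φ : 𝓣 := ⟨fun p => ρ p.1 * θ p.2, by
        exact (hρ.comp contDiff_fst).mul (hθ.comp contDiff_snd),
      HasCompactSupport.intro (hs.isCompact.prod hθs.isCompact) (fun p hp => by
        simp only [mem_prod, not_and_or] at hp
        rcases hp with h | h <;> simp [image_eq_zero_of_notMem_tsupport h]), by
      have hcl : IsClosed ((univ : Set V) ×ˢ tsupport θ) :=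
        isClosed_univ.prod (isClosed_tsupport _)
      refine (closure_minimal (fun p hp => ?_) hcl).trans fun p hp => hθt hp.2
      refine ⟨mem_univ _, subset_tsupport _ fun h => hp ?_⟩
      simp [h]⟩ with hΦ
    have hder : ∀ (a : V) (p : V × ℝ),
        (∂_{((a, (0 : ℝ)) : V × ℝ)} Φ : 𝓣) p = θ p.2 * fderiv ℝ ρ p.1 a := by
      intro a p
      refine (hasLineDerivAt_testFunction Φ _ p).unique ?_
      have h := (((hρ.differentiable (by simp)) p.1).hasFDerivAt.hasLineDerivAt a)
      unfold HasLineDerivAt at h ⊢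
      have e1 : (fun t : ℝ => Φ (p + t • ((a, (0 : ℝ)) : V × ℝ))) =
          fun t : ℝ => θ p.2 * ρ (p.1 + t • a) := by
        funext t
        change ρ (p.1 + t • a) * θ (p.2 + t • (0 : ℝ)) = _
        simp [mul_comm]
      rw [e1]
      exact h.const_mul _
    have hint : ∀ {g : Fn}, Cl g → ∀ a : V,
        Integrable fun p : V × ℝ => g p * (θ p.2 * fderiv ℝ ρ p.1 a) := fun {g} hg a => by
      have h := hg.tame.integrable_mul (∂_{((a, (0 : ℝ)) : V × ℝ)} Φ : 𝓣)
      simpa only [hder] using h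
    have e1 := h1 (∂_{((e', (0 : ℝ)) : V × ℝ)} Φ)
    have e2 := h2 (∂_{((e, (0 : ℝ)) : V × ℝ)} Φ)
    rw [Distribution.lineDerivOp_apply_apply, testFunction_lineDeriv_comm,
      ← Distribution.lineDerivOp_apply_apply, e2] at e1
    simp only [hder] at e1
    have e3 : ∫ p : V × ℝ, (u p * (θ p.2 * fderiv ℝ ρ p.1 e') -
        w p * (θ p.2 * fderiv ℝ ρ p.1 e)) = 0 := by
      rw [integral_sub (hint hu _) (hint hw _), e1, sub_self]
    rw [← e3, Measure.volume_eq_prod]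
    refine Eq.trans ?_ (integral_prod_symm _ ((hint hu e').sub (hint hw e))).symm
    refine integral_congr_ae (ae_of_all _ fun z => ?_)
    change θ z * F z = _
    rw [hF]
    simp only
    rw [← integral_const_mul]
    refine integral_congr_ae (ae_of_all _ fun y => ?_)
    change _ = u (y, z) * (θ z * fderiv ℝ ρ y e') - w (y, z) * (θ z * fderiv ℝ ρ y e)
    ring

/-- Smooth truncations of scale `n + 1`. -/
def trunc (d : ℕ) (n : ℕ) (y : E d) : ℝ :=
  (⟨1, 2, one_pos, one_lt_two⟩ : ContDiffBump (0 : E d)) (((n : ℝ) + 1)⁻¹ • y)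

theorem contDiff_trunc (n : ℕ) : ContDiff ℝ ∞ (trunc d n) :=
  (ContDiffBump.contDiff _).comp (contDiff_const_smul _)

theorem hasCompactSupport_trunc (n : ℕ) : HasCompactSupport (trunc d n) :=
  (ContDiffBump.hasCompactSupport _).comp_smul (by positivity)

theorem trunc_eventually_eq (y : V) : ∀ᶠ n : ℕ in atTop, trunc d n =ᶠ[𝓝 y] fun _ => 1 := by
  filter_upwards [eventually_gt_atTop ⌈‖y‖⌉₊] with n hn
  have h : ‖y‖ < (n : ℝ) + 1 := ((Nat.le_ceil _).trans_lt (Nat.cast_lt.2 hn)).trans (lt_add_one _)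
  filter_upwards [continuous_norm.continuousAt.eventually_lt continuousAt_const h] with x hx
  refine ContDiffBump.one_of_mem_closedBall _ ?_
  rw [mem_closedBall_zero_iff, norm_smul, norm_of_nonneg (by positivity),
    inv_mul_le_iff₀ (by positivity)]
  simpa using hx.le

theorem exists_fderiv_trunc_le (e : V) : ∃ M : ℝ, 0 ≤ M ∧ ∀ (n : ℕ) (y : V),
    |fderiv ℝ (trunc d n) y e| ≤ M := by
  set b : ContDiffBump (0 : V) := ⟨1, 2, one_pos, one_lt_two⟩
  have hb : ContDiff ℝ ∞ b := b.contDiff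
  obtain ⟨M, hM⟩ := (b.hasCompactSupport.fderiv (𝕜 := ℝ)).exists_bound_of_continuous
    (hb.continuous_fderiv (by simp))
  have hM0 := (norm_nonneg _).trans (hM 0)
  refine ⟨M * ‖e‖, by positivity, fun n y => ?_⟩
  have h1 : fderiv ℝ (trunc d n) y e = fderiv ℝ b (((n : ℝ) + 1)⁻¹ • y) (((n : ℝ) + 1)⁻¹ • e) := by
    have h := (hb.differentiable (by simp) (((n : ℝ) + 1)⁻¹ • y)).hasFDerivAt.comp y
      ((hasFDerivAt_id y).const_smul (((n : ℝ) + 1)⁻¹))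
    have h' : HasFDerivAt (trunc d n) _ y := h
    rw [h'.fderiv]
    simp
  rw [h1]
  refine (ContinuousLinearMap.le_opNorm _ _).trans (mul_le_mul (hM _) ?_ (norm_nonneg _) hM0)
  rw [norm_smul, norm_of_nonneg (by positivity)]
  exact mul_le_of_le_one_left (norm_nonneg _) (inv_le_one_of_one_le₀ (by simp))

theorem tendsto_integral_trunc (hu : Measurable u) (hB : ∀ y, |u y| ≤ B) (κ : 𝓢(V, ℝ)) (e : V) :
    Tendsto (fun n : ℕ => ∫ y, u y * fderiv ℝ (fun y => κ y * trunc d n y) y e) atTop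
      (𝓝 (∫ y, u y * fderiv ℝ κ y e)) := by
  obtain ⟨M, hM0, hM⟩ := exists_fderiv_trunc_le e
  have hk : Differentiable ℝ κ := κ.differentiable
  have hd : ∀ (n : ℕ) (y : V), fderiv ℝ (fun y => κ y * trunc d n y) y e =
      κ y * fderiv ℝ (trunc d n) y e + trunc d n y * fderiv ℝ κ y e := fun n y => by
    rw [fderiv_fun_mul (hk y) ((contDiff_trunc n).differentiable (by simp) y)]
    simp
  have hi : Integrable fun y => fderiv ℝ κ y e := by
    have h := (∂_{e} κ : 𝓢(V, ℝ)).integrable (μ := volume)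
    exact h.congr (ae_of_all _ fun y => SchwartzMap.lineDerivOp_apply_eq_fderiv e κ y)
  refine tendsto_integral_of_dominated_convergence
    (fun y => B * (|κ y| * M + |fderiv ℝ κ y e|)) (fun n => ?_) ?_
    (fun n => ae_of_all _ fun y => ?_) (ae_of_all _ fun y => ?_)
  · have hc : ContDiff ℝ ∞ fun y => κ y * trunc d n y := (κ.smooth ⊤).mul (contDiff_trunc n)
    exact (hu.mul ((hc.continuous_fderiv (by simp)).clm_apply
      continuous_const).measurable).aestronglyMeasurable
  · exact ((κ.integrable.abs.mul_const M).add hi.abs).const_mul B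
  · rw [norm_mul, hd]
    refine mul_le_mul (hB y) ((norm_add_le _ _).trans (add_le_add ?_ ?_)) (norm_nonneg _)
      ((abs_nonneg _).trans (hB y))
    · rw [norm_mul]
      exact mul_le_mul_of_nonneg_left (hM n y) (abs_nonneg _)
    · rw [norm_mul, norm_of_nonneg (show 0 ≤ trunc d n y from ContDiffBump.nonneg _)]
      exact mul_le_of_le_one_left (norm_nonneg _) (ContDiffBump.le_one _)
  · refine tendsto_const_nhds.congr' ?_
    filter_upwards [trunc_eventually_eq y] with n hn
    rw [hd, hn.fderiv_eq, hn.eq_of_nhds]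
    simp

theorem fderiv_eq_neg_ker (hg : Wiener g) {e : V}
    (hg' : Wiener fun ξ => dirD e ξ * g ξ) {κ : 𝓢(V, ℝ)} {x : V}
    (hκ : ∀ y, κ y = ker g (x - y)) (y : V) :
    fderiv ℝ κ y e = -ker (fun ξ => dirD e ξ * g ξ) (x - y) := by
  have hk : Differentiable ℝ κ := κ.differentiable
  refine ((hk y).hasFDerivAt.hasLineDerivAt e).unique ?_
  set w := x - y
  have hc : Continuous fun t : ℝ => ker (fun ξ => dirD e ξ * g ξ) (w + t • e) :=
    (continuous_ker hg'.int).comp (by fun_prop)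
  have h1 : ∀ t : ℝ, -1 ≤ t → ker g (w + t • e) = ker g (w + (-1 : ℝ) • e) +
      ∫ τ in (-1 : ℝ)..t, ker (fun ξ => dirD e ξ * g ξ) (w + τ • e) := fun t ht => by
    have hkm : ∀ (f : V → ℂ) (τ : ℝ), ker (modul e τ f) w = ker f (w + τ • e) := fun f τ => by
      rw [ker_eq_re, ker_modul, ← ker_eq_re]
    have h := sker_sub_eq_integral (g := fun t => modul e t g)
      (g' := fun t => modul e t fun ξ => dirD e ξ * g ξ) ht (hg.modul e _).int (hg.modul e _).int
      (measurable_modul e hg'.cont.measurable) (fun t _ ξ => hasDerivAt_modul e t g ξ)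
      hg'.int.norm (fun t _ ξ => (norm_modul e t _ ξ).le) w
    simp only [hkm] at h
    rw [intervalIntegral.integral_of_le ht, ← h]
    ring
  have h2 : HasDerivAt (fun t : ℝ => ker g (w + t • e))
      (ker (fun ξ => dirD e ξ * g ξ) (w + (0 : ℝ) • e)) 0 := by
    have h3 := intervalIntegral.integral_hasDerivAt_right (hc.intervalIntegrable (-1) 0)
      hc.stronglyMeasurable.stronglyMeasurableAtFilter hc.continuousAt
    refine (h3.const_add (ker g (w + (-1 : ℝ) • e))).congr_of_eventuallyEq ?_
    filter_upwards [Ioi_mem_nhds (by norm_num : (-1 : ℝ) < 0)] with t ht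
    exact h1 t (le_of_lt ht)
  have h4 := HasDerivAt.comp (0 : ℝ) (h₂ := fun t : ℝ => ker g (w + t • e)) (h := fun t : ℝ => -t)
    (by simpa using h2) (hasDerivAt_neg (0 : ℝ))
  have e1 : (fun t : ℝ => κ (y + t • e)) = (fun t : ℝ => ker g (w + t • e)) ∘ fun t : ℝ => -t := by
    funext t
    simp only [Function.comp, hκ, w]
    congr 1
    module
  unfold HasLineDerivAt
  rw [e1]
  simpa using h4

theorem bsym_zero_eq (ψ : LP) (m : V → ℂ) (j : ℤ) : bsym m 0 ψ.ph j = fun ξ => m ξ * ψ.phc j ξ := by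
  funext ξ
  simp [bsym, hsym, phc, ψ.phi_eq]

theorem continuous_annular_block (hm : Hom σ m.1) (ψ : LP)
    (j : ℤ) (hu : Measurable u) (hB : ∀ y, |u y| ≤ B) :
    Continuous (mop (fun ξ => m.1 ξ * ψ.phc j ξ) u) :=
  bsym_zero_eq ψ m.1 j ▸ continuous_block hm ψ j hu hB

theorem ae_curl_block {U : Fin d → Fn} (hU : ∀ k, Cl (U k)) (hg : ∀ k : Fin d,
      IsGivenBy (∂_{((single k (1 : ℝ), (0 : ℝ)) : V × ℝ)} v) (U k))
    (ψ : LP) {M : Symbol d} (hM : Hom σ M.1) (i : ℤ) (k l : Fin d) :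
    ∀ᵐ z ∂(volume.restrict (Iio (0 : ℝ))), ∀ x,
      mop (fun ξ => ((partialD l).mul M).1 ξ * ψ.phc i ξ) (fun y => U k (y, z)) x =
        mop (fun ξ => ((partialD k).mul M).1 ξ * ψ.phc i ξ) (fun y => U l (y, z)) x := by
  have hW := hM.annular_block ψ i
  have hd : ∀ k : Fin d, (fun ξ => dirD (single k 1) ξ * (M.1 ξ * ψ.phc i ξ)) =
      fun ξ => ((partialD k).mul M).1 ξ * ψ.phc i ξ := fun k => by
    funext ξ
    rw [dirD_single, ← mul_assoc]
    rfl
  have hW' : ∀ k : Fin d, Wiener fun ξ =>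
      dirD (single k 1) ξ * (M.1 ξ * ψ.phc i ξ) := fun k => by
    rw [hd]
    exact Hom.annular_block ((hom_partialD k).mul hM) ψ i
  have h1 : ∀ᵐ z ∂(volume.restrict (Iio (0 : ℝ))), ∀ n m : ℕ,
      ∫ y, U k (y, z) * fderiv ℝ (fun y => lpKernel ψ M i (TopologicalSpace.denseSeq V m) y *
        trunc d n y) y (single l 1) =
      ∫ y, U l (y, z) * fderiv ℝ (fun y => lpKernel ψ M i (TopologicalSpace.denseSeq V m) y *
        trunc d n y) y (single k 1) := by
    rw [ae_all_iff]
    intro n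
    rw [ae_all_iff]
    intro m
    exact ae_curl_slice (hU k) (hU l) (hg k) (hg l)
      (((lpKernel ψ M i _).smooth ⊤).mul (contDiff_trunc n)) (hasCompactSupport_trunc n).mul_left
  filter_upwards [h1] with z hz
  obtain ⟨B, hB⟩ := (hU k).bdd
  obtain ⟨B', hB'⟩ := (hU l).bdd
  refine fun x => congrFun (Continuous.ext_on (TopologicalSpace.denseRange_denseSeq V)
    (continuous_annular_block ((hom_partialD l).mul hM) ψ i ((hU k).slice z) (fun y => hB (y, z)))
    (continuous_annular_block ((hom_partialD k).mul hM) ψ i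
      ((hU l).slice z) (fun y => hB' (y, z))) ?_) x
  rintro _ ⟨m, rfl⟩
  set κ := lpKernel ψ M i (TopologicalSpace.denseSeq V m)
  have h2 := tendsto_nhds_unique
    ((tendsto_integral_trunc ((hU k).slice z) (fun y => hB (y, z)) κ _).congr fun n => hz n m)
    (tendsto_integral_trunc ((hU l).slice z) (fun y => hB' (y, z)) κ _)
  have hk : ∀ (l k : Fin d), ∫ y, U k (y, z) * fderiv ℝ κ y (single l 1) =
      -mop (fun ξ => ((partialD l).mul M).1 ξ * ψ.phc i ξ) (fun y => U k (y, z))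
        (TopologicalSpace.denseSeq V m) := fun l k => by
    rw [mop, ← integral_neg]
    refine integral_congr_ae (ae_of_all _ fun y => ?_)
    simp only
    rw [fderiv_eq_neg_ker hW (hW' l) (lpKernel_apply ψ M i _) y, hd]
    ring
  rw [hk, hk, neg_inj] at h2
  exact h2

theorem Wiener.sum {ι : Type*} (s : Finset ι) {g : ι → V → ℂ} (hg : ∀ i, Wiener (g i)) (hu : Measurable u) (hB : ∀ y, |u y| ≤ B) (x : V) :
    Wiener (fun ξ => ∑ i ∈ s, g i ξ) ∧
      mop (fun ξ => ∑ i ∈ s, g i ξ) u x = ∑ i ∈ s, mop (g i) u x := by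
  classical
  induction s using Finset.induction_on with
  | empty =>
    have h := mop_const_mul 0 (fun _ : V => (0 : ℂ)) u x
    simp only [mul_zero, zero_mul] at h
    simpa using ⟨Wiener.zero, h⟩
  | insert a s ha ih =>
    simp only [sum_insert ha]
    exact ⟨(hg a).add ih.1, by rw [(hg a).mop_add ih.1 hu hB, ih.2]⟩

theorem sum_partialD_mul_riesz (ψ : LP) (i : ℤ) (ξ : V) :
    ∑ l : Fin d, ((partialD l).mul (invAbs.mul (riesz l))).1 ξ * ψ.phc i ξ =
      ((-1 : ℝ) : ℂ) * ψ.phc i ξ := by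
  rw [← sum_mul]
  by_cases h : ξ = 0
  · have h0 : ψ.phc i ξ = 0 := by
      rw [phc, ψ.phi_eq_zero_of_small i ξ (by rw [h]; norm_num), Complex.ofReal_zero]
    rw [h0, mul_zero, mul_zero]
  · congr 1
    have hn : ‖ξ‖ ≠ 0 := norm_ne_zero_iff.2 h
    have h1 : ∀ l : Fin d, ((partialD l).mul (invAbs.mul (riesz l))).1 ξ =
        ((-(ξ l ^ 2 / ‖ξ‖ ^ 2) : ℝ) : ℂ) := fun l => by
      simp only [Symbol.mul, partialD, invAbs, riesz]
      push_cast
      linear_combination (((ξ l : ℝ) : ℂ) * ((‖ξ‖ : ℝ) : ℂ)⁻¹ * (((ξ l : ℝ) : ℂ) / ((‖ξ‖ : ℝ) : ℂ))) *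
        Complex.I_sq
    simp only [h1]
    rw [← Complex.ofReal_sum, Finset.sum_neg_distrib, ← Finset.sum_div,
      ← real_norm_sq_eq, div_self (pow_ne_zero 2 hn)]

theorem partialD_mul_invAbs (k : Fin d) (ξ : V) :
    (partialD k).1 ξ * invAbs.1 ξ = (riesz k).1 ξ := by
  simp only [partialD, invAbs, riesz]
  push_cast
  ring

/-- The gradient of a potential is recovered from `|D|` of it, block by block. -/
theorem cheminLerner_gradient_le (ψ : LP) : ∃ C : ℝ≥0, ∀ {v : 𝓓'(ℍ, ℝ)}
    {U : Fin d → Fn} {a : Fn}, (∀ k, Cl (U k)) → Cl a →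
    (∀ k : Fin d, IsGivenBy (∂_{((single k (1 : ℝ), (0 : ℝ)) : V × ℝ)} v) (U k)) →
    (∀ᵐ p ∂μJ, HasSum (fun j : ℤ => -∑ k : Fin d,
      funBlock ψ (riesz k) j (fun y => U k (y, p.2)) p.1) (a p)) →
    ∀ (k : Fin d) (q : ℝ≥0∞), q = 1 ∨ q = ⊤ → ∀ s : ℝ, CL ψ q s (U k) ≤ C * CL ψ q s a := by
  have hb := fun k : Fin d => (hom_riesz k).block_bound ψ.annular_fat ψ.fat_herm
  choose C hC0 hC using hb
  have hCW : ∀ k (i : ℤ), Wiener (bsym (riesz k).1 0 ψ.fat i) ∧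
      wnorm (bsym (riesz k).1 0 ψ.fat i) ≤ ∑ k, C k := fun k i => by
    obtain ⟨h1, h2, _⟩ := hC k i 0 le_rfl
    refine ⟨h1, h2.trans ?_⟩
    simpa using single_le_sum (fun k _ => hC0 k) (Finset.mem_univ k)
  refine ⟨(∑ k, C k).toNNReal, fun {v U a} hU ha hg hs k q hq s => ?_⟩
  rw [cheminLerner_eq, cheminLerner_eq, ← ENNReal.tsum_mul_left]
  refine tsum_le_tsum fun i => ?_
  rw [mul_left_comm, ← tn_const_mul hq _ (measurable_bn ψ i ha)]
  refine mul_le_mul_right (tn_mono_ae ?_) _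
  have hcurl : ∀ᵐ z ∂(volume.restrict (Iio (0 : ℝ))), ∀ l x,
      mop (fun ξ => ((partialD l).mul (invAbs.mul (riesz l))).1 ξ * ψ.phc i ξ)
        (fun y => U k (y, z)) x =
      mop (fun ξ => ((partialD k).mul (invAbs.mul (riesz l))).1 ξ * ψ.phc i ξ)
        (fun y => U l (y, z)) x := by
    rw [ae_all_iff]
    exact fun l => ae_curl_block hU hg ψ (hom_invAbs.mul (hom_riesz l)) i k l
  filter_upwards [hcurl, ae_slice hs] with z hz hsz
  choose B hB using fun l => (hU l).bdd
  obtain ⟨B', hB'⟩ := ha.bdd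
  have hBm : ∀ l y, |U l (y, z)| ≤ ∑ l, |B l| := fun l y => ((hB l _).trans (le_abs_self _)).trans
    (single_le_sum (f := fun l => |B l|) (fun l _ => abs_nonneg _) (Finset.mem_univ l))
  have hum := fun l => (hU l).slice z
  have hR : ∀ l, Wiener fun ξ => (riesz l).1 ξ * ψ.phc i ξ :=
    fun l => (hom_riesz l).annular_block ψ i
  have hfat := (hCW k i).1
  have hrec : ∀ x, ψ.del i (fun y => a (y, z)) x =
      -∑ l, mop (fun ξ => (riesz l).1 ξ * ψ.phc i ξ) (fun y => U l (y, z)) x := fun x => by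
    have h := del_eq_of_hasSum ψ (m := fun l => riesz l) (fun l => hom_riesz l)
      (u := fun l y => -U l (y, z)) (fun l => (hum l).neg) (B := ∑ l, |B l|)
      (fun l y => by rw [abs_neg]; exact hBm l y) (ha.slice z) (fun y => hB' (y, z)) (by
        filter_upwards [hsz] with y hy
        refine hy.congr_fun fun j => ?_
        simp only [mop_neg_right, funBlock_eq_mop, bsym_zero_eq, Finset.sum_neg_distrib]) i x
    simpa only [mop_neg_right, bsym_zero_eq, Finset.sum_neg_distrib] using h
  have key : ∀ x, ψ.del i (fun y => U k (y, z)) x =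
      mop (bsym (riesz k).1 0 ψ.fat i) (ψ.del i fun y => a (y, z)) x := by
    intro x
    have h1 := (Wiener.sum Finset.univ (fun l => Hom.annular_block
      ((hom_partialD l).mul (hom_invAbs.mul (hom_riesz l))) ψ i) (hum k) (hBm k) x).2
    have h2 : mop (fun ξ => ∑ l : Fin d, (partialD l).1 ξ * (invAbs.1 ξ *
        (riesz l).1 ξ) * ψ.phc i ξ) (fun y => U k (y, z)) x = -ψ.del i (fun y => U k (y, z)) x := by
      have : (fun ξ => ∑ l : Fin d, (partialD l).1 ξ * (invAbs.1 ξ *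
        (riesz l).1 ξ) * ψ.phc i ξ) = fun ξ => ((-1 : ℝ) : ℂ) * ψ.phc i ξ :=
        funext fun ξ => sum_partialD_mul_riesz ψ i ξ
      rw [this, mop_const_mul, neg_one_mul]
      rfl
    rw [h2] at h1
    have h3 : ∀ l, mop (fun ξ => (partialD l).1 ξ * (invAbs.1 ξ *
        (riesz l).1 ξ) * ψ.phc i ξ) (fun y => U k (y, z)) x = mop (bsym (riesz k).1 0 ψ.fat i)
          (mop (fun ξ => (riesz l).1 ξ * ψ.phc i ξ) fun y => U l (y, z)) x := fun l => by
      rw [hfat.mop_mop (hR l) (hum l) (hBm l)]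
      refine (hz l x).trans (congrArg (fun g => mop g (fun y => U l (y, z)) x) (funext fun ξ => ?_))
      have h4 := congrFun ((bsym_zero_eq ψ (riesz k).1 i).symm.trans
        (bsym_ph_eq ψ (riesz k).1 0 i)) ξ
      simp only [Symbol.mul] at h4 ⊢
      linear_combination (riesz l).1 ξ * h4 + (riesz l).1 ξ * ψ.phc i ξ * (partialD_mul_invAbs k ξ)
    simp only [h3] at h1
    rw [← mop_sum_right hfat Finset.univ (fun l => measurable_mop (hR l).int (hum l))
      (fun l y => (hR l).abs_mop_le (hBm l) y)] at h1
    rw [← neg_inj, h1, ← mop_neg_right]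
    exact congrArg (fun u => mop _ u x) (funext fun y => by rw [hrec, neg_neg])
  refine iSup_le fun x => ?_
  rw [key]
  refine (hfat.enorm_mop_le _ x).trans (mul_le_mul' (ofReal_le_ofReal (hCW k i).2) ?_)
  exact iSup_le fun y => enorm_del_le_bn ψ i a y z

/-! ### Neumann series -/

/-- Countable subadditivity of a functional on families of functions. -/
def SubAdd {ι : Type} (F : (ι → Fn) → ℝ≥0∞) : Prop :=
  ∀ {u : ℕ → ι → Fn} {v : ι → Fn}, (∀ n i, Cl (u n i)) →
    (∀ i, ∑' n, supN (u n i) < ⊤) → (∀ i p, HasSum (fun n => u n i p) (v i p)) → F v ≤ ∑' n, F (u n)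

theorem hasSum_of_supN {u : ℕ → Fn} (h : ∑' n, supN (u n) < ⊤) (p : V × ℝ) :
    HasSum (fun n => u n p) (∑' n, u n p) :=
  (Summable.of_norm_bounded (summable_toReal h.ne) fun n =>
    abs_le_supN (ENNReal.lt_top_of_tsum_ne_top h.ne n) p).hasSum

theorem tsum_half_pow : ∑' n : ℕ, (2⁻¹ : ℝ≥0∞) ^ n = 2 := by
  rw [ENNReal.tsum_geometric, ENNReal.one_sub_inv_two, inv_inv]

theorem neumann_series {ι : Type} {N : (ι → Fn) → ℝ≥0∞}
    (hsup : ∀ u i, supN (u i) ≤ N u) (hN : SubAdd N) {L : (ι → Fn) → ι → Fn}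
    (hadd : ∀ u v, (∀ i, Cl (u i)) → N u < ⊤ → (∀ i, Cl (v i)) → N v < ⊤ → L (u + v) = L u + L v)
    (hcl : ∀ u, (∀ i, Cl (u i)) → N u < ⊤ → ∀ i, Cl (L u i))
    (hL : ∀ u, (∀ i, Cl (u i)) → N u < ⊤ → N (L u) ≤ 2⁻¹ * N u)
    {b : ι → Fn} (hb : ∀ i, Cl (b i)) (hNb : N b < ⊤) :
    ∃ u, (∀ i, Cl (u i)) ∧ N u < ⊤ ∧ u = b + L u ∧ ∀ F : (ι → Fn) → ℝ≥0∞, SubAdd F →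
      (∀ u, (∀ i, Cl (u i)) → N u < ⊤ → F (L u) ≤ 2⁻¹ * F u) → F u ≤ 2 * F b := by
  set t : ℕ → ι → Fn := fun n => L^[n] b with ht
  have hsucc : ∀ n, t (n + 1) = L (t n) := fun n => Function.iterate_succ_apply' L n b
  have hgood : ∀ n, (∀ i, Cl (t n i)) ∧ N (t n) < ⊤ := fun n => by
    induction n with
    | zero => exact ⟨hb, hNb⟩
    | succ n ih =>
      rw [hsucc]
      exact ⟨hcl _ ih.1 ih.2, (hL _ ih.1 ih.2).trans_lt (mul_lt_top (by simp) ih.2)⟩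
  have hgeo : ∀ F : (ι → Fn) → ℝ≥0∞, (∀ u, (∀ i, Cl (u i)) → N u < ⊤ → F (L u) ≤ 2⁻¹ * F u) →
      ∀ m n, F (t (n + m)) ≤ 2⁻¹ ^ n * F (t m) := fun F hF m n => by
    induction n with
    | zero => simp
    | succ n ih =>
      rw [add_right_comm, hsucc, pow_succ', mul_assoc]
      exact (hF _ (hgood _).1 (hgood _).2).trans (mul_le_mul_right ih _)
  have hgeos : ∀ F : (ι → Fn) → ℝ≥0∞, (∀ u, (∀ i, Cl (u i)) → N u < ⊤ → F (L u) ≤ 2⁻¹ * F u) →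
      ∀ m, ∑' n, F (t (n + m)) ≤ 2 * F (t m) := fun F hF m => by
    refine (tsum_le_tsum (hgeo F hF m)).trans_eq ?_
    rw [ENNReal.tsum_mul_right, tsum_half_pow]
  have hs : ∀ m i, ∑' n, supN (t (n + m) i) < ⊤ := fun m i =>
    (tsum_le_tsum fun n => hsup _ i).trans_lt ((hgeos N hL m).trans_lt
      (mul_lt_top (by simp) (hgood m).2))
  set w : ℕ → ι → Fn := fun m i p => ∑' n, t (n + m) i p with hw
  have hsum : ∀ m i p, HasSum (fun n => t (n + m) i p) (w m i p) := fun m i p =>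
    hasSum_of_supN (hs m i) p
  have hwN : ∀ m, N (w m) ≤ 2 * N (t m) := fun m =>
    (hN (fun n i => (hgood _).1 i) (hs m) (hsum m)).trans (hgeos N hL m)
  have hwT : ∀ m, N (w m) < ⊤ := fun m =>
    (hwN m).trans_lt (mul_lt_top (by simp) (hgood m).2)
  have hwC : ∀ m i, Cl (w m i) := fun m i => Cl.of_supN
    (Measurable.tsum fun n => ((hgood (n + m)).1 i).meas) ((hsup _ i).trans_lt (hwT m))
  have hstep : ∀ m, w m = t m + w (m + 1) := fun m => by
    funext i p
    have h := (hsum m i p).summable.tsum_eq_zero_add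
    simp only [zero_add] at h
    change w m i p = t m i p + w (m + 1) i p
    simp only [hw, h, add_right_comm _ 1 m, add_assoc]
  have hpart : ∀ m i p, b i p + L (w 0) i p =
      ∑ n ∈ Finset.range (m + 1), t n i p + L (w m) i p := fun m i p => by
    induction m with
    | zero => simp [ht]
    | succ m ih =>
      rw [ih, Finset.sum_range_succ _ (m + 1), hsucc, add_assoc, add_right_inj]
      conv_lhs => rw [hstep m, hadd _ _ (hgood m).1 (hgood m).2 (hwC _) (hwT _)]
      rfl
  refine ⟨w 0, hwC 0, hwT 0, ?_, fun F hFs hF => ?_⟩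
  · funext i p
    have h1 := (hsum 0 i p).tendsto_sum_nat.comp (tendsto_add_atTop_nat 1)
    have h2 : Tendsto (fun m => L (w m) i p) atTop (𝓝 0) := by
      have h3 : ∀ m, |L (w m) i p| ≤ (N b).toReal * (2⁻¹ : ℝ) ^ m := fun m => by
        have h4 : ‖L (w m) i p‖ₑ ≤ N b * 2⁻¹ ^ m := by
          refine (enorm_le_supN _ p).trans ((hsup _ i).trans ((hL _ (hwC m) (hwT m)).trans ?_))
          refine (mul_le_mul_right (hwN m) _).trans ?_
          rw [← mul_assoc, ENNReal.inv_mul_cancel (by simp) (by simp), one_mul, mul_comm]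
          exact hgeo N hL 0 m
        have h5 := toReal_mono (mul_ne_top hNb.ne (by simp)) h4
        simpa using h5
      refine squeeze_zero_norm h3 ?_
      simpa using (tendsto_pow_atTop_nhds_zero_of_lt_one (by norm_num : (0 : ℝ) ≤ 2⁻¹)
        (by norm_num)).const_mul (N b).toReal
    have h6 := h1.add h2
    rw [add_zero] at h6
    refine tendsto_nhds_unique h6 (tendsto_const_nhds.congr fun m => ?_)
    simpa using hpart m i p
  · exact (hFs (fun n i => (hgood _).1 i) (hs 0) (hsum 0)).trans (hgeos F hF 0)

/-! ### Functionals adapted to the fixed point argument -/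

/-- Functionals that are countably subadditive, satisfy a tame product estimate, and are compatible
with harmonic extension and with integration against the Poisson semigroup. -/
structure IsFunc (ψ : LP) (P : Fn → ℝ≥0∞) (r : ℝ) : Prop where
  tsum : ∀ {ι : Type} [Countable ι] {u : ι → Fn} {v : Fn}, (∀ i, Cl (u i)) →
    ∑' i, supN (u i) < ⊤ → (∀ p, HasSum (fun i => u i p) (v p)) → P v ≤ ∑' i, P (u i)
  neg : ∀ u, P (fun p => -u p) = P u
  mul : ∃ C : ℝ≥0, ∀ u v, Cl u → Cl v → P (fun p => u p * v p) ≤ C * (P u * supN v + supN u * P v)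
  harm : ∀ {m : Symbol d}, Hom 1 m.1 → ∃ C : ℝ≥0, ∀ f, β ψ f < ⊤ →
    P (harm ψ m f) ≤ C * besovNorm ψ r Λ f
  zop : ∀ {m : Symbol d}, Hom 1 m.1 → Continuous m.1 → ∃ C : ℝ≥0, ∀ q, Cl q →
    CL ψ 1 1 q < ⊤ → ∀ S : ℝ → Set ℝ, (∀ z, S z ⊆ Iio 0) → P (zop m.1 S q) ≤ C * P q
  le : ∀ q, CL ψ 1 (r + 1) q ≤ P q

theorem isFunc_xNorm [NeZero d] (ψ : LP) (hr : 0 < r) : IsFunc ψ (xNorm ψ r) r where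
  tsum hu hs hv := by
    unfold xNorm
    rw [tsum_add]
    exact add_le_add (cheminLerner_tsum_le ψ (.inr rfl) r hu hs hv)
      (cheminLerner_tsum_le ψ (.inl rfl) (r + 1) hu hs hv)
  neg u := by simp only [xNorm, cheminLerner_neg]
  mul := by
    obtain ⟨C, hC⟩ := cheminLerner_mul_le ψ hr
    obtain ⟨C', hC'⟩ := cheminLerner_mul_le ψ (by linarith : 0 < r + 1)
    refine ⟨C + C', fun u v hu hv => ?_⟩
    refine (add_le_add (hC _ (.inr rfl) u v hu hv) (hC' _ (.inl rfl) u v hu hv)).trans ?_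
    rw [coe_add, add_mul]
    unfold xNorm
    gcongr <;> first | exact le_self_add | exact le_add_self
  harm hm := by
    obtain ⟨C, hC⟩ := hm.cheminLerner_harm_le ψ
    refine ⟨C + C, fun f hf => ?_⟩
    rw [coe_add, add_mul]
    exact add_le_add (hC f hf r).1 (hC f hf r).2
  zop hm hc := by
    obtain ⟨C, hC⟩ := hm.cheminLerner_zop_le hc ψ
    refine ⟨C + C, fun q hq hq1 S hS => ?_⟩
    rw [coe_add, add_mul]
    exact add_le_add (((hC q hq hq1 S hS r).2).trans (mul_le_mul_right le_add_self _))
      (((hC q hq hq1 S hS (r + 1)).1).trans (mul_le_mul_right le_add_self _))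
  le q := le_add_self

/-- The norm of `X_*`, with an honest supremum. -/
def nStar (ψ : LP) (u : Fn) : ℝ≥0∞ := supN u + CL ψ 1 1 u

theorem isFunc_nStar [NeZero d] (ψ : LP) : IsFunc ψ (nStar ψ) 0 where
  tsum {ι _ u v} hu hs hv := by
    unfold nStar
    rw [tsum_add]
    refine add_le_add (iSup_le fun p => ?_) (cheminLerner_tsum_le ψ (.inl rfl) 1 hu hs hv)
    rw [← (hv p).tsum_eq]
    exact (enorm_tsum_le_tsum_enorm).trans (tsum_le_tsum fun i => enorm_le_supN _ p)
  neg u := by simp only [nStar, cheminLerner_neg, supN_neg]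
  mul := by
    obtain ⟨C, hC⟩ := cheminLerner_mul_le ψ one_pos
    refine ⟨1 + C, fun u v hu hv => ?_⟩
    refine (add_le_add (supN_mul_le u v) (hC _ (.inl rfl) u v hu hv)).trans ?_
    rw [coe_add, add_mul, ENNReal.coe_one, one_mul]
    unfold nStar
    refine add_le_add ?_ (mul_le_mul_right (add_le_add ?_ ?_) _)
    · exact (mul_le_mul_left le_self_add _).trans le_self_add
    · exact mul_le_mul_left le_add_self _
    · exact mul_le_mul_right le_add_self _
  harm hm := by
    obtain ⟨C, hC⟩ := hm.cheminLerner_harm_le ψ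
    obtain ⟨C', hC'⟩ := hm.harm_le ψ
    refine ⟨C' + C, fun f hf => ?_⟩
    rw [coe_add, add_mul]
    have h := (hC f hf 0).2
    rw [zero_add] at h
    exact add_le_add (hC' f hf) h
  zop hm hc := by
    obtain ⟨C, hC⟩ := hm.cheminLerner_zop_le hc ψ
    obtain ⟨C', hC'⟩ := hm.supN_zop_le hc ψ
    refine ⟨C' + C, fun q hq hq1 S hS => ?_⟩
    rw [coe_add, add_mul]
    exact add_le_add ((hC' q hq S hS).trans (mul_le_mul_right le_add_self _))
      (((hC q hq hq1 S hS 1).1).trans (mul_le_mul_right le_add_self _))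
  le q := by
    rw [zero_add]
    exact le_add_self

namespace IsFunc

theorem sum_le (h : IsFunc ψ P r) {ι : Type} [Fintype ι] {u : ι → Fn} (hu : ∀ i, Cl (u i)) :
    P (fun p => ∑ i, u i p) ≤ ∑ i, P (u i) := by
  rw [← tsum_fintype (L := .unconditional ι)]
  refine h.tsum hu ?_ fun p => hasSum_fintype _
  rw [tsum_fintype]
  exact sum_lt_top.2 fun i _ => (hu i).supN_lt_top

theorem add_le (h : IsFunc ψ P r)
    {u v : Fn} (hu : Cl u) (hv : Cl v) : P (fun p => u p + v p) ≤ P u + P v := by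
  have := h.sum_le (ι := Bool) (u := fun b => if b then u else v) (by simp [hu, hv])
  simpa using this

theorem sub_le (h : IsFunc ψ P r)
    {u v : Fn} (hu : Cl u) (hv : Cl v) : P (fun p => u p - v p) ≤ P u + P v := by
  have := h.add_le hu hv.neg
  simpa only [sub_eq_add_neg, h.neg] using this

theorem subAdd (h : IsFunc ψ P r) {ι : Type}
    [Fintype ι] : SubAdd fun u : ι → Fn => ∑ i, P (u i) := fun {u v} hu hs hv => by
  rw [Summable.tsum_finsetSum fun _ _ => ENNReal.summable]
  exact sum_le_sum fun i _ => h.tsum (fun n => hu n i) (hs i) (hv i)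

end IsFunc

theorem SubAdd.add {ι : Type} {F G : (ι → Fn) → ℝ≥0∞} (hF : SubAdd F) (hG : SubAdd G)
    (c : ℝ≥0∞) : SubAdd fun u => F u + c * G u := fun {u v} hu hs hv => by
  rw [tsum_add, ENNReal.tsum_mul_left]
  exact add_le_add (hF hu hs hv) (mul_le_mul_right (hG hu hs hv) _)

theorem supN_le_nStar (ψ : LP) (u : Fn) : supN u ≤ nStar ψ u := le_self_add

theorem tame_neumann [NeZero d] (ψ : LP) {ι : Type} [Fintype ι] {L : (ι → Fn) → ι → Fn}
    (hadd : ∀ u v, (∀ i, Cl (u i)) → ∑ i, nStar ψ (u i) < ⊤ → (∀ i, Cl (v i)) →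
      ∑ i, nStar ψ (v i) < ⊤ → L (u + v) = L u + L v)
    (hcl : ∀ u, (∀ i, Cl (u i)) → ∑ i, nStar ψ (u i) < ⊤ → ∀ i, Cl (L u i))
    (hL : ∀ u, (∀ i, Cl (u i)) → ∑ i, nStar ψ (u i) < ⊤ →
      ∑ i, nStar ψ (L u i) ≤ 4⁻¹ * ∑ i, nStar ψ (u i))
    {b : ι → Fn} (hb : ∀ i, Cl (b i)) (hNb : ∑ i, nStar ψ (b i) < ⊤) :
    ∃ u, (∀ i, Cl (u i)) ∧ ∑ i, nStar ψ (u i) < ⊤ ∧ u = b + L u ∧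
      ∑ i, nStar ψ (u i) ≤ 2 * ∑ i, nStar ψ (b i) ∧
      ∀ {P : Fn → ℝ≥0∞} {r : ℝ}, IsFunc ψ P r → ∀ X : ℝ≥0∞,
      (∀ u, (∀ i, Cl (u i)) → ∑ i, nStar ψ (u i) < ⊤ →
        ∑ i, P (L u i) ≤ X * ∑ i, nStar ψ (u i) + 2⁻¹ * ∑ i, P (u i)) →
      ∑ i, P (u i) ≤ 2 * (∑ i, P (b i) + 4 * X * ∑ i, nStar ψ (b i)) := by
  have h42 : (4⁻¹ : ℝ≥0∞) ≤ 2⁻¹ := ENNReal.inv_le_inv.2 (by norm_num)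
  have h44 : (4 : ℝ≥0∞) * 4⁻¹ = 1 := ENNReal.mul_inv_cancel (by norm_num) (by norm_num)
  have h24 : (2⁻¹ : ℝ≥0∞) * 4 = 2 := by
    rw [show (4 : ℝ≥0∞) = 2 * 2 by norm_num, ← mul_assoc,
      ENNReal.inv_mul_cancel (by norm_num) (by norm_num), one_mul]
  have hL2 : ∀ u, (∀ i, Cl (u i)) → ∑ i, nStar ψ (u i) < ⊤ →
      ∑ i, nStar ψ (L u i) ≤ 2⁻¹ * ∑ i, nStar ψ (u i) := fun u h1 h2 =>
    (hL u h1 h2).trans (mul_le_mul_left h42 _)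
  obtain ⟨u, hu, hNu, hfix, hF⟩ := neumann_series (N := fun u : ι → Fn => ∑ i, nStar ψ (u i))
    (fun u i => le_self_add.trans
      (single_le_sum (f := fun i => nStar ψ (u i)) (fun i _ => zero_le) (Finset.mem_univ i)))
    (isFunc_nStar ψ).subAdd hadd hcl hL2 hb hNb
  refine ⟨u, hu, hNu, hfix, hF _ (isFunc_nStar ψ).subAdd hL2, fun {P r} hP X hX => ?_⟩
  refine le_self_add.trans (hF (fun u => ∑ i, P (u i) + 4 * X * ∑ i, nStar ψ (u i))
      (SubAdd.add hP.subAdd (isFunc_nStar ψ).subAdd (4 * X)) fun u h1 h2 => ?_)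
  refine (add_le_add (hX u h1 h2) (mul_le_mul_right (hL u h1 h2) _)).trans_eq ?_
  rw [mul_add, ← mul_assoc, ← mul_assoc, mul_right_comm 4 X, h44, ← mul_assoc, h24]
  ring

/-- Coefficients that are controlled by `η` as long as `η` is small. -/
structure Coef (ψ : LP) (P : Fn → ℝ≥0∞) (r : ℝ) (c : ℝ≥0)
    (h : TD → Fn) : Prop where
  cl : ∀ η, β ψ η ≤ c → Cl (h η)
  fin : ∀ η, β ψ η ≤ c → nStar ψ (h η) < ⊤
  sup : ∃ C : ℝ≥0, ∀ η, β ψ η ≤ c → supN (h η) ≤ C * β ψ η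
  est : ∃ C : ℝ≥0, ∀ η, β ψ η ≤ c → P (h η) ≤ C * besovNorm ψ r Λ η

namespace Coef

variable {P : (E d × ℝ → ℝ) → ℝ≥0∞} {r : ℝ} {c : ℝ≥0}
  {g h : TemperedDist d → E d × ℝ → ℝ}

theorem harm [NeZero d] (hP : IsFunc ψ P r) (c : ℝ≥0) (hm : Hom 1 m.1) :
    Coef ψ P r c (harm ψ m) := by
  obtain ⟨C, hC⟩ := hm.harm_le ψ
  obtain ⟨C', hC'⟩ := hP.harm hm
  obtain ⟨C₂, hC₂⟩ := (isFunc_nStar ψ).harm hm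
  have hlt : ∀ {η : TD}, β ψ η ≤ c → β ψ η < ⊤ := fun h => h.trans_lt coe_lt_top
  exact ⟨fun η hη => hm.cl_harm (hlt hη),
    fun η hη => (hC₂ η (hlt hη)).trans_lt (mul_lt_top coe_lt_top (hlt hη)),
    ⟨C, fun η hη => hC η (hlt hη)⟩, ⟨C', fun η hη => hC' η (hlt hη)⟩⟩

theorem sub [NeZero d] (hP : IsFunc ψ P r) (hg : Coef ψ P r c g) (hh : Coef ψ P r c h) :
    Coef ψ P r c fun η p => g η p - h η p := by
  obtain ⟨C, hC⟩ := hg.sup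
  obtain ⟨C', hC'⟩ := hh.sup
  obtain ⟨C₂, hC₂⟩ := hg.est
  obtain ⟨C₂', hC₂'⟩ := hh.est
  refine ⟨fun η hη => (hg.cl η hη).sub (hh.cl η hη), fun η hη =>
    ((isFunc_nStar ψ).sub_le (hg.cl η hη) (hh.cl η hη)).trans_lt
      (add_lt_top.2 ⟨hg.fin η hη, hh.fin η hη⟩), ⟨C + C', fun η hη => ?_⟩,
    ⟨C₂ + C₂', fun η hη => ?_⟩⟩
  · rw [coe_add, add_mul]
    exact (supN_sub_le _ _).trans (add_le_add (hC η hη) (hC' η hη))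
  · rw [coe_add, add_mul]
    exact (hP.sub_le (hg.cl η hη) (hh.cl η hη)).trans (add_le_add (hC₂ η hη) (hC₂' η hη))

theorem sum [NeZero d] (hP : IsFunc ψ P r) {ι : Type} [Fintype ι]
    {g : ι → TD → Fn} (hg : ∀ i, Coef ψ P r c (g i)) : Coef ψ P r c fun η p => ∑ i, g i η p := by
  choose C hC using fun i => (hg i).sup
  choose C' hC' using fun i => (hg i).est
  refine ⟨fun η hη => Cl.sum _ fun i => (hg i).cl η hη, fun η hη =>
    ((isFunc_nStar ψ).sum_le fun i => (hg i).cl η hη).trans_lt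
      (sum_lt_top.2 fun i _ => (hg i).fin η hη), ⟨∑ i, C i, fun η hη => ?_⟩,
    ⟨∑ i, C' i, fun η hη => ?_⟩⟩
  · rw [ofNNReal_finsetSum, sum_mul]
    exact (supN_sum_le _ _).trans (sum_le_sum fun i _ => hC i η hη)
  · rw [ofNNReal_finsetSum, sum_mul]
    exact (hP.sum_le fun i => (hg i).cl η hη).trans (sum_le_sum fun i _ => hC' i η hη)

theorem fin_mul [NeZero d] {u v : Fn} (hu : Cl u) (hv : Cl v) (h1 : nStar ψ u < ⊤)
    (h2 : nStar ψ v < ⊤) : nStar ψ (fun p => u p * v p) < ⊤ := by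
  obtain ⟨K, hK⟩ := (isFunc_nStar ψ).mul
  exact (hK u v hu hv).trans_lt (mul_lt_top coe_lt_top (add_lt_top.2
    ⟨mul_lt_top h1 hv.supN_lt_top, mul_lt_top hu.supN_lt_top h2⟩))

theorem mul [NeZero d] (hP : IsFunc ψ P r) (hg : Coef ψ P r c g) (hh : Coef ψ P r c h) :
    Coef ψ P r c fun η p => g η p * h η p := by
  obtain ⟨C, hC⟩ := hg.sup
  obtain ⟨C', hC'⟩ := hh.sup
  obtain ⟨C₂, hC₂⟩ := hg.est
  obtain ⟨C₂', hC₂'⟩ := hh.est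
  obtain ⟨K, hK⟩ := hP.mul
  have hs : ∀ η, β ψ η ≤ c → supN (g η) ≤ C * c := fun η hη =>
    (hC η hη).trans (mul_le_mul_right hη _)
  have hs' : ∀ η, β ψ η ≤ c → supN (h η) ≤ C' * c := fun η hη =>
    (hC' η hη).trans (mul_le_mul_right hη _)
  refine ⟨fun η hη => (hg.cl η hη).mul (hh.cl η hη), fun η hη =>
    fin_mul (hg.cl η hη) (hh.cl η hη) (hg.fin η hη) (hh.fin η hη),
    ⟨C * c * C', fun η hη => ?_⟩, ⟨K * (C₂ * (C' * c) + C * c * C₂'), fun η hη => ?_⟩⟩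
  · refine (supN_mul_le _ _).trans ((mul_le_mul' (hs η hη) (hC' η hη)).trans_eq ?_)
    push_cast
    ring
  · refine (hK _ _ (hg.cl η hη) (hh.cl η hη)).trans ((mul_le_mul_right (add_le_add
      (mul_le_mul' (hC₂ η hη) (hs' η hη)) (mul_le_mul' (hs η hη) (hC₂' η hη))) _).trans_eq ?_)
    push_cast
    ring

end Coef

theorem exists_small (A : ℝ≥0) : ∃ c : ℝ≥0, 0 < c ∧ A * c ≤ 4⁻¹ := by
  refine ⟨4⁻¹ * (A + 1)⁻¹, by positivity, ?_⟩
  rw [mul_left_comm]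
  refine mul_le_of_le_one_right' ?_
  rw [← div_eq_mul_inv]
  exact div_le_one_of_le₀ (by simp) (by simp)

theorem coe_mul_le_quarter {A c : ℝ≥0} (h : A * c ≤ 4⁻¹) {x : ℝ≥0∞} (hx : x ≤ c) :
    (A : ℝ≥0∞) * x ≤ 4⁻¹ :=
  (mul_le_mul_right hx _).trans (by
    have h1 := coe_le_coe.2 h
    rwa [ENNReal.coe_inv (by norm_num), coe_mul] at h1)

/-- Quotients of coefficients by `1 + a`, for small `a`. -/
theorem Coef.div_one_add [NeZero d] (hP : IsFunc ψ P r) {a b : TD → Fn} {c₁ : ℝ≥0} (hc₁ : 0 < c₁)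
    (ha : Coef ψ P r c₁ a) (hb : Coef ψ P r c₁ b) (ha₀ : Coef ψ (nStar ψ) 0 c₁ a)
    (hb₀ : Coef ψ (nStar ψ) 0 c₁ b) :
    ∃ c, 0 < c ∧ c ≤ c₁ ∧ Coef ψ P r c fun η p => b η p / (1 + a η p) := by
  obtain ⟨K₀, hK₀⟩ := (isFunc_nStar ψ).mul
  obtain ⟨K, hK⟩ := hP.mul
  obtain ⟨A₀, hA₀⟩ := ha₀.est
  obtain ⟨B₀, hB₀⟩ := hb₀.est
  obtain ⟨A, hA⟩ := ha.est
  obtain ⟨B, hB⟩ := hb.est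
  obtain ⟨c₂, hc₂, hsm⟩ := exists_small (A₀ + K₀ * 2 * A₀ + K * A₀)
  set c := min c₁ c₂ with hc
  have hle : ∀ {x : ℝ≥0∞} {D : ℝ≥0}, x ≤ c → D ≤ A₀ + K₀ * 2 * A₀ + K * A₀ → (D : ℝ≥0∞) * x ≤ 4⁻¹ :=
    fun {x D} hx hD => coe_mul_le_quarter ((mul_le_mul' hD (min_le_right _ _)).trans hsm) hx
  have key : ∀ η, β ψ η ≤ c → Cl (fun p => b η p / (1 + a η p)) ∧
      nStar ψ (fun p => b η p / (1 + a η p)) ≤ 2 * B₀ * β ψ η ∧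
      P (fun p => b η p / (1 + a η p)) ≤ 2 * (B + 4 * (K * A) * (B₀ * c)) * besovNorm ψ r Λ η := by
    intro η hη
    have hη1 : β ψ η ≤ c₁ :=
      hη.trans (coe_le_coe.2 (min_le_left _ _))
    have hlt : β ψ η < ⊤ := hη.trans_lt coe_lt_top
    have hac := ha.cl η hη1
    have hsup : supN (a η) ≤ A₀ * β ψ η := le_self_add.trans (hA₀ η hη1)
    have hne : ∀ p, 1 + a η p ≠ 0 := fun p => by
      have h1 := (enorm_le_supN (a η) p).trans (hsup.trans (hle hη (le_self_add.trans le_self_add)))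
      have h2 := toReal_mono (by simp) h1
      simp only [toReal_enorm, ENNReal.toReal_inv, ENNReal.toReal_ofNat, norm_eq_abs] at h2
      have h3 := abs_le.1 h2
      norm_num at h3
      intro h4
      linarith [h3.1]
    obtain ⟨u, hu, hNu, hfix, hN, hPu⟩ := tame_neumann ψ (ι := Unit)
      (L := fun u i p => -(a η p * u i p)) (fun u v _ _ _ _ => by
        funext i p
        simp only [Pi.add_apply]
        ring) (fun u h1 _ i => (hac.mul (h1 i)).neg) (fun u h1 h2 => by
        simp only [Finset.univ_unique, sum_singleton, (isFunc_nStar ψ).neg]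
        refine (hK₀ _ _ hac (h1 _)).trans ?_
        have e1 : nStar ψ (a η) * supN (u default) + supN (a η) * nStar ψ (u default) ≤
            2 * (A₀ * β ψ η) * nStar ψ (u default) := by
          rw [two_mul, add_mul]
          exact add_le_add (mul_le_mul' (hA₀ η hη1) le_self_add) (mul_le_mul_left hsup _)
        refine (mul_le_mul_right e1 _).trans ?_
        rw [← mul_assoc]
        refine mul_le_mul_left ?_ _
        have := hle hη (D := K₀ * 2 * A₀) (le_add_self.trans le_self_add)
        push_cast at this
        calc _ = _ := by ring
          _ ≤ _ := this)
      (b := fun _ => b η) (fun _ => hb.cl η hη1) (by simpa using hb₀.fin η hη1)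
    have hval : u default = fun p => b η p / (1 + a η p) := by
      funext p
      have h := congrFun (congrFun hfix default) p
      simp only [Pi.add_apply] at h
      rw [eq_div_iff (hne p)]
      linarith
    have h1 := hPu hP (K * A * besovNorm ψ r Λ η) fun u h1 h2 => by
      simp only [Finset.univ_unique, sum_singleton, hP.neg]
      refine (hK _ _ hac (h1 _)).trans ?_
      rw [mul_add]
      refine add_le_add ?_ ?_
      · refine (mul_le_mul_right (mul_le_mul' (hA η hη1) (supN_le_nStar ψ _)) _).trans_eq ?_
        rw [← mul_assoc, ← mul_assoc]
      · rw [← mul_assoc]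
        refine mul_le_mul_left ((mul_le_mul_right hsup _).trans ?_) _
        have := hle hη (D := K * A₀) le_add_self
        push_cast at this
        rw [← mul_assoc]
        exact this.trans (ENNReal.inv_le_inv.2 (by norm_num))
    simp only [Finset.univ_unique, sum_singleton, hval] at h1 hN
    refine ⟨hval ▸ hu _, hN.trans ?_, h1.trans ?_⟩
    · rw [mul_assoc]
      exact mul_le_mul_right (hB₀ η hη1) _
    · rw [mul_assoc 2 (_ + _), add_mul]
      refine mul_le_mul_right (add_le_add (hB η hη1) ?_) _
      refine (mul_le_mul_right ((hB₀ η hη1).trans (mul_le_mul_right hη _)) _).trans_eq ?_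
      ring
  refine ⟨c, lt_min hc₁ hc₂, min_le_left _ _, fun η hη => (key η hη).1, fun η hη =>
    (key η hη).2.1.trans_lt ?_, ⟨2 * B₀, fun η hη => ?_⟩,
    ⟨2 * (B + 4 * (K * A) * (B₀ * c)), fun η hη => ?_⟩⟩
  · exact mul_lt_top (mul_lt_top (by simp) coe_lt_top) (hη.trans_lt coe_lt_top)
  · push_cast
    exact le_self_add.trans (key η hη).2.1
  · push_cast
    exact (key η hη).2.2

/-! ### The linear operator of the fixed point problem -/

theorem zop_congr {m : V → ℂ} {S : ℝ → Set ℝ} (hS : ∀ z, S z ⊆ Iio 0) {q q' : Fn}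
    (h : q =ᵐ[μJ] q') : zop m S q = zop m S q' := by
  funext p
  refine integral_congr_ae ?_
  filter_upwards [ae_restrict_of_ae_restrict_of_subset (hS p.2) (ae_slice h)] with τ hτ
  exact congrFun (mop_congr_ae _ hτ) p.1

theorem zop_add [NeZero d] (hm : Hom 1 m.1)
    (hc : Continuous m.1) {S : ℝ → Set ℝ} (hS : ∀ z, S z ⊆ Iio 0) {q q' : Fn}
    (hq : Cl q) (hq' : Cl q') (h1 : CL ψ 1 1 q < ⊤) (h1' : CL ψ 1 1 q' < ⊤) :
    zop m.1 S (q + q') = zop m.1 S q + zop m.1 S q' := by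
  funext p
  change _ = zop m.1 S q p + zop m.1 S q' p
  unfold zop
  rw [← integral_add (hm.heat_integrableOn hc ψ hq h1 p.1 p.2 (hS p.2))
    (hm.heat_integrableOn hc ψ hq' h1' p.1 p.2 (hS p.2))]
  refine integral_congr_ae ?_
  obtain ⟨B, hB⟩ := hq.bdd
  obtain ⟨B', hB'⟩ := hq'.bdd
  filter_upwards [ae_ne_restrict (S p.2) p.2] with τ hτ
  exact mop_add_right (hm.wiener_heat hc ψ (abs_pos.2 (sub_ne_zero.2 hτ.symm))).1 (hq.slice τ)
    (hq'.slice τ) (fun y => hB _) (fun y => hB' _) p.1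

/-- The unknown `(∇_x v, ∂_z v)`. -/
abbrev Unk (d : ℕ) : Type := Option (Fin d) → E d × ℝ → ℝ

def Good (ψ : LP) (U : Unk d) : Prop := (∀ o, Cl (U o)) ∧ ∑ o, nStar ψ (U o) < ⊤

theorem Good.lt_top {U : Unk d} (h : Good ψ U) (o : Option (Fin d)) :
    nStar ψ (U o) < ⊤ := sum_lt_top.1 h.2 o (Finset.mem_univ o)

theorem Good.sub [NeZero d] {U Y : Unk d} (hU : Good ψ U) (hV : Good ψ Y) : Good ψ (U - Y) :=
  ⟨fun o => (hU.1 o).sub (hV.1 o), sum_lt_top.2 fun o _ =>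
    ((isFunc_nStar ψ).sub_le (hU.1 o) (hV.1 o)).trans_lt (add_lt_top.2 ⟨hU.lt_top o, hV.lt_top o⟩)⟩

def tameBound (ψ : LP) (P : Fn → ℝ≥0∞) (r : ℝ) (η : TD) (U : Unk d) : ℝ≥0∞ :=
  besovNorm ψ r Λ η * ∑ o, supN (U o) + β ψ η * ∑ o, P (U o)

/-- Operators that are linear in `U`, depend only on the class of `U` modulo null sets, and satisfy
a tame estimate. -/
structure TameOp (ψ : LP) (P : Fn → ℝ≥0∞) (r : ℝ) (c : ℝ≥0)
    (T : TD → Unk d → Fn) : Prop where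
  cl : ∀ η, β ψ η ≤ c → ∀ U, Good ψ U → Cl (T η U)
  fin : ∀ η, β ψ η ≤ c → ∀ U, Good ψ U → nStar ψ (T η U) < ⊤
  add : ∀ η, β ψ η ≤ c → ∀ U Y, Good ψ U → Good ψ Y → T η (U + Y) = T η U + T η Y
  congr : ∀ η U Y, (∀ o, U o =ᵐ[μJ] Y o) → T η U =ᵐ[μJ] T η Y
  est : ∃ C : ℝ≥0, ∀ η, β ψ η ≤ c → ∀ U, Good ψ U → P (T η U) ≤ C * tameBound ψ P r η U

namespace TameOp

variable {P : (E d × ℝ → ℝ) → ℝ≥0∞} {r : ℝ} {c : ℝ≥0}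
  {T T' : TemperedDist d → Unk d → E d × ℝ → ℝ}

theorem mono {c' : ℝ≥0} (hc : c' ≤ c) (h : TameOp ψ P r c T) : TameOp ψ P r c' T := by
  have hc' : (c' : ℝ≥0∞) ≤ c := coe_le_coe.2 hc
  obtain ⟨C, hC⟩ := h.est
  exact ⟨fun η hη => h.cl η (hη.trans hc'), fun η hη => h.fin η (hη.trans hc'),
    fun η hη => h.add η (hη.trans hc'), h.congr, ⟨C, fun η hη => hC η (hη.trans hc')⟩⟩

theorem neg (hP : IsFunc ψ P r) (h : TameOp ψ P r c T) : TameOp ψ P r c fun η U p => -T η U p := by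
  obtain ⟨C, hC⟩ := h.est
  refine ⟨fun η hη U hU => (h.cl η hη U hU).neg, fun η hη U hU => ?_, fun η hη U Y hU hV => ?_,
    fun η U Y hUV => ?_, ⟨C, fun η hη U hU => ?_⟩⟩
  · have := h.fin η hη U hU
    simpa only [nStar, supN_neg, cheminLerner_neg] using this
  · rw [h.add η hη U Y hU hV]
    exact neg_add (T η U) (T η Y)
  · filter_upwards [h.congr η U Y hUV] with p hp
    rw [hp]
  · rw [hP.neg]
    exact hC η hη U hU

theorem sub [NeZero d] (hP : IsFunc ψ P r) (h : TameOp ψ P r c T) (h' : TameOp ψ P r c T') :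
    TameOp ψ P r c fun η U p => T η U p - T' η U p := by
  obtain ⟨C, hC⟩ := h.est
  obtain ⟨C', hC'⟩ := h'.est
  refine ⟨fun η hη U hU => (h.cl η hη U hU).sub (h'.cl η hη U hU), fun η hη U hU =>
    ((isFunc_nStar ψ).sub_le (h.cl η hη U hU) (h'.cl η hη U hU)).trans_lt
      (add_lt_top.2 ⟨h.fin η hη U hU, h'.fin η hη U hU⟩), fun η hη U Y hU hV => ?_,
    fun η U Y hUV => ?_, ⟨C + C', fun η hη U hU => ?_⟩⟩
  · rw [h.add η hη U Y hU hV, h'.add η hη U Y hU hV]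
    exact add_sub_add_comm (T η U) (T η Y) (T' η U) (T' η Y)
  · filter_upwards [h.congr η U Y hUV, h'.congr η U Y hUV] with p hp hp'
    rw [hp, hp']
  · rw [coe_add, add_mul]
    exact (hP.sub_le (h.cl η hη U hU) (h'.cl η hη U hU)).trans
      (add_le_add (hC η hη U hU) (hC' η hη U hU))

theorem sum [NeZero d] (hP : IsFunc ψ P r) {ι : Type} [Fintype ι]
    {T : ι → TD → Unk d → Fn} (h : ∀ i, TameOp ψ P r c (T i)) :
    TameOp ψ P r c fun η U p => ∑ i, T i η U p := by
  choose C hC using fun i => (h i).est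
  refine ⟨fun η hη U hU => Cl.sum _ fun i => (h i).cl η hη U hU, fun η hη U hU =>
    ((isFunc_nStar ψ).sum_le fun i => (h i).cl η hη U hU).trans_lt
      (sum_lt_top.2 fun i _ => (h i).fin η hη U hU), fun η hη U Y hU hV => ?_,
    fun η U Y hUV => ?_, ⟨∑ i, C i, fun η hη U hU => ?_⟩⟩
  · funext p
    simp only [(h _).add η hη U Y hU hV, Pi.add_apply]
    exact sum_add_distrib
  · filter_upwards [ae_all_iff.2 fun i => (h i).congr η U Y hUV] with p hp
    simp only [hp]
  · rw [ofNNReal_finsetSum, sum_mul]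
    exact (hP.sum_le fun i => (h i).cl η hη U hU).trans (sum_le_sum fun i _ => hC i η hη U hU)

theorem add_op [NeZero d] (hP : IsFunc ψ P r) (h : TameOp ψ P r c T) (h' : TameOp ψ P r c T') :
    TameOp ψ P r c fun η U p => T η U p + T' η U p := by
  simpa only [sub_neg_eq_add] using h.sub hP (h'.neg hP)

theorem coef_mul [NeZero d] (hP : IsFunc ψ P r) {h : TD → Fn}
    (hh : Coef ψ P r c h) (o : Option (Fin d)) : TameOp ψ P r c fun η U p => h η p * U o p := by
  obtain ⟨K, hK⟩ := hP.mul
  obtain ⟨C, hC⟩ := hh.sup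
  obtain ⟨C', hC'⟩ := hh.est
  refine ⟨fun η hη U hU => (hh.cl η hη).mul (hU.1 o), fun η hη U hU =>
    Coef.fin_mul (hh.cl η hη) (hU.1 o) (hh.fin η hη) (hU.lt_top o), fun η hη U Y hU hV => ?_,
    fun η U Y hUV => ?_, ⟨K * (C' + C), fun η hη U hU => ?_⟩⟩
  · exact mul_add (h η) (U o) (Y o)
  · filter_upwards [hUV o] with p hp
    rw [hp]
  · refine (hK _ _ (hh.cl η hη) (hU.1 o)).trans ?_
    rw [coe_mul, mul_assoc, coe_add, tameBound]
    refine mul_le_mul_right ?_ _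
    have e1 : P (h η) * supN (U o) ≤ C' * (besovNorm ψ r Λ η * ∑ o, supN (U o)) := by
      rw [← mul_assoc]
      exact mul_le_mul' (hC' η hη) (single_le_sum (f := fun o => supN (U o))
        (fun _ _ => zero_le) (Finset.mem_univ o))
    have e2 : supN (h η) * P (U o) ≤ C * (β ψ η * ∑ o, P (U o)) := by
      rw [← mul_assoc]
      exact mul_le_mul' (hC η hη) (single_le_sum (f := fun o => P (U o))
        (fun _ _ => zero_le) (Finset.mem_univ o))
    rw [add_mul]
    exact add_le_add (e1.trans (mul_le_mul_right le_self_add _))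
      (e2.trans (mul_le_mul_right le_add_self _))

theorem fin_cheminLerner (h : TameOp ψ P r c T) (hη : β ψ η ≤ c) {U : Unk d} (hU : Good ψ U) :
    CL ψ 1 1 (T η U) < ⊤ := le_add_self.trans_lt (h.fin η hη U hU)

theorem zop [NeZero d] (hP : IsFunc ψ P r) (hm : Hom 1 m.1)
    (hc : Continuous m.1) {S : ℝ → Set ℝ} (hSm : MeasurableSet {p : ℝ × ℝ | p.2 ∈ S p.1})
    (hS : ∀ z, S z ⊆ Iio 0) (h : TameOp ψ P r c T) :
    TameOp ψ P r c fun η U => zop m.1 S (T η U) := by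
  obtain ⟨K, hK⟩ := hP.zop hm hc
  obtain ⟨K', hK'⟩ := (isFunc_nStar ψ).zop hm hc
  obtain ⟨C, hC⟩ := h.est
  refine ⟨fun η hη U hU => hm.cl_zop hc ψ hSm hS (h.cl η hη U hU) (h.fin_cheminLerner hη hU),
    fun η hη U hU => (hK' _ (h.cl η hη U hU) (h.fin_cheminLerner hη hU) S hS).trans_lt
      (mul_lt_top coe_lt_top (h.fin η hη U hU)), fun η hη U Y hU hV => ?_,
    fun η U Y hUV => by rw [zop_congr hS (h.congr η U Y hUV)], ⟨K * C, fun η hη U hU => ?_⟩⟩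
  · rw [h.add η hη U Y hU hV]
    exact zop_add hm hc hS (h.cl η hη U hU) (h.cl η hη Y hV) (h.fin_cheminLerner hη hU)
      (h.fin_cheminLerner hη hV)
  · rw [coe_mul, mul_assoc]
    exact (hK _ (h.cl η hη U hU) (h.fin_cheminLerner hη hU) S hS).trans
      (mul_le_mul_right (hC η hη U hU) _)

end TameOp

/-- `(|∇_x H|² - |D_x|H) / (1 + |D_x|H)`. -/
def gCoef (ψ : LP) (η : TD) (p : V × ℝ) : ℝ :=
  (∑ k, harm ψ (partialD k) η p * harm ψ (partialD k) η p - harm ψ Λ η p) / (1 + harm ψ Λ η p)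

/-- `Q_a`. -/
def opA (ψ : LP) (η : TD) (U : Unk d) (p : V × ℝ) : ℝ :=
  ∑ k, harm ψ (partialD k) η p * U (some k) p - gCoef ψ η p * U none p

/-- The components of the vector field `B`. -/
def opB (ψ : LP) (k : Fin d) (η : TD) (U : Unk d) (p : V × ℝ) : ℝ :=
  harm ψ (partialD k) η p * U none p - harm ψ Λ η p * U (some k) p

def past (z : ℝ) : Set ℝ := Iio 0 ∩ Iic z

theorem past_subset (z : ℝ) : past z ⊆ Iio 0 := inter_subset_left

theorem Ioo_subset_Iio_zero (z : ℝ) : Ioo z 0 ⊆ Iio (0 : ℝ) := fun _ h => h.2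

theorem measurableSet_past : MeasurableSet {p : ℝ × ℝ | p.2 ∈ past p.1} :=
  (measurableSet_lt measurable_snd measurable_const).inter
    (measurableSet_le measurable_snd measurable_fst)

def opW (ψ : LP) (η : TD) (U : Unk d) (p : V × ℝ) : ℝ :=
  ∑ k, zop (partialD k).1 past (opB ψ k η U) p - zop (Λ).1 past (opA ψ η U) p

def opQ (ψ : LP) (η : TD) (U : Unk d) (p : V × ℝ) : ℝ :=
  opA ψ η U p + opW ψ η U p

def opD (ψ : LP) (η : TD) (U : Unk d) : Fn :=
  zop (Λ).1 (fun z => Ioo z 0) (opQ ψ η U)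

def opL (ψ : LP) (η : TD) (U : Unk d) : Unk d
  | some k => fun p => -zop (partialD k).1 (fun z => Ioo z 0) (opQ ψ η U) p
  | none => fun p => -(opD ψ η U p - opQ ψ η U p)

structure TameOps (ψ : LP) (P : Fn → ℝ≥0∞) (r : ℝ) (c : ℝ≥0) : Prop where
  a : TameOp ψ P r c (opA ψ)
  b : ∀ k, TameOp ψ P r c (opB ψ k)
  w : TameOp ψ P r c (opW ψ)
  q : TameOp ψ P r c (opQ ψ)
  d : TameOp ψ P r c (opD ψ)
  l : ∀ o, TameOp ψ P r c fun η U => opL ψ η U o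

theorem exists_tameOps [NeZero d]
    (hP : IsFunc ψ P r) : ∃ c : ℝ≥0, 0 < c ∧ c ≤ 1 ∧ TameOps ψ P r c := by
  have hN := isFunc_nStar ψ
  obtain ⟨c, hc0, hc1, hg⟩ := Coef.div_one_add hP one_pos (Coef.harm hP 1 hom_abs)
    ((Coef.sum hP fun k : Fin d => (Coef.harm hP 1 (hom_partialD k)).mul hP
      (Coef.harm hP 1 (hom_partialD k))).sub hP (Coef.harm hP 1 hom_abs))
    (Coef.harm hN 1 hom_abs)
    ((Coef.sum hN fun k : Fin d => (Coef.harm hN 1 (hom_partialD k)).mul hN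
      (Coef.harm hN 1 (hom_partialD k))).sub hN (Coef.harm hN 1 hom_abs))
  have ha : TameOp ψ P r c (opA ψ) :=
    (TameOp.sum hP fun k : Fin d => TameOp.coef_mul hP (Coef.harm hP c (hom_partialD k)) (some k)).sub
      hP (TameOp.coef_mul hP hg none)
  have hb : ∀ k, TameOp ψ P r c (opB ψ k) := fun k =>
    (TameOp.coef_mul hP (Coef.harm hP c (hom_partialD k)) none).sub hP
      (TameOp.coef_mul hP (Coef.harm hP c hom_abs) (some k))
  have hw : TameOp ψ P r c (opW ψ) :=
    (TameOp.sum hP fun k : Fin d => (hb k).zop hP (hom_partialD k) (continuous_partialD k)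
      measurableSet_past past_subset).sub hP
      (ha.zop hP hom_abs continuous_abs_symbol measurableSet_past past_subset)
  have hq : TameOp ψ P r c (opQ ψ) := ha.add_op hP hw
  have hd : TameOp ψ P r c (opD ψ) :=
    hq.zop hP hom_abs continuous_abs_symbol measurableSet_Ioo_family Ioo_subset_Iio_zero
  refine ⟨c, hc0, hc1, ha, hb, hw, hq, hd, fun o => ?_⟩
  cases o with
  | none => exact (hd.sub hP hq).neg hP
  | some k =>
    exact (hq.zop hP (hom_partialD k) (continuous_partialD k) measurableSet_Ioo_family
      Ioo_subset_Iio_zero).neg hP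

def dataU (ψ : LP) (f : TD) : Unk d
  | some k => harm ψ (partialD k) f
  | none => harm ψ Λ f

theorem cl_dataU (hf : β ψ f < ⊤) (o : Option (Fin d)) : Cl (dataU ψ f o) := by
  cases o with
  | none => exact hom_abs.cl_harm hf
  | some k => exact (hom_partialD k).cl_harm hf

theorem dataU_le (hP : IsFunc ψ P r) : ∃ C : ℝ≥0, ∀ f, β ψ f < ⊤ →
      ∑ o, P (dataU ψ f o) ≤ C * besovNorm ψ r Λ f := by
  have h : ∀ o, ∃ C : ℝ≥0, ∀ f, β ψ f < ⊤ → P (dataU ψ f o) ≤ C * besovNorm ψ r Λ f := fun o => by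
    cases o with
    | none => exact hP.harm hom_abs
    | some k => exact hP.harm (hom_partialD k)
  choose C hC using h
  refine ⟨∑ o, C o, fun f hf => ?_⟩
  rw [ofNNReal_finsetSum, sum_mul]
  exact sum_le_sum fun o _ => hC o f hf

theorem TameOps.mono {c c' : ℝ≥0} (hc : c' ≤ c) (h : TameOps ψ P r c) : TameOps ψ P r c' :=
  ⟨h.a.mono hc, fun k => (h.b k).mono hc, h.w.mono hc, h.q.mono hc, h.d.mono hc,
    fun o => (h.l o).mono hc⟩

theorem TameOps.l_le {c : ℝ≥0} (h : TameOps ψ P r c) : ∃ C : ℝ≥0, ∀ η, β ψ η ≤ c → ∀ U, Good ψ U →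
      ∑ o, P (opL ψ η U o) ≤ C * tameBound ψ P r η U := by
  choose C hC using fun o => (h.l o).est
  refine ⟨∑ o, C o, fun η hη U hU => ?_⟩
  rw [ofNNReal_finsetSum, sum_mul]
  exact sum_le_sum fun o _ => hC o η hη U hU

theorem exists_contraction [NeZero d] (ψ : LP) : ∃ c : ℝ≥0, 0 < c ∧ c ≤ 1 ∧
    TameOps ψ (nStar ψ) 0 c ∧ ∀ η, β ψ η ≤ c → ∀ U, Good ψ U →
      ∑ o, nStar ψ (opL ψ η U o) ≤ 4⁻¹ * ∑ o, nStar ψ (U o) := by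
  obtain ⟨c, hc0, hc1, hT⟩ := exists_tameOps (isFunc_nStar ψ)
  obtain ⟨C, hC⟩ := hT.l_le
  obtain ⟨c', hc'0, hc'⟩ := exists_small (C * 2)
  refine ⟨min c c', lt_min hc0 hc'0, (min_le_left _ _).trans hc1, hT.mono (min_le_left _ _),
    fun η hη U hU => ?_⟩
  refine (hC η (hη.trans (coe_le_coe.2 (min_le_left _ _))) U hU).trans ?_
  have h1 : tameBound ψ (nStar ψ) 0 η U ≤ 2 * β ψ η * ∑ o, nStar ψ (U o) := by
    rw [tameBound, two_mul, add_mul]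
    exact add_le_add_left (mul_le_mul_right (sum_le_sum fun o _ => supN_le_nStar ψ _) _) _
  refine (mul_le_mul_right h1 _).trans ?_
  rw [← mul_assoc]
  refine mul_le_mul_left ?_ _
  have h2 := coe_mul_le_quarter hc' (hη.trans (coe_le_coe.2 (min_le_right _ _)))
  rw [coe_mul, mul_assoc] at h2
  exact h2

/-- Solutions of the fixed point problem for the gradient. -/
structure Sol (ψ : LP) (η f : TD) (U : Unk d) : Prop where
  good : Good ψ U
  fix : U = dataU ψ f + opL ψ η U
  le : ∑ o, nStar ψ (U o) ≤ 2 * ∑ o, nStar ψ (dataU ψ f o)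
  tame : ∀ {P : Fn → ℝ≥0∞} {r : ℝ}, IsFunc ψ P r → ∀ X : ℝ≥0∞,
    (∀ Y, Good ψ Y → ∑ o, P (opL ψ η Y o) ≤ X * ∑ o, nStar ψ (Y o) + 2⁻¹ * ∑ o, P (Y o)) →
    ∑ o, P (U o) ≤ 2 * (∑ o, P (dataU ψ f o) + 4 * X * ∑ o, nStar ψ (dataU ψ f o))

theorem exists_sol [NeZero d] {c : ℝ≥0} (hT : TameOps ψ (nStar ψ) 0 c) (hη : β ψ η ≤ c)
    (hL : ∀ U, Good ψ U → ∑ o, nStar ψ (opL ψ η U o) ≤ 4⁻¹ * ∑ o, nStar ψ (U o))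
    (hf : β ψ f < ⊤) : ∃ U, Sol ψ η f U := by
  obtain ⟨C, hC⟩ := dataU_le (isFunc_nStar ψ)
  obtain ⟨U, h1, h2, h3, h4, h5⟩ := tame_neumann ψ (L := opL ψ η)
    (fun u v hu hu' hv hv' => funext fun o => (hT.l o).add η hη u v ⟨hu, hu'⟩ ⟨hv, hv'⟩)
    (fun u hu hu' o => (hT.l o).cl η hη u ⟨hu, hu'⟩) (fun u hu hu' => hL u ⟨hu, hu'⟩)
    (b := dataU ψ f) (cl_dataU hf) ((hC f hf).trans_lt (mul_lt_top coe_lt_top hf))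
  exact ⟨U, ⟨h1, h2⟩, h3, h4, fun hP X hX => h5 hP X fun u hu hu' => hX u ⟨hu, hu'⟩⟩

theorem Sol.est [NeZero d] (hP : IsFunc ψ P r) : ∃ c : ℝ≥0, 0 < c ∧ c ≤ 1 ∧ ∃ C : ℝ≥0, ∀ {η f : TD},
      β ψ η ≤ c → β ψ f < ⊤ → ∀ {U}, Sol ψ η f U →
      P (fun p => harm ψ Λ f p - opD ψ η U p) + P (U none) ≤ C * (besovNorm ψ r Λ f +
          besovNorm ψ r Λ η * β ψ f) ∧
      ∑ k, P (opB ψ k η U) + P (opA ψ η U) ≤ C * (β ψ η * besovNorm ψ r Λ f +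
          besovNorm ψ r Λ η * β ψ f) := by
  obtain ⟨c, hc0, hc1, hT⟩ := exists_tameOps hP
  obtain ⟨L, hL⟩ := hT.l_le
  obtain ⟨c', hc'0, hc'⟩ := exists_small L
  obtain ⟨D₀, hD₀⟩ := dataU_le (isFunc_nStar ψ)
  obtain ⟨D, hD⟩ := dataU_le hP
  obtain ⟨M, hM⟩ := hT.d.est
  obtain ⟨A, hA⟩ := hT.a.est
  choose B hB using fun k => (hT.b k).est
  set C₁ : ℝ≥0 := 2 * (D + 4 * L * D₀)
  set C₂ : ℝ≥0 := C₁ + 2 * D₀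
  refine ⟨min c c', lt_min hc0 hc'0, (min_le_left _ _).trans hc1, D + M * C₂ + C₁ + (∑ k, B k + A) * C₂,
    fun {η f} hη hf U hU => ?_⟩
  set x := β ψ η
  set y := besovNorm ψ r Λ η
  set s := β ψ f
  set t := besovNorm ψ r Λ f
  have hη1 : x ≤ c := hη.trans (coe_le_coe.2 (min_le_left _ _))
  have hx1 : x ≤ 1 := hη1.trans (by exact_mod_cast hc1)
  have hNU : ∑ o, supN (U o) ≤ 2 * (D₀ * s) :=
    (sum_le_sum fun o _ => supN_le_nStar ψ _).trans (hU.le.trans (mul_le_mul_right (hD₀ f hf) _))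
  have hPU : ∑ o, P (U o) ≤ C₁ * (t + y * s) := by
    refine (hU.tame hP (L * y) fun Y hV => ?_).trans ?_
    · refine (hL η hη1 Y hV).trans ?_
      rw [tameBound, mul_add, ← mul_assoc, ← mul_assoc]
      refine add_le_add (mul_le_mul_right (sum_le_sum fun o _ => supN_le_nStar ψ _) _)
        (mul_le_mul_left ?_ _)
      exact (coe_mul_le_quarter hc' (hη.trans (coe_le_coe.2 (min_le_right _ _)))).trans
        (ENNReal.inv_le_inv.2 (by norm_num))
    · refine (mul_le_mul_right (add_le_add (hD f hf) (mul_le_mul_right (hD₀ f hf) _)) _).trans ?_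
      have e : (C₁ : ℝ≥0∞) * (t + y * s) = 2 * (D * t + 4 * (L * y) * (D₀ * s)) +
          2 * (D * (y * s) + 4 * L * D₀ * t) := by
        simp only [C₁]
        push_cast
        ring
      rw [e]
      exact le_self_add
  have hTB : tameBound ψ P r η U ≤ C₂ * (x * t + y * s) := by
    refine (add_le_add (mul_le_mul_right hNU y) (mul_le_mul_right hPU x)).trans ?_
    have e1 : x * (C₁ * (t + y * s)) ≤ C₁ * (x * t + y * s) := by
      rw [mul_left_comm, mul_add]
      exact mul_le_mul_right (add_le_add_right (mul_le_of_le_one_left' hx1) _) _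
    refine (add_le_add_right e1 _).trans ?_
    have e : (C₂ : ℝ≥0∞) * (x * t + y * s) =
        y * (2 * (D₀ * s)) + C₁ * (x * t + y * s) + 2 * D₀ * (x * t) := by
      simp only [C₂]
      push_cast
      ring
    rw [e]
    exact le_self_add
  have hxt : x * t + y * s ≤ t + y * s := add_le_add_left (mul_le_of_le_one_left' hx1) _
  constructor
  · have e1 : P (fun p => harm ψ Λ f p - opD ψ η U p) ≤ (D + M * C₂) * (t + y * s) := by
      refine (hP.sub_le (hom_abs.cl_harm hf) (hT.d.cl η hη1 U hU.good)).trans ?_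
      have e2 : P (harm ψ Λ f) ≤ D * (t + y * s) :=
        (single_le_sum (f := fun o => P (dataU ψ f o)) (fun _ _ => zero_le)
          (Finset.mem_univ none)).trans ((hD f hf).trans (mul_le_mul_right le_self_add _))
      rw [add_mul, mul_assoc]
      exact add_le_add e2 ((hM η hη1 U hU.good).trans (mul_le_mul_right (hTB.trans
        (mul_le_mul_right hxt _)) _))
    have e3 : P (U none) ≤ C₁ * (t + y * s) := (single_le_sum (f := fun o => P (U o))
      (fun _ _ => zero_le) (Finset.mem_univ none)).trans hPU
    refine (add_le_add e1 e3).trans ?_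
    rw [← add_mul]
    push_cast
    exact mul_le_mul_left le_self_add _
  · have e1 : ∑ k, P (opB ψ k η U) + P (opA ψ η U) ≤
        (∑ k, (B k : ℝ≥0∞) + A) * tameBound ψ P r η U := by
      rw [add_mul, sum_mul]
      exact add_le_add (sum_le_sum fun k _ => hB k η hη1 U hU.good) (hA η hη1 U hU.good)
    refine (e1.trans (mul_le_mul_right hTB _)).trans ?_
    rw [← mul_assoc]
    push_cast
    exact mul_le_mul_left le_add_self _

theorem bn_neg (ψ : LP) (j : ℤ) (u : Fn) (z : ℝ) : bn ψ j (fun p => -u p) z = bn ψ j u z := by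
  simp only [bn, del, mop_neg_right, enorm_neg]

theorem besovNormFun_opW_le [NeZero d] (ψ : LP) : ∃ C : ℝ≥0, ∀ (r : ℝ) (c : ℝ≥0)
    (η : TD) (U : Unk d), TameOps ψ (nStar ψ) 0 c → β ψ η ≤ c →
    Good ψ U → besovNormFun ψ r (fun x => opW ψ η U (x, 0)) ≤
      C * (∑ k, CL ψ 1 (r + 1) (opB ψ k η U) + CL ψ 1 (r + 1) (opA ψ η U)) := by
  obtain ⟨A, hA⟩ := hom_abs.bn_zop_le continuous_abs_symbol ψ
  choose B hB using fun k : Fin d => (hom_partialD k).bn_zop_le (continuous_partialD k) ψ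
  refine ⟨∑ k, B k + A, fun r c η U hT hη hU => ?_⟩
  let u : Unk d := fun o => o.elim (fun p => -zop (Λ).1 past (opA ψ η U) p)
    fun k => zop (partialD k).1 past (opB ψ k η U)
  have hcl : ∀ o, Cl (u o) := fun o => by
    cases o with
    | none =>
      exact (hom_abs.cl_zop continuous_abs_symbol ψ measurableSet_past past_subset
        (hT.a.cl η hη U hU) (hT.a.fin_cheminLerner hη hU)).neg
    | some k =>
      exact (hom_partialD k).cl_zop (continuous_partialD k) ψ measurableSet_past
        past_subset ((hT.b k).cl η hη U hU) ((hT.b k).fin_cheminLerner hη hU)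
  have hw : ∀ p, HasSum (fun o => u o p) (opW ψ η U p) := fun p => by
    have h := hasSum_fintype fun o => u o p
    rw [Fintype.sum_option] at h
    convert h using 1
    exact (neg_add_eq_sub _ _).symm
  have hbn : ∀ j, bn ψ j (opW ψ η U) 0 ≤ ∑ o, bn ψ j (u o) 0 := fun j => by
    have h := bn_tsum_le ψ hcl (by
      rw [tsum_fintype]
      exact sum_lt_top.2 fun o _ => (hcl o).supN_lt_top) hw j 0
    rwa [tsum_fintype] at h
  have hz : ∀ {q : Fn} {v : Fn} {K : ℝ≥0}, (∀ j, bn ψ j v 0 ≤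
      K * ∫⁻ τ in Iio 0, kap j |0 - τ| * bn ψ j q τ) →
      ∑' j : ℤ, ofReal ((2 : ℝ) ^ (r * j)) * bn ψ j v 0 ≤
        K * CL ψ 1 (r + 1) q := fun {q v K} h => by
    rw [cheminLerner_one_eq, ← ENNReal.tsum_mul_left]
    refine tsum_le_tsum fun j => ?_
    have h1 : ∫⁻ τ in Iio 0, kap j |0 - τ| * bn ψ j q τ ≤
        ofReal ((2 : ℝ) ^ j) * ∫⁻ τ in Iio 0, bn ψ j q τ := by
      rw [← lintegral_const_mul' _ _ ofReal_ne_top]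
      exact lintegral_mono fun τ => mul_le_mul_left (kap_le (abs_nonneg _)) _
    refine (mul_le_mul_right ((h j).trans (mul_le_mul_right h1 _)) _).trans_eq ?_
    rw [add_mul, one_mul, rpow_add two_pos, ← two_zpow_eq_rpow, ofReal_mul (by positivity)]
    ring
  calc besovNormFun ψ r (fun x => opW ψ η U (x, 0))
      = ∑' j : ℤ, ofReal ((2 : ℝ) ^ (r * j)) * bn ψ j (opW ψ η U) 0 := by
        simp only [besovNormFun, funBlock_one_eq]
        rfl
    _ ≤ ∑' j : ℤ, ∑ o, ofReal ((2 : ℝ) ^ (r * j)) * bn ψ j (u o) 0 :=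
        tsum_le_tsum fun j => by
          rw [← mul_sum]
          exact mul_le_mul_right (hbn j) _
    _ = ∑ o, ∑' j : ℤ, ofReal ((2 : ℝ) ^ (r * j)) * bn ψ j (u o) 0 :=
        Summable.tsum_finsetSum fun _ _ => ENNReal.summable
    _ ≤ A * CL ψ 1 (r + 1) (opA ψ η U) + ∑ k, B k * CL ψ 1 (r + 1) (opB ψ k η U) := by
        rw [Fintype.sum_option]
        refine add_le_add (hz fun j => ?_) (sum_le_sum fun k _ => hz fun j => ?_)
        · refine (bn_neg ψ j _ 0).trans_le ?_
          exact hA _ (hT.a.cl η hη U hU) (hT.a.fin_cheminLerner hη hU) past past_subset j 0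
        · exact hB k _ ((hT.b k).cl η hη U hU) ((hT.b k).fin_cheminLerner hη hU) past
            past_subset j 0
    _ ≤ _ := by
        rw [coe_add, add_mul, mul_add, mul_add, add_comm]
        refine add_le_add (le_trans ?_ le_self_add) le_add_self
        rw [mul_sum]
        refine sum_le_sum fun k _ => mul_le_mul_left (coe_le_coe.2 ?_) _
        exact single_le_sum (f := B) (fun _ _ => zero_le) (Finset.mem_univ k)

theorem bsym_riesz_fat (ψ : LP) (m : Symbol d) (i : ℤ) (ξ : V) :
    bsym m.1 0 ψ.fat i ξ * ψ.phc i ξ = m.1 ξ * ψ.phc i ξ :=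
  (congrFun ((bsym_zero_eq ψ m.1 i).symm.trans (bsym_ph_eq ψ m.1 0 i)) ξ).symm

theorem Hom.wiener_fat (hm : Hom σ m.1) (ψ : LP) (i : ℤ) : Wiener (bsym m.1 0 ψ.fat i) := by
  obtain ⟨C, _, hC⟩ := hm.block_bound ψ.annular_fat ψ.fat_herm
  exact (hC i 0 le_rfl).1

theorem Hom.mop_eq_fat_del (hm : Hom σ m.1) (ψ : LP) (i : ℤ) (hu : Measurable u) (hB : ∀ y, |u y| ≤ B) (x : V) :
    mop (fun ξ => m.1 ξ * ψ.phc i ξ) u x = mop (bsym m.1 0 ψ.fat i) (ψ.del i u) x := by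
  rw [del, (hm.wiener_fat ψ i).mop_mop (wiener_phc ψ i) hu hB]
  simp only [bsym_riesz_fat]

theorem riesz_mul_abs (k : Fin d) (ξ : V) : (riesz k).1 ξ * (Λ).1 ξ = (partialD k).1 ξ := by
  simp only [partialD, Symbol.abs, riesz]
  by_cases h : ξ = 0
  · simp [h]
  · have hn : ((‖ξ‖ : ℝ) : ℂ) ≠ 0 := by exact_mod_cast norm_ne_zero_iff.2 h
    push_cast
    field_simp

theorem sum_riesz_sq (ψ : LP) (i : ℤ) (ξ : V) :
    ∑ k : Fin d, bsym (riesz k).1 0 ψ.fat i ξ * ((riesz k).1 ξ * ψ.phc i ξ) =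
      ((-1 : ℝ) : ℂ) * ψ.phc i ξ := by
  rw [← sum_partialD_mul_riesz ψ i ξ]
  refine sum_congr rfl fun k _ => ?_
  simp only [Symbol.mul]
  rw [mul_left_comm, bsym_riesz_fat, ← mul_assoc, ← partialD_mul_invAbs k ξ]
  ring

theorem Hom.hasSum_zop [NeZero d] (hm : Hom 1 m.1) (hc : Continuous m.1)
    (ψ : LP) (hq : Cl q) (hq1 : CL ψ 1 1 q < ⊤)
    {S : ℝ → Set ℝ} (hS : ∀ z, S z ⊆ Iio 0) (x : V) (z : ℝ) :
    HasSum (fun i => ψ.del i (fun y => zop m.1 S q (y, z)) x) (zop m.1 S q (x, z)) := by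
  simp only [hm.del_zop hc ψ hq hq1 hS]
  obtain ⟨B, hB⟩ := hq.bdd
  obtain ⟨C, hC⟩ := hm.block_le ψ
  have hmeas : ∀ i, Measurable fun τ : ℝ =>
      mop (bsym m.1 |z - τ| ψ.ph i) (fun y => q (y, τ)) x := fun i => by
    have h := (measurable_mop_heat (m := fun ξ => m.1 ξ * ψ.phc i ξ)
      (hm.annular_block ψ i).cont.measurable hq.meas).comp
      (measurable_const.prodMk measurable_id : Measurable fun τ : ℝ => (((x, z) : V × ℝ), τ))
    convert h using 2 with τ
    refine congrArg (fun g => mop g (fun y => q (y, τ)) x) (funext fun ξ => ?_)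
    rw [bsym, phc, ψ.phi_eq]
    ring
  have hle : ∀ i, ∫⁻ τ in S z, ‖mop (bsym m.1 |z - τ| ψ.ph i) (fun y => q (y, τ)) x‖ₑ ≤
      C * ∫⁻ τ in Iio 0, kap i |z - τ| * bn ψ i q τ := fun i => by
    rw [← lintegral_const_mul' _ _ coe_ne_top]
    refine (lintegral_mono fun τ => ?_).trans (lintegral_mono_set (hS z))
    refine (hC i _ (abs_nonneg _) _ (hq.slice τ) B (fun y => hB _) x).trans_eq ?_
    rw [zpow_one, mul_assoc]
    rfl
  have hm' : ∀ i, Measurable fun τ : ℝ => kap i |z - τ| * bn ψ i q τ := fun i =>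
    ((measurable_kap i).comp (by fun_prop : Measurable fun τ : ℝ => |z - τ|)).mul
      (measurable_bn ψ i hq)
  have hsum : ∑' i, ∫⁻ τ in S z, ‖mop (bsym m.1 |z - τ| ψ.ph i) (fun y => q (y, τ)) x‖ₑ ≠ ⊤ := by
    refine ((tsum_le_tsum hle).trans_lt ?_).ne
    rw [ENNReal.tsum_mul_left, ← lintegral_tsum fun i => (hm' i).aemeasurable]
    exact mul_lt_top coe_lt_top ((lintegral_dyadicBound_le ψ hq
      (s := fun τ => |z - τ|) (by fun_prop) fun τ => abs_nonneg _).trans_lt hq1)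
  refine hasSum_integral_of_hasSum (fun i => ⟨(hmeas i).aestronglyMeasurable,
    ENNReal.lt_top_of_tsum_ne_top hsum i⟩) ?_ ?_
  · filter_upwards [ae_ne_restrict (S z) z] with τ hτ
    have hs := abs_pos.2 (sub_ne_zero.2 hτ.symm)
    obtain ⟨_, h2, h3⟩ := hm.wiener_heat hc ψ hs
    exact hasSum_mop (fun i => hm.wiener_bsym ψ i hs.le) h2 h3 (hq.slice τ) (fun y => hB (y, τ)) x
  · refine (summable_toReal hsum).congr fun i => ?_
    exact (integral_norm_eq_lintegral_enorm (hmeas i).aestronglyMeasurable).symm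

/-- The part `m(D)` of the gradient of `e^{z|D|} f - ∫_z^0 e^{(z-τ)|D|} q dτ`. -/
def fld (ψ : LP) (m : Symbol d) (f : TD) (q : Fn) (p : V × ℝ) : ℝ :=
  harm ψ m f p - zop m.1 (fun z => Ioo z 0) q p

theorem Cl.memLp_top {u : Fn} (hu : Cl u) : MemLp u ⊤ μJ := by
  obtain ⟨B, hB⟩ := hu.bdd
  exact memLp_top_of_bound hu.meas.aestronglyMeasurable B (ae_of_all _ hB)

section

variable [NeZero d] {q : E d × ℝ → ℝ}

theorem cl_zop_fut (hq : Cl q) (hq1 : CL ψ 1 1 q < ⊤)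
    (hm : Hom 1 m.1) (hc : Continuous m.1) : Cl (zop m.1 (fun z => Ioo z 0) q) :=
  hm.cl_zop hc ψ measurableSet_Ioo_family Ioo_subset_Iio_zero hq hq1

theorem cl_fld (hf : β ψ f < ⊤) (hq : Cl q) (hq1 : CL ψ 1 1 q < ⊤) (hm : Hom 1 m.1) (hc : Continuous m.1) : Cl (fld ψ m f q) :=
  (hm.cl_harm hf).sub (cl_zop_fut hq hq1 hm hc)

theorem mop_fld (hf : β ψ f < ⊤) (hq : Cl q) (hq1 : CL ψ 1 1 q < ⊤) (hm : Hom 1 m.1)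
    (hc : Continuous m.1) (hg : Wiener g) (x : V) (z : ℝ) :
    mop g (fun y => fld ψ m f q (y, z)) x = mop g (fun y => harm ψ m f (y, z)) x -
      mop g (fun y => zop m.1 (fun z => Ioo z 0) q (y, z)) x := by
  obtain ⟨B, hB⟩ := (hm.cl_harm hf).bdd
  obtain ⟨B', hB'⟩ := (cl_zop_fut hq hq1 hm hc).bdd
  exact mop_sub_right hg ((hm.cl_harm hf).slice z) ((cl_zop_fut hq hq1 hm hc).slice z)
    (fun y => hB _) (fun y => hB' _) x

theorem hasSum_fld (hf : β ψ f < ⊤) (hq : Cl q) (hq1 : CL ψ 1 1 q < ⊤) (hm : Hom 1 m.1)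
    (hc : Continuous m.1) (x : V) (hz : z < 0) :
    HasSum (fun i => ψ.del i (fun y => fld ψ m f q (y, z)) x) (fld ψ m f q (x, z)) := by
  have h1 := (hm.summable_harm hf (neg_nonneg.2 hz.le) x).hasSum
  have h2 := hm.hasSum_zop hc ψ hq hq1 Ioo_subset_Iio_zero x z
  have h3 := h1.sub h2
  have e : fld ψ m f q (x, z) = (∑' j, distBlock ψ (m.mul (heat (-z))) j f x) -
      zop m.1 (fun z => Ioo z 0) q (x, z) := by
    rw [fld, harm, if_pos hz]
  rw [e]
  refine h3.congr_fun fun i => ?_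
  rw [← hm.del_harm hf i hz x]
  exact mop_fld hf hq hq1 hm hc (wiener_phc ψ i) x z

theorem mop_riesz_fld (hf : β ψ f < ⊤) (hq : Cl q)
    (hq1 : CL ψ 1 1 q < ⊤) (k : Fin d) (i : ℤ) (x : V) (hz : z < 0) :
    mop (fun ξ => (riesz k).1 ξ * ψ.phc i ξ) (fun y => fld ψ Λ f q (y, z)) x =
      ψ.del i (fun y => fld ψ (partialD k) f q (y, z)) x := by
  have hW := (hom_riesz k).annular_block ψ i
  rw [mop_fld hf hq hq1 hom_abs continuous_abs_symbol hW, del,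
    mop_fld hf hq hq1 (hom_partialD k) (continuous_partialD k) (wiener_phc ψ i)]
  congr 1
  · obtain ⟨B, hB⟩ := (hom_abs.cl_harm hf).bdd
    rw [(hom_riesz k).mop_eq_fat_del ψ i ((hom_abs.cl_harm hf).slice z) (fun y => hB _)]
    have h1 : (ψ.del i fun y => harm ψ Λ f (y, z)) = distBlock ψ ((Λ).mul (heat (-z))) i f :=
      funext fun y => hom_abs.del_harm hf i hz y
    rw [h1]
    refine Eq.trans ?_ ((hom_partialD k).del_harm hf i hz x).symm
    refine mop_fat_distBlock ψ (hom_riesz k) i (hom_abs.wiener_mul_heat ψ i (neg_nonneg.2 hz.le))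
      le_rfl (fun ξ _ => ?_) f x
    simp only [Symbol.mul]
    rw [← riesz_mul_abs]
    simp [hsym]
    ring
  · rw [hom_abs.mop_zop continuous_abs_symbol ψ hW hq hq1 Ioo_subset_Iio_zero]
    refine Eq.trans ?_ ((hom_partialD k).del_zop (continuous_partialD k) ψ hq hq1
      Ioo_subset_Iio_zero i x z).symm
    refine integral_congr_ae (ae_of_all _ fun τ => congrArg (fun g => mop g _ x)
      (funext fun ξ => ?_))
    rw [bsym, ← riesz_mul_abs, phc, ψ.phi_eq]
    ring

theorem sum_mop_riesz_fld (hf : β ψ f < ⊤) (hq : Cl q)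
    (hq1 : CL ψ 1 1 q < ⊤) (i : ℤ) (x : V) (hz : z < 0) :
    -∑ k, mop (fun ξ => (riesz k).1 ξ * ψ.phc i ξ) (fun y => fld ψ (partialD k) f q (y, z)) x =
      ψ.del i (fun y => fld ψ Λ f q (y, z)) x := by
  have ha := cl_fld hf hq hq1 hom_abs continuous_abs_symbol
  obtain ⟨B, hB⟩ := ha.bdd
  have h1 : ∀ k, mop (fun ξ => (riesz k).1 ξ * ψ.phc i ξ)
        (fun y => fld ψ (partialD k) f q (y, z)) x =
      mop (fun ξ => bsym (riesz k).1 0 ψ.fat i ξ *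
        ((riesz k).1 ξ * ψ.phc i ξ)) (fun y => fld ψ Λ f q (y, z)) x := fun k => by
    have hk := cl_fld hf hq hq1 (hom_partialD k) (continuous_partialD k)
    obtain ⟨B', hB'⟩ := hk.bdd
    rw [(hom_riesz k).mop_eq_fat_del ψ i (hk.slice z) (fun y => hB' _),
      ← ((hom_riesz k).wiener_fat ψ i).mop_mop ((hom_riesz k).annular_block ψ i)
      (ha.slice z) (fun y => hB _)]
    exact congrArg (fun u => mop _ u x) (funext fun y => (mop_riesz_fld hf hq hq1 k i y hz).symm)
  simp only [h1]
  rw [← (Wiener.sum Finset.univ (fun k => ((hom_riesz k).wiener_fat ψ i).mul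
    ((hom_riesz k).annular_block ψ i)) (ha.slice z) (fun y => hB _) x).2]
  simp only [sum_riesz_sq]
  rw [mop_const_mul, neg_one_mul, neg_neg]
  rfl

variable (ψ f q) in
def gradOf : GradData d :=
  ⟨fun p => WithLp.toLp 2 fun k => fld ψ (partialD k) f q p,
    fun p => fld ψ Λ f q p + q p, fld ψ Λ f q⟩

theorem hasGradData_gradOf (hf : β ψ f < ⊤) (hq : Cl q) (hq1 : CL ψ 1 1 q < ⊤)
    (hv : IsGivenBy v fun p => harmU ψ f p - duh q p + c) : HasGradData ψ v (gradOf ψ f q) := by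
  have hcl : ∀ k, Cl (fld ψ (partialD k) f q) := fun k =>
    cl_fld hf hq hq1 (hom_partialD k) (continuous_partialD k)
  have ha := cl_fld hf hq hq1 hom_abs continuous_abs_symbol
  have hconst : ∀ e : V × ℝ, WeakDeriv e (fun _ => c) fun _ => 0 := fun e =>
    weakDeriv_of_hasLineDerivAt (Cl.tame ⟨measurable_const, |c|, fun _ => le_rfl⟩) Cl.zero.tame
      fun p _ => by
        unfold HasLineDerivAt
        exact hasDerivAt_const _ _
  have key : ∀ {e : V × ℝ} {G G' : Fn}, Cl G → Cl G' → WeakDeriv e (harmU ψ f) G →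
      WeakDeriv e (duh q) G' → IsGivenBy (∂_{e} v) fun p => G p - G' p := fun {e G G'} h1 h2 h3 h4 => by
    have h := ((h3.sub (tame_harmU hf) h1.tame (tame_duh hq) h2.tame h4).add
      ((tame_harmU hf).sub (tame_duh hq)) (h1.tame.sub h2.tame)
      (Cl.tame ⟨measurable_const, |c|, fun _ => le_rfl⟩) Cl.zero.tame (hconst e)).isGivenBy hv
    simpa only [add_zero] using h
  refine ⟨?_, (ha.add hq).memLp_top, fun k => ?_, ?_, fun k => ?_, ?_⟩
  · choose B hB using fun k => (hcl k).bdd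
    refine memLp_top_of_bound (Measurable.aestronglyMeasurable ?_) (√(∑ k, B k ^ 2))
      (ae_of_all _ fun p => ?_)
    · exact (WithLp.measurable_toLp 2 _).comp (measurable_pi_lambda _ fun k => (hcl k).meas)
    · refine Real.le_sqrt_of_sq_le ?_
      rw [real_norm_sq_eq]
      exact sum_le_sum fun k _ => sq_le_sq' (abs_le.1 (hB k p)).1 (abs_le.1 (hB k p)).2
  · exact key ((hom_partialD k).cl_harm hf) (cl_zop_fut hq hq1 (hom_partialD k)
      (continuous_partialD k)) (weakDeriv_harmU_line hf k) (weakDeriv_duh_line ψ hq hq1 k)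
  · have h := key (hom_abs.cl_harm hf) ((cl_zop_fut hq hq1 hom_abs continuous_abs_symbol).sub hq)
      (weakDeriv_harmU_time hf) (weakDeriv_duh_time ψ hq hq1)
    simpa only [gradOf, fld, sub_sub_eq_add_sub, sub_add_eq_add_sub] using h
  · rw [halfVol, ae_restrict_iff' (ℍ).isOpen.measurableSet]
    refine ae_of_all _ fun p hp => ?_
    simp only [funBlock_one_eq]
    exact hasSum_fld hf hq hq1 (hom_partialD k) (continuous_partialD k) p.1 hp
  · rw [halfVol, ae_restrict_iff' (ℍ).isOpen.measurableSet]
    refine ae_of_all _ fun p hp => ?_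
    refine (hasSum_fld hf hq hq1 hom_abs continuous_abs_symbol p.1 hp).congr_fun fun i => ?_
    simp only [funBlock_eq_mop]
    exact sum_mop_riesz_fld hf hq hq1 i p.1 hp

end

/-! ### Fixed points in terms of bounded representatives -/

theorem exists_cl {u : Fn} (hu : AEStronglyMeasurable u μJ) (hb : eLpNorm u ⊤ μJ < ⊤) :
    ∃ u', Cl u' ∧ u =ᵐ[μJ] u' ∧ supN u' ≤ eLpNorm u ⊤ μJ := by
  set B := (eLpNorm u ⊤ μJ).toReal with hB
  have hm := hu.stronglyMeasurable_mk.measurable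
  set s : Set (V × ℝ) := {p | ‖hu.mk u p‖ ≤ B}
  have hs : MeasurableSet s := measurableSet_le hm.norm measurable_const
  have hle : ∀ p, ‖s.indicator (hu.mk u) p‖ ≤ B := fun p => by
    by_cases hp : p ∈ s
    · rw [indicator_of_mem hp]
      exact hp
    · rw [indicator_of_notMem hp, norm_zero]
      exact toReal_nonneg
  refine ⟨s.indicator (hu.mk u), ⟨hm.indicator hs, B, hle⟩, ?_, iSup_le fun p => ?_⟩
  · rw [eLpNorm_exponent_top] at hb hB
    filter_upwards [hu.ae_eq_mk, ae_le_eLpNormEssSup (f := u) (μ := μJ)] with p h1 h2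
    rw [indicator_of_mem, h1]
    change ‖hu.mk u p‖ ≤ B
    rw [← h1, hB, ← toReal_enorm]
    exact toReal_mono hb.ne h2
  · rw [← ofReal_norm]
    exact ENNReal.ofReal_le_of_le_toReal (hle p)

theorem eLpNorm_top_le_supN (u : Fn) : eLpNorm u ⊤ μJ ≤ supN u := by
  rw [eLpNorm_exponent_top]
  exact essSup_le_of_ae_le _ (ae_of_all _ (enorm_le_supN u))

theorem xStarNorm_le_nStar (ψ : LP) (u : Fn) : xStarNorm ψ u ≤ nStar ψ u :=
  add_le_add_left (eLpNorm_top_le_supN u) _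

theorem ae_halfVol_of_ae {Q : ℝ → Prop} (h : ∀ᵐ z ∂(volume.restrict (Iio 0)), Q z) :
    ∀ᵐ p ∂μJ, Q p.2 := by
  rw [halfVol_eq]
  exact Measure.quasiMeasurePreserving_snd.ae h

theorem ae_halfVol_of_forall {Q : V × ℝ → Prop} (h : ∀ p, p.2 < 0 → Q p) : ∀ᵐ p ∂μJ, Q p := by
  rw [halfVol, ae_restrict_iff' (ℍ).isOpen.measurableSet]
  exact ae_of_all _ h

theorem isGivenBy_congr {u : 𝓓'(ℍ, ℝ)} {g G : Fn} (h : g =ᵐ[μJ] G)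
    (hu : IsGivenBy u g) : IsGivenBy u G := fun φ => by
  rw [hu φ]
  rw [halfVol, Filter.EventuallyEq, ae_restrict_iff' (ℍ).isOpen.measurableSet] at h
  refine integral_congr_ae (h.mono fun p hp => ?_)
  by_cases hm : p ∈ (ℍ : Set (V × ℝ))
  · simp only [hp hm]
  · simp only [image_eq_zero_of_notMem_tsupport fun h' => hm (φ.tsupport_subset h'), mul_zero]

theorem locallyIntegrableOn_of_memLp_top {g : Fn} (hg : MemLp g ⊤ μJ) :
    LocallyIntegrableOn g (ℍ : Set (V × ℝ)) :=
  have : IsLocallyFiniteMeasure μJ := by unfold halfVol; infer_instance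
  locallyIntegrableOn_of_locallyIntegrable_restrict (hg.locallyIntegrable le_top)

/-- `U` represents `(∇_x v, ∂_z v)`. -/
def Rep (D : GradData d) (U : Unk d) : Prop :=
  (∀ k, (fun p => D.gradX p k) =ᵐ[μJ] U (some k)) ∧ D.gradZ =ᵐ[μJ] U none

theorem memLp_gradX_apply {D : GradData d} (h : MemLp D.gradX ⊤ μJ) (k : Fin d) :
    MemLp (fun p => D.gradX p k) ⊤ μJ :=
  (EuclideanSpace.proj k : V →L[ℝ] ℝ).comp_memLp' h

theorem rep_unique {D D' : GradData d} {U : Unk d}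
    (h : HasGradData ψ v D) (h' : HasGradData ψ v D') (hU : Rep D U) : Rep D' U :=
  ⟨fun k => (ae_eq_of_isGivenBy
      (locallyIntegrableOn_of_memLp_top (memLp_gradX_apply h'.memLp_gradX k))
      (locallyIntegrableOn_of_memLp_top (memLp_gradX_apply h.memLp_gradX k))
      (h'.weak_gradX k) (h.weak_gradX k)).trans (hU.1 k),
    (ae_eq_of_isGivenBy (locallyIntegrableOn_of_memLp_top h'.memLp_gradZ)
      (locallyIntegrableOn_of_memLp_top h.memLp_gradZ) h'.weak_gradZ h.weak_gradZ).trans hU.2⟩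

theorem exists_good (hv : MemVStar ψ v) : ∃ U, Good ψ U ∧ ∀ D, HasGradData ψ v D → Rep D U := by
  obtain ⟨D, hD⟩ := iInf_lt_iff.1 hv
  obtain ⟨h, hN⟩ := iInf_lt_iff.1 hD
  obtain ⟨hNa, hNz⟩ := add_lt_top.1 hN
  choose X hX1 hX2 _ using fun k => exists_cl (memLp_gradX_apply h.memLp_gradX k).1
    (memLp_gradX_apply h.memLp_gradX k).2
  obtain ⟨Z, hZ1, hZ2, hZ3⟩ := exists_cl h.memLp_gradZ.1 h.memLp_gradZ.2
  have hs : ∀ᵐ p ∂μJ, HasSum (fun j : ℤ => -∑ k : Fin d,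
      funBlock ψ (riesz k) j (fun y => X k (y, p.2)) p.1) (D.absD p) := by
    filter_upwards [h.hasSum_absD,
      ae_halfVol_of_ae (ae_all_iff.2 fun k => ae_slice (hX2 k))] with p hp hq
    refine hp.congr_fun fun j => ?_
    simp only [funBlock_eq_mop]
    exact congrArg Neg.neg (sum_congr rfl fun k _ =>
      congrFun (mop_congr_ae _ (EventuallyEq.symm (hq k))) p.1)
  have hm : AEStronglyMeasurable D.absD μJ := by
    refine ⟨fun p => ∑' j : ℤ, -∑ k : Fin d, funBlock ψ (riesz k) j (fun y => X k (y, p.2)) p.1, ?_,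
      hs.mono fun p hp => hp.tsum_eq.symm⟩
    refine (Measurable.tsum fun j => ?_).stronglyMeasurable
    refine (Finset.measurable_fun_sum _ fun k _ => ?_).neg
    simp only [funBlock_eq_mop]
    exact measurable_mop_slice ((hom_riesz k).annular_block ψ j).int (hX1 k).meas
  obtain ⟨a, ha1, ha2, ha3⟩ := exists_cl hm (le_self_add.trans_lt hNa)
  obtain ⟨C, hC⟩ := cheminLerner_gradient_le ψ
  have hg := hC hX1 ha1 (fun k => isGivenBy_congr (hX2 k) (h.weak_gradX k)) (by
    filter_upwards [hs, ha2] with p hp hq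
    rwa [← hq])
  refine ⟨fun o => o.elim Z X, ⟨fun o => ?_, sum_lt_top.2 fun o _ => ?_⟩, fun D' h' =>
    rep_unique h h' ⟨hX2, hZ2⟩⟩
  · cases o with
    | none => exact hZ1
    | some k => exact hX1 k
  · cases o with
    | none =>
      refine add_lt_top.2 ⟨hZ1.supN_lt_top, ?_⟩
      change CL ψ 1 1 Z < ⊤
      rw [← cheminLerner_congr ψ 1 1 hZ2]
      exact le_add_self.trans_lt hNz
    | some k =>
      refine add_lt_top.2 ⟨(hX1 k).supN_lt_top,
        (hg k 1 (Or.inl rfl) 1).trans_lt (mul_lt_top coe_lt_top ?_)⟩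
      rw [← cheminLerner_congr ψ 1 1 ha2]
      exact le_add_self.trans_lt hNa

theorem qA_eq {D : GradData d} {U : Unk d} {p : V × ℝ}
    (hp : p.2 < 0) (hX : ∀ k, D.gradX p k = U (some k) p) (hZ : D.gradZ p = U none p) :
    qA ψ η D p = opA ψ η U p := by
  rw [qA, opA, gCoef, hZ, absDH_apply ψ η hp, real_norm_sq_eq, PiLp.inner_apply]
  simp only [gradH_apply ψ η hp, hX, sq, RCLike.inner_apply, conj_trivial, mul_comm]

theorem qBField_eq {D : GradData d} {U : Unk d} {p : V × ℝ}
    (hp : p.2 < 0) (hX : ∀ k, D.gradX p k = U (some k) p) (hZ : D.gradZ p = U none p) (k : Fin d) :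
    qBField ψ η D p k = opB ψ k η U p := by
  rw [qBField, opB, absDH_apply ψ η hp, ← hZ, ← hX, ← gradH_apply ψ η hp k, mul_comm (gradH ψ η p k)]
  rfl

/-- The integrand of `opW`. -/
def source (ψ : LP) (η : TD) (U : Unk d) (s : ℝ) (x : V) (τ : ℝ) : ℝ :=
  ∑ k, mop (fun ξ => (partialD k).1 ξ * hsym s ξ) (fun y => opB ψ k η U (y, τ)) x -
    mop (fun ξ => (Λ).1 ξ * hsym s ξ) (fun y => opA ψ η U (y, τ)) x

section

variable {D : GradData d} {U : Unk d}

theorem ae_slice_eq (h : Rep D U) : ∀ᵐ τ ∂(volume.restrict (Iio (0 : ℝ))),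
    (fun y => qA ψ η D (y, τ)) =ᵐ[volume] (fun y => opA ψ η U (y, τ)) ∧
    ∀ k, (fun y => qBField ψ η D (y, τ) k) =ᵐ[volume] fun y => opB ψ k η U (y, τ) := by
  filter_upwards [ae_restrict_mem measurableSet_Iio, ae_slice (ae_all_iff.2 h.1), ae_slice h.2]
    with τ hτ hX hZ
  constructor
  · filter_upwards [hX, hZ] with y h1 h2
    exact qA_eq (p := (y, τ)) hτ h1 h2
  · intro k
    filter_upwards [hX, hZ] with y h1 h2
    exact qBField_eq (p := (y, τ)) hτ h1 h2 k

theorem ae_sourceTerm_eq (h : Rep D U) : ∀ᵐ τ ∂(volume.restrict (Iio (0 : ℝ))), ∀ (z : ℝ) (x : V),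
    τ ≤ z → sourceTerm ψ η D (z - τ) x τ = source ψ η U |z - τ| x τ := by
  filter_upwards [ae_slice_eq (ψ := ψ) (η := η) h] with τ hτ z x hz
  rw [abs_of_nonneg (sub_nonneg.2 hz)]
  simp only [sourceTerm, source, convMult_eq_mop]
  rw [mop_congr_ae _ hτ.1]
  refine congrArg₂ _ (sum_congr rfl fun k _ => ?_) rfl
  rw [mop_congr_ae _ (hτ.2 k)]
  rfl

theorem ae_sourceTerm_past (h : Rep D U) (z : ℝ) (x : V) : ∀ᵐ τ ∂(volume.restrict (past z)),
    source ψ η U |z - τ| x τ = sourceTerm ψ η D (z - τ) x τ := by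
  filter_upwards [ae_restrict_of_ae_restrict_of_subset (past_subset z) (ae_sourceTerm_eq h),
    ae_restrict_mem (measurableSet_Iio.inter measurableSet_Iic)] with τ h1 h2
  exact (h1 z x h2.2).symm

theorem ae_convMult_eq {g q : Fn} (x : V)
    (h : ∀ᵐ τ ∂(volume.restrict (Ioo z 0)), (fun y => g (y, τ)) =ᵐ[volume] fun y => q (y, τ)) :
    (fun τ => mop (hsym |z - τ|) (fun y => q (y, τ)) x) =ᵐ[volume.restrict (Ioo z 0)]
      fun τ => convMult (heat (τ - z)) (fun y => g (y, τ)) x := by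
  filter_upwards [h, ae_restrict_mem measurableSet_Ioo] with τ h1 h2
  rw [convMult_eq_mop, mop_congr_ae _ h1, abs_sub_comm, abs_of_pos (sub_pos.2 h2.1)]
  rfl

theorem ae_qA_slice (h : Rep D U) (z : ℝ) : ∀ᵐ τ ∂(volume.restrict (Ioo z 0)),
    (fun y => qA ψ η D (y, τ)) =ᵐ[volume] fun y => opA ψ η U (y, τ) :=
  (ae_restrict_of_ae_restrict_of_subset (Ioo_subset_Iio_zero z) (ae_slice_eq h)).mono fun _ h => h.1

theorem intervalIntegral_convMult {g q : Fn} (hz : z < 0) (x : V)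
    (h : ∀ᵐ τ ∂(volume.restrict (Ioo z 0)), (fun y => g (y, τ)) =ᵐ[volume] fun y => q (y, τ)) :
    ∫ τ in (0 : ℝ)..z, convMult (heat (τ - z)) (fun y => g (y, τ)) x = -duh q (x, z) := by
  rw [intervalIntegral.integral_symm, intervalIntegral.integral_of_le hz.le,
    integral_Ioc_eq_integral_Ioo, duh_apply]
  exact congrArg Neg.neg (integral_congr_ae (ae_convMult_eq x h)).symm

variable [NeZero d] {c : ℝ≥0}

theorem integrableOn_source (hT : TameOps ψ (nStar ψ) 0 c) (hη : β ψ η ≤ c)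
    (hU : Good ψ U) (x : V) (z : ℝ) {S : Set ℝ} (hS : S ⊆ Iio 0) :
    IntegrableOn (fun τ => source ψ η U |z - τ| x τ) S :=
  (integrable_finsetSum _ fun k _ => (hom_partialD k).heat_integrableOn (continuous_partialD k) ψ
      ((hT.b k).cl η hη U hU) ((hT.b k).fin_cheminLerner hη hU) x z hS).sub
    (hom_abs.heat_integrableOn continuous_abs_symbol ψ (hT.a.cl η hη U hU)
      (hT.a.fin_cheminLerner hη hU) x z hS)

theorem opW_eq (hT : TameOps ψ (nStar ψ) 0 c) (hη : β ψ η ≤ c) (hU : Good ψ U) (x : V) (z : ℝ) :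
    opW ψ η U (x, z) = ∫ τ in past z, source ψ η U |z - τ| x τ := by
  have hB := fun k => (hom_partialD k).heat_integrableOn (continuous_partialD k) ψ
    ((hT.b k).cl η hη U hU) ((hT.b k).fin_cheminLerner hη hU) x z (past_subset z)
  simp only [opW, zop, source]
  rw [integral_sub (integrable_finsetSum _ fun k _ => hB k) (hom_abs.heat_integrableOn
    continuous_abs_symbol ψ (hT.a.cl η hη U hU) (hT.a.fin_cheminLerner hη hU) x z (past_subset z)),
    integral_finsetSum _ fun k _ => hB k]

theorem past_ae_eq (hz : z ≤ 0) : past z =ᵐ[volume] Iic z := by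
  have h : (Iio (0 : ℝ) ∩ Iic z : Set ℝ) =ᵐ[volume] (Iic 0 ∩ Iic z : Set ℝ) :=
    Iio_ae_eq_Iic.inter (ae_eq_refl _)
  rwa [inter_eq_right.2 (Iic_subset_Iic.2 hz)] at h

theorem wTerm_eq (hT : TameOps ψ (nStar ψ) 0 c) (hη : β ψ η ≤ c)
    (hU : Good ψ U) (h : Rep D U) (x : V) (hz : z ≤ 0) : wTerm ψ η D x z = opW ψ η U (x, z) := by
  rw [opW_eq hT hη hU, wTerm, ← setIntegral_congr_set (past_ae_eq hz)]
  exact (integral_congr_ae (ae_sourceTerm_past h z x)).symm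

theorem remainder_eq (hT : TameOps ψ (nStar ψ) 0 c) (hη : β ψ η ≤ c)
    (hU : Good ψ U) (h : Rep D U) : remainder ψ η D = fun x => opW ψ η U (x, 0) := by
  funext x
  rw [← wTerm_eq hT hη hU h x le_rfl, wTerm, remainder, ← setIntegral_congr_set Iio_ae_eq_Iic]
  simp only [zero_sub]

theorem integrableOn_duh (hq : Cl q) (x : V) (z : ℝ) :
    IntegrableOn (fun τ => mop (hsym |z - τ|) (fun y => q (y, τ)) x) (Ioo z 0) := by
  obtain ⟨B, hB⟩ := hq.bdd
  refine Measure.integrableOn_of_bounded (M := wnorm (hsym (d := d) 1) * B) (by simp)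
    ((measurable_mop_hsym hq.meas).comp (f := fun τ : ℝ => ((x, z), τ))
      (by fun_prop)).aestronglyMeasurable ?_
  filter_upwards [ae_restrict_mem measurableSet_Ioo] with τ hτ
  exact abs_mop_hsym_le hB _ hτ.1.ne

theorem duh_add {q q' : Fn} (hq : Cl q) (hq' : Cl q') (p : V × ℝ) :
    duh (fun p => q p + q' p) p = duh q p + duh q' p := by
  obtain ⟨B, hB⟩ := hq.bdd
  obtain ⟨B', hB'⟩ := hq'.bdd
  simp only [duh_apply]
  rw [← integral_add (integrableOn_duh hq p.1 p.2) (integrableOn_duh hq' p.1 p.2)]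
  refine setIntegral_congr_fun measurableSet_Ioo fun τ hτ => ?_
  exact mop_add_right (wiener_hsym (abs_pos.2 (sub_ne_zero.2 hτ.1.ne))) (hq.slice τ) (hq'.slice τ)
    (fun y => hB _) (fun y => hB' _) p.1

theorem intervalIntegrable_convMult {g q : Fn} (hq : Cl q) (hz : z < 0) (x : V)
    (h : ∀ᵐ τ ∂(volume.restrict (Ioo z 0)), (fun y => g (y, τ)) =ᵐ[volume] fun y => q (y, τ)) :
    IntervalIntegrable (fun τ => convMult (heat (τ - z)) (fun y => g (y, τ)) x) volume 0 z := by
  refine IntervalIntegrable.symm ?_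
  rw [intervalIntegrable_iff_integrableOn_Ioo_of_le hz.le]
  exact (integrableOn_duh hq x z).congr (ae_convMult_eq x h)

theorem ae_wTerm_slice (hT : TameOps ψ (nStar ψ) 0 c) (hη : β ψ η ≤ c)
    (hU : Good ψ U) (h : Rep D U) (z : ℝ) : ∀ᵐ τ ∂(volume.restrict (Ioo z 0)),
    (fun y => wTerm ψ η D y τ) =ᵐ[volume] fun y => opW ψ η U (y, τ) := by
  filter_upwards [ae_restrict_mem measurableSet_Ioo] with τ hτ
  exact ae_of_all _ fun y => wTerm_eq hT hη hU h y hτ.2.le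

theorem opT_eq (hT : TameOps ψ (nStar ψ) 0 c) (hη : β ψ η ≤ c)
    (hU : Good ψ U) (h : Rep D U) (f : TD) {p : V × ℝ} (hp : p.2 < 0) :
    opT ψ η f D p = harmU ψ f p - duh (opQ ψ η U) p := by
  rw [opT, intervalIntegral_convMult hp p.1 (ae_qA_slice h p.2),
    intervalIntegral_convMult (g := fun q => wTerm ψ η D q.1 q.2) hp p.1
      (ae_wTerm_slice hT hη hU h p.2), harmU, if_pos hp]
  have e := duh_add (hT.a.cl η hη U hU) (hT.w.cl η hη U hU) p
  change duh (opQ ψ η U) p = _ at e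
  rw [e]
  ring

theorem converges_of_rep (hT : TameOps ψ (nStar ψ) 0 c) (hη : β ψ η ≤ c)
    (hU : Good ψ U) (h : Rep D U) : Converges ψ η D where
  inner_integral x z hz := IntegrableOn.congr_set_ae ((integrableOn_source hT hη hU x z
    (past_subset z)).congr (ae_sourceTerm_past h z x)) (past_ae_eq hz).symm
  outer_integral_qA x _ hz :=
    intervalIntegrable_convMult (hT.a.cl η hη U hU) hz x (ae_qA_slice h _)
  outer_integral_w x _ hz := intervalIntegrable_convMult (g := fun q => wTerm ψ η D q.1 q.2)
    (hT.w.cl η hη U hU) hz x (ae_wTerm_slice hT hη hU h _)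

end

theorem eqModConst_of_isGivenBy {G : Fn} (hG : Tame G) {v w : 𝓓'(ℍ, ℝ)} {a : ℝ}
    (hv : IsGivenBy v fun p => G p + a) (hw : IsGivenBy w G) : EqModConst v w := by
  refine ⟨a, fun φ => ?_⟩
  have ha : Tame fun _ : V × ℝ => a := Cl.tame ⟨measurable_const, |a|, fun _ => le_rfl⟩
  rw [hv, hw, ← integral_const_mul, ← integral_add (hG.integrable_mul φ) (ha.integrable_mul φ)]
  simp only [add_mul]

section

variable {U : Unk d} {c : ℝ≥0}

theorem ae_eq_zero_of_contraction (hT : TameOps ψ (nStar ψ) 0 c)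
    (hL : ∀ U, Good ψ U → ∑ o, nStar ψ (opL ψ η U o) ≤ 4⁻¹ * ∑ o, nStar ψ (U o))
    (hU : Good ψ U) (h : ∀ o, U o =ᵐ[μJ] opL ψ η U o) (o : Option (Fin d)) : U o =ᵐ[μJ] 0 := by
  choose W hW1 hW2 hW3 using fun o => exists_cl (hU.1 o).memLp_top.1 (hU.1 o).memLp_top.2
  have hN : ∀ o, nStar ψ (W o) < ⊤ := fun o => by
    refine add_lt_top.2 ⟨(hW1 o).supN_lt_top, ?_⟩
    rw [← cheminLerner_congr ψ 1 1 (hW2 o)]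
    exact le_add_self.trans_lt (hU.lt_top o)
  have hW : Good ψ W := ⟨hW1, sum_lt_top.2 fun o _ => hN o⟩
  have hfix : ∀ o, U o =ᵐ[μJ] opL ψ η W o := fun o =>
    (h o).trans ((hT.l o).congr η U W hW2)
  have hle : ∑ o, nStar ψ (W o) ≤ ∑ o, nStar ψ (opL ψ η W o) := sum_le_sum fun o _ => by
    refine add_le_add ((hW3 o).trans ?_) (cheminLerner_congr ψ 1 1 ((hW2 o).symm.trans (hfix o))).le
    rw [eLpNorm_congr_ae (hfix o)]
    exact eLpNorm_top_le_supN _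
  have h0 : ∑ o, nStar ψ (W o) = 0 := by
    by_contra hne
    refine absurd (hle.trans (hL W hW)) (not_le.2 ?_)
    calc 4⁻¹ * ∑ o, nStar ψ (W o) < 1 * ∑ o, nStar ψ (W o) :=
          ENNReal.mul_lt_mul_left hne hW.2.ne (ENNReal.inv_lt_one.2 (by norm_num))
      _ = _ := one_mul _
  have h1 : supN (W o) = 0 := le_antisymm ((supN_le_nStar ψ _).trans
    (Finset.sum_eq_zero_iff.1 h0 o (Finset.mem_univ o)).le) zero_le
  filter_upwards [hW2 o] with p hp
  rw [hp]
  exact enorm_eq_zero.1 (le_antisymm ((enorm_le_supN _ p).trans h1.le) zero_le)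

theorem gradOf_gradX (k : Fin d) (p : V × ℝ) :
    (gradOf (ψ := ψ) (f := f) (q := opQ ψ η U)).gradX p k =
      dataU ψ f (some k) p + opL ψ η U (some k) p :=
  sub_eq_add_neg _ _

theorem gradOf_gradZ (p : V × ℝ) : (gradOf (ψ := ψ) (f := f) (q := opQ ψ η U)).gradZ p =
    dataU ψ f none p + opL ψ η U none p := by
  change harm ψ Λ f p - _ + _ = harm ψ Λ f p + -(_ - _)
  rw [opD]
  ring

theorem rep_gradOf_iff {Y : Unk d} : Rep (gradOf (ψ := ψ) (f := f) (q := opQ ψ η U)) Y ↔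
    ∀ o, (fun p => dataU ψ f o p + opL ψ η U o p) =ᵐ[μJ] Y o := by
  simp only [Rep, gradOf_gradX, Option.forall, ← gradOf_gradZ]
  exact and_comm

variable [NeZero d]

theorem hasGradData_of_isGivenBy (hT : TameOps ψ (nStar ψ) 0 c)
    (hη : β ψ η ≤ c) (hf : β ψ f < ⊤) (hU : Good ψ U) {a : ℝ}
    (hv : IsGivenBy v fun p => harmU ψ f p - duh (opQ ψ η U) p + a) :
    HasGradData ψ v (gradOf (ψ := ψ) (f := f) (q := opQ ψ η U)) :=
  hasGradData_gradOf hf (hT.q.cl η hη U hU) (hT.q.fin_cheminLerner hη hU) hv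

/-- Fixed points in `𝒱_*` have the gradient given by the solution `U`. -/
theorem Sol.of_isFixedPoint (hT : TameOps ψ (nStar ψ) 0 c) (hη : β ψ η ≤ c)
    (hL : ∀ U, Good ψ U → ∑ o, nStar ψ (opL ψ η U o) ≤ 4⁻¹ * ∑ o, nStar ψ (U o))
    (hf : β ψ f < ⊤) (hU : Sol ψ η f U) (hv : MemVStar ψ v) (hfix : IsFixedPoint ψ η f v) :
    (∀ D, HasGradData ψ v D → Rep D U) ∧
      ∃ a : ℝ, IsGivenBy v fun p => harmU ψ f p - duh (opQ ψ η U) p + a := by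
  obtain ⟨Y, hV, hrep⟩ := exists_good hv
  obtain ⟨D, hD, a, ha⟩ := hfix
  have hg : IsGivenBy v fun p => harmU ψ f p - duh (opQ ψ η Y) p + a :=
    isGivenBy_congr (ae_halfVol_of_forall fun p hp => by
      rw [opT_eq hT hη hV (hrep D hD) f hp]) ha
  have hVfix := rep_gradOf_iff.1 (hrep _ (hasGradData_of_isGivenBy hT hη hf hV hg))
  have hW := hV.sub hU.good
  have heq : ∀ o, Y o =ᵐ[μJ] U o := fun o => by
    have h0 := ae_eq_zero_of_contraction hT hL hW (fun o => by
      have hadd := (hT.l o).add η hη (Y - U) U hW hU.good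
      rw [sub_add_cancel] at hadd
      filter_upwards [hVfix o] with p hp
      have h1 := congrFun hadd p
      have h2 := congrFun (congrFun hU.fix o) p
      simp only [Pi.add_apply, Pi.sub_apply] at h1 h2 ⊢
      linarith) o
    filter_upwards [h0] with p hp
    exact sub_eq_zero.1 hp
  refine ⟨fun D hD => ⟨fun k => ((hrep D hD).1 k).trans (heq _), (hrep D hD).2.trans (heq _)⟩,
    a, ?_⟩
  have e : duh (opQ ψ η Y) = duh (opQ ψ η U) :=
    zop_congr Ioo_subset_Iio_zero (hT.q.congr η Y U heq)
  rwa [← e]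

theorem potNorm_le (hT : TameOps ψ (nStar ψ) 0 c) (hη : β ψ η ≤ c)
    (hf : β ψ f < ⊤) (hU : Sol ψ η f U) {a : ℝ}
    (hv : IsGivenBy v fun p => harmU ψ f p - duh (opQ ψ η U) p + a) (N : Fn → ℝ≥0∞) :
    potNorm ψ N v ≤ N (fun p => harm ψ Λ f p - opD ψ η U p) + N (U none) := by
  refine (iInf₂_le _ (hasGradData_of_isGivenBy hT hη hf hU.good hv)).trans_eq ?_
  congr 2
  exact (funext gradOf_gradZ).trans (congrFun hU.fix none).symm

theorem Sol.exists_isFixedPoint (hT : TameOps ψ (nStar ψ) 0 c) (hη : β ψ η ≤ c) (hf : β ψ f < ⊤)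
    (hU : Sol ψ η f U) : ∃ v : 𝓓'(ℍ, ℝ), IsFixedPoint ψ η f v ∧
      IsGivenBy v (fun p => harmU ψ f p - duh (opQ ψ η U) p) := by
  have hv := ((tame_harmU hf).sub (tame_duh (hT.q.cl η hη U hU.good))).isGivenBy_distOf
  have hr : Rep (gradOf (ψ := ψ) (f := f) (q := opQ ψ η U)) U :=
    rep_gradOf_iff.2 fun o => Filter.EventuallyEq.of_eq (congrFun hU.fix o).symm
  refine ⟨_, ⟨_, hasGradData_of_isGivenBy (a := 0) hT hη hf hU.good (by simpa using hv), 0,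
    isGivenBy_congr (ae_halfVol_of_forall fun p hp => ?_) hv⟩, hv⟩
  simp only [opT_eq hT hη hU.good hr f hp, add_zero]

end

theorem Sol.bounds [NeZero d] (hP : IsFunc ψ P r) {c₀ : ℝ≥0} (hT : TameOps ψ (nStar ψ) 0 c₀) :
    ∃ c : ℝ≥0, 0 < c ∧ c ≤ 1 ∧ ∃ C : ℝ≥0, ∀ {η f : TD}, β ψ η ≤ c → β ψ η ≤ c₀ →
      β ψ f < ⊤ → ∀ {U}, Sol ψ η f U →
      P (fun p => harm ψ Λ f p - opD ψ η U p) + P (U none) ≤ C * besovNorm ψ r Λ f +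
          C * besovNorm ψ r Λ η * β ψ f ∧
      besovNormFun ψ r (fun x => opW ψ η U (x, 0)) ≤ C * β ψ η * besovNorm ψ r Λ f +
          C * besovNorm ψ r Λ η * β ψ f := by
  obtain ⟨c, hc0, hc1, A, hA⟩ := Sol.est hP
  obtain ⟨B, hB⟩ := besovNormFun_opW_le ψ
  refine ⟨c, hc0, hc1, (1 + B) * A, fun {η f} hη hη₀ hf {U} hU => ?_⟩
  obtain ⟨h1, h2⟩ := hA hη hf hU
  simp only [mul_assoc, ← mul_add]
  rw [coe_mul, coe_add, ENNReal.coe_one, mul_assoc, mul_assoc]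
  constructor
  · exact h1.trans (le_mul_of_one_le_left' le_self_add)
  · refine (hB r c₀ η U hT hη₀ hU.good).trans (mul_le_mul' le_add_self (le_trans ?_ h2))
    exact add_le_add (sum_le_sum fun k _ => hP.le _) (hP.le _)

theorem exists_half_le_one_add_absDH (ψ : LP) : ∃ c : ℝ≥0, 0 < c ∧ c < 1 ∧
    ∀ η, β ψ η ≤ c → ∀ (x : V) (z : ℝ), z < 0 → 1 / 2 ≤ 1 + absDH ψ η (x, z) := by
  obtain ⟨A, hA⟩ := (hom_abs (d := d)).harm_le ψ
  obtain ⟨c, hc0, hc⟩ := exists_small A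
  refine ⟨min c 2⁻¹, lt_min hc0 (by positivity), (min_le_right _ _).trans_lt
    (inv_lt_one_of_one_lt₀ one_lt_two), fun η hη x z hz => ?_⟩
  have h1 := (hA η (hη.trans_lt coe_lt_top)).trans
    (coe_mul_le_quarter hc (hη.trans (coe_le_coe.2 (min_le_left _ _))))
  have h2 := abs_le_supN (h1.trans_lt (by simp)) (x, z)
  have h3 := toReal_mono (by simp) h1
  rw [ENNReal.toReal_inv, ENNReal.toReal_ofNat] at h3
  rw [absDH_apply ψ η hz]
  linarith [(abs_le.1 (h2.trans h3)).1]

end Muskat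

end

theorem proposition3p3 (d : ℕ) (hd : 1 ≤ d) (ψ : LPCutoff d) :
    ∃ c₀ : ℝ, 0 < c₀ ∧ c₀ < 1 ∧
      (∀ η : TemperedDist d, MemBesov ψ 1 η →
        besovNorm ψ 0 Symbol.abs η ≤ ENNReal.ofReal c₀ →
        ∀ (x : E d) (z : ℝ), z < 0 → 1 / 2 ≤ 1 + absDH ψ η (x, z)) ∧
      ∃ c₁ : ℝ, 0 < c₁ ∧ c₁ < c₀ ∧
        (∃ C : ℝ≥0, ∀ η f : TemperedDist d,
          MemBesov ψ 1 η → MemBesov ψ 1 f →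
          besovNorm ψ 0 Symbol.abs η < ENNReal.ofReal c₁ →
          (∀ v : 𝓓'(halfSpace d, ℝ), MemVStar ψ v →
            ∀ D : GradData d, HasGradData ψ v D → Converges ψ η D) ∧
          ∃ v : 𝓓'(halfSpace d, ℝ),
            MemVStar ψ v ∧ IsFixedPoint ψ η f v ∧
            (∀ v' : 𝓓'(halfSpace d, ℝ), MemVStar ψ v' →
              IsFixedPoint ψ η f v' → EqModConst v' v) ∧
            (∀ v' : 𝓓'(halfSpace d, ℝ), MemVStar ψ v' → IsFixedPoint ψ η f v' →
              ∀ D D' : GradData d, HasGradData ψ v D → HasGradData ψ v' D' →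
                dirichletNeumann ψ η f D' = dirichletNeumann ψ η f D) ∧
            vStarNorm ψ v ≤ C * besovNorm ψ 0 Symbol.abs f ∧
            ∀ D : GradData d, HasGradData ψ v D →
              besovNormFun ψ 0 (remainder ψ η D) ≤
                C * besovNorm ψ 0 Symbol.abs η *
                  besovNorm ψ 0 Symbol.abs f) ∧
        ∀ r : ℝ, 0 < r → ∃ c : ℝ, 0 < c ∧ c < c₁ ∧ ∃ C : ℝ≥0, ∀ η f : TemperedDist d,
          MemBesov ψ 1 η → MemBesov ψ (1 + r) η →
          MemBesov ψ 1 f → MemBesov ψ (1 + r) f →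
          besovNorm ψ 0 Symbol.abs η < ENNReal.ofReal c →
          ∀ v : 𝓓'(halfSpace d, ℝ),
            MemVStar ψ v → IsFixedPoint ψ η f v →
            MemV ψ r v ∧
            vNorm ψ r v ≤
              C * besovNorm ψ r Symbol.abs f +
                C * besovNorm ψ r Symbol.abs η *
                  besovNorm ψ 0 Symbol.abs f ∧
            ∀ D : GradData d, HasGradData ψ v D →
              besovNormFun ψ r (remainder ψ η D) ≤
                C * besovNorm ψ 0 Symbol.abs η *
                    besovNorm ψ r Symbol.abs f +
                  C * besovNorm ψ r Symbol.abs η *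
                    besovNorm ψ 0 Symbol.abs f := by
  
  have : NeZero d := ⟨by lia⟩
  obtain ⟨c₀, hc₀0, hc₀1, h0⟩ := exists_half_le_one_add_absDH ψ
  obtain ⟨cT, hcT0, _, hT, hL⟩ := exists_contraction ψ
  obtain ⟨cE, hcE0, hcE1, C, hC⟩ := Sol.bounds (isFunc_nStar ψ) hT
  set c₁ : ℝ≥0 := min (c₀ / 2) (min cT cE) with hc₁
  have hle₁ : ∀ {x : ℝ≥0∞}, x ≤ c₁ → x ≤ cT ∧ x ≤ cE := fun h =>
    ⟨h.trans (ENNReal.coe_le_coe.2 ((min_le_right _ _).trans (min_le_left _ _))),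
      h.trans (ENNReal.coe_le_coe.2 ((min_le_right _ _).trans (min_le_right _ _)))⟩
  have hpos₁ : 0 < c₁ := lt_min (half_pos hc₀0) (lt_min hcT0 hcE0)
  have habs : ∀ {f : TemperedDist d}, MemBesov ψ 1 f → besovNorm ψ 0 Symbol.abs f < ⊤ :=
    fun hf => besovNorm_abs_lt_top ψ 0 (by rwa [add_zero])
  refine ⟨c₀, hc₀0, hc₀1, fun η _ hη => h0 η (by rwa [ENNReal.ofReal_coe_nnreal] at hη), c₁, hpos₁,
    NNReal.coe_lt_coe.2 ((min_le_left _ _).trans_lt (half_lt_self hc₀0)), ⟨2 * C,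
    fun η f _ hf hη => ?_⟩, fun r hr => ?_⟩
  · rw [ENNReal.ofReal_coe_nnreal] at hη
    obtain ⟨hηT, hηE⟩ := hle₁ hη.le
    have hf := habs hf
    obtain ⟨U, hU⟩ := exists_sol hT hηT (hL η hηT) hf
    obtain ⟨v, hfix, hv⟩ := hU.exists_isFixedPoint hT hηT hf
    obtain ⟨h1, h2⟩ := hC hηE hηT hf hU
    have hη1 : besovNorm ψ 0 Symbol.abs η ≤ 1 := hηE.trans (ENNReal.coe_le_one_iff.2 hcE1)
    have hvle : vStarNorm ψ v ≤ ((2 * C : ℝ≥0) : ℝ≥0∞) * besovNorm ψ 0 Symbol.abs f := by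
      refine (potNorm_le (a := 0) hT hηT hf hU (by simpa using hv) _).trans
        ((add_le_add (xStarNorm_le_nStar ψ _) (xStarNorm_le_nStar ψ _)).trans (h1.trans ?_))
      rw [ENNReal.coe_mul, ENNReal.coe_ofNat, two_mul, add_mul]
      exact add_le_add le_rfl (mul_le_mul_left (mul_le_of_le_one_right' hη1) _)
    have hvm : MemVStar ψ v :=
      hvle.trans_lt (ENNReal.mul_lt_top ENNReal.coe_lt_top hf)
    have hrep := (hU.of_isFixedPoint hT hηT (hL η hηT) hf hvm hfix).1
    refine ⟨fun w hw D hD => ?_, v, hvm, hfix, fun w hw hwfix => ?_,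
      fun w hw hwfix D D' hD hD' => ?_, hvle, fun D hD => ?_⟩
    · obtain ⟨V, hV, hVrep⟩ := exists_good hw
      exact converges_of_rep hT hηT hV (hVrep D hD)
    · obtain ⟨a, ha⟩ := (hU.of_isFixedPoint hT hηT (hL η hηT) hf hw hwfix).2
      exact eqModConst_of_isGivenBy
        ((tame_harmU hf).sub (tame_duh (hT.q.cl η hηT U hU.good))) ha hv
    · have hrep' := (hU.of_isFixedPoint hT hηT (hL η hηT) hf hw hwfix).1
      unfold dirichletNeumann
      rw [remainder_eq hT hηT hU.good (hrep D hD), remainder_eq hT hηT hU.good (hrep' D' hD')]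
    · rw [remainder_eq hT hηT hU.good (hrep D hD)]
      refine h2.trans_eq ?_
      rw [ENNReal.coe_mul, ENNReal.coe_ofNat]
      ring
  · obtain ⟨cR, hcR0, _, C, hC⟩ := Sol.bounds (isFunc_xNorm ψ hr) hT
    refine ⟨(min (c₁ / 2) cR : ℝ≥0), lt_min (half_pos hpos₁) hcR0, NNReal.coe_lt_coe.2
      ((min_le_left _ _).trans_lt (half_lt_self hpos₁)), C, fun η f _ hηr hf hfr hη v hv hfix => ?_⟩
    rw [ENNReal.ofReal_coe_nnreal] at hη
    have hηR := hη.le.trans (ENNReal.coe_le_coe.2 (min_le_right _ _))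
    have hηT := (hle₁ (hη.le.trans (ENNReal.coe_le_coe.2
      ((min_le_left _ _).trans (half_le_self zero_le))))).1
    have hf := habs hf
    obtain ⟨U, hU⟩ := exists_sol hT hηT (hL η hηT) hf
    obtain ⟨hrep, a, ha⟩ := hU.of_isFixedPoint hT hηT (hL η hηT) hf hv hfix
    obtain ⟨h1, h2⟩ := hC hηR hηT hf hU
    have hvle := (potNorm_le hT hηT hf hU ha (xNorm ψ r)).trans h1
    have hηr := besovNorm_abs_lt_top ψ r hηr
    have hfr := besovNorm_abs_lt_top ψ r hfr
    refine ⟨hvle.trans_lt (ENNReal.add_lt_top.2 ⟨ENNReal.mul_lt_top ENNReal.coe_lt_top hfr,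
      ENNReal.mul_lt_top (ENNReal.mul_lt_top ENNReal.coe_lt_top hηr) hf⟩), hvle, fun D hD => ?_⟩
    rwa [remainder_eq hT hηT hU.good (hrep D hD)]
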